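/- **Setting.** Let $\tilde G=SL_2(\mathbb R)\times\{\pm1\}$ with $(g,s)(h,t)=(gh,\alpha(g,h)st)$, where $\alpha(g,h)=\left(\frac{X(gh)}{X(g)},\frac{X(gh)}{X(h)}\right)_H$ is Kubota's cocycle: $X\begin{pmatrix}a&b\\c&d\end{pmatrix}=c$ if $c\ne0$ and $=d$ if $c=0$, and $(x,y)_H=-1$ if $x,y<0$ and $=1$ otherwise. Put $\tilde n_x=\left(\begin{pmatrix}1&x\\0&1\end{pmatrix},1\right)$, $\tilde n_{-,x}=\left(\begin{pmatrix}1&0\\x&1\end{pmatrix},1\right)$, $\tilde a_u=\left(\begin{pmatrix}u&0\\0&u^{-1}\end{pmatrix},1\right)$ for $u>0$, $\tilde s=\left(\begin{pmatrix}0&-1\\1&0\end{pmatrix},1\right)$, $\tilde m_{e_1,e_2}=(e_1\cdot 1,e_2)$ for $e_1,e_2\in\{\pm1\}$, and $\tilde k_\theta=\left(\begin{pmatrix}\cos\theta&-\sin\theta\\\sin\theta&\cos\theta\end{pmatrix},\kappa(\theta)\right)$, where $\kappa$ is $4\pi$-periodic, $\kappa=1$ on $[-\pi,\pi)$ and $\kappa=-1$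 on $[-2\pi,2\pi)\setminus[-\pi,\pi)$. Let $\epsilon\in\{\pm1\}$, and let $\sigma_\epsilon(\tilde m_{1,\pm1})=\pm1$, $\sigma_\epsilon(\tilde m_{-1,\pm1})=\mp\epsilon i$. For $\nu\in\mathbb C$ let $V^\infty_{\epsilon,\nu}$ be the space of smooth $f:\tilde G\to\mathbb C$ with $f(g\,\tilde m_{e_1,e_2}\tilde a_u\tilde n_{-,y})=\left(\sigma_\epsilon(\tilde m_{e_1,e_2})\,u^{\nu-1}\right)^{-1}f(g)$, with its usual topology (locally uniform convergence of all derivatives) and the action $(\pi(h)f)(g)=f(h^{-1}g)$. Let $V^{-\infty}_{\epsilon,\nu}$ be the continuous dual of $V^\infty_{-\epsilon,-\nu}$ with the strong topology and the dual action; it contains $V^\infty_{\epsilon,\nu}$ through $\langle f,\phi\rangle=\int_{-\pi/2}^{\pi/2}f(\tilde k_\theta)\phi(\tilde k_\theta)\,d\theta$. For $\phi\in V^\infty_{-\epsilon,-\nu}$ write $\phi_0(x)=\phi(\tilde n_x)$, $\phi_\infty(x)=\phi(\tilde s^{-1}\tilde n_x)$; $e(x)=e^{2\pi ix}$. A family $F_\mu\in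 V^\infty_{\pm\epsilon,\mu}$ $(\mu\in\mathbb C)$ is *flat* if $F_\mu(\tilde k_\theta)$ does not depend on $\mu$, for every $\theta$. **Distributions.** Let $\langle\delta_{\epsilon,\nu,0},\phi\rangle=\phi(1)$ and $\delta_{\epsilon,\nu,\infty}=\pi(\tilde s)\delta_{\epsilon,\nu,0}$. For $n\in\mathbb Z\setminus\{0\}$ let $\mathbf e_{\epsilon,\nu,n}\in V^{-\infty}_{\epsilon,\nu}$ be the canonical extension of $e(nx)$ to infinity: with any integer $k\ge0$ such that $\mathrm{Re}\,\nu+k>0$, $$\langle\mathbf e_{\epsilon,\nu,n},\phi\rangle=\left(\frac{-1}{2\pi in}\right)^{k}\int_{\mathbb R}\phi_0^{(k)}(x)\,e(nx)\,dx .$$ For $\nu\notin\{0,-1,-2,\dots\}$ let $\mathbf e_{\epsilon,\nu,0}=\mathbf 1_{\epsilon,\nu}$ be the constant distribution: for $\mathrm{Re}\,\nu>0$, $$\langle\mathbf 1_{\epsilon,\nu},\phi\rangle=\int_{-1}^1\phi_0(x)\,dx+\int_{-1}^1\mathrm{sgn}(-x)^{\epsilon/2}|x|^{\nu-1}\phi_\infty(x)\,dx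 ,$$ where $\mathrm{sgn}(y)^{\epsilon/2}=1$ for $y>0$ and $=\epsilon i$ for $y<0$, and for the other $\nu$ the homogeneous distribution $\mathrm{sgn}(-x)^{\epsilon/2}|x|^{\nu-1}$ is defined by analytic continuation in $\nu$. **Eisenstein distribution.** Let $\tilde\Gamma_1(4)=\left\{\left(\begin{pmatrix}a&b\\c&d\end{pmatrix},\left(\frac cd\right)\right)\right\}$, where $a,b,c,d\in\mathbb Z$, $ad-bc=1$, $a\equiv d\equiv1$ and $c\equiv0\pmod 4$, with the Kronecker symbol, and $\tilde\Gamma_\infty=\{\tilde n_m:m\in\mathbb Z\}$. With $\zeta_2(s)=(1-2^{-s})\zeta(s)$ put, for $\mathrm{Re}\,\nu>1$, $$\tilde E^{(\infty)}_{\epsilon,\nu}=\zeta_2(2\nu+1)\sum_{\gamma\in\tilde\Gamma_1(4)/\tilde\Gamma_\infty}\pi(\gamma)\,\delta_{\epsilon,\nu,\infty}\in V^{-\infty}_{\epsilon,\nu},$$ and for $n\ne0$ let $a_{\epsilon,\nu}(n)=\int_0^1\left(\tilde E^{(\infty)}_{\epsilon,\nu}\right)_0(x)\,e(-nx)\,dx$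 be the $n$-th Fourier coefficient of the ($1$-periodic) restriction $x\mapsto \tilde E^{(\infty)}_{\epsilon,\nu}(\tilde n_x)$. **Intertwining operator.** For $\mathrm{Re}\,\nu>0$ let $I_{\epsilon,\nu}:V^\infty_{\epsilon,-\nu}\to V^\infty_{\epsilon,\nu}$, $(I_{\epsilon,\nu}f)(g)=\int_{\mathbb R}f(g\,\tilde s\,\tilde n_t)\,dt$. **Gamma factors.** Let $G_0(s)=\dfrac{2\Gamma(s)}{(2\pi)^s}\cos\dfrac{\pi s}2$, as a meromorphic function (removable singularities removed), and for $\epsilon_1,\epsilon_2\in\{\pm1\}$ let $G_{(\epsilon_1,\epsilon_2)}(s)=\dfrac{(1-\epsilon_1i)\Gamma(s)}{(2\pi)^s}\left(\cos\dfrac{\pi s}2+\epsilon_1\epsilon_2\sin\dfrac{\pi s}2\right)$. **Statement.** For each $\epsilon\in\{\pm1\}$: 1. The series for $\tilde E^{(\infty)}_{\epsilon,\nu}$ converges for $\mathrm{Re}\,\nu>1$ in the strong topology, and $\tilde E^{(\infty)}_{\epsilon,\nu}$ extends to all $\nu\in\mathbb C\setminus\{0,\frac12\}$, in such a way that $\nu\mapsto\langle\tilde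 E^{(\infty)}_{\epsilon,\nu},F_{-\nu}\rangle$ is holomorphic there for every flat family $F$. For every $n\ne0$, $a_{\epsilon,\nu}(n)$ extends holomorphically to $\nu\in\mathbb C\setminus\{\frac12\}$. 2. The integrals defining $I_{\epsilon,\nu}$ converge absolutely for $\mathrm{Re}\,\nu>0$, and $I_{\epsilon,\nu}$ extends to continuous operators $V^\infty_{\epsilon,-\nu}\to V^\infty_{\epsilon,\nu}$ for $\nu\in\mathbb C\setminus\{0,-1,-2,\dots\}$, in such a way that $\nu\mapsto(I_{\epsilon,\nu}F_{-\nu})(\tilde k_\theta)$ is holomorphic there for every flat family $F$ and every $\theta$. For each such $\nu$, $I_{\epsilon,\nu}$ extends to a continuous operator $V^{-\infty}_{\epsilon,-\nu}\to V^{-\infty}_{\epsilon,\nu}$ for the strong topologies. 3. For all $\nu\in\mathbb C$ with $\nu\notin\{0,-1,-2,\dots\}$ and $\nu\ne-\frac12$, $$I_{\epsilon,\nu}\tilde E^{(\infty)}_{\epsilon,-\nu}=\sum_{n\in\mathbb Z}c_{\epsilon,\nu}(n)\,\mathbf e_{\epsilon,\nu,n}+c_{\epsilon,\nu}(\infty)\,\delta_{\epsilon,\nu,\infty},$$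 the series converging unconditionally in the strong topology of $V^{-\infty}_{\epsilon,\nu}$, where $$c_{\epsilon,\nu}(n)=G_{(\epsilon,\mathrm{sgn}(n))}(\nu)\,|n|^{-\nu}\,a_{\epsilon,-\nu}(n)\quad(n\ne0),$$ $$c_{\epsilon,\nu}(0)=(1-2^{2\nu-1})\,G_0(2\nu)\,\zeta(2\nu),\qquad c_{\epsilon,\nu}(\infty)=(1-\epsilon i)\,2^{2\nu-1}\,G_0(2\nu)\,\zeta(2\nu+1),$$ and at $\nu=\frac12$, where $\zeta(2\nu)$ has a pole, $c_{\epsilon,\nu}(0)$ stands for its limit, which is $0$. -/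

import Mathlib

open scoped ContDiff Topology MatrixGroups

namespace Metaplectic

/-! ### The metaplectic group -/

/-- The Hilbert symbol of `ℝ`. -/
noncomputable def hilbert (x y : ℝ) : ℤˣ := if x < 0 ∧ y < 0 then -1 else 1

/-- `X(a b; c d) = c` if `c ≠ 0`, and `d` if `c = 0`. -/
noncomputable def X (g : SL(2, ℝ)) : ℝ := if g.1 1 0 ≠ 0 then g.1 1 0 else g.1 1 1

/-- The Kubota cocycle. -/
noncomputable def cocycle (g h : SL(2, ℝ)) : ℤˣ := hilbert (X (g * h) / X g) (X (g * h) / X h)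

/-- The underlying set `SL₂(ℝ) × {±1}` of the metaplectic group. -/
@[ext] structure Mp where
  mat : SL(2, ℝ)
  sgn : ℤˣ

noncomputable instance : Mul Mp := ⟨fun g h => ⟨g.mat * h.mat, cocycle g.mat h.mat * g.sgn * h.sgn⟩⟩
noncomputable instance : One Mp := ⟨⟨1, 1⟩⟩
noncomputable instance : Inv Mp := ⟨fun g => ⟨g.mat⁻¹, cocycle g.mat⁻¹ g.mat * g.sgn⟩⟩

theorem X_ne_zero (g : SL(2, ℝ)) : X g ≠ 0 := by
  unfold X
  split_ifs with h
  · exact h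
  · intro h'
    have := g.2
    rw [Matrix.det_fin_two] at this
    simp only [ne_eq, not_not] at h
    simp [h, h'] at this

theorem X_one : X 1 = 1 := by simp [X]

theorem mul_neg_iff_ne {u v : ℝ} (hu : u ≠ 0) (hv : v ≠ 0) :
    u * v < 0 ↔ decide (u < 0) ≠ decide (v < 0) := by
  rcases lt_or_gt_of_ne hu with hu' | hu' <;> rcases lt_or_gt_of_ne hv with hv' | hv' <;>
    simp [hu', hv', hu'.le, hv'.le, mul_neg_iff, not_lt.2]

theorem hilbert_div {x y z : ℝ} (hx : x ≠ 0) (hy : y ≠ 0) (hz : z ≠ 0) :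
    hilbert (z / x) (z / y) = if decide (z < 0) ≠ decide (x < 0) ∧
      decide (z < 0) ≠ decide (y < 0) then -1 else 1 := by
  have h : ∀ w : ℝ, w ≠ 0 → (z / w < 0 ↔ decide (z < 0) ≠ decide (w < 0)) := fun w hw => by
    rw [← mul_neg_iff_ne hz hw, div_neg_iff, mul_neg_iff]
  simp only [hilbert, h x hx, h y hy]

theorem cocycle_bool : ∀ x y z p q r : Bool,
    ¬ (p = q ∧ y ≠ r ∧ x ≠ z) → ¬ (p ≠ q ∧ y = r ∧ x = z) →
    (if p ≠ x ∧ p ≠ y then (-1 : ℤˣ) else 1) * (if r ≠ p ∧ r ≠ z then (-1 : ℤˣ) else 1) =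
      (if r ≠ x ∧ r ≠ q then (-1 : ℤˣ) else 1) * (if q ≠ y ∧ q ≠ z then (-1 : ℤˣ) else 1) := by
  decide

/-- The sign identity behind the cocycle relation. -/
theorem cocycle_signs {x y z p q r : ℝ} (hx : x ≠ 0) (hy : y ≠ 0) (hz : z ≠ 0)
    (hp : p ≠ 0) (hq : q ≠ 0) (hr : r ≠ 0)
    (h1 : ¬ (0 < p * q ∧ y * r < 0 ∧ x * z < 0)) (h2 : ¬ (p * q < 0 ∧ 0 < y * r ∧ 0 < x * z)) :
    hilbert (p / x) (p / y) * hilbert (r / p) (r / z) =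
      hilbert (r / x) (r / q) * hilbert (q / y) (q / z) := by
  rw [hilbert_div hx hy hp, hilbert_div hp hz hr, hilbert_div hx hq hr, hilbert_div hy hz hq]
  have hm' : ∀ {u v : ℝ}, u ≠ 0 → v ≠ 0 → (0 < u * v ↔ decide (u < 0) = decide (v < 0)) := by
    intro u v hu hv
    have h0 : u * v ≠ 0 := mul_ne_zero hu hv
    rw [← not_iff_not, ← ne_eq (decide (u < 0)), ← mul_neg_iff_ne hu hv, not_lt]
    exact ⟨fun h => lt_of_le_of_ne h h0, le_of_lt⟩
  rw [hm' hp hq, mul_neg_iff_ne hy hr, mul_neg_iff_ne hx hz] at h1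
  rw [mul_neg_iff_ne hp hq, hm' hy hr, hm' hx hz] at h2
  exact cocycle_bool _ _ _ _ _ _ h1 h2

theorem X_of_ne {g : SL(2, ℝ)} (h : g.1 1 0 ≠ 0) : X g = g.1 1 0 := if_pos h

theorem X_of_eq {g : SL(2, ℝ)} (h : g.1 1 0 = 0) : X g = g.1 1 1 := if_neg (not_not.2 h)

theorem mul_one_zero (g h : SL(2, ℝ)) :
    (g * h).1 1 0 = g.1 1 0 * h.1 0 0 + g.1 1 1 * h.1 1 0 := by
  simp [Matrix.SpecialLinearGroup.coe_mul, Matrix.mul_apply, Fin.sum_univ_two]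

theorem mul_one_one (g h : SL(2, ℝ)) :
    (g * h).1 1 1 = g.1 1 0 * h.1 0 1 + g.1 1 1 * h.1 1 1 := by
  simp [Matrix.SpecialLinearGroup.coe_mul, Matrix.mul_apply, Fin.sum_univ_two]

theorem X_mul_left {g : SL(2, ℝ)} (hg : g.1 1 0 = 0) (h : SL(2, ℝ)) : X (g * h) = X g * X h := by
  have hd : g.1 1 1 ≠ 0 := X_of_eq hg ▸ X_ne_zero g
  rw [X_of_eq hg]
  have e := mul_one_zero g h
  rw [hg, zero_mul, zero_add] at e
  by_cases hc : h.1 1 0 = 0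
  · rw [X_of_eq hc, X_of_eq (by rw [e, hc, mul_zero]), mul_one_one, hg, zero_mul, zero_add]
  · rw [X_of_ne hc, X_of_ne (by rw [e]; exact mul_ne_zero hd hc), e]

theorem X_mul_right (g : SL(2, ℝ)) {h : SL(2, ℝ)} (hh : h.1 1 0 = 0) :
    ∃ t : ℝ, 0 < t ∧ X (g * h) = X g * X h * t := by
  have hd : h.1 1 1 ≠ 0 := X_of_eq hh ▸ X_ne_zero h
  have dh := h.2
  rw [Matrix.det_fin_two, hh, mul_zero, sub_zero] at dh
  have ha : h.1 0 0 ≠ 0 := left_ne_zero_of_mul (dh ▸ one_ne_zero)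
  have e := mul_one_zero g h
  rw [hh, mul_zero, add_zero] at e
  rw [X_of_eq hh]
  by_cases hc : g.1 1 0 = 0
  · refine ⟨1, one_pos, ?_⟩
    rw [X_of_eq hc, X_of_eq (by rw [e, hc, zero_mul]), mul_one_one, hc, zero_mul, zero_add, mul_one]
  · refine ⟨h.1 0 0 ^ 2, by positivity, ?_⟩
    rw [X_of_ne hc, X_of_ne (by rw [e]; exact mul_ne_zero hc ha), e]
    linear_combination (- g.1 1 0 * h.1 0 0) * dh

theorem X_signs (g h k : SL(2, ℝ)) :
    ¬ (0 < X (g * h) * X (h * k) ∧ X h * X (g * h * k) < 0 ∧ X g * X k < 0) ∧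
      ¬ (X (g * h) * X (h * k) < 0 ∧ 0 < X h * X (g * h * k) ∧ 0 < X g * X k) := by
  by_cases h1 : g.1 1 0 = 0
  · rw [mul_assoc g h k, X_mul_left h1, X_mul_left h1,
      show X h * (X g * X (h * k)) = X g * X h * X (h * k) by ring]
    constructor <;> rintro ⟨a, b, -⟩ <;> linarith
  by_cases h2 : h.1 1 0 = 0
  · obtain ⟨t, ht, e⟩ := X_mul_right g h2
    rw [X_mul_left h2, e,
      show X g * X h * t * (X h * X k) = (t * X h ^ 2) * (X g * X k) by ring]
    have hh := X_ne_zero h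
    have : 0 < t * X h ^ 2 := by positivity
    constructor <;> rintro ⟨a, -, b⟩
    · exact absurd ((mul_pos_iff_of_pos_left this).1 a) (by linarith)
    · exact absurd (mul_pos this b) (by linarith)
  by_cases h3 : k.1 1 0 = 0
  · obtain ⟨t, ht, e⟩ := X_mul_right h h3
    obtain ⟨t', ht', e'⟩ := X_mul_right (g * h) h3
    rw [e, e', show X (g * h) * (X h * X k * t) = t * (X (g * h) * X h * X k) by ring,
      show X h * (X (g * h) * X k * t') = t' * (X (g * h) * X h * X k) by ring]
    constructor <;> rintro ⟨a, b, -⟩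
    · have := (mul_pos_iff_of_pos_left ht).1 a
      exact absurd (mul_pos ht' this) (by linarith)
    · have := (mul_pos_iff_of_pos_left ht').1 b
      exact absurd (mul_pos ht this) (by linarith)
  have pl : (g * h).1 1 0 * (h * k).1 1 0 = h.1 1 0 * (g * h * k).1 1 0 + g.1 1 0 * k.1 1 0 := by
    have dh := h.2
    rw [Matrix.det_fin_two] at dh
    rw [mul_one_zero (g * h) k, mul_one_one, mul_one_zero g h, mul_one_zero h k]
    linear_combination (g.1 1 0 * k.1 1 0) * dh
  rw [X_of_ne h1, X_of_ne h2, X_of_ne h3]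
  by_cases h4 : (g * h).1 1 0 = 0
  · have hd : (g * h).1 1 1 ≠ 0 := X_of_eq h4 ▸ X_ne_zero (g * h)
    have h5 : (g * h * k).1 1 0 ≠ 0 := by
      rw [mul_one_zero (g * h) k, h4, zero_mul, zero_add]; exact mul_ne_zero hd h3
    rw [h4, zero_mul] at pl
    rw [X_of_ne h5]
    constructor <;> rintro ⟨-, a, b⟩ <;> linarith
  by_cases h5 : (h * k).1 1 0 = 0
  · have h6 : (g * h * k).1 1 0 ≠ 0 := by
      have dh := (h * k).2
      rw [Matrix.det_fin_two, h5, mul_zero, sub_zero] at dh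
      have ha : (h * k).1 0 0 ≠ 0 := left_ne_zero_of_mul (dh ▸ one_ne_zero)
      rw [mul_assoc, mul_one_zero g (h * k), h5, mul_zero, add_zero]; exact mul_ne_zero h1 ha
    rw [h5, mul_zero] at pl
    rw [X_of_ne h6]
    constructor <;> rintro ⟨-, a, b⟩ <;> linarith
  rw [X_of_ne h4, X_of_ne h5]
  by_cases h6 : (g * h * k).1 1 0 = 0
  · rw [h6, mul_zero, zero_add] at pl
    constructor <;> rintro ⟨a, -, b⟩ <;> linarith
  · rw [X_of_ne h6]
    constructor <;> rintro ⟨a, b, c⟩ <;> linarith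

/-- The cocycle relation. -/
theorem cocycle_assoc (g h k : SL(2, ℝ)) :
    cocycle g h * cocycle (g * h) k = cocycle g (h * k) * cocycle h k := by
  unfold cocycle
  rw [← mul_assoc]
  exact cocycle_signs (X_ne_zero _) (X_ne_zero _) (X_ne_zero _) (X_ne_zero _) (X_ne_zero _)
    (X_ne_zero _) (X_signs g h k).1 (X_signs g h k).2

theorem cocycle_one_left (g : SL(2, ℝ)) : cocycle 1 g = 1 := by
  simp [cocycle, hilbert, X_ne_zero, not_lt.2 zero_le_one]

/-- The metaplectic group: `(g, s) * (h, t) = (g h, α(g, h) s t)`. -/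
noncomputable instance : Group Mp :=
  Group.ofLeftAxioms
    (fun g h k => by
      apply Mp.ext
      · exact mul_assoc _ _ _
      · show cocycle (g.mat * h.mat) k.mat * (cocycle g.mat h.mat * g.sgn * h.sgn) * k.sgn =
          cocycle g.mat (h.mat * k.mat) * g.sgn * (cocycle h.mat k.mat * h.sgn * k.sgn)
        have := cocycle_assoc g.mat h.mat k.mat
        calc _ = (cocycle g.mat h.mat * cocycle (g.mat * h.mat) k.mat) *
              (g.sgn * h.sgn * k.sgn) := by ac_rfl
          _ = _ := by rw [this]; ac_rfl)
    (fun g => by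
      apply Mp.ext
      · exact one_mul _
      · show cocycle 1 g.mat * 1 * g.sgn = g.sgn
        simp [cocycle_one_left])
    (fun g => by
      apply Mp.ext
      · exact inv_mul_cancel _
      · show cocycle g.mat⁻¹ g.mat * (cocycle g.mat⁻¹ g.mat * g.sgn) * g.sgn = 1
        rw [← mul_assoc, Int.units_mul_self, one_mul, Int.units_mul_self])

/-! ### Standard elements and subgroups -/

/-- `ñ_x = ((1 x; 0 1), 1)`. -/
noncomputable def nPlus (x : ℝ) : Mp := ⟨⟨!![1, x; 0, 1], by simp⟩, 1⟩

/-- `ñ_{-,x} = ((1 0; x 1), 1)`. -/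
noncomputable def nMinus (x : ℝ) : Mp := ⟨⟨!![1, 0; x, 1], by simp⟩, 1⟩

/-- `ã_u = ((u 0; 0 u⁻¹), 1)`, for `u > 0`. -/
noncomputable def aTilde (u : ℝ) (hu : 0 < u) : Mp :=
  ⟨⟨!![u, 0; 0, u⁻¹], by simp [hu.ne']⟩, 1⟩

/-- `m̃_{e₁, e₂} = ((e₁ 0; 0 e₁), e₂)`, for `e₁, e₂ = ±1`. -/
noncomputable def mTilde (e₁ e₂ : ℤˣ) : Mp :=
  ⟨⟨!![((e₁ : ℤ) : ℝ), 0; 0, ((e₁ : ℤ) : ℝ)], by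
    rcases Int.units_eq_one_or e₁ with h | h <;> simp [h]⟩, e₂⟩

/-- `k̃_θ`, with sign `+1` for `θ ∈ [-π, π)` and `-1` on the rest of `[-2π, 2π)`, extended
`4π`-periodically. -/
noncomputable def kTilde (θ : ℝ) : Mp :=
  ⟨⟨!![Real.cos θ, -Real.sin θ; Real.sin θ, Real.cos θ], by
    rw [Matrix.det_fin_two_of]; nlinarith [Real.sin_sq_add_cos_sq θ]⟩,
    if toIcoMod (mul_pos four_pos Real.pi_pos) (-(2 * Real.pi)) θ ∈ Set.Ico (-Real.pi) Real.pi
    then 1 else -1⟩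

/-- `s̃ = ((0 -1; 1 0), 1)`. -/
noncomputable def sTilde : Mp := ⟨⟨!![0, -1; 1, 0], by simp⟩, 1⟩

/-- The Kronecker symbol `(a / n)`. -/
noncomputable def kronecker (a n : ℤ) : ℤ :=
  if n = 0 then (if a.natAbs = 1 then 1 else 0)
  else (if n < 0 ∧ a < 0 then -1 else 1) * ZMod.χ₈ (a : ZMod 8) ^ padicValNat 2 n.natAbs *
    jacobiSym a (n.natAbs / 2 ^ padicValNat 2 n.natAbs)

/-- The set underlying `Γ̃₁(4)`: the elements `((a b; c d), (c / d))` with `a, b, c, d` integers,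
`a ≡ d ≡ 1` and `c ≡ 0` modulo `4`. -/
def Gamma14 : Set Mp :=
  {γ | ∃ a b c d : ℤ, γ.mat.1 = !![(a : ℝ), (b : ℝ); (c : ℝ), (d : ℝ)] ∧
    a ≡ 1 [ZMOD 4] ∧ d ≡ 1 [ZMOD 4] ∧ c ≡ 0 [ZMOD 4] ∧ (γ.sgn : ℤ) = kronecker c d}

/-- `Γ̃_∞ = {ñ_m : m ∈ ℤ}`, the cyclic group generated by `ñ_1`. -/
noncomputable def GammaInf : Subgroup Mp := Subgroup.zpowers (nPlus 1)

/-- The coset space `Γ̃₁(4) / Γ̃_∞`, as a set of left cosets of `Γ̃_∞`. -/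
abbrev EisCosets : Type := {q : Mp ⧸ GammaInf // ∃ γ ∈ Gamma14, (γ : Mp ⧸ GammaInf) = q}

/-! ### Smooth principal series -/

/-- The character `σ_ε` of `M̃`: `σ_ε(1, ±1) = ±1` and `σ_ε(-1, ±1) = ∓ε i`. -/
noncomputable def sigma (ε e₁ e₂ : ℤˣ) : ℂ :=
  if e₁ = 1 then ((e₂ : ℤ) : ℂ) else -(((e₂ : ℤ) : ℂ) * ((ε : ℤ) : ℂ) * Complex.I)

/-- The value `ω_{ε,ν}(m̃_{e₁,e₂} ã_u ñ_-) = σ_ε(m̃_{e₁,e₂}) u^{ν-1}` of the quasi-character of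
`B̃ = M̃ Ã Ñ_-`. -/
noncomputable def omega (ε : ℤˣ) (ν : ℂ) (e₁ e₂ : ℤˣ) (u : ℝ) : ℂ :=
  sigma ε e₁ e₂ * (u : ℂ) ^ (ν - 1)

/-- Smooth functions on the Lie group `SL₂~(ℝ)`. The maps
`(x, t, y) ↦ g ñ_x ã_{exp t} ñ_{-,y}` are diffeomorphisms of `ℝ³` onto open sets, which cover the
group when `g` varies. -/
def IsSmooth (f : Mp → ℂ) : Prop :=
  ∀ g : Mp, ContDiff ℝ ∞ fun p : ℝ × ℝ × ℝ =>
    f (g * nPlus p.1 * aTilde (Real.exp p.2.1) (Real.exp_pos _) * nMinus p.2.2)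

/-- The space of `V^∞_{ε,ν}`: smooth `f` with `f(g b) = ω_{ε,ν}(b⁻¹) f(g)` for `b ∈ B̃`. -/
def smoothSubmodule (ε : ℤˣ) (ν : ℂ) : Submodule ℂ (Mp → ℂ) where
  carrier := {f | IsSmooth f ∧ ∀ (g : Mp) (e₁ e₂ : ℤˣ) (u : ℝ) (hu : 0 < u) (y : ℝ),
    f (g * (mTilde e₁ e₂ * aTilde u hu * nMinus y)) = (omega ε ν e₁ e₂ u)⁻¹ * f g}
  add_mem' := fun {f₁ f₂} h₁ h₂ =>
    ⟨fun g => (h₁.1 g).add (h₂.1 g), fun g e₁ e₂ u hu y => by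
      simp only [Pi.add_apply, h₁.2, h₂.2, mul_add]⟩
  zero_mem' := ⟨fun _ => contDiff_const, fun _ _ _ _ _ _ => by simp⟩
  smul_mem' := fun c f h =>
    ⟨fun g => (h.1 g).const_smul c, fun g e₁ e₂ u hu y => by
      simp only [Pi.smul_apply, h.2, smul_eq_mul]; ring⟩

/-- `V^∞_{ε,ν}`. It is not a reducible synonym of the submodule, because it does not carry the
topology of pointwise convergence. -/
def SmoothVec (ε : ℤˣ) (ν : ℂ) : Type := ↥(smoothSubmodule ε ν)

variable {ε : ℤˣ} {ν : ℂ}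

noncomputable instance : AddCommGroup (SmoothVec ε ν) :=
  inferInstanceAs (AddCommGroup ↥(smoothSubmodule ε ν))

noncomputable instance : Module ℂ (SmoothVec ε ν) :=
  inferInstanceAs (Module ℂ ↥(smoothSubmodule ε ν))

instance : CoeFun (SmoothVec ε ν) fun _ => Mp → ℂ := ⟨fun f => f.1⟩

theorem SmoothVec.isSmooth (f : SmoothVec ε ν) : IsSmooth f := f.2.1

theorem aTilde_one (h : (0 : ℝ) < 1) : aTilde 1 h = 1 := by
  apply Mp.ext
  · apply Subtype.ext
    simp only [aTilde]
    ext i j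
    fin_cases i <;> fin_cases j <;> simp [show (1 : Mp).mat = 1 from rfl]
  · rfl

theorem nMinus_zero : nMinus 0 = 1 := by
  apply Mp.ext
  · apply Subtype.ext
    ext i j
    fin_cases i <;> fin_cases j <;> simp [nMinus, show (1 : Mp).mat = 1 from rfl]
  · rfl

theorem nPlus_zero : nPlus 0 = 1 := by
  apply Mp.ext
  · apply Subtype.ext
    ext i j
    fin_cases i <;> fin_cases j <;> simp [nPlus, show (1 : Mp).mat = 1 from rfl]
  · rfl

theorem IsSmooth.contDiff_nPlus {f : Mp → ℂ} (hf : IsSmooth f) (g : Mp) :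
    ContDiff ℝ ∞ fun x : ℝ => f (g * nPlus x) := by
  have h := (hf g).comp (contDiff_id.prodMk (contDiff_const (c := ((0 : ℝ), (0 : ℝ)))))
  convert h using 2 with x
  simp [Real.exp_zero, aTilde_one, nMinus_zero]

/-- `f ↦` the `j`-th derivative of `x ↦ f(g ñ_x)`, as a continuous function on `ℝ`. -/
noncomputable def jet (ε : ℤˣ) (ν : ℂ) :
    SmoothVec ε ν →ₗ[ℂ] (Mp × ℕ → C(ℝ, ℂ)) where
  toFun f i := ⟨iteratedDeriv i.2 fun x => f (i.1 * nPlus x),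
    (f.isSmooth.contDiff_nPlus i.1).continuous_iteratedDeriv i.2 (by exact_mod_cast le_top)⟩
  map_add' f₁ f₂ := by
    funext i
    ext x
    exact iteratedDeriv_add
      ((f₁.isSmooth.contDiff_nPlus i.1).contDiffAt.of_le (by exact_mod_cast le_top))
      ((f₂.isSmooth.contDiff_nPlus i.1).contDiffAt.of_le (by exact_mod_cast le_top))
  map_smul' c f := by
    funext i
    ext x
    exact iteratedDeriv_const_smul_field c _

/-- The usual topology of `V^∞_{ε,ν}`: locally uniform convergence of all derivatives. Since
`f` is determined along `M̃ Ã Ñ_-` by its transformation law, only derivatives along the lines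
`x ↦ g ñ_x`, for all `g`, have to be controlled. -/
noncomputable instance : TopologicalSpace (SmoothVec ε ν) :=
  TopologicalSpace.induced (jet ε ν) inferInstance

instance : IsTopologicalAddGroup (SmoothVec ε ν) := topologicalAddGroup_induced (jet ε ν)

instance : ContinuousSMul ℂ (SmoothVec ε ν) := continuousSMul_induced (jet ε ν)

theorem continuous_eval (g : Mp) : Continuous fun f : SmoothVec ε ν => f g := by
  have h : Continuous fun f : SmoothVec ε ν => jet ε ν f (g, 0) 0 :=
    (continuous_eval_const (F := C(ℝ, ℂ)) (0 : ℝ)).comp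
      ((continuous_apply (g, 0)).comp continuous_induced_dom)
  convert h using 2 with f
  simp [jet, nPlus_zero]

/-- The action `(π(h) f)(g) = f(h⁻¹ g)` on `V^∞_{ε,ν}`. -/
noncomputable def translate (h : Mp) : SmoothVec ε ν →L[ℂ] SmoothVec ε ν where
  toFun f := ⟨fun g => f (h⁻¹ * g), fun g => by
    simpa only [mul_assoc] using f.2.1 (h⁻¹ * g), fun g e₁ e₂ u hu y => by
    have := f.2.2 (h⁻¹ * g) e₁ e₂ u hu y
    rwa [mul_assoc h⁻¹ g] at this⟩
  map_add' _ _ := rfl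
  map_smul' _ _ := rfl
  cont := by
    refine continuous_induced_rng.2 (continuous_pi fun i => ?_)
    have h1 : Continuous fun f : SmoothVec ε ν => jet ε ν f (h⁻¹ * i.1, i.2) :=
      (continuous_apply _).comp continuous_induced_dom
    convert h1 using 2 with f
    ext x
    show iteratedDeriv i.2 (fun x => f (h⁻¹ * (i.1 * nPlus x))) x =
      iteratedDeriv i.2 (fun x => f (h⁻¹ * i.1 * nPlus x)) x
    simp only [mul_assoc]

/-! ### Distributional principal series -/

/-- `V^{-∞}_{ε,ν}`, the dual of `V^∞_{-ε,-ν}` with the strong topology (uniform convergence on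
bounded sets). -/
abbrev Dist (ε : ℤˣ) (ν : ℂ) : Type := SmoothVec (-ε) (-ν) →L[ℂ] ℂ

/-- `T` is the distribution defined by the smooth vector `f` through the pairing
`⟨f, φ⟩ = ∫_{-π/2}^{π/2} f(k̃_θ) φ(k̃_θ) dθ`. -/
def Represents (T : Dist ε ν) (f : SmoothVec ε ν) : Prop :=
  ∀ φ : SmoothVec (-ε) (-ν),
    T φ = ∫ θ in (-(Real.pi / 2))..(Real.pi / 2), f (kTilde θ) * φ (kTilde θ)

/-- The action `⟨π(h) T, φ⟩ = ⟨T, π(h⁻¹) φ⟩` on `V^{-∞}_{ε,ν}`. -/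
noncomputable def act (h : Mp) (T : Dist ε ν) : Dist ε ν := T.comp (translate h⁻¹)

/-- `δ_{ε,ν,0}`: the restriction to `Ñ` is the Dirac distribution at `0`, the restriction to
`s̃⁻¹ Ñ` is `0`. -/
noncomputable def deltaZero (ε : ℤˣ) (ν : ℂ) : Dist ε ν where
  toFun φ := φ 1
  map_add' _ _ := rfl
  map_smul' _ _ := rfl
  cont := continuous_eval 1

/-- `δ_{ε,ν,∞} = π(s̃) δ_{ε,ν,0}`. -/
noncomputable def deltaInfty (ε : ℤˣ) (ν : ℂ) : Dist ε ν := act sTilde (deltaZero ε ν)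

open Classical in
/-- The distribution `φ ↦ Φ φ`, if this is a continuous linear functional. -/
noncomputable def distOf (Φ : SmoothVec (-ε) (-ν) → ℂ) : Dist ε ν :=
  if h : ∃ T : Dist ε ν, ∀ φ, T φ = Φ φ then h.choose else 0

/-- The number `k = max(0, ⌊1 - Re ν⌋)`; it satisfies `Re ν + k > 0`, and `k = 0` if `Re ν > 0`. -/
noncomputable def order (ν : ℂ) : ℕ := ⌊1 - ν.re⌋₊

/-- `sgn(x)^{ε/2}` for `x ≠ 0`, with the principal branch. -/
noncomputable def sgnHalf (ε : ℤˣ) (x : ℝ) : ℂ :=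
  if x < 0 then ((ε : ℤ) : ℂ) * Complex.I else 1

/-- `e(x) = exp(2 π i x)`. -/
noncomputable def expTwoPi (x : ℝ) : ℂ := Complex.exp (2 * Real.pi * Complex.I * x)

/-- For `n ≠ 0`: the pairing of the canonical extension of `e(n x)` with `φ`, that is
`∫ e(n x) φ₀(x) dx`, where `φ₀(x) = φ(ñ_x)`, regularised by `k`-fold integration by parts.
As `φ₀^{(k)}(x) = O(|x|^{-Re ν - 1 - k})`, the integral converges absolutely, and its value does not
depend on `k` as long as `Re ν + k > 0`; so the distribution vanishes to infinite order at `∞`. -/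
noncomputable def waveFunctional (ε : ℤˣ) (ν : ℂ) (n : ℤ) (φ : SmoothVec (-ε) (-ν)) : ℂ :=
  (-1 / (2 * Real.pi * Complex.I * n)) ^ order ν *
    ∫ x : ℝ, iteratedDeriv (order ν) (fun x => φ (nPlus x)) x * expTwoPi (n * x)

/-- The Taylor coefficient of degree `j` at `0` of `φ_∞(x) = φ(s̃⁻¹ ñ_x)`. -/
noncomputable def taylorInfty (φ : Mp → ℂ) (j : ℕ) : ℂ :=
  iteratedDeriv j (fun x => φ (sTilde⁻¹ * nPlus x)) 0 / (j.factorial : ℂ)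

/-- For `ν ∉ {0, -1, -2, …}`: the pairing of the distribution with restrictions `1` to `Ñ` and
`sgn(-x)^{ε/2} |x|^{ν-1}` to `s̃⁻¹ Ñ` with `φ`. The homogeneous distribution is continued
analytically in `ν` from `Re ν > 0` in the usual way, by subtraction of the Taylor polynomial. -/
noncomputable def oneFunctional (ε : ℤˣ) (ν : ℂ) (φ : SmoothVec (-ε) (-ν)) : ℂ :=
  (∫ x in (-1 : ℝ)..1, φ (nPlus x)) +
  (∫ x in (-1 : ℝ)..1, sgnHalf ε (-x) * ((|x| : ℝ) : ℂ) ^ (ν - 1) *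
    (φ (sTilde⁻¹ * nPlus x) - ∑ j ∈ Finset.range (order ν), taylorInfty φ j * (x : ℂ) ^ j)) +
  ∑ j ∈ Finset.range (order ν),
    taylorInfty φ j * ((-1) ^ j + ((ε : ℤ) : ℂ) * Complex.I) / (ν + j)

/-- The distributions `𝕖_{ε,ν,n}`, where `𝕖_{ε,ν,0}` is the constant `𝟙_{ε,ν}`. -/
noncomputable def wave (ε : ℤˣ) (ν : ℂ) (n : ℤ) : Dist ε ν :=
  if n = 0 then distOf (oneFunctional ε ν) else distOf (waveFunctional ε ν n)

/-- `A` is the `n`-th Fourier coefficient `∫₀¹ T₀(x) e(-n x) dx` of the restriction `T₀` of `T` to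
`Ñ`: `T₀(ψ e(-n ·)) = A` for all test functions `ψ` whose integral translates sum up to `1`.
Here `T₀(ψ e(-n ·)) = T(φ)` for the `φ` with `φ(ñ_x) = ψ(x) e(-n x)`. -/
def IsFourierCoeff (T : Dist ε ν) (n : ℤ) (A : ℂ) : Prop :=
  ∀ (ψ : ℝ → ℝ) (φ : SmoothVec (-ε) (-ν)), ContDiff ℝ ∞ ψ → HasCompactSupport ψ →
    (∀ x, ∑' m : ℤ, ψ (x + m) = 1) →
    (∀ x, φ (nPlus x) = (ψ x : ℂ) * expTwoPi (-(n * x))) → T φ = A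

/-! ### Analytic continuation of the Eisenstein distribution and the intertwining operators -/

/-- A family `F_μ ∈ V^∞_{ε,μ}` whose restriction to `K̃` does not depend on `μ`. -/
def IsFlat (F : ∀ μ : ℂ, SmoothVec ε μ) : Prop :=
  ∀ (μ μ' : ℂ) (θ : ℝ), F μ (kTilde θ) = F μ' (kTilde θ)

/-- `ζ₂(s) = (1 - 2^{-s}) ζ(s)`. -/
noncomputable def zetaTwo (s : ℂ) : ℂ := (1 - (2 : ℂ) ^ (-s)) * riemannZeta s

/-- `E` is the analytic continuation of the Eisenstein distribution at `∞` to `ℂ ∖ {0, 1/2}`: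
for `Re ν > 1`, `E_ν = ζ₂(2ν+1) ∑_{γ ∈ Γ̃₁(4)/Γ̃_∞} π(γ) δ_{ε,ν,∞}` with convergence in the strong
topology, and `ν ↦ ⟨E_ν, F_{-ν}⟩` is holomorphic on `ℂ ∖ {0, 1/2}` for all flat families `F`. -/
def IsEisenstein (ε : ℤˣ) (E : ∀ ν : ℂ, Dist ε ν) : Prop :=
  (∀ ν : ℂ, 1 < ν.re → HasSum (fun q : EisCosets =>
    zetaTwo (2 * ν + 1) • act q.1.out (deltaInfty ε ν)) (E ν)) ∧
  ∀ F : ∀ μ : ℂ, SmoothVec (-ε) μ, IsFlat F →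
    DifferentiableOn ℂ (fun ν => E ν (F (-ν))) {ν | ν ≠ 0 ∧ ν ≠ 1 / 2}

/-- `a n ν`, for `n ≠ 0`, is the analytic continuation to `ℂ ∖ {1/2}` of the `n`-th Fourier
coefficient of `E_ν`, which is defined for `Re ν > 1`. -/
def IsEisensteinCoeff (ε : ℤˣ) (E : ∀ ν : ℂ, Dist ε ν) (a : ℤ → ℂ → ℂ) : Prop :=
  ∀ n : ℤ, n ≠ 0 → (∀ ν : ℂ, 1 < ν.re → IsFourierCoeff (E ν) n (a n ν)) ∧
    DifferentiableOn ℂ (a n) {ν | ν ≠ 1 / 2}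

/-- `J` is the analytic continuation to `ℂ ∖ {0, -1, -2, …}` of the intertwining operators
`V^∞_{ε,-ν} → V^∞_{ε,ν}`, `(J_ν f)(g) = ∫ f(g s̃ ñ_t) dt`, given for `Re ν > 0`:
`ν ↦ (J_ν F_{-ν})(k̃_θ)` is holomorphic for all flat families `F` and all `θ`. -/
def IsIntertwining (ε : ℤˣ) (J : ∀ ν : ℂ, SmoothVec ε (-ν) →L[ℂ] SmoothVec ε ν) : Prop :=
  (∀ ν : ℂ, 0 < ν.re → ∀ (f : SmoothVec ε (-ν)) (g : Mp),
    MeasureTheory.Integrable (fun t : ℝ => f (g * sTilde * nPlus t)) ∧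
    J ν f g = ∫ t : ℝ, f (g * sTilde * nPlus t)) ∧
  ∀ F : ∀ μ : ℂ, SmoothVec ε μ, IsFlat F → ∀ θ : ℝ,
    DifferentiableOn ℂ (fun ν => J ν (F (-ν)) (kTilde θ)) {ν | ∀ m : ℕ, ν ≠ -m}

/-- For `ν ∉ {0, -1, -2, …}`, the operator `I_ν`, which is continuous for the strong topologies,
extends `J_ν` to distributions. -/
def IsExtension (ε : ℤˣ) (J : ∀ ν : ℂ, SmoothVec ε (-ν) →L[ℂ] SmoothVec ε ν)
    (I : ∀ ν : ℂ, Dist ε (-ν) →L[ℂ] Dist ε ν) : Prop :=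
  ∀ ν : ℂ, (∀ m : ℕ, ν ≠ -m) → ∀ (T : Dist ε (-ν)) (f : SmoothVec ε (-ν)),
    Represents T f → Represents (I ν T) (J ν f)

/-! ### The coefficients -/

/-- `G₀(s) = 2 (2π)^{-s} Γ(s) cos(π s / 2)`, with removable singularities removed. -/
noncomputable def G0 : ℂ → ℂ :=
  toMeromorphicNFOn (fun s => 2 * Complex.Gamma s / (2 * Real.pi : ℂ) ^ s *
    Complex.cos (Real.pi * s / 2)) Set.univ

/-- `G_{(ε₁,ε₂)}(s) = (1 - ε₁ i) (2π)^{-s} Γ(s) (cos(π s / 2) + ε₁ ε₂ sin(π s / 2))`. -/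
noncomputable def G (e₁ e₂ : ℤ) (s : ℂ) : ℂ :=
  (1 - e₁ * Complex.I) * Complex.Gamma s / (2 * Real.pi : ℂ) ^ s *
    (Complex.cos (Real.pi * s / 2) + e₁ * e₂ * Complex.sin (Real.pi * s / 2))

/-- The coefficients `c_{ε,ν}(n)`, in terms of the Fourier coefficients `a n ν = a_{ε,ν}(n)`. -/
noncomputable def coeff (ε : ℤˣ) (a : ℤ → ℂ → ℂ) (ν : ℂ) (n : ℤ) : ℂ :=
  if n = 0 then (1 - (2 : ℂ) ^ (2 * ν - 1)) * G0 (2 * ν) * riemannZeta (2 * ν)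
  else G ε n.sign ν * ((|n| : ℤ) : ℂ) ^ (-ν) * a n (-ν)

/-- The coefficient `c_{ε,ν}(∞)`. -/
noncomputable def coeffInfty (ε : ℤˣ) (ν : ℂ) : ℂ :=
  (1 - ((ε : ℤ) : ℂ) * Complex.I) * (2 : ℂ) ^ (2 * ν - 1) * G0 (2 * ν) * riemannZeta (2 * ν + 1)

end Metaplectic

namespace Metaplectic

noncomputable section

open scoped Real
open MeasureTheory Filter
open ArithmeticFunction hiding map_zero log
open Complex (I exp Gamma exp_add continuous_re I_sq cpow_neg cpow_add norm_real ofReal_mul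
  ofReal_one arg exp_mul_I re conj_ofReal norm_exp ofReal_re cpow_def_of_ne_zero Gammaℝ ofReal_cpow
  neg_re mul_cpow_ofReal_nonneg conj_I Gamma_ne_zero_of_re_pos cpow_one exp_eq_exp_iff_exists_int
  ofReal_log normSq_pos re_ofReal_mul sub_re norm_I abs_re_le_norm sin_neg cos_neg inv_cpow
  cpow_eq_zero_iff real_smul ofReal_pow ofReal_neg norm_cpow_eq_rpow_re_of_pos
  norm_exp_ofReal_mul_I ofReal_ne_zero differentiableAt_Gamma add_re exp_sub
  norm_natCast_cpow_of_pos exp_conj cpow_sub continuous_ofReal re_le_norm ofReal_inv ofReal_div im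
  ofReal_zero ofReal_ofNat exp_pi_mul_I I_re I_im one_re norm_mul_exp_arg_mul_I normSq mul_im
  inv_re inv_im)
open Finset (range sum_congr mem_range mem_filter sum_range_succ mul_sum sum_mul sum_range_succ'
  sum_eq_zero sum_empty sum_const sum_nonneg range_zero single_le_sum mem_sigma sum_le_sum
  sum_insert sum_mul_sum)
open Real (arctan cos pi_pos tan log sin rpow_add rpow_mul pi_ne_zero sqrt_eq_rpow rpow_natCast
  mul_rpow sqrt norm_of_nonneg rpow_neg rpow_nonneg norm_eq_abs sqrt_pos sqrt_mul rpow_pos_of_pos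
  arctan_neg sqrt_sq rpow_two exp_le_exp cos_arctan arctan_tan)
open Set (Icc Ioc univ mem_univ EqOn uIcc_of_le Ioo)
open intervalIntegral (integral_of_le integral_congr)
open Summable (of_norm_bounded)
open ZMod (stdAddChar)
open Metric (ball)
open Nat (cast_nonneg Coprime succ_ne_zero odd_mul cast_mul cast_zero odd_iff mem_divisors
  prime_two cast_succ cast_ofNat)
open Int (cast_ne_zero units_eq_one_or natAbs_pos cast_abs)
open Matrix (of_apply cons_val' cons_val_one cons_val_zero cons_val_fin_one)
open Function (uncurry)

variable {ε : ℤˣ} {ν : ℂ}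


/-! ### A square root of the factor of automorphy -/

/-- The argument with values in `[-π, π)`. -/
def argm (w : ℂ) : ℝ := -arg ((starRingEnd ℂ) w)

/-- The square root with argument in `[-π / 2, π / 2)`. -/
def sqrtm (w : ℂ) : ℂ := ((‖w‖ ^ (1 / 2 : ℝ) : ℝ) : ℂ) * exp (I * ((argm w / 2 : ℝ) : ℂ))

lemma neg_pi_le_argm (w : ℂ) : -π ≤ argm w := neg_le_neg (Complex.arg_le_pi _)

lemma argm_lt_pi (w : ℂ) : argm w < π := by
  have := Complex.neg_pi_lt_arg ((starRingEnd ℂ) w)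
  unfold argm; linarith

lemma norm_mul_exp_argm (w : ℂ) : (‖w‖ : ℂ) * exp (I * (argm w : ℂ)) = w := by
  have h := congrArg (starRingEnd ℂ) (norm_mul_exp_arg_mul_I ((starRingEnd ℂ) w))
  rw [Complex.conj_conj, map_mul, ← exp_conj, map_mul, conj_ofReal,
    conj_ofReal, conj_I, Complex.norm_conj] at h
  refine Eq.trans ?_ h
  rw [argm]
  push_cast; ring_nf

lemma argm_exp {r t : ℝ} (hr : 0 < r) (h1 : -π ≤ t) (h2 : t < π) :
    argm ((r : ℂ) * exp (I * (t : ℂ))) = t := by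
  rw [argm, map_mul, ← exp_conj, map_mul, conj_I, conj_ofReal,
    conj_ofReal, show -I * (t : ℂ) = ((-t : ℝ) : ℂ) * I by push_cast; ring,
    exp_mul_I, Complex.arg_mul_cos_add_sin_mul_I hr ⟨by linarith, by linarith⟩]
  ring

lemma sqrtm_ne_zero {w : ℂ} (hw : w ≠ 0) : sqrtm w ≠ 0 := by
  have : 0 < ‖w‖ := norm_pos_iff.2 hw
  exact mul_ne_zero (mod_cast (rpow_pos_of_pos this _).ne') (Complex.exp_ne_zero _)

lemma sqrtm_sq (w : ℂ) : sqrtm w ^ 2 = w := by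
  conv_rhs => rw [← norm_mul_exp_argm w]
  rw [sqrtm, mul_pow, ← Complex.exp_nat_mul, ← ofReal_pow, ← rpow_natCast,
    ← rpow_mul (norm_nonneg _)]
  norm_num
  grind

lemma sqrtm_mul {v w : ℂ} (hv : v ≠ 0) (hw : w ≠ 0) :
    sqrtm (v * w) = (((if decide (argm (v * w) < 0) ≠ decide (argm v < 0) ∧
      decide (argm (v * w) < 0) ≠ decide (argm w < 0) then -1 else 1 : ℤˣ) : ℤ) : ℂ) *
      sqrtm v * sqrtm w := by
  have e := norm_mul_exp_argm (v * w)
  have hn : (‖v * w‖ : ℂ) = ‖v‖ * ‖w‖ := by simp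
  have hne : (‖v * w‖ : ℂ) ≠ 0 := mod_cast norm_ne_zero_iff.2 (mul_ne_zero hv hw)
  have e2 : exp (I * (argm (v * w) : ℂ)) = exp (I * (argm v : ℂ) + I * (argm w : ℂ)) := by
    apply mul_left_cancel₀ hne
    rw [e, exp_add, hn]
    conv_lhs => rw [← norm_mul_exp_argm v, ← norm_mul_exp_argm w]
    ring
  obtain ⟨k, hk⟩ := exp_eq_exp_iff_exists_int.1 e2
  have hk' : argm (v * w) = argm v + argm w + k * (2 * π) := by
    have : I * ((argm (v * w) : ℝ) : ℂ) = I * ((argm v + argm w + k * (2 * π) : ℝ) : ℂ) := by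
      rw [hk]; push_cast; ring
    exact_mod_cast mul_left_cancel₀ Complex.I_ne_zero this
  have b1 := neg_pi_le_argm v
  have b2 := argm_lt_pi v
  have b3 := neg_pi_le_argm w
  have b4 := argm_lt_pi w
  have b5 := neg_pi_le_argm (v * w)
  have b6 := argm_lt_pi (v * w)
  have hp := pi_pos
  have hk1 : (-2 : ℝ) < k := by nlinarith
  have hk2 : (k : ℝ) < 2 := by nlinarith
  have hk1' : -2 < k := mod_cast hk1
  have hk2' : k < 2 := mod_cast hk2
  have main : sqrtm (v * w) = exp (k * π * I) * sqrtm v * sqrtm w := by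
    unfold sqrtm
    rw [hk', norm_mul, mul_rpow (norm_nonneg _) (norm_nonneg _),
      show I * ((((argm v + argm w + k * (2 * π)) / 2 : ℝ)) : ℂ) =
        k * π * I + I * ((argm v / 2 : ℝ) : ℂ) +
          I * ((argm w / 2 : ℝ) : ℂ) by push_cast; ring, exp_add, exp_add]
    push_cast; ring
  rw [main]
  congr 2
  interval_cases k
  · push_cast at hk' ⊢
    have c1 : 0 ≤ argm v := by linarith
    have c2 : 0 ≤ argm w := by linarith
    have c3 : argm (v * w) < 0 := by linarith
    simp [c1.not_gt, c2.not_gt, c3]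
  · have h0 : argm (v * w) = argm v + argm w := by grind
    rw [if_neg]
    · simp
    grind
  · push_cast at hk' ⊢
    have c1 : argm v < 0 := by linarith
    have c2 : argm w < 0 := by linarith
    have c3 : 0 ≤ argm (v * w) := by linarith
    simp_all

lemma argm_neg_iff {w : ℂ} : argm w < 0 ↔ w.im < 0 ∨ (w.im = 0 ∧ w.re < 0) := by
  rw [argm, neg_lt_zero, lt_iff_le_and_ne, Complex.arg_nonneg_iff, Ne, eq_comm, Complex.arg_eq_zero_iff]
  simp only [Complex.conj_im, Complex.conj_re]
  grind

/-- The factor of automorphy `c z + d`. -/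
def den (g : SL(2, ℝ)) (z : ℂ) : ℂ := (g.1 1 0 : ℂ) * z + (g.1 1 1 : ℂ)

/-- The action by fractional linear transformations. -/
def mob (g : SL(2, ℝ)) (z : ℂ) : ℂ := ((g.1 0 0 : ℂ) * z + (g.1 0 1 : ℂ)) / den g z

lemma det_eq (g : SL(2, ℝ)) : g.1 0 0 * g.1 1 1 - g.1 0 1 * g.1 1 0 = 1 := by
  have := g.2; rwa [Matrix.det_fin_two] at this

lemma den_ne_zero (g : SL(2, ℝ)) {z : ℂ} (hz : 0 < z.im) : den g z ≠ 0 := by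
  intro h
  have h1 := congrArg im h
  simp [den] at h1
  have hc : g.1 1 0 = 0 := by grind
  have h2 := congrArg re h
  simp [den, hc] at h2
  have := det_eq g
  grind

lemma mob_im (g : SL(2, ℝ)) {z : ℂ} (hz : 0 < z.im) : 0 < (mob g z).im := by
  have hd := den_ne_zero g hz
  have hn : 0 < normSq (den g z) := normSq_pos.2 hd
  have : (mob g z).im = z.im / normSq (den g z) := by
    rw [mob, Complex.div_im]
    have e := det_eq g
    field_simp
    simp [den]
    grind
  simp_all

lemma den_mul (g h : SL(2, ℝ)) {z : ℂ} (hz : 0 < z.im) :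
    den (g * h) z = den g (mob h z) * den h z := by
  have hd := den_ne_zero h hz
  have : mob h z * den h z = (h.1 0 0 : ℂ) * z + (h.1 0 1 : ℂ) := div_mul_cancel₀ _ hd
  rw [den, mul_one_zero, mul_one_one]
  conv_rhs => rw [den, add_mul, mul_assoc, this, den]
  push_cast; ring

lemma argm_den_neg_iff (g : SL(2, ℝ)) {z : ℂ} (hz : 0 < z.im) : argm (den g z) < 0 ↔ X g < 0 := by
  rw [argm_neg_iff]
  by_cases hc : g.1 1 0 = 0
  · rw [X_of_eq hc]; simp [den, hc]
  · rw [X_of_ne hc]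
    simp only [den, Complex.add_im, mul_im, ofReal_re, Complex.ofReal_im, zero_mul,
      add_zero, mul_eq_zero, hc, hz.ne', or_self, false_and, or_false]
    exact ⟨fun h => by nlinarith, fun h => by nlinarith⟩

/-- The automorphy factor of weight `1/2` on the metaplectic group. -/
def jf (g : Mp) (z : ℂ) : ℂ := ((g.sgn : ℤ) : ℂ) * sqrtm (den g.mat z)

lemma Mp.mul_mat (g h : Mp) : (g * h).mat = g.mat * h.mat := rfl

lemma Mp.mul_sgn (g h : Mp) : (g * h).sgn = cocycle g.mat h.mat * g.sgn * h.sgn := rfl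

lemma Mp.inv_mat (g : Mp) : (g⁻¹).mat = g.mat⁻¹ := rfl

lemma units_cast_ne_zero (e : ℤˣ) : ((e : ℤ) : ℂ) ≠ 0 := by simp

lemma jf_mul (g h : Mp) {z : ℂ} (hz : 0 < z.im) : jf (g * h) z = jf g (mob h.mat z) * jf h z := by
  have hz' := mob_im h.mat hz
  have h1 := den_ne_zero h.mat hz
  have h2 := den_ne_zero g.mat hz'
  have e := sqrtm_mul h2 h1
  rw [← den_mul _ _ hz] at e
  have d : cocycle g.mat h.mat = if decide (argm (den (g.mat * h.mat) z) < 0) ≠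
      decide (argm (den g.mat (mob h.mat z)) < 0) ∧ decide (argm (den (g.mat * h.mat) z) < 0) ≠
      decide (argm (den h.mat z) < 0) then -1 else 1 := by
    rw [cocycle, hilbert_div (X_ne_zero _) (X_ne_zero _) (X_ne_zero _)]
    simp only [argm_den_neg_iff _ hz, argm_den_neg_iff _ hz']
  rw [← d] at e
  have hs : (((cocycle g.mat h.mat : ℤˣ) : ℤ) : ℂ) * ((cocycle g.mat h.mat : ℤˣ) : ℤ) = 1 := by
    rw [← Int.cast_mul, ← Units.val_mul, Int.units_mul_self]; simp
  rw [jf, Mp.mul_mat, Mp.mul_sgn, e, jf, jf]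
  push_cast
  grind

lemma jf_ne_zero (g : Mp) {z : ℂ} (hz : 0 < z.im) : jf g z ≠ 0 :=
  mul_ne_zero (units_cast_ne_zero _) (sqrtm_ne_zero (den_ne_zero _ hz))

lemma jf_sq (g : Mp) (z : ℂ) : jf g z ^ 2 = den g.mat z := by
  rw [jf, mul_pow, sqrtm_sq, ← Int.cast_pow, ← Units.val_pow_eq_pow_val, Int.units_sq]; simp

lemma norm_units (e : ℤˣ) : ‖((e : ℤ) : ℂ)‖ = 1 := by
  rcases units_eq_one_or e with h | h <;> simp [h]

lemma Mp.ext_jf {g h : Mp} (hm : g.mat = h.mat) {z : ℂ} (hz : 0 < z.im) (hj : jf g z = jf h z) :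
    g = h := by
  apply Mp.ext hm
  rw [jf, jf, hm] at hj
  have := mul_right_cancel₀ (sqrtm_ne_zero (den_ne_zero _ hz)) hj
  exact Units.ext (mod_cast this)

/-- A square root of `d i - b`, equivariant under the lower triangular group. -/
def pf (g : Mp) : ℂ := jf (sTilde * g⁻¹) I

lemma pf_ne_zero (g : Mp) : pf g ≠ 0 := jf_ne_zero _ (by simp)

lemma pf_mul (g h : Mp) : pf (g * h) = jf (sTilde * h⁻¹) (mob g.mat⁻¹ I) * jf g⁻¹ I := by
  rw [pf, mul_inv_rev, ← mul_assoc, jf_mul _ _ (by simp), Mp.inv_mat]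

lemma den_sTilde_inv (h : SL(2, ℝ)) (z : ℂ) :
    den (sTilde.mat * h⁻¹) z = (h.1 1 1 : ℂ) * z - (h.1 0 1 : ℂ) := by
  rw [den, mul_one_zero, mul_one_one]
  simp [sTilde, Matrix.SpecialLinearGroup.SL2_inv_expl, sub_eq_add_neg]

lemma pf_sq (g : Mp) : pf g ^ 2 = (g.mat.1 1 1 : ℂ) * I - (g.mat.1 0 1 : ℂ) := by
  rw [pf, jf_sq, Mp.mul_mat, Mp.inv_mat, den_sTilde_inv]

lemma jf_of_sgn {g : Mp} {s : ℤˣ} (h : g.sgn = s) (z : ℂ) :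
    jf g z = ((s : ℤ) : ℂ) * sqrtm (den g.mat z) := by rw [jf, h]

/-! ### The metaplectic rotations and the Iwasawa decomposition -/

lemma entry_mul (g h : SL(2, ℝ)) (i j : Fin 2) :
    (g * h).1 i j = g.1 i 0 * h.1 0 j + g.1 i 1 * h.1 1 j := by
  rw [Matrix.SpecialLinearGroup.coe_mul, Matrix.mul_apply, Fin.sum_univ_two]

lemma inv_entries (g : SL(2, ℝ)) : g⁻¹.1 0 0 = g.1 1 1 ∧ g⁻¹.1 0 1 = -g.1 0 1 ∧
    g⁻¹.1 1 0 = -g.1 1 0 ∧ g⁻¹.1 1 1 = g.1 0 0 := by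
  rw [Matrix.SpecialLinearGroup.SL2_inv_expl]; simp

lemma SL2_ext {g h : SL(2, ℝ)} (h00 : g.1 0 0 = h.1 0 0) (h01 : g.1 0 1 = h.1 0 1)
    (h10 : g.1 1 0 = h.1 1 0) (h11 : g.1 1 1 = h.1 1 1) : g = h := by
  ext i j
  fin_cases i <;> fin_cases j <;> assumption

lemma den_kTilde (θ : ℝ) : den (kTilde θ).mat I = exp (I * (θ : ℂ)) := by
  rw [mul_comm I, exp_mul_I, den]
  simp [kTilde]; ring

lemma sqrtm_exp {t : ℝ} (h1 : -π ≤ t) (h2 : t < π) :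
    sqrtm (exp (I * (t : ℂ))) = exp (I * ((t / 2 : ℝ) : ℂ)) := by
  have := argm_exp one_pos h1 h2
  rw [ofReal_one, one_mul] at this
  rw [sqrtm, this, mul_comm I (t : ℂ), norm_exp_ofReal_mul_I]
  simp

lemma jf_kTilde (θ : ℝ) : jf (kTilde θ) I = exp (I * ((θ / 2 : ℝ) : ℂ)) := by
  have hp := pi_pos
  set t := toIcoMod (mul_pos four_pos pi_pos) (-(2 * π)) θ with ht
  set n := toIcoDiv (mul_pos four_pos pi_pos) (-(2 * π)) θ with hn
  have hm : -(2 * π) ≤ t ∧ t < -(2 * π) + 4 * π :=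
    toIcoMod_mem_Ico (mul_pos four_pos pi_pos) (-(2 * π)) θ
  have hθ : θ = t + n * (4 * π) := by simp_all
  have e1 : exp (I * (θ : ℂ)) = exp (I * (t : ℂ)) := by
    refine exp_eq_exp_iff_exists_int.2 ⟨2 * n, ?_⟩
    rw [hθ]; push_cast; ring
  have e2 : exp (I * ((θ / 2 : ℝ) : ℂ)) = exp (I * ((t / 2 : ℝ) : ℂ)) := by
    refine exp_eq_exp_iff_exists_int.2 ⟨n, ?_⟩
    rw [hθ]; push_cast; ring
  rw [jf, den_kTilde, e1, e2]
  simp only [kTilde, ← ht]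
  split_ifs with h
  · rw [sqrtm_exp h.1 h.2]; simp
  · rw [Set.mem_Ico, not_and_or, not_le, not_lt] at h
    rcases h with h | h
    · have e3 : exp (I * (t : ℂ)) = exp (I * ((t + 2 * π : ℝ) : ℂ)) :=
        exp_eq_exp_iff_exists_int.2 ⟨-1, by push_cast; ring⟩
      rw [e3, sqrtm_exp (by linarith) (by linarith), show I * (((t + 2 * π) / 2 : ℝ) : ℂ) =
          I * ((t / 2 : ℝ) : ℂ) + π * I by push_cast; ring,
        exp_add, exp_pi_mul_I]
      simp
    · have e3 : exp (I * (t : ℂ)) = exp (I * ((t - 2 * π : ℝ) : ℂ)) :=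
        exp_eq_exp_iff_exists_int.2 ⟨1, by push_cast; ring⟩
      rw [e3, sqrtm_exp (by linarith) (by linarith), show I * (((t - 2 * π) / 2 : ℝ) : ℂ) =
          I * ((t / 2 : ℝ) : ℂ) - π * I by push_cast; ring,
        exp_sub, exp_pi_mul_I]
      simp [div_neg]

lemma mob_kTilde (θ : ℝ) : mob (kTilde θ).mat I = I := by
  rw [mob, div_eq_iff (den_ne_zero _ (by simp)), den]
  simp only [kTilde, of_apply, cons_val', cons_val_zero, cons_val_one, cons_val_fin_one]
  push_cast
  linear_combination (-(Complex.sin θ : ℂ)) * I_sq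

lemma kTilde_add (a b : ℝ) : kTilde (a + b) = kTilde a * kTilde b := by
  refine Mp.ext_jf (z := I) ?_ (by simp) ?_
  · rw [Mp.mul_mat]
    apply SL2_ext <;> rw [entry_mul] <;> simp [kTilde, Real.cos_add, Real.sin_add] <;> ring
  · rw [jf_mul _ _ (by simp), mob_kTilde, jf_kTilde, jf_kTilde, jf_kTilde, ← exp_add]
    push_cast; ring_nf

lemma kTilde_zero : kTilde 0 = 1 := by
  have h := kTilde_add 0 0
  simp_all

lemma kTilde_neg (a : ℝ) : kTilde (-a) = (kTilde a)⁻¹ := by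
  rw [eq_inv_iff_mul_eq_one, ← kTilde_add, neg_add_cancel, kTilde_zero]

lemma sTilde_eq : sTilde = kTilde (π / 2) := by
  refine Mp.ext_jf (z := I) ?_ (by simp) ?_
  · ext i j
    fin_cases i <;> fin_cases j <;> simp [sTilde, kTilde]
  · rw [jf_kTilde, jf]
    have : den sTilde.mat I = exp (I * ((π / 2 : ℝ) : ℂ)) := by
      rw [mul_comm I, exp_mul_I]
      simp [den, sTilde]
    have hp := pi_pos
    rw [this, sqrtm_exp (by linarith) (by linarith)]
    simp [sTilde]

lemma sTilde_inv_eq : sTilde⁻¹ = kTilde (-(π / 2)) := by rw [kTilde_neg, sTilde_eq]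

lemma pf_kTilde (θ : ℝ) : pf (kTilde θ) = exp (I * ((π / 4 - θ / 2 : ℝ) : ℂ)) := by
  rw [pf, sTilde_eq, ← kTilde_neg, ← kTilde_add, jf_kTilde]
  ring_nf

lemma borel_entries (u : ℝ) (hu : 0 < u) (y : ℝ) :
    (aTilde u hu * nMinus y).mat.1 0 0 = u ∧ (aTilde u hu * nMinus y).mat.1 0 1 = 0 ∧
    (aTilde u hu * nMinus y).mat.1 1 0 = u⁻¹ * y ∧ (aTilde u hu * nMinus y).mat.1 1 1 = u⁻¹ := by
  rw [Mp.mul_mat]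
  refine ⟨?_, ?_, ?_, ?_⟩ <;> rw [entry_mul] <;> simp [aTilde, nMinus]

lemma sgn_borel (u : ℝ) (hu : 0 < u) (y : ℝ) : (aTilde u hu * nMinus y).sgn = 1 := by
  rw [Mp.mul_sgn, cocycle, X_mul_left (by rfl)]
  have : X (aTilde u hu).mat = u⁻¹ := by rw [X_of_eq (by rfl)]; rfl
  rw [this, mul_div_assoc, mul_div_assoc, div_self (X_ne_zero _)]
  simp [hilbert, aTilde, nMinus, hu.le]

lemma sgn_sTilde_mul_inv (u : ℝ) (hu : 0 < u) (y : ℝ) :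
    (sTilde * (aTilde u hu * nMinus y)⁻¹).sgn = 1 := by
    have h1 := sgn_borel u hu y
    obtain ⟨m1, m2, m3, m4⟩ := borel_entries u hu y
    set b := aTilde u hu * nMinus y
    have hbi : b⁻¹.mat.1 1 0 = -(u⁻¹ * y) ∧ b⁻¹.mat.1 1 1 = u ∧ b⁻¹.mat.1 0 0 = u⁻¹ ∧
        b⁻¹.mat.1 0 1 = 0 := by
      rw [Mp.inv_mat]
      obtain ⟨n1, n2, n3, n4⟩ := inv_entries b.mat
      grind
    have h2 : b⁻¹.sgn = 1 := by
      show cocycle b.mat⁻¹ b.mat * b.sgn = 1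
      rw [h1, cocycle, inv_mul_cancel, X_one, mul_one, ← Mp.inv_mat]
      by_cases hy : y = 0
      · have e1 : X b⁻¹.mat = u := by rw [X_of_eq (by grind), hbi.2.1]
        simp [hilbert, e1, hu.le]
      · have e1 : X b⁻¹.mat = -(u⁻¹ * y) := by rw [X_of_ne (by grind), hbi.1]
        have e2 : X b.mat = u⁻¹ * y := by rw [X_of_ne (by grind), m3]
        rw [e1, e2, hilbert, if_neg]
        grind
    have e1 : (sTilde * b⁻¹).mat.1 1 0 = u⁻¹ := by
      rw [Mp.mul_mat, mul_one_zero, hbi.1, hbi.2.2.1]; simp [sTilde]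
    have e2 : X (sTilde * b⁻¹).mat = u⁻¹ := by rw [X_of_ne (by grind), e1]
    have e3 : X sTilde.mat = 1 := by rw [X_of_ne (by simp [sTilde])]; rfl
    rw [Mp.mul_sgn, h2, cocycle, ← Mp.mul_mat, e2, e3, hilbert, if_neg]
    · rfl
    · rintro ⟨h, -⟩
      rw [div_one, inv_lt_zero] at h; linarith

lemma mob_inv_im (g : Mp) : 0 < (mob g.mat⁻¹ I).im := mob_im _ (by simp)

lemma pf_eq (g : Mp) : pf g = sqrtm (mob g.mat⁻¹ I) * jf g⁻¹ I := by
  have := pf_mul g 1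
  rw [mul_one, inv_one, mul_one] at this
  rw [this, jf]
  simp [sTilde, den]

lemma sqrtm_pos_mul {r : ℝ} (hr : 0 < r) {z : ℂ} (hz : z ≠ 0) :
    sqrtm ((r : ℂ) * z) = ((r ^ (1 / 2 : ℝ) : ℝ) : ℂ) * sqrtm z := by
  have : argm ((r : ℂ) * z) = argm z := by
    conv_lhs => rw [← norm_mul_exp_argm z, ← mul_assoc, ← ofReal_mul]
    exact argm_exp (mul_pos hr (norm_pos_iff.2 hz)) (neg_pi_le_argm z) (argm_lt_pi z)
  rw [sqrtm, this, norm_mul, Complex.norm_of_nonneg hr.le, mul_rpow hr.le (norm_nonneg _), sqrtm]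
  push_cast; ring

lemma ne_zero_of_im_pos {z : ℂ} (hz : 0 < z.im) : z ≠ 0 := by rintro rfl; simp at hz

lemma pf_mul_borel (g : Mp) (u : ℝ) (hu : 0 < u) (y : ℝ) :
    pf (g * (aTilde u hu * nMinus y)) = ((u ^ (-(1 / 2) : ℝ) : ℝ) : ℂ) * pf g := by
  have hz := mob_inv_im g
  have h2 := sgn_sTilde_mul_inv u hu y
  rw [pf_mul, pf_eq g, jf_of_sgn h2, Mp.mul_mat, Mp.inv_mat, den_sTilde_inv]
  obtain ⟨m1, m2, m3, m4⟩ := borel_entries u hu y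
  rw [m4, m2, ofReal_zero, sub_zero, sqrtm_pos_mul (inv_pos.2 hu) (ne_zero_of_im_pos hz),
    Real.inv_rpow hu.le, ← rpow_neg hu.le]
  simp; ring

lemma pf_mul_nPlus (g : Mp) (x : ℝ) : pf (g * nPlus x) = sqrtm (mob g.mat⁻¹ I - x) * jf g⁻¹ I := by
  rw [pf_mul]
  have h2 : (nPlus x)⁻¹.sgn = 1 := by
    show cocycle (nPlus x).mat⁻¹ (nPlus x).mat * (nPlus x).sgn = 1
    rw [cocycle, inv_mul_cancel, X_one]
    have : X (nPlus x).mat = 1 := by rw [X_of_eq (by rfl)]; rfl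
    rw [this, hilbert, if_neg]
    · rfl
    simp
  have h3 : (sTilde * (nPlus x)⁻¹).sgn = 1 := by
    have e1 : (sTilde * (nPlus x)⁻¹).mat.1 1 0 = 1 := by
      rw [Mp.mul_mat, mul_one_zero, Mp.inv_mat, (inv_entries _).1, (inv_entries _).2.2.1]
      simp [sTilde, nPlus]
    have e2 : X (sTilde * (nPlus x)⁻¹).mat = 1 := by rw [X_of_ne (by rw [e1]; simp), e1]
    have e3 : X sTilde.mat = 1 := by rw [X_of_ne (by simp [sTilde])]; rfl
    rw [Mp.mul_sgn, h2, cocycle, ← Mp.mul_mat, e2, e3, hilbert, if_neg]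
    · rfl
    simp
  rw [jf_of_sgn h3, Mp.mul_mat, Mp.inv_mat, den_sTilde_inv]
  simp [nPlus]

lemma Mp.ext_pf {g h : Mp} (hm : g.mat = h.mat) (hp : pf g = pf h) : g = h := by
  have : sTilde * g⁻¹ = sTilde * h⁻¹ :=
    Mp.ext_jf (z := I) (by rw [Mp.mul_mat, Mp.mul_mat, Mp.inv_mat, Mp.inv_mat, hm]) (by simp) hp
  simpa

/-- Elements with proportional `pf` differ by an element of the connected lower triangular group. -/
lemma eq_mul_borel {g h : Mp} {t : ℝ} (ht : 0 < t) (e : pf g = (t : ℂ) * pf h) :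
    ∃ (u : ℝ) (hu : 0 < u) (y : ℝ), u = t ^ (-2 : ℝ) ∧ g = h * (aTilde u hu * nMinus y) := by
  have e2 : pf g ^ 2 = (t : ℂ) ^ 2 * pf h ^ 2 := by rw [e]; ring
  rw [pf_sq, pf_sq] at e2
  have r1 := congrArg re e2
  have r2 := congrArg im e2
  rw [← ofReal_pow] at r1 r2
  simp only [sub_re, Complex.mul_re, ofReal_re, I_re, mul_zero,
    Complex.ofReal_im, I_im, mul_one, sub_self, zero_sub, zero_mul, sub_zero,
    Complex.sub_im, mul_im, add_zero] at r1 r2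
  have hb : g.mat.1 0 1 = t ^ 2 * h.mat.1 0 1 := by linarith
  have dg := det_eq g.mat
  have dh := det_eq h.mat
  have hu0 : 0 < t ^ (-2 : ℝ) := rpow_pos_of_pos ht _
  have hu : (t ^ (-2 : ℝ) : ℝ) = (t ^ 2)⁻¹ := by simp
  refine ⟨t ^ (-2 : ℝ), hu0, t ^ (-2 : ℝ) * (-(h.mat.1 1 0 * g.mat.1 0 0) + h.mat.1 0 0 * g.mat.1 1 0),
    rfl, ?_⟩
  generalize hu1 : t ^ (-2 : ℝ) = u at *
  have hut : u⁻¹ = t ^ 2 := by grind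
  have hut' : u * t ^ 2 = 1 := by grind
  have hut2 : u⁻¹ * u = 1 := inv_mul_cancel₀ hu0.ne'
  refine Mp.ext_pf ?_ ?_
  · obtain ⟨m1, m2, m3, m4⟩ := borel_entries u hu0
      (u * (-(h.mat.1 1 0 * g.mat.1 0 0) + h.mat.1 0 0 * g.mat.1 1 0))
    rw [Mp.mul_mat h]
    have hD : u * g.mat.1 1 1 = h.mat.1 1 1 := by grind
    have hB : u * g.mat.1 0 1 = h.mat.1 0 1 := by grind
    apply SL2_ext
    · rw [entry_mul, m1, m3]
      grind
    · rw [entry_mul, m2, m4, hut, hb]; ring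
    · rw [entry_mul, m1, m3]
      grind
    · rw [entry_mul, m2, m4, hut, r2]; ring
  · rw [pf_mul_borel, e, ← hu1, ← rpow_mul ht.le]
    norm_num

lemma exists_iwasawa (g : Mp) :
    ∃ (θ u : ℝ) (hu : 0 < u) (y : ℝ), g = kTilde θ * (aTilde u hu * nMinus y) := by
  have h : pf g = (‖pf g‖ : ℂ) * pf (kTilde (π / 2 - 2 * arg (pf g))) := by
    rw [pf_kTilde]
    conv_lhs => rw [← norm_mul_exp_arg_mul_I (pf g)]
    ring_nf
  obtain ⟨u, hu, y, -, e⟩ := eq_mul_borel (norm_pos_iff.2 (pf_ne_zero g)) h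
  grind

lemma argm_eq_arctan {z : ℂ} (hz : 0 < z.im) (x : ℝ) :
    argm (z - x) = π / 2 + arctan ((x - z.re) / z.im) := by
  set t := arctan ((x - z.re) / z.im)
  have h1 := Real.neg_pi_div_two_lt_arctan ((x - z.re) / z.im)
  have h2 := Real.arctan_lt_pi_div_two ((x - z.re) / z.im)
  have hc : 0 < cos t := Real.cos_arctan_pos _
  have ht : tan t = (x - z.re) / z.im := Real.tan_arctan _
  have hp := pi_pos
  rw [← argm_exp (r := z.im / cos t) (by positivity) (t := π / 2 + t) (by linarith) (by linarith)]
  congr 1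
  rw [mul_comm I, exp_mul_I, ← Complex.ofReal_cos, ← Complex.ofReal_sin,
    add_comm (π / 2), Real.cos_add_pi_div_two, Real.sin_add_pi_div_two]
  rw [Real.tan_eq_sin_div_cos] at ht
  field_simp at ht
  have hc' : (cos t : ℂ) ≠ 0 := mod_cast hc.ne'
  have ht' : (z.im : ℂ) * sin t = cos t * (x - z.re) := mod_cast (by linarith)
  conv_lhs => rw [← Complex.re_add_im z]
  push_cast at *
  grind

/-- The Iwasawa decomposition along the lines `x ↦ g ñ_x`. -/
lemma exists_iwasawa_nPlus (g : Mp) : ∃ (C x₀ y₀ r : ℝ), 0 < y₀ ∧ 0 < r ∧ ∀ x : ℝ,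
    ∃ (u : ℝ) (hu : 0 < u) (y : ℝ), u = r * (1 + ((x - x₀) / y₀) ^ 2) ^ (-(1 / 2) : ℝ) ∧
      g * nPlus x = kTilde (C - arctan ((x - x₀) / y₀)) * (aTilde u hu * nMinus y) := by
  set z := mob g.mat⁻¹ I with hz
  have hz0 : 0 < z.im := mob_inv_im g
  set q := jf g⁻¹ I with hq
  have hq0 : q ≠ 0 := jf_ne_zero _ (by simp)
  have hqn : 0 < ‖q‖ := norm_pos_iff.2 hq0
  refine ⟨-2 * arg q, z.re, z.im, ‖q‖ ^ (-2 : ℝ) * z.im ^ (-1 : ℝ), hz0, by positivity, ?_⟩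
  intro x
  have hw : z - x ≠ 0 := ne_zero_of_im_pos (by simpa)
  have hwn : 0 < ‖z - x‖ := norm_pos_iff.2 hw
  obtain ⟨u, hu, y, h1, h2⟩ := eq_mul_borel (g := g * nPlus x)
    (h := kTilde (-2 * arg q - arctan ((x - z.re) / z.im)))
    (t := ‖z - x‖ ^ (1 / 2 : ℝ) * ‖q‖) (by positivity) (by
      rw [pf_mul_nPlus, pf_kTilde, sqrtm, ← hz, argm_eq_arctan hz0, ← hq]
      conv_lhs => rw [← norm_mul_exp_arg_mul_I q]
      rw [show I * ((π / 4 - (-2 * arg q - arctan ((x - z.re) / z.im)) / 2 : ℝ) : ℂ) = I *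
        (((π / 2 + arctan ((x - z.re) / z.im)) / 2 : ℝ) : ℂ) +
        (arg q) * I by push_cast; ring, exp_add]
      push_cast; ring)
  refine ⟨u, hu, y, ?_, h2⟩
  have hn : ‖z - x‖ ^ 2 = z.im ^ 2 * (1 + ((x - z.re) / z.im) ^ 2) := by
    rw [← Complex.normSq_eq_norm_sq, Complex.normSq_apply]
    simp
    grind
  rw [h1, mul_rpow (by positivity) hqn.le, ← rpow_mul hwn.le]
  have : ‖z - x‖ ^ (1 / 2 * -2 : ℝ) = (‖z - x‖ ^ 2) ^ (-(1 / 2) : ℝ) := by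
    rw [← rpow_natCast, ← rpow_mul hwn.le]; norm_num
  rw [this, hn, mul_rpow (by positivity) (by positivity), ← rpow_natCast, ← rpow_mul hz0.le]
  ring_nf

lemma nPlus_iwasawa (x : ℝ) : ∃ (u : ℝ) (hu : 0 < u) (y : ℝ),
    u = (1 + x ^ 2) ^ (-(1 / 2) : ℝ) ∧ ∀ θ : ℝ,
      kTilde θ * nPlus x = kTilde (θ - arctan x) * (aTilde u hu * nMinus y) := by
  have hw : I - x ≠ 0 := ne_zero_of_im_pos (by simp)
  have hwn : 0 < ‖I - x‖ := norm_pos_iff.2 hw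
  have hm : mob (1 : Mp).mat⁻¹ I = I := by rw [show (1 : Mp).mat = 1 from rfl]; simp [mob, den]
  have hj : jf (1 : Mp)⁻¹ I = 1 := by rw [inv_one, ← kTilde_zero, jf_kTilde]; simp
  obtain ⟨u, hu, y, h1, h2⟩ := eq_mul_borel (g := 1 * nPlus x) (h := kTilde (0 - arctan x))
    (t := ‖I - x‖ ^ (1 / 2 : ℝ)) (by positivity) (by
      have := argm_eq_arctan (z := I) (by simp) x
      rw [I_re, I_im, sub_zero, div_one] at this
      rw [pf_mul_nPlus, pf_kTilde, sqrtm, hm, hj, this, mul_one]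
      ring_nf)
  refine ⟨u, hu, y, ?_, fun θ => ?_⟩
  · have hn : ‖I - x‖ ^ 2 = 1 + x ^ 2 := by
      rw [← Complex.normSq_eq_norm_sq, Complex.normSq_apply]; simp; ring
    rw [h1, ← hn, ← rpow_natCast, ← rpow_mul hwn.le, ← rpow_mul hwn.le]
    norm_num
  · rw [one_mul] at h2
    rw [h2, ← mul_assoc, ← kTilde_add]
    ring_nf

lemma mTilde_eq_kTilde_pi : mTilde (-1) (-1) = kTilde π := by
  refine Mp.ext_jf (z := I) ?_ (by simp) ?_
  · apply SL2_ext <;> simp [mTilde, kTilde]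
  · have hp := pi_pos
    rw [jf_kTilde, jf]
    have : den (mTilde (-1) (-1)).mat I = exp (I * ((-π : ℝ) : ℂ)) := by
      rw [mul_comm I, exp_mul_I]
      simp [den, mTilde]
    rw [this, sqrtm_exp le_rfl (by linarith)]
    have e : ((π / 2 : ℝ) : ℂ) = (π : ℂ) / 2 := by simp
    have e' : ((-π / 2 : ℝ) : ℂ) = -((π : ℂ) / 2) := by push_cast; ring
    rw [e, e', mul_neg, mul_comm I, Complex.exp_neg, Complex.exp_pi_div_two_mul_I]
    simp [mTilde]

lemma mTilde_one_one : mTilde 1 1 = 1 := by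
  apply Mp.ext
  · apply SL2_ext <;> simp [mTilde, show (1 : Mp).mat = 1 from rfl]
  · rfl

/-! ### Holomorphic parametric integrals and identity theorems -/

lemma differentiableOn_integral {α : Type*} [MeasurableSpace α] {m : Measure α} {U : Set ℂ}
    {F : ℂ → α → ℂ} (hd : ∀ᵐ a ∂m, DifferentiableOn ℂ (fun z => F z a) U)
    (hm : ∀ z ∈ U, AEStronglyMeasurable (F z) m)
    (hb : ∀ z₀ ∈ U, ∃ r > 0, ball z₀ r ⊆ U ∧ ∃ b : α → ℝ, Integrable b m ∧
      ∀ᵐ a ∂m, ∀ z ∈ ball z₀ r, ‖F z a‖ ≤ b a) :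
    DifferentiableOn ℂ (fun z => ∫ a, F z a ∂m) U := by
  intro z₀ hz₀
  obtain ⟨r, hr, hU, b, hbi, hb⟩ := hb z₀ hz₀
  have hnhds : ∀ z ∈ ball z₀ r, U ∈ 𝓝 z := fun z hz =>
    mem_of_superset (Metric.isOpen_ball.mem_nhds hz) hU
  have hr2 : 0 < r / 2 := by linarith
  have hder : ∀ᵐ a ∂m, ∀ z ∈ ball z₀ r, HasDerivAt (fun z => F z a) (deriv (fun z => F z a) z) z := by
    filter_upwards [hd] with a ha z hz
    exact (ha.differentiableAt (hnhds z hz)).hasDerivAt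
  have key := hasDerivAt_integral_of_dominated_loc_of_deriv_le (μ := m) (F := F)
    (F' := fun z a => deriv (fun z => F z a) z) (x₀ := z₀) (s := ball z₀ (r / 2))
    (bound := fun a => b a / (r / 4)) (Metric.ball_mem_nhds _ hr2) ?_ ?_ ?_ ?_ ?_ ?_
  · exact key.2.differentiableAt.differentiableWithinAt
  · filter_upwards [Metric.ball_mem_nhds z₀ hr] with z hz using hm z (hU hz)
  · exact hbi.mono' (hm _ hz₀) (by
      filter_upwards [hb] with a ha using ha _ (Metric.mem_ball_self hr))
  · let u : ℕ → ℂ := fun n => (r / 2 : ℝ) / ((n : ℂ) + 1)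
    have hu : Tendsto u atTop (𝓝 0) := by
      have := (tendsto_one_div_add_atTop_nhds_zero_nat (𝕜 := ℂ)).const_mul ((r / 2 : ℝ) : ℂ)
      grind
    have hu0 : ∀ n, u n ≠ 0 := fun n => div_ne_zero (mod_cast hr2.ne') (mod_cast succ_ne_zero n)
    have hun : ∀ n, z₀ + u n ∈ ball z₀ r := fun n => by
      rw [mem_ball_iff_norm, add_sub_cancel_left]
      simp only [u, norm_div, norm_real, norm_of_nonneg hr2.le]
      have : (1 : ℝ) ≤ ‖(n : ℂ) + 1‖ := by rw [← cast_succ, Complex.norm_natCast]; simp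
      calc r / 2 / ‖(n : ℂ) + 1‖ ≤ r / 2 := div_le_self hr2.le this
        _ < r := by linarith
    refine aestronglyMeasurable_of_tendsto_ae atTop
      (f := fun n a => (u n)⁻¹ • (F (z₀ + u n) a - F z₀ a)) (fun n => ?_) ?_
    · exact ((hm _ (hU (hun n))).sub (hm _ hz₀)).const_smul (u n)⁻¹
    · filter_upwards [hder] with a ha
      have := (ha z₀ (Metric.mem_ball_self hr)).tendsto_slope_zero
      exact this.comp (tendsto_nhdsWithin_iff.2 ⟨hu, Eventually.of_forall hu0⟩)
  · filter_upwards [hb, hd] with a ha hda z hz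
    have hsub : Metric.closedBall z (r / 4) ⊆ ball z₀ r := fun w hw => by
      rw [Metric.mem_ball] at *
      rw [Metric.mem_closedBall] at hw
      linarith [dist_triangle w z z₀]
    refine Complex.norm_deriv_le_of_forall_mem_sphere_norm_le (by linarith) ?_ fun w hw =>
      ha w (hsub (Metric.sphere_subset_closedBall hw))
    refine DifferentiableOn.diffContOnCl ?_
    rw [closure_ball _ (by linarith : r / 4 ≠ 0)]
    exact hda.mono (hsub.trans hU)
  · fun_prop
  · filter_upwards [hder] with a ha z hz using ha z (Metric.ball_subset_ball (by linarith) hz)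

lemma eqOn_of_eqOn_open {f g : ℂ → ℂ} {U V : Set ℂ} (hU : IsOpen U) (hc : IsPreconnected U)
    (hf : DifferentiableOn ℂ f U) (hg : DifferentiableOn ℂ g U) (hV : IsOpen V)
    (hVU : (V ∩ U).Nonempty) (h : ∀ z ∈ V ∩ U, f z = g z) : EqOn f g U := by
  obtain ⟨z, hz⟩ := hVU
  refine (hf.analyticOnNhd hU).eqOn_of_preconnected_of_eventuallyEq (hg.analyticOnNhd hU) hc hz.2 ?_
  filter_upwards [(hV.inter hU).mem_nhds hz] with w hw using h w hw

/-- The complement of the poles of the Gamma function. -/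
def gammaDomain : Set ℂ := {ν | ∀ m : ℕ, ν ≠ -m}

lemma isClosed_range_neg_natCast : IsClosed (Set.range fun m : ℕ => (-m : ℂ)) := by
  have h : Set.range (fun m : ℕ => (-m : ℂ)) = (fun z : ℂ => -z) ⁻¹' Set.range ((↑) : ℕ → ℂ) := by
    grind
  rw [h]
  have h2 := Complex.isometry_ofReal.isClosedEmbedding.comp Nat.isClosedEmbedding_coe_real
  have h3 := h2.isClosed_range.preimage (continuous_neg (G := ℂ))
  simpa

lemma gammaDomain_eq : gammaDomain = (Set.range fun m : ℕ => (-m : ℂ))ᶜ := by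
  ext z; simp [gammaDomain, eq_comm]

lemma isOpen_gammaDomain : IsOpen gammaDomain := by
  rw [gammaDomain_eq]; exact isClosed_range_neg_natCast.isOpen_compl

lemma isPreconnected_compl_countable {s : Set ℂ} (hs : s.Countable) : IsPreconnected sᶜ :=
  (hs.isConnected_compl_of_one_lt_rank (by simp)).isPreconnected

lemma isPreconnected_gammaDomain : IsPreconnected gammaDomain := by
  rw [gammaDomain_eq]; exact isPreconnected_compl_countable (Set.countable_range _)

lemma mem_gammaDomain_of_re_pos {ν : ℂ} (h : 0 < ν.re) : ν ∈ gammaDomain := fun m hm => by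
  rw [hm] at h; simp at h
  grind

/-! ### Functions on the circle -/

/-- The quasi-period of the restriction of vectors in `V^∞_{ε,ν}` to `K̃`. -/
def chi (ε : ℤˣ) : ℂ := -(((ε : ℤ) : ℂ) * I)

lemma units_cast_sq (ε : ℤˣ) : ((ε : ℤ) : ℂ) * ((ε : ℤ) : ℂ) = 1 := by
  rw [← Int.cast_mul, ← Units.val_mul, Int.units_mul_self]; simp

lemma chi_sq (ε : ℤˣ) : chi ε ^ 2 = -1 := by
  rw [chi]; linear_combination (I ^ 2) * units_cast_sq ε + I_sq

lemma chi_mul_chi_neg (ε : ℤˣ) : chi ε * chi (-ε) = 1 := by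
  have := chi_sq ε
  rw [chi] at *
  rw [chi]; push_cast; grind

lemma norm_chi (ε : ℤˣ) : ‖chi ε‖ = 1 := by
  rw [chi, norm_neg, norm_mul, norm_units, norm_I, one_mul]

/-- Smooth functions on the line with quasi-period `χ`. -/
structure IsQP (χ : ℂ) (h : ℝ → ℂ) : Prop where
  contDiff : ContDiff ℝ ∞ h
  add_pi : ∀ θ, h (θ + π) = χ * h θ

/-- The derivatives of order at most `k` are bounded by `M`. -/
def Bd (k : ℕ) (M : ℝ) (h : ℝ → ℂ) : Prop := ∀ j ≤ k, ∀ θ, ‖iteratedDeriv j h θ‖ ≤ M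

lemma Bd.mono {k k' : ℕ} {M M' : ℝ} {h : ℝ → ℂ} (hb : Bd k M h) (hk : k' ≤ k) (hM : M ≤ M') :
    Bd k' M' h := fun j hj θ => (hb j (hj.trans hk) θ).trans hM

lemma Bd.nonneg {k : ℕ} {M : ℝ} {h : ℝ → ℂ} (hb : Bd k M h) : 0 ≤ M :=
  (norm_nonneg _).trans (hb 0 (Nat.zero_le _) 0)

lemma Bd.norm_le {k : ℕ} {M : ℝ} {h : ℝ → ℂ} (hb : Bd k M h) (θ : ℝ) : ‖h θ‖ ≤ M := by
  simpa using hb 0 (Nat.zero_le _) θ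

lemma Bd.deriv {k : ℕ} {M : ℝ} {h : ℝ → ℂ} (hb : Bd (k + 1) M h) : Bd k M (deriv h) :=
  fun j hj θ => by rw [← iteratedDeriv_succ']; exact hb (j + 1) (by omega) θ

lemma contDiff_deriv {h : ℝ → ℂ} (hh : ContDiff ℝ ∞ h) : ContDiff ℝ ∞ (deriv h) :=
  (contDiff_infty_iff_deriv.1 hh).2

lemma contDiff_iteratedDeriv {h : ℝ → ℂ} (hh : ContDiff ℝ ∞ h) (n : ℕ) :
    ContDiff ℝ ∞ (iteratedDeriv n h) := by
  induction n with
  | zero => simpa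
  | succ n ih => rw [iteratedDeriv_succ]; fun_prop

lemma IsQP.iteratedDeriv {χ : ℂ} {h : ℝ → ℂ} (hh : IsQP χ h) (n : ℕ) :
    IsQP χ (iteratedDeriv n h) := by
  refine ⟨contDiff_iteratedDeriv hh.contDiff n, fun θ => ?_⟩
  have h1 := congrFun (iteratedDeriv_comp_add_const n h π) θ
  rw [← h1, show (fun z => h (z + π)) = fun z => χ * h z from funext hh.add_pi]
  simp

lemma IsQP.deriv {χ : ℂ} {h : ℝ → ℂ} (hh : IsQP χ h) : IsQP χ (deriv h) := by
  have := hh.iteratedDeriv 1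
  simpa

lemma IsQP.add {χ : ℂ} {h₁ h₂ : ℝ → ℂ} (hh₁ : IsQP χ h₁) (hh₂ : IsQP χ h₂) :
    IsQP χ (fun θ => h₁ θ + h₂ θ) :=
  ⟨hh₁.1.add hh₂.1, fun θ => by rw [hh₁.2, hh₂.2, mul_add]⟩

lemma IsQP.const_mul {χ : ℂ} {h : ℝ → ℂ} (hh : IsQP χ h) (c : ℂ) : IsQP χ (fun θ => c * h θ) :=
  ⟨contDiff_const.mul hh.1, fun θ => by rw [hh.2]; ring⟩

lemma IsQP.comp_add {χ : ℂ} {h : ℝ → ℂ} (hh : IsQP χ h) (a : ℝ) : IsQP χ (fun θ => h (a + θ)) :=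
  ⟨hh.1.comp (contDiff_const.add contDiff_id), fun θ => by rw [← add_assoc, hh.2]⟩

lemma IsQP.add_zsmul {χ : ℂ} {h : ℝ → ℂ} (hh : IsQP χ h) (hχ : χ ≠ 0) (n : ℤ) (θ : ℝ) :
    h (θ + n * π) = χ ^ n * h θ := by
  induction n with
  | zero => simp
  | succ n ih =>
    rw [show θ + ((n + 1 : ℤ) : ℝ) * π = θ + ((n : ℤ) : ℝ) * π + π by grind,
      hh.2, ih, zpow_add_one₀ hχ]; ring
  | pred n ih =>
    have := hh.2 (θ + ((-n - 1 : ℤ) : ℝ) * π)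
    rw [show θ + ((-n - 1 : ℤ) : ℝ) * π + π = θ + ((-n : ℤ) : ℝ) * π by grind, ih] at this
    rw [zpow_sub_one₀ hχ, mul_right_comm, this]; field_simp

lemma IsQP.exists_mem_Icc {χ : ℂ} {h : ℝ → ℂ} (hh : IsQP χ h) (hχ : ‖χ‖ = 1) (a θ : ℝ) :
    ∃ t ∈ Icc a (a + π), ‖h θ‖ = ‖h t‖ := by
  have h0 : χ ≠ 0 := by rintro rfl; simp at hχ
  refine ⟨toIcoMod pi_pos a θ, Set.Ico_subset_Icc_self (toIcoMod_mem_Ico pi_pos a θ), ?_⟩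
  have := toIcoMod_add_toIcoDiv_zsmul pi_pos a θ
  conv_lhs => rw [← this, zsmul_eq_mul, hh.add_zsmul h0, norm_mul, norm_zpow, hχ, one_zpow, one_mul]

lemma IsQP.exists_bound {χ : ℂ} {h : ℝ → ℂ} (hh : IsQP χ h) (hχ : ‖χ‖ = 1) :
    ∃ M, ∀ θ, ‖h θ‖ ≤ M := by
  obtain ⟨M, hM⟩ := isCompact_Icc.exists_bound_of_continuousOn
    (hh.contDiff.continuous.continuousOn (s := Icc 0 (0 + π)))
  refine ⟨M, fun θ => ?_⟩
  obtain ⟨t, ht, e⟩ := hh.exists_mem_Icc hχ 0 θ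
  grind

lemma IsQP.exists_bd {χ : ℂ} {h : ℝ → ℂ} (hh : IsQP χ h) (hχ : ‖χ‖ = 1) (k : ℕ) :
    ∃ M, Bd k M h := by
  choose M hM using fun j => (hh.iteratedDeriv j).exists_bound hχ
  refine ⟨∑ j ∈ range (k + 1), M j, fun j hj θ => (hM j θ).trans ?_⟩
  exact single_le_sum (f := M) (fun i _ => (norm_nonneg _).trans (hM i 0)) (mem_range.2 (by omega))

/-! ### The operators `A_b` -/

/-- The derivative along `x ↦ ñ_x` in terms of the restriction to `K̃`. -/
def aop (b : ℂ) (h : ℝ → ℂ) : ℝ → ℂ := fun θ =>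
  -((cos θ : ℝ) : ℂ) * deriv h θ + b * ((sin θ : ℝ) : ℂ) * h θ

def aopIter (b : ℂ) : ℕ → (ℝ → ℂ) → ℝ → ℂ
  | 0, h => h
  | k + 1, h => aop (b + k) (aopIter b k h)

/-- The function `x ↦ h(-arctan x) (1 + x²)^{-b/2}`. -/
def chart (b : ℂ) (h : ℝ → ℂ) (x : ℝ) : ℂ := h (-arctan x) * ((1 + x ^ 2 : ℝ) : ℂ) ^ (-b / 2)

lemma contDiff_ofReal_comp {f : ℝ → ℝ} (hf : ContDiff ℝ ∞ f) : ContDiff ℝ ∞ fun x => (f x : ℂ) :=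
  Complex.ofRealCLM.contDiff.comp hf

lemma contDiff_aop (b : ℂ) {h : ℝ → ℂ} (hh : ContDiff ℝ ∞ h) : ContDiff ℝ ∞ (aop b h) :=
  ((contDiff_ofReal_comp Real.contDiff_cos).neg.mul (contDiff_deriv hh)).add
    ((contDiff_const.mul (contDiff_ofReal_comp Real.contDiff_sin)).mul hh)

lemma contDiff_aopIter (b : ℂ) (k : ℕ) {h : ℝ → ℂ} (hh : ContDiff ℝ ∞ h) :
    ContDiff ℝ ∞ (aopIter b k h) := by
  induction k with
  | zero => exact hh
  | succ k ih => exact contDiff_aop _ ih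

lemma one_add_sq_pos (x : ℝ) : 0 < 1 + x ^ 2 := by positivity

lemma one_add_sq_mem_slitPlane (x : ℝ) : ((1 + x ^ 2 : ℝ) : ℂ) ∈ Complex.slitPlane :=
  Complex.ofReal_mem_slitPlane.2 (one_add_sq_pos x)

lemma hasDerivAt_chart (b : ℂ) {h : ℝ → ℂ} (hh : ContDiff ℝ ∞ h) (x : ℝ) :
    HasDerivAt (chart b h) (chart (b + 1) (aop b h) x) x := by
  have hp := one_add_sq_pos x
  have h1 : HasDerivAt (fun x : ℝ => -arctan x) (-(1 / (1 + x ^ 2))) x :=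
    (Real.hasDerivAt_arctan x).neg
  have h2 : HasDerivAt (fun x : ℝ => h (-arctan x))
      ((-(1 / (1 + x ^ 2)) : ℝ) • deriv h (-arctan x)) x :=
    HasDerivAt.scomp x (hh.differentiable (by simp) _).hasDerivAt h1
  have h3 : HasDerivAt (fun x : ℝ => ((1 + x ^ 2 : ℝ) : ℂ)) ((2 * x : ℝ) : ℂ) x := by
    have : HasDerivAt (fun x : ℝ => 1 + x ^ 2) (2 * x) x := by
      simpa using (hasDerivAt_pow 2 x).const_add 1
    exact this.ofReal_comp
  have h4 : HasDerivAt (fun x : ℝ => ((1 + x ^ 2 : ℝ) : ℂ) ^ (-b / 2))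
      ((-b / 2) * ((1 + x ^ 2 : ℝ) : ℂ) ^ (-b / 2 - 1) * ((2 * x : ℝ) : ℂ)) x :=
    HasDerivAt.comp (h₂ := fun z : ℂ => z ^ (-b / 2)) x
      (((hasDerivAt_id ((1 + x ^ 2 : ℝ) : ℂ)).cpow_const (one_add_sq_mem_slitPlane x)).congr_deriv
        (mul_one _)) h3
  have h5 := h2.mul h4
  refine h5.congr_deriv ?_
  have hc : cos (-arctan x) = 1 / sqrt (1 + x ^ 2) := by rw [Real.cos_neg, cos_arctan]
  have hs : sin (-arctan x) = -(x / sqrt (1 + x ^ 2)) := by rw [Real.sin_neg, Real.sin_arctan]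
  have hne : ((1 + x ^ 2 : ℝ) : ℂ) ≠ 0 := mod_cast hp.ne'
  have hsq : ((sqrt (1 + x ^ 2) : ℝ) : ℂ) ≠ 0 := by exact_mod_cast (sqrt_pos.2 hp).ne'
  have e1 : ((1 + x ^ 2 : ℝ) : ℂ) ^ (-(b + 1) / 2) =
      ((1 + x ^ 2 : ℝ) : ℂ) ^ (-b / 2) / ((sqrt (1 + x ^ 2) : ℝ) : ℂ) := by
    rw [show -(b + 1) / 2 = -b / 2 - ((1 / 2 : ℝ) : ℂ) by push_cast; ring, cpow_sub _ _ hne,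
      ← ofReal_cpow hp.le, sqrt_eq_rpow]
  have e2 : ((1 + x ^ 2 : ℝ) : ℂ) ^ (-b / 2 - 1) =
      ((1 + x ^ 2 : ℝ) : ℂ) ^ (-b / 2) / ((1 + x ^ 2 : ℝ) : ℂ) := by
    rw [cpow_sub _ _ hne, cpow_one]
  have e3 : ((sqrt (1 + x ^ 2) : ℝ) : ℂ) ^ 2 = ((1 + x ^ 2 : ℝ) : ℂ) := by
    rw [← ofReal_pow, Real.sq_sqrt hp.le]
  rw [chart, aop, hc, hs, e1, e2]
  rw [real_smul]
  rw [← e3] at hne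
  push_cast at e3 ⊢
  grind

lemma iteratedDeriv_chart (b : ℂ) {h : ℝ → ℂ} (hh : ContDiff ℝ ∞ h) (k : ℕ) :
    iteratedDeriv k (chart b h) = chart (b + k) (aopIter b k h) := by
  induction k with
  | zero => simp [aopIter]
  | succ k ih =>
    rw [iteratedDeriv_succ, ih]
    funext x
    rw [(hasDerivAt_chart (b + k) (contDiff_aopIter b k hh) x).deriv]
    simp [aopIter, add_assoc]

lemma contDiff_chart (b : ℂ) {h : ℝ → ℂ} (hh : ContDiff ℝ ∞ h) : ContDiff ℝ ∞ (chart b h) := by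
  refine contDiff_infty.2 fun n => ?_
  refine contDiff_of_differentiable_iteratedDeriv fun m _ => ?_
  rw [iteratedDeriv_chart b hh]
  exact fun x => (hasDerivAt_chart (b + m) (contDiff_aopIter b m hh) x).differentiableAt

lemma norm_chart (b : ℂ) (h : ℝ → ℂ) (x : ℝ) :
    ‖chart b h x‖ = ‖h (-arctan x)‖ * (1 + x ^ 2) ^ (-b.re / 2) := by
  rw [chart, norm_mul, norm_cpow_eq_rpow_re_of_pos (one_add_sq_pos x)]
  simp

/-! ### Restriction to `K̃` -/

lemma kTilde_pi_comm (g : Mp) : kTilde π * g = g * kTilde π := by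
  have h1 : ∀ z, jf (kTilde π) z = jf (kTilde π) I := fun z => by rw [jf, jf]; simp [den, kTilde]
  refine Mp.ext_jf (z := I) ?_ (by simp) ?_
  · rw [Mp.mul_mat, Mp.mul_mat g]
    apply SL2_ext <;> rw [entry_mul, entry_mul] <;> simp [kTilde]
  · rw [jf_mul (kTilde π) _ (by simp), jf_mul _ (kTilde π) (by simp), h1, mob_kTilde, mul_comm]

lemma kTilde_natCast_mul_pi (n : ℕ) : kTilde (n * π) = kTilde π ^ n := by
  induction n with
  | zero => simp [kTilde_zero]
  | succ n ih => rw [pow_succ, ← ih, ← kTilde_add]; grind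

lemma mTilde_eq_kTilde (ε e₁ e₂ : ℤˣ) : ∃ n : ℕ, mTilde e₁ e₂ = kTilde (n * π) ∧
    (sigma ε e₁ e₂)⁻¹ = chi ε ^ n := by
  have hs : ∀ e₁ e₂ e₁' e₂', (mTilde e₁ e₂ * mTilde e₁' e₂').mat = (mTilde (e₁ * e₁') 1).mat := by
    intro a b c d
    rw [Mp.mul_mat]
    apply SL2_ext <;> rw [entry_mul] <;> simp [mTilde]
  have h2 : mTilde 1 (-1) = kTilde π ^ 2 := by
    rw [pow_two, ← mTilde_eq_kTilde_pi]
    apply Mp.ext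
    · rw [hs]; rfl
    · rw [Mp.mul_sgn, cocycle, ← Mp.mul_mat, hs]; simp [mTilde, X, hilbert]
  have h3 : mTilde (-1) 1 = kTilde π ^ 3 := by
    rw [pow_succ, ← h2, ← mTilde_eq_kTilde_pi]
    apply Mp.ext
    · grind
    · rw [Mp.mul_sgn, cocycle, ← Mp.mul_mat, hs]; simp [mTilde, X, hilbert]
  have c2 := chi_sq ε
  have hε := units_cast_sq ε
  rcases units_eq_one_or e₁ with rfl | rfl <;> rcases units_eq_one_or e₂ with rfl | rfl
  · exact ⟨0, by simp [mTilde_one_one, kTilde_zero], by simp [sigma]⟩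
  · exact ⟨2, by rw [kTilde_natCast_mul_pi, h2], by rw [c2]; simp [sigma]⟩
  · refine ⟨3, by rw [kTilde_natCast_mul_pi, h3], inv_eq_of_mul_eq_one_right ?_⟩
    have : sigma ε (-1) 1 = chi ε := by simp [sigma, chi]
    grind
  · refine ⟨1, by rw [kTilde_natCast_mul_pi, pow_one, mTilde_eq_kTilde_pi], inv_eq_of_mul_eq_one_right ?_⟩
    have : sigma ε (-1) (-1) = -chi ε := by simp [sigma, chi]
    grind

lemma borel_mul (u : ℝ) (hu : 0 < u) (y u' : ℝ) (hu' : 0 < u') (y' : ℝ) :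
    ∃ y'', (aTilde u hu * nMinus y) * (aTilde u' hu' * nMinus y') =
      aTilde (u * u') (mul_pos hu hu') * nMinus y'' := by
  have h := pf_mul_borel 1 u hu y
  have h' := pf_mul_borel (aTilde u hu * nMinus y) u' hu' y'
  rw [one_mul] at h
  rw [mul_assoc] at h'
  have h2 : pf ((aTilde u hu * nMinus y) * (aTilde u' hu' * nMinus y')) =
      (((u * u') ^ (-(1 / 2) : ℝ) : ℝ) : ℂ) * pf 1 := by
    rw [mul_assoc, h', h, mul_rpow hu.le hu'.le]; push_cast; ring
  obtain ⟨v, hv, y'', e, e2⟩ := eq_mul_borel (rpow_pos_of_pos (mul_pos hu hu') _) h2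
  rw [← rpow_mul (mul_pos hu hu').le] at e
  simp_all

/-- The restriction of a vector to `K̃`. -/
def restr (f : SmoothVec ε ν) : ℝ → ℂ := fun θ => f (kTilde θ)

lemma SmoothVec.map_borel (f : SmoothVec ε ν) (g : Mp) (u : ℝ) (hu : 0 < u) (y : ℝ) :
    f (g * (aTilde u hu * nMinus y)) = (u : ℂ) ^ (1 - ν) * f g := by
  have := f.2.2 g 1 1 u hu y
  rw [mTilde_one_one, one_mul] at this
  have e : (omega ε ν 1 1 u)⁻¹ = (u : ℂ) ^ (1 - ν) := by
    rw [omega, sigma, if_pos rfl]; simp [← cpow_neg]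
  rw [this, e]

lemma SmoothVec.ext_restr {f₁ f₂ : SmoothVec ε ν} (h : ∀ θ, restr f₁ θ = restr f₂ θ) : f₁ = f₂ := by
  refine Subtype.ext (funext fun g => ?_)
  obtain ⟨θ, u, hu, y, rfl⟩ := exists_iwasawa g
  exact (f₁.map_borel _ u hu y).trans ((congrArg _ (h θ)).trans (f₂.map_borel _ u hu y).symm)

lemma ofReal_rpow_cpow {r : ℝ} (hr : 0 < r) (t : ℝ) (z : ℂ) :
    ((r ^ t : ℝ) : ℂ) ^ z = (r : ℂ) ^ (t * z) := by
  rw [cpow_def_of_ne_zero (mod_cast (rpow_pos_of_pos hr t).ne'),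
    cpow_def_of_ne_zero (mod_cast hr.ne'), ← ofReal_log (by positivity),
    Real.log_rpow hr, ← ofReal_log hr.le]
  push_cast; ring_nf

lemma SmoothVec.kTilde_mul_nPlus (f : SmoothVec ε ν) (θ x : ℝ) :
    f (kTilde θ * nPlus x) = chart (1 - ν) (fun t => restr f (θ + t)) x := by
  obtain ⟨u, hu, y, e, h⟩ := nPlus_iwasawa x
  rw [h, f.map_borel, e, ofReal_rpow_cpow (one_add_sq_pos x), chart, restr, mul_comm, ← sub_eq_add_neg]
  push_cast; ring_nf

lemma restr_add (f : SmoothVec ε ν) (θ : ℝ) {t : ℝ} (h1 : -(π / 2) < t)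
    (h2 : t < π / 2) : restr f (θ + t) =
      f (kTilde θ * nPlus (-tan t)) * ((1 + tan t ^ 2 : ℝ) : ℂ) ^ ((1 - ν) / 2) := by
  have hne : ((1 + tan t ^ 2 : ℝ) : ℂ) ≠ 0 := mod_cast (one_add_sq_pos _).ne'
  rw [f.kTilde_mul_nPlus, chart, arctan_neg, neg_neg, arctan_tan h1 h2, neg_sq, mul_assoc,
    ← cpow_add _ _ hne, neg_div, neg_add_cancel, Complex.cpow_zero, mul_one]

lemma contDiff_restr (f : SmoothVec ε ν) : ContDiff ℝ ∞ (restr f) := by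
  rw [contDiff_iff_contDiffAt]
  intro θ
  have hp := pi_pos
  have h0 : cos 0 ≠ 0 := by simp
  have htan : ContDiffAt ℝ ∞ tan 0 := Real.contDiffAt_tan.2 h0
  have h1 : ContDiffAt ℝ ∞ (fun t : ℝ => f (kTilde θ * nPlus (-tan t)) *
      ((1 + tan t ^ 2 : ℝ) : ℂ) ^ ((1 - ν) / 2)) 0 := by
    refine ContDiffAt.mul ?_ ?_
    · exact (f.isSmooth.contDiff_nPlus (kTilde θ)).contDiffAt.comp 0 htan.neg
    · have h2 : ContDiffAt ℝ ∞ (fun t : ℝ => ((1 + tan t ^ 2 : ℝ) : ℂ)) 0 :=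
        Complex.ofRealCLM.contDiff.contDiffAt.comp 0 (contDiffAt_const.add (htan.pow 2))
      have h3 : ContDiffAt ℝ ∞ (fun z : ℂ => z ^ ((1 - ν) / 2)) ((1 + tan 0 ^ 2 : ℝ) : ℂ) :=
        (analyticAt_id.cpow analyticAt_const (one_add_sq_mem_slitPlane _)).contDiffAt.restrict_scalars ℝ
      fun_prop
  have h4 : ContDiffAt ℝ ∞ (fun t => restr f (θ + t)) 0 := by
    refine h1.congr_of_eventuallyEq ?_
    filter_upwards [Ioo_mem_nhds (show -(π / 2) < 0 by linarith)
      (show 0 < π / 2 by linarith)] with t ht using restr_add f θ ht.1 ht.2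
  have h5 : ContDiffAt ℝ ∞ (fun t => restr f (θ + (t - θ))) θ := by
    have : ContDiffAt ℝ ∞ (fun t => restr f (θ + t)) (θ - θ) := by simpa
    exact ContDiffAt.comp (f := fun t : ℝ => t - θ) (g := fun t => restr f (θ + t)) θ this
      (contDiffAt_id.sub contDiffAt_const)
  simpa using h5

lemma isQP_restr (f : SmoothVec ε ν) : IsQP (chi ε) (restr f) := by
  refine ⟨contDiff_restr f, fun θ => ?_⟩
  have h := f.2.2 (kTilde θ) (-1) (-1) 1 one_pos 0
  rw [aTilde_one, nMinus_zero, mul_one, mul_one, mTilde_eq_kTilde_pi, ← kTilde_add] at h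
  refine h.trans ?_
  rw [omega, restr]
  congr 1
  have c2 := chi_sq ε
  have : sigma ε (-1) (-1) = -chi ε := by simp [sigma, chi]
  rw [this, ofReal_one, Complex.one_cpow, mul_one]
  grind

/-- The vector with given restriction to `K̃`. -/
def ofRestrFun (ν : ℂ) (h : ℝ → ℂ) (g : Mp) : ℂ :=
  h (π / 2 - 2 * arg (pf g)) * ((‖pf g‖ : ℝ) : ℂ) ^ (2 * (ν - 1))

lemma chi_ne_zero (ε : ℤˣ) : chi ε ≠ 0 := fun h => by have := norm_chi ε; simp [h] at this

lemma ofRestrFun_apply {h : ℝ → ℂ} (hh : IsQP (chi ε) h) (θ u : ℝ) (hu : 0 < u) (y : ℝ) :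
    ofRestrFun ν h (kTilde θ * (aTilde u hu * nMinus y)) = (u : ℂ) ^ (1 - ν) * h θ := by
  have hu' : 0 < u ^ (-(1 / 2) : ℝ) := rpow_pos_of_pos hu _
  have hn : ‖((u ^ (-(1 / 2) : ℝ) : ℝ) : ℂ) * pf (kTilde θ)‖ = u ^ (-(1 / 2) : ℝ) := by
    rw [norm_mul, pf_kTilde, mul_comm I, norm_exp_ofReal_mul_I, mul_one,
      Complex.norm_of_nonneg hu'.le]
  have e := norm_mul_exp_arg_mul_I (((u ^ (-(1 / 2) : ℝ) : ℝ) : ℂ) * pf (kTilde θ))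
  rw [hn] at e
  have e2 := mul_left_cancel₀ (mod_cast hu'.ne') e
  rw [pf_kTilde] at e2
  obtain ⟨n, hn'⟩ := exp_eq_exp_iff_exists_int.1 e2
  rw [← pf_kTilde] at hn'
  rw [ofRestrFun, pf_mul_borel, hn, ofReal_rpow_cpow hu, mul_comm]
  congr 1
  · simp
  · set a := arg (((u ^ (-(1 / 2) : ℝ) : ℝ) : ℂ) * pf (kTilde θ))
    have ha : a = π / 4 - θ / 2 + n * (2 * π) := by
      have : I * (a : ℂ) = I * ((π / 4 - θ / 2 + n * (2 * π) : ℝ) : ℂ) := by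
        rw [mul_comm, hn']; push_cast; ring
      exact_mod_cast mul_left_cancel₀ Complex.I_ne_zero this
    have := hh.add_zsmul (chi_ne_zero ε) (-4 * n) θ
    rw [show π / 2 - 2 * a = θ + ((-4 * n : ℤ) : ℝ) * π by grind, this, zpow_mul]
    have c4 : chi ε ^ (-4 : ℤ) = 1 := by
      rw [show (-4 : ℤ) = -((2 * 2 : ℕ) : ℤ) by norm_num, zpow_neg, zpow_natCast, pow_mul, chi_sq]
      norm_num
    simp_all

lemma ofRestrFun_mul_nPlus {h : ℝ → ℂ} (hh : IsQP (chi ε) h) (g : Mp) :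
    ∃ (C x₀ y₀ r : ℝ), 0 < y₀ ∧ 0 < r ∧ ∀ x : ℝ, ofRestrFun ν h (g * nPlus x) =
      (r : ℂ) ^ (1 - ν) * chart (1 - ν) (fun t => h (C + t)) ((x - x₀) / y₀) := by
  obtain ⟨C, x₀, y₀, r, hy, hr, H⟩ := exists_iwasawa_nPlus g
  refine ⟨C, x₀, y₀, r, hy, hr, fun x => ?_⟩
  obtain ⟨u, hu, y, e, e'⟩ := H x
  have hp := one_add_sq_pos ((x - x₀) / y₀)
  rw [e', ofRestrFun_apply hh, e, ofReal_mul, mul_cpow_ofReal_nonneg hr.le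
    (by positivity), ofReal_rpow_cpow hp, chart, mul_assoc, ← sub_eq_add_neg, mul_comm (h _)]
  push_cast; ring_nf

def ofRestr (ν : ℂ) {h : ℝ → ℂ} (hh : IsQP (chi ε) h) : SmoothVec ε ν := ⟨ofRestrFun ν h, by
    have key : ∀ (g : Mp) (u : ℝ) (hu : 0 < u) (y : ℝ),
        ofRestrFun ν h (g * (aTilde u hu * nMinus y)) = (u : ℂ) ^ (1 - ν) * ofRestrFun ν h g := by
      intro g u hu y
      obtain ⟨θ, v, hv, y', rfl⟩ := exists_iwasawa g
      obtain ⟨y'', e⟩ := borel_mul v hv y' u hu y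
      rw [mul_assoc, e, ofRestrFun_apply hh, ofRestrFun_apply hh, ofReal_mul,
        mul_cpow_ofReal_nonneg hv.le hu.le]
      ring
    constructor
    · intro g
      obtain ⟨C, x₀, y₀, r, hy, hr, H⟩ := ofRestrFun_mul_nPlus (ν := ν) hh g
      have : (fun p : ℝ × ℝ × ℝ => ofRestrFun ν h
          (g * nPlus p.1 * aTilde (Real.exp p.2.1) (Real.exp_pos _) * nMinus p.2.2)) =
          fun p => exp (p.2.1 * (1 - ν)) * ((r : ℂ) ^ (1 - ν) *
            chart (1 - ν) (fun t => h (C + t)) ((p.1 - x₀) / y₀)) := by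
        funext p
        rw [mul_assoc, key, H, cpow_def_of_ne_zero (mod_cast (Real.exp_pos _).ne'),
          ← ofReal_log (Real.exp_pos _).le, Real.log_exp]
      rw [this]
      have hc : ContDiff ℝ ∞ (chart (1 - ν) fun t => h (C + t)) :=
        contDiff_chart _ (hh.comp_add C).contDiff
      refine ContDiff.mul ?_ (contDiff_const.mul (hc.comp ?_))
      · exact ((contDiff_ofReal_comp contDiff_id).comp (contDiff_fst.comp contDiff_snd) |>.mul
          contDiff_const).cexp
      · exact (contDiff_fst.sub contDiff_const).div_const _
    · intro g e₁ e₂ u hu y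
      obtain ⟨n, e, e'⟩ := mTilde_eq_kTilde ε e₁ e₂
      obtain ⟨θ, v, hv, y', rfl⟩ := exists_iwasawa g
      have hc : (aTilde v hv * nMinus y') * kTilde π ^ n =
          kTilde π ^ n * (aTilde v hv * nMinus y') :=
        ((Commute.pow_left (kTilde_pi_comm _) n : Commute _ _)).eq.symm
      rw [mul_assoc (mTilde e₁ e₂), ← mul_assoc, key, e, kTilde_natCast_mul_pi, mul_assoc (kTilde θ), hc,
        ← mul_assoc, ← kTilde_natCast_mul_pi, ← kTilde_add, ofRestrFun_apply hh, ofRestrFun_apply hh,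
        omega, mul_inv, e', ← cpow_neg]
      have := hh.add_zsmul (chi_ne_zero ε) n θ
      rw [Int.cast_natCast, zpow_natCast] at this
      rw [this, neg_sub]
      ring⟩

lemma restr_ofRestr {h : ℝ → ℂ} (hh : IsQP (chi ε) h) : restr (ofRestr ν hh) = h := by
  funext θ
  have := ofRestrFun_apply (ν := ν) hh θ 1 one_pos 0
  rw [aTilde_one, nMinus_zero, mul_one, mul_one] at this
  simpa

/-! ### The topology of `V^∞_{ε,ν}` in terms of the restriction to `K̃` -/

lemma norm_iteratedDeriv_trig (n : ℕ) : ∀ t : ℝ,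
    ‖iteratedDeriv n (fun t : ℝ => ((cos t : ℝ) : ℂ)) t‖ ≤ 1 ∧
    ‖iteratedDeriv n (fun t : ℝ => ((sin t : ℝ) : ℂ)) t‖ ≤ 1 := by
  have h1 : deriv (fun t : ℝ => ((cos t : ℝ) : ℂ)) = fun t => -((sin t : ℝ) : ℂ) := by
    funext t
    rw [(Real.hasDerivAt_cos t).ofReal_comp.deriv]; simp
  have h2 : deriv (fun t : ℝ => ((sin t : ℝ) : ℂ)) = fun t => ((cos t : ℝ) : ℂ) := by
    funext t
    exact (Real.hasDerivAt_sin t).ofReal_comp.deriv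
  induction n with
  | zero =>
    intro t
    simp only [iteratedDeriv_zero, norm_real]
    exact ⟨Real.abs_cos_le_one t, Real.abs_sin_le_one t⟩
  | succ n ih =>
    intro t
    rw [iteratedDeriv_succ', iteratedDeriv_succ', h1, h2, iteratedDeriv_fun_neg, norm_neg]
    grind

lemma contDiffAt_nat {h : ℝ → ℂ} (hh : ContDiff ℝ ∞ h) (n : ℕ) (t : ℝ) : ContDiffAt ℝ n h t :=
  hh.contDiffAt.of_le (mod_cast le_top)

lemma norm_iteratedDeriv_mul_le {c h : ℝ → ℂ} (hc : ContDiff ℝ ∞ c) (hh : ContDiff ℝ ∞ h) {t : ℝ}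
    {K M : ℝ} {n : ℕ} (hK : ∀ i ≤ n, ‖iteratedDeriv i c t‖ ≤ K)
    (hM : ∀ i ≤ n, ‖iteratedDeriv i h t‖ ≤ M) :
    ‖iteratedDeriv n (fun t => c t * h t) t‖ ≤ 2 ^ n * (K * M) := by
  have hK0 : 0 ≤ K := (norm_nonneg _).trans (hK 0 (Nat.zero_le _))
  rw [iteratedDeriv_fun_mul (contDiffAt_nat hc n t) (contDiffAt_nat hh n t)]
  refine (norm_sum_le _ _).trans ?_
  have : (2 : ℝ) ^ n = ∑ i ∈ range (n + 1), (n.choose i : ℝ) := by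
    exact_mod_cast (Nat.sum_range_choose n).symm
  rw [this, sum_mul]
  refine sum_le_sum fun i hi => ?_
  rw [norm_mul, norm_mul, Complex.norm_natCast, mul_assoc]
  exact mul_le_mul_of_nonneg_left (mul_le_mul (hK i (by grind)) (hM _ (by omega))
    (norm_nonneg _) hK0) (cast_nonneg _)

lemma norm_iteratedDeriv_mul_sub_le {c h : ℝ → ℂ} (hc : ContDiff ℝ ∞ c) (hh : ContDiff ℝ ∞ h)
    {t : ℝ} {M : ℝ} {n : ℕ} (hM0 : 0 ≤ M) (hK : ∀ i ≤ n, ‖iteratedDeriv i c t‖ ≤ 1)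
    (hM : ∀ i < n, ‖iteratedDeriv i h t‖ ≤ M) :
    ‖iteratedDeriv n (fun t => c t * h t) t - c t * iteratedDeriv n h t‖ ≤ 2 ^ n * M := by
  rw [iteratedDeriv_fun_mul (contDiffAt_nat hc n t) (contDiffAt_nat hh n t), sum_range_succ']
  simp only [Nat.choose_zero_right, Nat.cast_one, one_mul, iteratedDeriv_zero, Nat.sub_zero,
    add_sub_cancel_right]
  refine (norm_sum_le _ _).trans ?_
  have : (2 : ℝ) ^ n = ∑ i ∈ range (n + 1), (n.choose i : ℝ) := by
    exact_mod_cast (Nat.sum_range_choose n).symm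
  rw [this, sum_range_succ', add_mul, sum_mul]
  refine le_trans (sum_le_sum fun i hi => ?_) (le_add_of_nonneg_right (by positivity))
  rw [norm_mul, norm_mul, Complex.norm_natCast, mul_assoc]
  have hi' := mem_range.1 hi
  refine mul_le_mul_of_nonneg_left ?_ (cast_nonneg _)
  calc _ ≤ 1 * M := mul_le_mul (hK _ (by omega)) (hM _ (by omega)) (norm_nonneg _) zero_le_one
    _ = M := one_mul M

lemma contDiff_cosC : ContDiff ℝ ∞ fun t : ℝ => ((cos t : ℝ) : ℂ) :=
  contDiff_ofReal_comp Real.contDiff_cos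

lemma contDiff_sinC : ContDiff ℝ ∞ fun t : ℝ => ((sin t : ℝ) : ℂ) :=
  contDiff_ofReal_comp Real.contDiff_sin

lemma iteratedDeriv_aop (b : ℂ) {h : ℝ → ℂ} (hh : ContDiff ℝ ∞ h) (n : ℕ) (t : ℝ) :
    iteratedDeriv n (aop b h) t = -iteratedDeriv n (fun t => ((cos t : ℝ) : ℂ) * deriv h t) t +
      b * iteratedDeriv n (fun t => ((sin t : ℝ) : ℂ) * h t) t := by
  have e : aop b h = fun t => -(((cos t : ℝ) : ℂ) * deriv h t) +
      b * (((sin t : ℝ) : ℂ) * h t) := by funext t; rw [aop]; ring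
  have h1 := contDiff_cosC.mul (contDiff_deriv hh)
  have h2 := contDiff_sinC.mul hh
  rw [e, iteratedDeriv_fun_add (contDiffAt_nat h1.neg n t)
    (contDiffAt_nat (contDiff_const.mul h2) n t), iteratedDeriv_fun_neg]
  simp

lemma Bd.aop {k : ℕ} {M : ℝ} {h : ℝ → ℂ} (hb : Bd (k + 1) M h) (hh : ContDiff ℝ ∞ h) (b : ℂ) :
    Bd k (2 ^ k * (1 + ‖b‖) * M) (aop b h) := by
  intro j hj t
  have hM := hb.nonneg
  rw [iteratedDeriv_aop b hh]
  have h1 := norm_iteratedDeriv_mul_le (n := j) (K := 1) (M := M) (t := t) contDiff_cosC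
    (contDiff_deriv hh) (fun i _ => (norm_iteratedDeriv_trig i t).1)
    (fun i hi => hb.deriv i (hi.trans hj) t)
  have h2 := norm_iteratedDeriv_mul_le (n := j) (K := 1) (M := M) (t := t) contDiff_sinC hh
    (fun i _ => (norm_iteratedDeriv_trig i t).2) (fun i hi => hb i (by omega) t)
  have h3 : (2 : ℝ) ^ j ≤ 2 ^ k := pow_le_pow_right₀ (by norm_num) hj
  refine (norm_add_le _ _).trans ?_
  rw [norm_neg, norm_mul]
  calc _ ≤ 2 ^ j * (1 * M) + ‖b‖ * (2 ^ j * (1 * M)) :=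
        add_le_add h1 (mul_le_mul_of_nonneg_left h2 (norm_nonneg _))
    _ = 2 ^ j * ((1 + ‖b‖) * M) := by ring
    _ ≤ 2 ^ k * ((1 + ‖b‖) * M) := by gcongr
    _ = _ := by ring

lemma Bd.comp_add {k : ℕ} {M : ℝ} {h : ℝ → ℂ} (hb : Bd k M h) (a : ℝ) :
    Bd k M (fun t => h (a + t)) := fun j hj t => by
  rw [iteratedDeriv_comp_const_add]; exact hb j hj _

lemma exists_bd_aopIter (b : ℂ) (k : ℕ) : ∀ l : ℕ, ∃ C, 0 ≤ C ∧
    ∀ (h : ℝ → ℂ), ContDiff ℝ ∞ h → ∀ M, Bd (k + l) M h → Bd l (C * M) (aopIter b k h) := by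
  induction k with
  | zero => exact fun l => ⟨1, zero_le_one, fun h _ M hb => by simpa [aopIter] using hb⟩
  | succ k ih =>
    intro l
    obtain ⟨C, hC, H⟩ := ih (l + 1)
    refine ⟨2 ^ l * (1 + ‖b + k‖) * C, by positivity, fun h hh M hb => ?_⟩
    rw [mul_assoc]
    exact (H h hh M (by grind)).aop (contDiff_aopIter b k hh) _

lemma aopIter_succ' (b : ℂ) (k : ℕ) (h : ℝ → ℂ) :
    aopIter b (k + 1) h = aopIter (b + 1) k (aop b h) := by
  induction k with
  | zero => simp [aopIter]
  | succ k ih =>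
    rw [aopIter, ih, aopIter]
    congr 1; grind

lemma exists_bound_of_aopIter (j : ℕ) : ∀ b : ℂ, ∃ C, 0 ≤ C ∧ ∀ (h : ℝ → ℂ), ContDiff ℝ ∞ h →
    ∀ (M t : ℝ), 1 / 2 ≤ cos t → (∀ i ≤ j, ‖aopIter b i h t‖ ≤ M) →
      ∀ l ≤ j, ‖iteratedDeriv l h t‖ ≤ C * M := by
  induction j with
  | zero =>
    intro b
    refine ⟨1, zero_le_one, fun h _ M t _ hM l hl => ?_⟩
    obtain rfl : l = 0 := by omega
    simpa [aopIter] using hM 0 le_rfl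
  | succ j ih =>
    intro b
    obtain ⟨C₁, hC₁, H₁⟩ := ih b
    obtain ⟨C₂, hC₂, H₂⟩ := ih (b + 1)
    refine ⟨C₁ + 2 * (C₂ + ‖b‖ * (2 ^ j * C₁) + 2 ^ j * C₁), by positivity,
      fun h hh M t ht hM l hl => ?_⟩
    have hM0 : 0 ≤ M := (norm_nonneg _).trans (hM 0 (Nat.zero_le _))
    have K₁ := H₁ h hh M t ht (fun i hi => hM i (by omega))
    have K₂ := H₂ (aop b h) (contDiff_aop b hh) M t ht
      (fun i hi => by rw [← aopIter_succ']; grind) j le_rfl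
    rcases Nat.lt_or_ge l (j + 1) with hl' | hl'
    · refine (K₁ l (by omega)).trans ?_
      gcongr
      have : 0 ≤ 2 * (C₂ + ‖b‖ * (2 ^ j * C₁) + 2 ^ j * C₁) := by positivity
      linarith
    obtain rfl : l = j + 1 := by omega
    have h1 := norm_iteratedDeriv_mul_sub_le (n := j) (M := C₁ * M) (t := t) contDiff_cosC
      (contDiff_deriv hh) (by positivity) (fun i _ => (norm_iteratedDeriv_trig i t).1)
      (fun i hi => by rw [← iteratedDeriv_succ']; grind)
    have h2 := norm_iteratedDeriv_mul_le (n := j) (K := 1) (M := C₁ * M) (t := t) contDiff_sinC hh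
      (fun i _ => (norm_iteratedDeriv_trig i t).2) (fun i hi => K₁ i hi)
    have h3 := iteratedDeriv_aop b hh j t
    rw [← iteratedDeriv_succ'] at h1
    set P := iteratedDeriv j (fun t => ((cos t : ℝ) : ℂ) * deriv h t) t
    set Q := iteratedDeriv j (fun t => ((sin t : ℝ) : ℂ) * h t) t
    have h4 : ((cos t : ℝ) : ℂ) * iteratedDeriv (j + 1) h t = -iteratedDeriv j (aop b h) t + b * Q -
          (P - ((cos t : ℝ) : ℂ) * iteratedDeriv (j + 1) h t) := by rw [h3]; ring
    have h5 : cos t * ‖iteratedDeriv (j + 1) h t‖ ≤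
        C₂ * M + ‖b‖ * (2 ^ j * (1 * (C₁ * M))) + 2 ^ j * (C₁ * M) := by
      have : cos t * ‖iteratedDeriv (j + 1) h t‖ =
          ‖((cos t : ℝ) : ℂ) * iteratedDeriv (j + 1) h t‖ := by
        rw [norm_mul, Complex.norm_of_nonneg (by linarith)]
      rw [this, h4]
      refine (norm_sub_le _ _).trans (add_le_add ((norm_add_le _ _).trans (add_le_add ?_ ?_)) h1)
      · simpa
      · rw [norm_mul]; gcongr
    have h6 : 1 / 2 * ‖iteratedDeriv (j + 1) h t‖ ≤ cos t * ‖iteratedDeriv (j + 1) h t‖ := by gcongr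
    have h7 : 0 ≤ C₁ * M := by positivity
    grind

lemma exists_bound_restr (f : SmoothVec ε ν) (j : ℕ) :
    BddAbove (Set.range fun θ => ‖iteratedDeriv j (restr f) θ‖) := by
  obtain ⟨M, hM⟩ := ((isQP_restr f).iteratedDeriv j).exists_bound (norm_chi ε)
  exact ⟨M, by rintro _ ⟨θ, rfl⟩; exact hM θ⟩

lemma iteratedDeriv_restr_smul (c : ℂ) (f : SmoothVec ε ν) (j : ℕ) (θ : ℝ) :
    iteratedDeriv j (restr (c • f)) θ = c * iteratedDeriv j (restr f) θ :=
  iteratedDeriv_const_mul_field c (restr f)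

/-- The sum of the maxima of the derivatives of order at most `k` of the restriction to `K̃`. -/
def supNorm (k : ℕ) (f : SmoothVec ε ν) : ℝ :=
  ∑ j ∈ range (k + 1), ⨆ θ, ‖iteratedDeriv j (restr f) θ‖

lemma iSup_restr_nonneg (f : SmoothVec ε ν) (j : ℕ) : 0 ≤ ⨆ θ, ‖iteratedDeriv j (restr f) θ‖ :=
  Real.iSup_nonneg fun _ => norm_nonneg _

lemma supNorm_nonneg (k : ℕ) (f : SmoothVec ε ν) : 0 ≤ supNorm k f :=
  sum_nonneg fun j _ => iSup_restr_nonneg f j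

lemma bd_restr (k : ℕ) (f : SmoothVec ε ν) : Bd k (supNorm k f) (restr f) := by
  intro j hj θ
  refine (le_ciSup (exists_bound_restr f j) θ).trans ?_
  exact single_le_sum (f := fun j => ⨆ θ, ‖iteratedDeriv j (restr f) θ‖)
    (fun i _ => iSup_restr_nonneg f i) (mem_range.2 (by omega))

lemma supNorm_le {k : ℕ} {f : SmoothVec ε ν} {M : ℝ} (h : Bd k M (restr f)) :
    supNorm k f ≤ (k + 1) * M := by
  have : supNorm k f ≤ ∑ j ∈ range (k + 1), M :=
    sum_le_sum fun j hj => ciSup_le fun θ => h j (by grind) θ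
  simpa

lemma supNorm_smul (k : ℕ) (c : ℂ) (f : SmoothVec ε ν) : supNorm k (c • f) = ‖c‖ * supNorm k f := by
  unfold supNorm
  rw [mul_sum]
  refine sum_congr rfl fun j _ => ?_
  simp only [iteratedDeriv_restr_smul, norm_mul]
  rw [Real.mul_iSup_of_nonneg (norm_nonneg _)]

/-- The maximum of a derivative along `x ↦ g ñ_x` for `|x| ≤ 1`. -/
def jetNorm (f : SmoothVec ε ν) (i : Mp × ℕ) : ℝ := ‖(jet ε ν f i).restrict (Icc (-1 : ℝ) 1)‖

lemma continuous_jetNorm (i : Mp × ℕ) : Continuous fun f : SmoothVec ε ν => jetNorm f i :=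
  ((ContinuousMap.continuous_restrict _).comp
    ((continuous_apply i).comp continuous_induced_dom)).norm

lemma norm_jet_le (f : SmoothVec ε ν) (i : Mp × ℕ) {x : ℝ} (hx : x ∈ Icc (-1 : ℝ) 1) :
    ‖iteratedDeriv i.2 (fun x => f (i.1 * nPlus x)) x‖ ≤ jetNorm f i :=
  ((jet ε ν f i).restrict (Icc (-1 : ℝ) 1)).norm_coe_le_norm ⟨x, hx⟩

lemma norm_aopIter_eq (b : ℂ) {h : ℝ → ℂ} (hh : ContDiff ℝ ∞ h) (i : ℕ) {t : ℝ}
    (h1 : -(π / 2) < t) (h2 : t < π / 2) : ‖aopIter b i h t‖ =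
      ‖iteratedDeriv i (chart b h) (-tan t)‖ * (1 + tan t ^ 2) ^ ((b.re + i) / 2) := by
  rw [iteratedDeriv_chart b hh, norm_chart, arctan_neg, neg_neg, arctan_tan h1 h2, neg_sq,
    mul_assoc, ← rpow_add (one_add_sq_pos _)]
  have : -(b + (i : ℂ)).re / 2 + (b.re + i) / 2 = 0 := by simp; ring
  simp_all

lemma exists_bound_near (ν : ℂ) (k : ℕ) : ∃ C, 0 ≤ C ∧ ∀ (f : SmoothVec ε ν) (θ t : ℝ),
    |t| ≤ π / 4 → ∀ l ≤ k, ‖iteratedDeriv l (restr f) (θ + t)‖ ≤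
      C * ∑ i ∈ range (k + 1), jetNorm f (kTilde θ, i) := by
  obtain ⟨C, hC, H⟩ := exists_bound_of_aopIter k (1 - ν)
  have hp := pi_pos
  refine ⟨C * 2 ^ (‖1 - ν‖ + k), by positivity, fun f θ t ht l hl => ?_⟩
  have hh : ContDiff ℝ ∞ fun t => restr f (θ + t) := ((isQP_restr f).comp_add θ).contDiff
  have ht' := abs_le.1 ht
  have hcos : 1 / 2 ≤ cos t := by
    rw [← Real.cos_abs, ← Real.cos_pi_div_three]
    exact Real.cos_le_cos_of_nonneg_of_le_pi (abs_nonneg t) (by linarith) (by linarith)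
  have harc := arctan_tan (x := t) (by linarith) (by linarith)
  have htan : -tan t ∈ Icc (-1 : ℝ) 1 := by
    have a1 : arctan (tan t) ≤ arctan 1 := by simp [*]
    have a2 : arctan (-1) ≤ arctan (tan t) := by simp [*]
    have := Real.arctan_strictMono.le_iff_le.1 a1
    have := Real.arctan_strictMono.le_iff_le.1 a2
    grind
  have htan2 : tan t ^ 2 ≤ 1 := by
    rw [← neg_sq]
    exact (sq_le_one_iff_abs_le_one _).2 (abs_le.2 htan)
  have h1 := H _ hh (2 ^ (‖1 - ν‖ + k) * ∑ i ∈ range (k + 1), jetNorm f (kTilde θ, i)) t hcos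
    (fun i hi => ?_) l hl
  · rw [iteratedDeriv_comp_const_add] at h1
    grind
  · rw [norm_aopIter_eq (1 - ν) hh i (by linarith) (by linarith), mul_comm]
    refine mul_le_mul ?_ ?_ (norm_nonneg _) (by positivity)
    · have hre : ((1 - ν).re + i) / 2 ≤ ‖1 - ν‖ + k := by
        have := re_le_norm (1 - ν)
        have h3 : (i : ℝ) ≤ k := mod_cast hi
        have := norm_nonneg (1 - ν)
        grind
      exact (Real.rpow_le_rpow_of_exponent_le (by nlinarith) hre).trans
        (Real.rpow_le_rpow (by positivity) (by linarith) (by positivity))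
    · have : (chart (1 - ν) fun t => restr f (θ + t)) = fun x => f (kTilde θ * nPlus x) :=
        funext fun x => (f.kTilde_mul_nPlus θ x).symm
      rw [this]
      refine (norm_jet_le f (kTilde θ, i) htan).trans ?_
      exact single_le_sum (f := fun i => jetNorm f (kTilde θ, i)) (fun i _ => norm_nonneg _)
        (mem_range.2 (by omega))

lemma exists_supNorm_le (ε : ℤˣ) (ν : ℂ) (k : ℕ) : ∃ C, 0 ≤ C ∧ ∀ f : SmoothVec ε ν, supNorm k f ≤
    C * ∑ i ∈ range (k + 1), (jetNorm f (kTilde 0, i) + jetNorm f (kTilde (π / 2), i)) := by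
  obtain ⟨C, hC, H⟩ := exists_bound_near (ε := ε) ν k
  refine ⟨(k + 1) * C, by positivity, fun f => ?_⟩
  rw [mul_assoc]
  refine supNorm_le fun l hl θ => ?_
  obtain ⟨t, ht, e⟩ := ((isQP_restr f).iteratedDeriv l).exists_mem_Icc (norm_chi ε) (-(π / 4)) θ
  have hs : ∀ θ, 0 ≤ ∑ i ∈ range (k + 1), jetNorm f (kTilde θ, i) :=
    fun θ => sum_nonneg fun i _ => norm_nonneg _
  rw [e, Finset.sum_add_distrib]
  rcases le_total t (π / 4) with h | h
  · have := H f 0 t (abs_le.2 ⟨ht.1, h⟩) l hl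
    rw [zero_add] at this
    refine this.trans (mul_le_mul_of_nonneg_left ?_ hC)
    simp_all
  · have := H f (π / 2) (t - π / 2) (abs_le.2 ⟨by linarith, by grind⟩) l hl
    rw [add_sub_cancel] at this
    refine this.trans (mul_le_mul_of_nonneg_left ?_ hC)
    linarith [hs 0]

lemma setOf_supNorm_lt_mem_nhds (k : ℕ) {δ : ℝ} (hδ : 0 < δ) :
    {f : SmoothVec ε ν | supNorm k f < δ} ∈ 𝓝 0 := by
  obtain ⟨C, hC, H⟩ := exists_supNorm_le ε ν k
  have hc : Continuous fun f : SmoothVec ε ν => C * ∑ i ∈ range (k + 1),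
      (jetNorm f (kTilde 0, i) + jetNorm f (kTilde (π / 2), i)) :=
    continuous_const.mul (continuous_finsetSum _ fun i _ =>
      (continuous_jetNorm _).add (continuous_jetNorm _))
  have h0 : ∀ i, jetNorm (0 : SmoothVec ε ν) i = 0 := fun i => by
    rw [jetNorm, map_zero]
    exact norm_zero
  have := hc.tendsto 0
  simp only [h0, add_zero, Finset.sum_const_zero, mul_zero] at this
  filter_upwards [this.eventually (gt_mem_nhds hδ)] with f hf using (H f).trans_lt hf

/-- A linear functional bounded by one of the norms `supNorm k` is continuous. -/
def mkDist (T : SmoothVec ε ν →ₗ[ℂ] ℂ) (h : ∃ k C, ∀ f, ‖T f‖ ≤ C * supNorm k f) :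
    SmoothVec ε ν →L[ℂ] ℂ where
  toLinearMap := T
  cont := by
    obtain ⟨k, C, h⟩ := h
    refine continuous_of_continuousAt_zero T.toAddMonoidHom ?_
    rw [ContinuousAt, Metric.tendsto_nhds]
    intro δ hδ
    filter_upwards [setOf_supNorm_lt_mem_nhds (ε := ε) (ν := ν) k
      (show 0 < δ / (|C| + 1) by positivity)] with f hf
    simp only [LinearMap.toAddMonoidHom_coe, map_zero, dist_zero_right]
    have h1 : supNorm k f < δ / (|C| + 1) := hf
    have h2 := supNorm_nonneg k f
    calc ‖T f‖ ≤ C * supNorm k f := h f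
      _ ≤ (|C| + 1) * supNorm k f := by gcongr; linarith [le_abs_self C]
      _ < (|C| + 1) * (δ / (|C| + 1)) := by gcongr
      _ = δ := by field_simp

lemma exists_bound_jet (ε : ℤˣ) (ν : ℂ) (g : Mp) (j : ℕ) {K : Set ℝ} (hK : IsCompact K) :
    ∃ C, 0 ≤ C ∧ ∀ (f : SmoothVec ε ν), ∀ x ∈ K,
      ‖iteratedDeriv j (fun x => f (g * nPlus x)) x‖ ≤ C * supNorm j f := by
  obtain ⟨a, x₀, y₀, r, hy, hr, H⟩ := exists_iwasawa_nPlus g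
  have key : ∀ f : SmoothVec ε ν, (fun x => f (g * nPlus x)) = fun x =>
      (r : ℂ) ^ (1 - ν) * chart (1 - ν) (fun t => restr f (a + t)) (y₀⁻¹ * (x - x₀)) := by
    intro f
    funext x
    obtain ⟨u, hu, y, e, e'⟩ := H x
    have hp := one_add_sq_pos ((x - x₀) / y₀)
    rw [e', f.map_borel, e, ofReal_mul, mul_cpow_ofReal_nonneg hr.le
      (by positivity), ofReal_rpow_cpow hp, chart, mul_assoc, ← sub_eq_add_neg, mul_comm (restr f _),
      inv_mul_eq_div, restr]
    push_cast; ring_nf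
  obtain ⟨C, hC, HC⟩ := exists_bd_aopIter (1 - ν) j 0
  have hcont : Continuous fun x : ℝ => (1 + (y₀⁻¹ * (x - x₀)) ^ 2) ^ (-(1 - ν + (j : ℂ)).re / 2) :=
    Continuous.rpow_const (by fun_prop) fun x => Or.inl (one_add_sq_pos _).ne'
  obtain ⟨D, hD⟩ := hK.exists_bound_of_continuousOn hcont.continuousOn
  refine ⟨‖(r : ℂ) ^ (1 - ν)‖ * (|y₀⁻¹ ^ j| * (C * |D|)), by positivity, fun f x hx => ?_⟩
  have hh : ContDiff ℝ ∞ fun t => restr f (a + t) := ((isQP_restr f).comp_add a).contDiff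
  rw [key, show (fun x => (r : ℂ) ^ (1 - ν) *
    chart (1 - ν) (fun t => restr f (a + t)) (y₀⁻¹ * (x - x₀))) = fun x => (r : ℂ) ^ (1 - ν) *
    (fun z => chart (1 - ν) (fun t => restr f (a + t)) (y₀⁻¹ * z)) (x - x₀) from rfl,
    iteratedDeriv_const_mul_field, iteratedDeriv_comp_sub_const j
      (fun z => chart (1 - ν) (fun t => restr f (a + t)) (y₀⁻¹ * z)),
    iteratedDeriv_comp_const_smul ((contDiff_chart (1 - ν) hh).of_le (mod_cast le_top))]
  beta_reduce
  rw [iteratedDeriv_chart _ hh, norm_mul, mul_assoc]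
  refine mul_le_mul_of_nonneg_left ?_ (norm_nonneg _)
  have h1 := (HC _ hh _ ((bd_restr j f).comp_add a)).norm_le (-arctan (y₀⁻¹ * (x - x₀)))
  have h2 := hD x hx
  rw [norm_of_nonneg (rpow_nonneg (one_add_sq_pos _).le _)] at h2
  rw [norm_smul, norm_chart, norm_eq_abs, mul_assoc]
  refine mul_le_mul_of_nonneg_left ?_ (abs_nonneg _)
  calc _ ≤ (C * supNorm j f) * |D| := mul_le_mul h1 (h2.trans (le_abs_self D))
        (rpow_nonneg (one_add_sq_pos _).le _) (mul_nonneg hC (supNorm_nonneg _ _))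
    _ = _ := by ring

/-- A linear map into `V^∞_{ε',ν'}` which is bounded with respect to the norms `supNorm`
is continuous. -/
def mkMap {ε' : ℤˣ} {ν' : ℂ} (T : SmoothVec ε ν →ₗ[ℂ] SmoothVec ε' ν')
    (h : ∀ k, ∃ l C, ∀ f, supNorm k (T f) ≤ C * supNorm l f) :
    SmoothVec ε ν →L[ℂ] SmoothVec ε' ν' where
  toLinearMap := T
  cont := by
    refine continuous_induced_rng.2 (continuous_pi fun i => ?_)
    refine continuous_of_continuousAt_zero
      (((LinearMap.proj i).comp ((jet ε' ν').comp T)).toAddMonoidHom : _ →+ C(ℝ, ℂ)) ?_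
    rw [ContinuousAt, map_zero, ContinuousMap.tendsto_iff_forall_isCompact_tendstoUniformlyOn]
    intro K hK
    rw [Metric.tendstoUniformlyOn_iff]
    intro δ hδ
    obtain ⟨D, hD, HD⟩ := exists_bound_jet ε' ν' i.1 i.2 hK
    obtain ⟨k, C, H⟩ := h i.2
    filter_upwards [setOf_supNorm_lt_mem_nhds (ε := ε) (ν := ν) k
      (show 0 < δ / (D * |C| + 1) by positivity)] with f hf x hx
    have h1 : supNorm k f < δ / (D * |C| + 1) := hf
    have h2 := supNorm_nonneg k f
    rw [ContinuousMap.zero_apply, dist_zero_left]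
    calc _ ≤ D * supNorm i.2 (T f) := HD (T f) x hx
      _ ≤ D * (|C| * supNorm k f) := by
        gcongr; exact (H f).trans (mul_le_mul_of_nonneg_right (le_abs_self C) h2)
      _ ≤ (D * |C| + 1) * supNorm k f := by linarith
      _ < (D * |C| + 1) * (δ / (D * |C| + 1)) := by gcongr
      _ = δ := by field_simp

lemma exists_supNorm_le_of_isVonNBounded {S : Set (SmoothVec ε ν)} (hS : Bornology.IsVonNBounded ℂ S)
    (k : ℕ) : ∃ M, 0 < M ∧ ∀ f ∈ S, supNorm k f ≤ M := by
  obtain ⟨r, hr, H⟩ := (hS (setOf_supNorm_lt_mem_nhds k one_pos)).exists_pos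
  refine ⟨r, hr, fun f hf => ?_⟩
  obtain ⟨v, hv, rfl⟩ := H (r : ℂ) (by simp [le_abs_self]) hf
  have hv' : supNorm k v < 1 := hv
  show supNorm k ((r : ℂ) • v) ≤ r
  rw [supNorm_smul, Complex.norm_of_nonneg hr.le]
  nlinarith

/-- Convergence of series of functionals in the strong topology. -/
lemma hasSum_strong {ι : Type*} {T : ι → SmoothVec ε ν →L[ℂ] ℂ} {S : SmoothVec ε ν →L[ℂ] ℂ}
    (hp : ∀ f, HasSum (fun i => T i f) (S f)) {k : ℕ} {C : ι → ℝ} (hC : Summable C)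
    (hC0 : ∀ i, 0 ≤ C i)     (hb : ∀ i f, ‖T i f‖ ≤ C i * supNorm k f) : HasSum T S := by
  have key : Filter.Tendsto (fun F : Finset ι => ∑ i ∈ F, T i - S) Filter.atTop (𝓝 0) := by
    rw [(ContinuousLinearMap.hasBasis_nhds_zero_of_basis Metric.nhds_basis_ball).tendsto_right_iff]
    rintro ⟨B, δ⟩ ⟨hB, hδ⟩
    obtain ⟨M, hM, hBM⟩ := exists_supNorm_le_of_isVonNBounded hB k
    have ht : Filter.Tendsto (fun F : Finset ι => (∑' i, C i - ∑ i ∈ F, C i) * M) Filter.atTop (𝓝 0) := by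
      have := (tendsto_const_nhds.sub hC.hasSum).mul_const (b := M) (a := ∑' i, C i - ∑' i, C i)
      simpa
    filter_upwards [ht.eventually (gt_mem_nhds hδ)] with F hF f hf
    rw [mem_ball_zero_iff]
    refine lt_of_le_of_lt ?_ hF
    have h1 : HasSum (fun i : {i // i ∉ F} => T i f) (S f - ∑ i ∈ F, T i f) := by
      exact (Finset.hasSum_compl_iff (f := fun i => T i f) F).2 (by simpa using hp f)
    have h2 : HasSum (fun i : {i // i ∉ F} => C i * M) ((∑' i, C i - ∑ i ∈ F, C i) * M) := by
      refine HasSum.mul_right M ?_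
      exact (Finset.hasSum_compl_iff (f := C) F).2 (by simpa using hC.hasSum)
    have h3 := tsum_of_norm_bounded h2 (f := fun i : {i // i ∉ F} => T i f) fun i => by
      exact (hb i f).trans (mul_le_mul_of_nonneg_left (hBM f hf) (hC0 i))
    rw [h1.tsum_eq] at h3
    rw [← norm_neg]
    simpa
  have := key.add_const S
  simpa

/-! ### Integrals of charts -/

lemma integrable_bracket {s : ℝ} (hs : 1 < s) : Integrable fun x : ℝ => (1 + x ^ 2) ^ (-s / 2) := by
  have := integrable_rpow_neg_one_add_norm_sq (E := ℝ) (μ := volume) (r := s) (by simpa)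
  simpa

lemma norm_chart_le {b : ℂ} {h : ℝ → ℂ} {M s : ℝ} (hM : ∀ θ, ‖h θ‖ ≤ M) (hs : s ≤ b.re) (x : ℝ) :
    ‖chart b h x‖ ≤ M * (1 + x ^ 2) ^ (-s / 2) := by
  rw [norm_chart]
  have hM0 : 0 ≤ M := (norm_nonneg _).trans (hM 0)
  exact mul_le_mul (hM _) (Real.rpow_le_rpow_of_exponent_le (by nlinarith) (by linarith))
    (rpow_nonneg (one_add_sq_pos x).le _) hM0

lemma continuous_chart (b : ℂ) {h : ℝ → ℂ} (hh : Continuous h) : Continuous (chart b h) := by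
  refine (hh.comp (Real.continuous_arctan.neg)).mul ?_
  refine Continuous.cpow (continuous_ofReal.comp (by fun_prop)) continuous_const fun x =>
    one_add_sq_mem_slitPlane x

lemma integrable_chart {b : ℂ} {h : ℝ → ℂ} {M : ℝ} (hh : Continuous h) (hM : ∀ θ, ‖h θ‖ ≤ M)
    (hb : 1 < b.re) : Integrable (chart b h) :=
  ((integrable_bracket hb).const_mul M).mono' (continuous_chart b hh).aestronglyMeasurable
    (ae_of_all _ fun x => norm_chart_le hM le_rfl x)

/-- The integral which bounds the integrals of charts. -/
def bracketInt (s : ℝ) : ℝ := ∫ x : ℝ, (1 + x ^ 2) ^ (-s / 2)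

lemma bracketInt_nonneg (s : ℝ) : 0 ≤ bracketInt s :=
  integral_nonneg fun x => rpow_nonneg (one_add_sq_pos x).le _

lemma norm_integral_chart_mul_le {b : ℂ} {h : ℝ → ℂ} {M s : ℝ} {g : ℝ → ℂ} (hM : ∀ θ, ‖h θ‖ ≤ M)
    (hs : 1 < s) (hb : s ≤ b.re) (hg : ∀ x, ‖g x‖ ≤ 1) :
    ‖∫ x, chart b h x * g x‖ ≤ M * bracketInt s := by
  rw [bracketInt, ← integral_const_mul]
  refine norm_integral_le_of_norm_le ((integrable_bracket hs).const_mul M) (ae_of_all _ fun x => ?_)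
  rw [norm_mul]
  exact (mul_le_of_le_one_right (norm_nonneg _) (hg x)).trans (norm_chart_le hM hb x)

/-! ### Holomorphic families of functions on the circle -/

/-- A family of smooth functions which depends holomorphically on a parameter in `U`. -/
structure HolFam (U : Set ℂ) (h : ℂ → ℝ → ℂ) : Prop where
  contDiff : ∀ ν ∈ U, ContDiff ℝ ∞ (h ν)
  holo : ∀ j θ, DifferentiableOn ℂ (fun ν => iteratedDeriv j (h ν) θ) U
  bd : ∀ ν₀ ∈ U, ∀ k, ∃ M, ∀ᶠ ν in 𝓝 ν₀, Bd k M (h ν)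

lemma HolFam.differentiableOn {U : Set ℂ} {h : ℂ → ℝ → ℂ} (hh : HolFam U h) (θ : ℝ) :
    DifferentiableOn ℂ (fun ν => h ν θ) U := by simpa using hh.holo 0 θ

lemma HolFam.mono {U V : Set ℂ} {h : ℂ → ℝ → ℂ} (hh : HolFam U h) (hV : V ⊆ U) : HolFam V h :=
  ⟨fun ν hν => hh.1 ν (hV hν), fun j θ => (hh.2 j θ).mono hV, fun ν hν => hh.3 ν (hV hν)⟩

lemma HolFam.congr {U : Set ℂ} (hU : IsOpen U) {h h' : ℂ → ℝ → ℂ} (hh : HolFam U h)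
    (e : ∀ ν ∈ U, h' ν = h ν) : HolFam U h' := by
  refine ⟨fun ν hν => e ν hν ▸ hh.1 ν hν, fun j θ => (hh.2 j θ).congr fun ν hν => by rw [e ν hν],
    fun ν₀ hν₀ k => ?_⟩
  obtain ⟨M, hM⟩ := hh.3 ν₀ hν₀ k
  exact ⟨M, by filter_upwards [hM, hU.mem_nhds hν₀] with ν h1 h2; rwa [e ν h2]⟩

lemma HolFam.of_cover {U : Set ℂ} {h : ℂ → ℝ → ℂ}
    (H : ∀ ν₀ ∈ U, ∃ V, IsOpen V ∧ ν₀ ∈ V ∧ HolFam V h) : HolFam U h := by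
  refine ⟨fun ν hν => ?_, fun j θ ν hν => ?_, fun ν hν => ?_⟩ <;> obtain ⟨V, hV, hm, hf⟩ := H ν hν
  · exact hf.1 ν hm
  · exact ((hf.2 j θ).differentiableAt (hV.mem_nhds hm)).differentiableWithinAt
  · exact hf.3 ν hm

lemma HolFam.const {χ : ℂ} (hχ : ‖χ‖ = 1) {h : ℝ → ℂ} (hh : IsQP χ h) (U : Set ℂ) :
    HolFam U fun _ => h :=
  ⟨fun _ _ => hh.contDiff, fun _ _ => differentiableOn_const _, fun _ _ k => by
    obtain ⟨M, hM⟩ := hh.exists_bd hχ k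
    exact ⟨M, Eventually.of_forall fun _ => hM⟩⟩

lemma HolFam.deriv {U : Set ℂ} {h : ℂ → ℝ → ℂ} (hh : HolFam U h) :
    HolFam U fun ν => deriv (h ν) := by
  refine ⟨fun ν hν => contDiff_deriv (hh.1 ν hν), fun j θ => ?_, fun ν₀ hν₀ k => ?_⟩
  · simp only [← iteratedDeriv_succ']
    exact hh.2 (j + 1) θ
  · obtain ⟨M, hM⟩ := hh.3 ν₀ hν₀ (k + 1)
    exact ⟨M, by filter_upwards [hM] with ν h1 using h1.deriv⟩

lemma Bd.add {k : ℕ} {M M' : ℝ} {h h' : ℝ → ℂ} (hb : Bd k M h) (hb' : Bd k M' h')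
    (hh : ContDiff ℝ ∞ h) (hh' : ContDiff ℝ ∞ h') : Bd k (M + M') fun θ => h θ + h' θ :=
  fun j hj θ => by
    rw [iteratedDeriv_fun_add (contDiffAt_nat hh j θ) (contDiffAt_nat hh' j θ)]
    exact (norm_add_le _ _).trans (add_le_add (hb j hj θ) (hb' j hj θ))

lemma Bd.const_mul {k : ℕ} {M : ℝ} {h : ℝ → ℂ} (hb : Bd k M h) (c : ℂ) :
    Bd k (‖c‖ * M) fun θ => c * h θ := fun j hj θ => by
  rw [iteratedDeriv_const_mul_field, norm_mul]
  exact mul_le_mul_of_nonneg_left (hb j hj θ) (norm_nonneg _)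

lemma HolFam.add {U : Set ℂ} (hU : IsOpen U) {h h' : ℂ → ℝ → ℂ} (hh : HolFam U h)
    (hh' : HolFam U h') : HolFam U fun ν θ => h ν θ + h' ν θ := by
  refine ⟨fun ν hν => (hh.1 ν hν).add (hh'.1 ν hν), fun j θ => ?_, fun ν₀ hν₀ k => ?_⟩
  · refine ((hh.2 j θ).add (hh'.2 j θ)).congr fun ν hν => ?_
    exact iteratedDeriv_fun_add (contDiffAt_nat (hh.1 ν hν) j θ) (contDiffAt_nat (hh'.1 ν hν) j θ)
  · obtain ⟨M, hM⟩ := hh.3 ν₀ hν₀ k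
    obtain ⟨M', hM'⟩ := hh'.3 ν₀ hν₀ k
    exact ⟨M + M', by
      filter_upwards [hM, hM', hU.mem_nhds hν₀] with ν h1 h2 h3 using h1.add h2 (hh.1 ν h3) (hh'.1 ν h3)⟩

lemma exists_bound_nhds {U : Set ℂ} (hU : IsOpen U) {c : ℂ → ℂ} (hc : DifferentiableOn ℂ c U)
    {ν₀ : ℂ} (hν₀ : ν₀ ∈ U) : ∀ᶠ ν in 𝓝 ν₀, ‖c ν‖ ≤ ‖c ν₀‖ + 1 := by
  have := (hc.differentiableAt (hU.mem_nhds hν₀)).continuousAt.norm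
  filter_upwards [this.eventually (gt_mem_nhds (lt_add_one _))] with ν hν using hν.le

lemma HolFam.smul {U : Set ℂ} (hU : IsOpen U) {h : ℂ → ℝ → ℂ} (hh : HolFam U h) {c : ℂ → ℂ}
    (hc : DifferentiableOn ℂ c U) : HolFam U fun ν θ => c ν * h ν θ := by
  refine ⟨fun ν hν => contDiff_const.mul (hh.1 ν hν), fun j θ => ?_, fun ν₀ hν₀ k => ?_⟩
  · refine (hc.mul (hh.2 j θ)).congr fun ν hν => iteratedDeriv_const_mul_field _ _
  · obtain ⟨M, hM⟩ := hh.3 ν₀ hν₀ k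
    refine ⟨(‖c ν₀‖ + 1) * M, ?_⟩
    filter_upwards [hM, exists_bound_nhds hU hc hν₀] with ν h1 h2
    exact (h1.const_mul (c ν)).mono le_rfl (mul_le_mul_of_nonneg_right h2 h1.nonneg)

lemma HolFam.comp_add {U : Set ℂ} {h : ℂ → ℝ → ℂ} (hh : HolFam U h) (a : ℝ) :
    HolFam U fun ν θ => h ν (a + θ) := by
  refine ⟨fun ν hν => (hh.1 ν hν).comp (contDiff_const.add contDiff_id), fun j θ => ?_,
    fun ν₀ hν₀ k => ?_⟩
  · simp only [iteratedDeriv_comp_const_add]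
    exact hh.2 j _
  · obtain ⟨M, hM⟩ := hh.3 ν₀ hν₀ k
    exact ⟨M, by filter_upwards [hM] with ν h1 using h1.comp_add a⟩

lemma Bd.mul_smooth {k : ℕ} {M : ℝ} {c h : ℝ → ℂ} (hb : Bd k M h) (hh : ContDiff ℝ ∞ h)
    (hc : ContDiff ℝ ∞ c) (hc1 : ∀ n t, ‖iteratedDeriv n c t‖ ≤ 1) :
    Bd k (2 ^ k * M) fun θ => c θ * h θ := fun j hj θ => by
  refine (norm_iteratedDeriv_mul_le (K := 1) (M := M) hc hh (fun i _ => hc1 i θ)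
    (fun i hi => hb i (hi.trans hj) θ)).trans ?_
  rw [one_mul]
  exact mul_le_mul_of_nonneg_right (pow_le_pow_right₀ (by norm_num) hj) hb.nonneg

lemma HolFam.mul_smooth {U : Set ℂ} (hU : IsOpen U) {h : ℂ → ℝ → ℂ} (hh : HolFam U h) {c : ℝ → ℂ}
    (hc : ContDiff ℝ ∞ c) (hb : ∀ n t, ‖iteratedDeriv n c t‖ ≤ 1) :
    HolFam U fun ν θ => c θ * h ν θ := by
  refine ⟨fun ν hν => hc.mul (hh.1 ν hν), fun j θ => ?_, fun ν₀ hν₀ k => ?_⟩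
  · have : DifferentiableOn ℂ (fun ν => ∑ i ∈ range (j + 1), (j.choose i : ℂ) *
        iteratedDeriv i c θ * iteratedDeriv (j - i) (h ν) θ) U :=
      DifferentiableOn.fun_sum fun i _ => (differentiableOn_const _).mul (hh.2 _ θ)
    refine this.congr fun ν hν => ?_
    exact iteratedDeriv_fun_mul (contDiffAt_nat hc j θ) (contDiffAt_nat (hh.1 ν hν) j θ)
  · obtain ⟨M, hM⟩ := hh.3 ν₀ hν₀ k
    exact ⟨2 ^ k * M, by
      filter_upwards [hM, hU.mem_nhds hν₀] with ν h1 h2 using h1.mul_smooth (hh.1 ν h2) hc hb⟩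

lemma HolFam.aop {U : Set ℂ} (hU : IsOpen U) {h : ℂ → ℝ → ℂ} (hh : HolFam U h) {b : ℂ → ℂ}
    (hb : DifferentiableOn ℂ b U) : HolFam U fun ν => aop (b ν) (h ν) := by
  have h1 := ((hh.deriv.mul_smooth hU contDiff_cosC fun n t => (norm_iteratedDeriv_trig n t).1).smul hU
    (differentiableOn_const (-1))).add hU
    ((hh.mul_smooth hU contDiff_sinC fun n t => (norm_iteratedDeriv_trig n t).2).smul hU hb)
  convert h1 using 3 with ν θ
  rw [Metaplectic.aop]; ring

lemma HolFam.aopIter {U : Set ℂ} (hU : IsOpen U) {h : ℂ → ℝ → ℂ} (hh : HolFam U h) {b : ℂ → ℂ}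
    (hb : DifferentiableOn ℂ b U) (k : ℕ) : HolFam U fun ν => aopIter (b ν) k (h ν) := by
  induction k with
  | zero => exact hh
  | succ k ih => exact ih.aop hU (hb.add_const _)

lemma HolFam.differentiableOn_integral_chart {U : Set ℂ} (hU : IsOpen U) {h : ℂ → ℝ → ℂ}
    (hh : HolFam U h) {b : ℂ → ℂ} (hb : DifferentiableOn ℂ b U) (hb1 : ∀ ν ∈ U, 1 < (b ν).re)
    {g : ℝ → ℂ} (hg : Continuous g) (hg1 : ∀ x, ‖g x‖ ≤ 1) :
    DifferentiableOn ℂ (fun ν => ∫ x, chart (b ν) (h ν) x * g x) U := by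
  refine differentiableOn_integral (ae_of_all _ fun x => ?_) (fun ν hν => ?_) fun ν₀ hν₀ => ?_
  · refine ((hh.differentiableOn _).mul ?_).mul (differentiableOn_const _)
    have h0 : ((1 + x ^ 2 : ℝ) : ℂ) ≠ 0 := mod_cast (one_add_sq_pos x).ne'
    exact (hb.neg.div_const 2).const_cpow (Or.inl h0)
  · exact ((continuous_chart _ (hh.1 ν hν).continuous).mul hg).aestronglyMeasurable
  · obtain ⟨M, hM⟩ := hh.3 ν₀ hν₀ 0
    have h1 := hb1 ν₀ hν₀
    have h2 : ∀ᶠ ν in 𝓝 ν₀, (1 + (b ν₀).re) / 2 < (b ν).re := (continuous_re.continuousAt.comp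
        (hb.differentiableAt (hU.mem_nhds hν₀)).continuousAt).eventually
        (lt_mem_nhds (by grind))
    obtain ⟨r, hr, H⟩ := Metric.eventually_nhds_iff_ball.1 ((hM.and h2).and (hU.mem_nhds hν₀))
    refine ⟨r, hr, fun ν hν => (H ν hν).2, fun x => M * (1 + x ^ 2) ^ (-((1 + (b ν₀).re) / 2) / 2),
      (integrable_bracket (by linarith)).const_mul M, ae_of_all _ fun x ν hν => ?_⟩
    rw [norm_mul]
    exact (mul_le_of_le_one_right (norm_nonneg _) (hg1 x)).trans
      (norm_chart_le (H ν hν).1.1.norm_le (H ν hν).1.2.le x)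

/-! ### The intertwining integral on the circle -/

/-- The intertwining integral, in terms of the restriction to `K̃`. -/
def jint (ν : ℂ) (h : ℝ → ℂ) (θ : ℝ) : ℂ := ∫ x, chart (1 + ν) (fun t => h (θ + π / 2 + t)) x

lemma norm_jint_le {ν : ℂ} {h : ℝ → ℂ} {M s : ℝ} (hM : ∀ θ, ‖h θ‖ ≤ M) (hs : 0 < s)
    (hν : s ≤ ν.re) (θ : ℝ) : ‖jint ν h θ‖ ≤ M * bracketInt (1 + s) := by
  have := norm_integral_chart_mul_le (b := 1 + ν) (h := fun t => h (θ + π / 2 + t)) (M := M)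
    (s := 1 + s) (g := fun _ => 1) (fun t => hM _) (by linarith) (by simpa) (by simp)
  simpa

lemma hasDerivAt_jint {ν : ℂ} (hν : 0 < ν.re) {h : ℝ → ℂ} (hh : ContDiff ℝ ∞ h) {M : ℝ}
    (hb : Bd 1 M h) (θ : ℝ) : HasDerivAt (jint ν h) (jint ν (deriv h) θ) θ := by
  have hν' : 1 < (1 + ν).re := by simpa
  have hs : ∀ (f : ℝ → ℂ), Continuous f → ∀ θ, Continuous fun t => f (θ + π / 2 + t) :=
    fun f hf θ => hf.comp (by fun_prop)
  have hb' : ∀ θ, ‖deriv h θ‖ ≤ M := Bd.norm_le (k := 0) hb.deriv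
  have hc' := (contDiff_deriv hh).continuous
  refine (hasDerivAt_integral_of_dominated_loc_of_deriv_le (x₀ := θ) (s := univ)
    (F := fun θ x => chart (1 + ν) (fun t => h (θ + π / 2 + t)) x)
    (F' := fun θ x => chart (1 + ν) (fun t => deriv h (θ + π / 2 + t)) x)
    (bound := fun x => M * (1 + x ^ 2) ^ (-(1 + ν).re / 2)) univ_mem ?_ ?_ ?_ ?_ ?_ ?_).2
  · exact Eventually.of_forall fun θ =>
      (continuous_chart _ (hs h hh.continuous θ)).aestronglyMeasurable
  · exact integrable_chart (hs h hh.continuous θ) (fun t => hb.norm_le _) hν'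
  · exact (continuous_chart _ (hs _ hc' θ)).aestronglyMeasurable
  · exact ae_of_all _ fun x θ _ => norm_chart_le (fun t => hb' _) le_rfl x
  · exact (integrable_bracket hν').const_mul M
  · refine ae_of_all _ fun x θ _ => ?_
    refine HasDerivAt.mul_const ?_ _
    have h1 := (hh.differentiable (by simp) (θ + π / 2 + -arctan x)).hasDerivAt
    have h2 := HasDerivAt.comp_add_const θ (π / 2 + -arctan x) (by simpa only [add_assoc] using h1)
    grind

lemma iteratedDeriv_jint {ν : ℂ} (hν : 0 < ν.re) {h : ℝ → ℂ} (hh : ContDiff ℝ ∞ h) {M : ℝ} {k : ℕ}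
    (hb : Bd k M h) : iteratedDeriv k (jint ν h) = jint ν (iteratedDeriv k h) := by
  induction k with
  | zero => simp
  | succ k ih =>
    rw [iteratedDeriv_succ, ih (hb.mono (Nat.le_succ k) le_rfl)]
    funext θ
    rw [(hasDerivAt_jint hν (contDiff_iteratedDeriv hh k) (M := M) ?_ θ).deriv, iteratedDeriv_succ]
    intro j hj t
    rw [iteratedDeriv_eq_iterate, iteratedDeriv_eq_iterate, ← Function.iterate_add_apply,
      ← iteratedDeriv_eq_iterate]
    exact hb _ (by omega) t

lemma contDiff_jint {ν : ℂ} (hν : 0 < ν.re) {h : ℝ → ℂ} (hh : ContDiff ℝ ∞ h)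
    (hb : ∀ k, ∃ M, Bd k M h) : ContDiff ℝ ∞ (jint ν h) := by
  refine contDiff_infty.2 fun n => contDiff_of_differentiable_iteratedDeriv fun m _ => ?_
  obtain ⟨M, hM⟩ := hb (m + 1)
  rw [iteratedDeriv_jint hν hh (hM.mono (Nat.le_succ m) le_rfl)]
  refine fun θ => (hasDerivAt_jint hν (contDiff_iteratedDeriv hh m) (M := M) ?_ θ).differentiableAt
  intro j hj t
  rw [iteratedDeriv_eq_iterate, iteratedDeriv_eq_iterate, ← Function.iterate_add_apply,
    ← iteratedDeriv_eq_iterate]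
  exact hM _ (by omega) t

lemma bd_jint {ν : ℂ} {s : ℝ} (hs : 0 < s) (hν : s ≤ ν.re) {h : ℝ → ℂ} (hh : ContDiff ℝ ∞ h)
    {M : ℝ} {k : ℕ} (hb : Bd k M h) : Bd k (M * bracketInt (1 + s)) (jint ν h) := fun j hj θ => by
  rw [iteratedDeriv_jint (hs.trans_le hν) hh (hb.mono hj le_rfl)]
  exact norm_jint_le (hb j hj) hs hν θ

lemma HolFam.exists_bd {U : Set ℂ} {h : ℂ → ℝ → ℂ} (hh : HolFam U h) {ν : ℂ} (hν : ν ∈ U) (k : ℕ) :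
    ∃ M, Bd k M (h ν) := by
  obtain ⟨M, hM⟩ := hh.3 ν hν k
  exact ⟨M, hM.self_of_nhds⟩

lemma HolFam.jint {U : Set ℂ} (hU : IsOpen U) {b : ℂ → ℂ} (hb : DifferentiableOn ℂ b U)
    (hpos : ∀ ν ∈ U, 0 < (b ν).re) {h : ℂ → ℝ → ℂ} (hh : HolFam U h) :
    HolFam U fun ν => jint (b ν) (h ν) := by
  refine ⟨fun ν hν => contDiff_jint (hpos ν hν) (hh.1 ν hν) (hh.exists_bd hν), fun j θ => ?_,
    fun ν₀ hν₀ k => ?_⟩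
  · have hj : HolFam U fun ν => iteratedDeriv j (h ν) := by
      induction j with
      | zero => simpa
      | succ j ih => simpa only [iteratedDeriv_succ] using ih.deriv
    have := (hj.comp_add (θ + π / 2)).differentiableOn_integral_chart hU
      (b := fun ν => 1 + b ν) (hb.const_add 1)
      (fun ν hν => by simp_all) (g := fun _ => 1) continuous_const (by simp)
    refine this.congr fun ν hν => ?_
    obtain ⟨M, hM⟩ := hh.exists_bd hν j
    rw [iteratedDeriv_jint (hpos ν hν) (hh.1 ν hν) hM]
    simp [Metaplectic.jint]
  · obtain ⟨M, hM⟩ := hh.3 ν₀ hν₀ k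
    have h0 := hpos ν₀ hν₀
    refine ⟨M * bracketInt (1 + (b ν₀).re / 2), ?_⟩
    have hc : ContinuousAt (fun ν => (b ν).re) ν₀ := continuous_re.continuousAt.comp
      (hb.differentiableAt (hU.mem_nhds hν₀)).continuousAt
    filter_upwards [hM, hU.mem_nhds hν₀, hc.eventually
      (lt_mem_nhds (show (b ν₀).re / 2 < (b ν₀).re by linarith))] with ν h1 h2 h3
    exact bd_jint (by linarith) h3.le (hh.1 ν h2) h1

lemma integral_chart_aop {b : ℂ} (hb : 0 < b.re) {h : ℝ → ℂ} (hh : ContDiff ℝ ∞ h) {M : ℝ}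
    (hM : Bd 1 M h) : ∫ x, chart (b + 1) (aop b h) x = 0 := by
  have hint : Integrable (chart (b + 1) (aop b h)) :=
    integrable_chart (contDiff_aop b hh).continuous (Bd.norm_le (k := 0) (hM.aop hh b)) (by simpa)
  have hb2 : 0 < b.re / 2 := by linarith
  have h0 : ∀ l : Filter ℝ, Tendsto (fun x : ℝ => 1 + x ^ 2) l atTop → Tendsto (chart b h) l (𝓝 0) := by
    intro l hl
    refine squeeze_zero_norm (norm_chart_le hM.norm_le le_rfl) ?_
    have := ((tendsto_rpow_neg_atTop hb2).comp hl).const_mul M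
    grind
  have h1 : Tendsto (fun x : ℝ => 1 + x ^ 2) atTop atTop :=
    tendsto_atTop_add_const_left _ _ (tendsto_pow_atTop two_ne_zero)
  have h2 : Tendsto (fun x : ℝ => 1 + x ^ 2) atBot atTop := by
    simpa [Function.comp_def] using h1.comp tendsto_neg_atBot_atTop
  have := integral_of_hasDerivAt_of_tendsto (fun x => hasDerivAt_chart b hh x) hint (h0 _ h2) (h0 _ h1)
  simpa

lemma chart_cos_mul (b : ℂ) (h : ℝ → ℂ) :
    chart b (fun t => ((cos t : ℝ) : ℂ) * h t) = chart (b + 1) h := by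
  funext x
  have hp := one_add_sq_pos x
  have hne : ((1 + x ^ 2 : ℝ) : ℂ) ≠ 0 := mod_cast hp.ne'
  have e : ((cos (-arctan x) : ℝ) : ℂ) = ((1 + x ^ 2 : ℝ) : ℂ) ^ (-(1 / 2) : ℂ) := by
    rw [Real.cos_neg, cos_arctan, one_div, sqrt_eq_rpow, ← rpow_neg hp.le, ofReal_cpow hp.le]
    simp
  rw [chart, chart, e, mul_comm _ (h _), mul_assoc, ← cpow_add _ _ hne]
  ring_nf

/-- The operator which links the intertwining integrals with parameters `ν` and `ν + 2`. -/
def dop (ν : ℂ) (h : ℝ → ℂ) : ℝ → ℂ := fun θ => deriv (deriv h) θ + (ν + 1) ^ 2 * h θ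

lemma aop_dop (ν : ℂ) {h : ℝ → ℂ} (hh : ContDiff ℝ ∞ h) (t : ℝ) :
    aop ν (fun t => -1 * (((cos t : ℝ) : ℂ) * deriv h t) + -(ν + 1) * (((sin t : ℝ) : ℂ) * h t)) t =
    ((cos t : ℝ) : ℂ) * (((cos t : ℝ) : ℂ) * dop ν h t) - ν * (ν + 1) * h t := by
  have h1 := (Real.hasDerivAt_cos t).ofReal_comp.mul
    ((contDiff_deriv hh).differentiable (by simp) t).hasDerivAt
  have h2 := (Real.hasDerivAt_sin t).ofReal_comp.mul (hh.differentiable (by simp) t).hasDerivAt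
  have h3 := ((h1.const_mul (-1)).add (h2.const_mul (-(ν + 1)))).deriv
  have h4 : ((sin t : ℝ) : ℂ) ^ 2 + ((cos t : ℝ) : ℂ) ^ 2 = 1 := by simp
  simp only [aop, dop]
  erw [h3]
  push_cast at h4 ⊢
  grind

lemma jint_dop {ν : ℂ} (hν : 0 < ν.re) {h : ℝ → ℂ} (hh : ContDiff ℝ ∞ h) {M : ℝ} (hM : Bd 2 M h)
    (θ : ℝ) : jint (ν + 2) (dop ν h) θ = ν * (ν + 1) * jint ν h θ := by
  set H : ℝ → ℂ := fun t => h (θ + π / 2 + t) with hH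
  have hHs : ContDiff ℝ ∞ H := hh.comp (contDiff_const.add contDiff_id)
  have hHb : Bd 2 M H := hM.comp_add _
  have hdH : (fun t => dop ν h (θ + π / 2 + t)) = dop ν H := by
    have e : ∀ f : ℝ → ℂ, deriv (fun t => f (θ + π / 2 + t)) = fun t =>
        deriv f (θ + π / 2 + t) := fun f => funext fun t => deriv_comp_const_add ..
    funext t
    rw [dop, dop, hH, e, e]
  have hQ := ((hHb.deriv.mul_smooth (contDiff_deriv hHs) contDiff_cosC
    fun n t => (norm_iteratedDeriv_trig n t).1).const_mul (-1)).add
    (((hHb.mono (k' := 1) (by norm_num) le_rfl).mul_smooth hHs contDiff_sinC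
    fun n t => (norm_iteratedDeriv_trig n t).2).const_mul (-(ν + 1)))
    (contDiff_const.mul (contDiff_cosC.mul (contDiff_deriv hHs)))
    (contDiff_const.mul (contDiff_sinC.mul hHs))
  have key := integral_chart_aop hν ((contDiff_const.mul (contDiff_cosC.mul (contDiff_deriv hHs))).add
    (contDiff_const.mul (contDiff_sinC.mul hHs))) hQ
  have hd : ContDiff ℝ ∞ (dop ν H) :=
    (contDiff_deriv (contDiff_deriv hHs)).add (contDiff_const.mul hHs)
  have hdb : ∀ t, ‖dop ν H t‖ ≤ M + ‖(ν + 1) ^ 2‖ * M := fun t => by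
    refine (norm_add_le _ _).trans (add_le_add (Bd.norm_le (k := 0) hHb.deriv.deriv t) ?_)
    rw [norm_mul]
    exact mul_le_mul_of_nonneg_left (hHb.norm_le t) (norm_nonneg _)
  have e1 : (fun x => chart (ν + 1) (aop ν (fun t => -1 * (((cos t : ℝ) : ℂ) * deriv H t) +
      -(ν + 1) * (((sin t : ℝ) : ℂ) * H t))) x) = fun x =>
      chart (1 + (ν + 2)) (dop ν H) x - ν * (ν + 1) * chart (1 + ν) H x := by
    funext x
    have e2 : chart (1 + (ν + 2)) (dop ν H) = chart (ν + 1) (fun t => ((cos t : ℝ) : ℂ) *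
        (((cos t : ℝ) : ℂ) * dop ν H t)) := by
      rw [chart_cos_mul (ν + 1) fun t => ((cos t : ℝ) : ℂ) * dop ν H t, chart_cos_mul]
      ring_nf
    rw [e2, add_comm 1 ν, chart, chart, chart, aop_dop ν hHs]
    ring
  have h1 : 1 < (1 + (ν + 2)).re := by simp; linarith
  have h2 : 1 < (1 + ν).re := by simpa
  erw [e1, integral_sub (integrable_chart hd.continuous hdb h1)
    ((integrable_chart hHs.continuous hHb.norm_le h2).const_mul _), integral_const_mul, sub_eq_zero] at key
  rw [jint, jint, hdH]
  exact key

/-! ### The normalised intertwining operator -/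

lemma Bd.dop {k : ℕ} {M : ℝ} {h : ℝ → ℂ} (hb : Bd (k + 2) M h) (hh : ContDiff ℝ ∞ h) (ν : ℂ) :
    Bd k (M + ‖(ν + 1) ^ 2‖ * M) (dop ν h) :=
  Bd.add hb.deriv.deriv ((hb.mono (by omega) le_rfl).const_mul _) (contDiff_deriv (contDiff_deriv hh))
    (contDiff_const.mul hh)

lemma contDiff_dop (ν : ℂ) {h : ℝ → ℂ} (hh : ContDiff ℝ ∞ h) : ContDiff ℝ ∞ (dop ν h) :=
  (contDiff_deriv (contDiff_deriv hh)).add (contDiff_const.mul hh)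

lemma IsQP.dop {χ : ℂ} {h : ℝ → ℂ} (hh : IsQP χ h) (ν : ℂ) : IsQP χ (Metaplectic.dop ν h) :=
  hh.deriv.deriv.add (hh.const_mul _)

lemma HolFam.dop {U : Set ℂ} (hU : IsOpen U) {h : ℂ → ℝ → ℂ} (hh : HolFam U h) {b : ℂ → ℂ}
    (hb : DifferentiableOn ℂ b U) : HolFam U fun ν => dop (b ν) (h ν) :=
  hh.deriv.deriv.add hU (hh.smul hU ((hb.add_const 1).pow 2))

lemma jint_qp {χ ν : ℂ} {h : ℝ → ℂ} (hh : IsQP χ h) (θ : ℝ) :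
    jint ν h (θ + π) = χ * jint ν h θ := by
  rw [jint, jint, ← integral_const_mul]
  congr 1
  funext x
  simp only [chart]
  rw [show θ + π + π / 2 + -arctan x = θ + π / 2 + -arctan x + π by ring, hh.add_pi, mul_assoc]

/-- The operator `Γ(ν)⁻¹ J_ν`, continued to `Re ν > -2 n`. -/
def kst : ℕ → ℂ → (ℝ → ℂ) → ℝ → ℂ
  | 0, ν, h => fun θ => (Gamma ν)⁻¹ * jint ν h θ
  | n + 1, ν, h => kst n (ν + 2) (dop ν h)

/-- The operator `Γ(ν)⁻¹ J_ν`, for all `ν`. -/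
def kop (ν : ℂ) : (ℝ → ℂ) → ℝ → ℂ := kst (order ν) ν

lemma order_spec (ν : ℂ) : 0 < ν.re + order ν := by
  have := Nat.lt_floor_add_one (1 - ν.re)
  rw [order]; linarith

lemma kst_succ (n : ℕ) : ∀ {ν : ℂ}, 0 < ν.re + 2 * n → ∀ {h : ℝ → ℂ}, ContDiff ℝ ∞ h →
    (∀ k, ∃ M, Bd k M h) → kst (n + 1) ν h = kst n ν h := by
  induction n with
  | zero =>
    intro ν hν h hh hb
    obtain ⟨M, hM⟩ := hb 2
    have hν : 0 < ν.re := by grind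
    funext θ
    simp only [kst]
    rw [jint_dop hν hh hM, show ν + 2 = ν + 1 + 1 by ring]
    have h0 : ν ≠ 0 := by rintro rfl; simp at hν
    have h1 : ν + 1 ≠ 0 := fun h => by
      have := congrArg re h
      simp at this; linarith
    grind
  | succ n ih =>
    intro ν hν h hh hb
    rw [kst, kst]
    refine ih (by push_cast at hν; simp; linarith) (contDiff_dop ν hh) fun k => ?_
    obtain ⟨M, hM⟩ := hb (k + 2)
    exact ⟨_, hM.dop hh ν⟩

lemma kst_eq_of_le {n m : ℕ} (hnm : n ≤ m) {ν : ℂ} (hν : 0 < ν.re + 2 * n) {h : ℝ → ℂ}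
    (hh : ContDiff ℝ ∞ h) (hb : ∀ k, ∃ M, Bd k M h) : kst m ν h = kst n ν h := by
  induction m, hnm using Nat.le_induction with
  | base => rfl
  | succ m hm ih =>
    rw [kst_succ m (hν.trans_le ?_) hh hb, ih]
    simpa

lemma kop_eq_kst {n : ℕ} {ν : ℂ} (hν : 0 < ν.re + 2 * n) {h : ℝ → ℂ}
    (hh : ContDiff ℝ ∞ h) (hb : ∀ k, ∃ M, Bd k M h) : kop ν h = kst n ν h := by
  have h1 := order_spec ν
  have h2 : (0 : ℝ) ≤ order ν := cast_nonneg _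
  rcases le_total n (order ν) with h | h
  · exact kst_eq_of_le h hν hh hb
  · exact (kst_eq_of_le h (by linarith) hh hb).symm

lemma kop_of_re_pos {ν : ℂ} (hν : 0 < ν.re) {χ : ℂ} (hχ : ‖χ‖ = 1) {h : ℝ → ℂ} (hh : IsQP χ h)
    (θ : ℝ) : kop ν h θ = (Gamma ν)⁻¹ * jint ν h θ := by
  rw [kop_eq_kst (n := 0) (by simpa) hh.contDiff (hh.exists_bd hχ), kst]

lemma HolFam.kst (n : ℕ) : ∀ {U : Set ℂ}, IsOpen U → ∀ {b : ℂ → ℂ}, DifferentiableOn ℂ b U →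
    (∀ ν ∈ U, 0 < (b ν).re + 2 * n) → ∀ {h : ℂ → ℝ → ℂ}, HolFam U h →
    HolFam U fun ν => kst n (b ν) (h ν) := by
  induction n with
  | zero =>
    intro U hU b hb hpos h hh
    refine (hh.jint hU hb (by grind)).smul hU ?_
    exact Complex.differentiable_one_div_Gamma.comp_differentiableOn hb
  | succ n ih =>
    intro U hU b hb hpos h hh
    exact ih hU (b := fun ν => b ν + 2) (hb.add_const 2)
      (fun ν hν => by have := hpos ν hν; push_cast at this; simp; linarith) (hh.dop hU hb)

lemma HolFam.kop {U : Set ℂ} (hU : IsOpen U) {b : ℂ → ℂ} (hb : DifferentiableOn ℂ b U)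
    {h : ℂ → ℝ → ℂ} (hh : HolFam U h) : HolFam U fun ν => kop (b ν) (h ν) := by
  refine HolFam.of_cover fun ν₀ hν₀ => ?_
  set n := order (b ν₀) with hn
  have hV : IsOpen (U ∩ b ⁻¹' {z | 0 < z.re + 2 * n}) := hb.continuousOn.isOpen_inter_preimage hU
    (isOpen_lt continuous_const (continuous_re.add continuous_const))
  refine ⟨_, hV, ⟨hν₀, ?_⟩, ?_⟩
  · have := order_spec (b ν₀)
    grind
  · have h1 := (hh.mono Set.inter_subset_left).kst n hV (hb.mono Set.inter_subset_left) fun ν hν => hν.2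
    exact h1.congr hV fun ν hν => kop_eq_kst hν.2 (hh.1 ν hν.1) (hh.exists_bd hν.1)

lemma IsQP.kst {χ : ℂ} (hχ : ‖χ‖ = 1) (n : ℕ) : ∀ {ν : ℂ}, 0 < ν.re + 2 * n → ∀ {h : ℝ → ℂ},
    IsQP χ h → IsQP χ (kst n ν h) := by
  induction n with
  | zero =>
    intro ν hν h hh
    have hν : 0 < ν.re := by grind
    refine ⟨contDiff_const.mul (contDiff_jint hν hh.contDiff (hh.exists_bd hχ)), fun θ => ?_⟩
    simp only [Metaplectic.kst, jint_qp hh]; ring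
  | succ n ih =>
    intro ν hν h hh
    exact ih (by push_cast at hν; simp; linarith) (hh.dop ν)

lemma IsQP.kop {χ : ℂ} (hχ : ‖χ‖ = 1) (ν : ℂ) {h : ℝ → ℂ} (hh : IsQP χ h) : IsQP χ (kop ν h) :=
  IsQP.kst hχ _ (by have := order_spec ν; grind) hh

lemma exists_bd_kst (n : ℕ) : ∀ {ν : ℂ}, 0 < ν.re + 2 * n → ∃ C, 0 ≤ C ∧ ∀ (h : ℝ → ℂ),
    ContDiff ℝ ∞ h → ∀ k M, Bd (k + 2 * n) M h → Bd k (C * M) (kst n ν h) := by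
  induction n with
  | zero =>
    intro ν hν
    have hν : 0 < ν.re := by grind
    refine ⟨‖(Gamma ν)⁻¹‖ * bracketInt (1 + ν.re),
      mul_nonneg (norm_nonneg _) (bracketInt_nonneg _), fun h hh k M hb => ?_⟩
    rw [mul_assoc, mul_comm (bracketInt _)]
    exact (bd_jint hν le_rfl hh hb).const_mul _
  | succ n ih =>
    intro ν hν
    obtain ⟨C, hC, H⟩ := ih (ν := ν + 2) (by push_cast at hν; simp; linarith)
    refine ⟨C * (1 + ‖(ν + 1) ^ 2‖), by positivity, fun h hh k M hb => ?_⟩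
    rw [mul_assoc, add_mul, one_mul]
    exact H _ (contDiff_dop ν hh) k _ ((Bd.dop (k := k + 2 * n) (by omega) hh ν))

lemma exists_bd_kop (ν : ℂ) : ∃ (l : ℕ) (C : ℝ), 0 ≤ C ∧ ∀ (h : ℝ → ℂ),
    ContDiff ℝ ∞ h → ∀ k M, Bd (k + l) M h → Bd k (C * M) (kop ν h) := by
  have := order_spec ν
  have : (0 : ℝ) ≤ order ν := cast_nonneg _
  obtain ⟨C, hC, H⟩ := exists_bd_kst (order ν) (ν := ν) (by linarith)
  exact ⟨_, C, hC, H⟩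

lemma jint_add_smul {ν : ℂ} (hν : 0 < ν.re) {h h' : ℝ → ℂ} (hh : Continuous h) (hh' : Continuous h')
    {M M' : ℝ} (hM : ∀ t, ‖h t‖ ≤ M) (hM' : ∀ t, ‖h' t‖ ≤ M') (c : ℂ) (θ : ℝ) :
    jint ν (fun t => h t + c * h' t) θ = jint ν h θ + c * jint ν h' θ := by
  have hν' : 1 < (1 + ν).re := by simpa
  rw [jint, jint, jint, ← integral_const_mul, ← integral_add]
  · congr 1; funext x; simp only [chart]; ring
  · exact integrable_chart (hh.comp (by fun_prop)) (fun t => hM _) hν'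
  · exact (integrable_chart (hh'.comp (by fun_prop)) (fun t => hM' _) hν').const_mul c

lemma dop_add_smul (ν : ℂ) {h h' : ℝ → ℂ} (hh : ContDiff ℝ ∞ h) (hh' : ContDiff ℝ ∞ h') (c : ℂ) :
    dop ν (fun t => h t + c * h' t) = fun t => dop ν h t + c * dop ν h' t := by
  have e : ∀ {h h' : ℝ → ℂ}, ContDiff ℝ ∞ h → ContDiff ℝ ∞ h' →
      deriv (fun t => h t + c * h' t) = fun t => deriv h t + c * deriv h' t := by
    intro h h' hh hh'
    funext t
    exact ((hh.differentiable (by simp) t).hasDerivAt.add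
      ((hh'.differentiable (by simp) t).hasDerivAt.const_mul c)).deriv
  funext t
  simp only [dop]
  rw [e hh hh', e (contDiff_deriv hh) (contDiff_deriv hh')]
  ring

lemma kst_add_smul {χ : ℂ} (hχ : ‖χ‖ = 1) (n : ℕ) : ∀ {ν : ℂ}, 0 < ν.re + 2 * n → ∀ {h h' : ℝ → ℂ},
    IsQP χ h → IsQP χ h' → ∀ c : ℂ, kst n ν (fun t => h t + c * h' t) =
      fun t => kst n ν h t + c * kst n ν h' t := by
  induction n with
  | zero =>
    intro ν hν h h' hh hh' c
    obtain ⟨M, hM⟩ := hh.exists_bound hχ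
    obtain ⟨M', hM'⟩ := hh'.exists_bound hχ
    funext θ
    simp only [kst]
    rw [jint_add_smul (by grind) hh.contDiff.continuous hh'.contDiff.continuous hM hM']
    ring
  | succ n ih =>
    intro ν hν h h' hh hh' c
    rw [kst, kst, kst, dop_add_smul ν hh.contDiff hh'.contDiff]
    exact ih (by push_cast at hν; simp; linarith) (hh.dop ν) (hh'.dop ν) c

lemma kop_add_smul {χ : ℂ} (hχ : ‖χ‖ = 1) (ν : ℂ) {h h' : ℝ → ℂ}
    (hh : IsQP χ h) (hh' : IsQP χ h') (c : ℂ) : kop ν (fun t => h t + c * h' t) =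
      fun t => kop ν h t + c * kop ν h' t :=
  kst_add_smul hχ _ (by have := order_spec ν; grind) hh hh' c

lemma kop_const_mul {χ : ℂ} (hχ : ‖χ‖ = 1) (ν : ℂ) {h : ℝ → ℂ} (hh : IsQP χ h) (c : ℂ) :
    kop ν (fun t => c * h t) = fun t => c * kop ν h t := by
  have hz : IsQP χ fun _ => (0 : ℂ) := ⟨contDiff_const, by simp⟩
  have h0 := kop_add_smul hχ ν hz hz 1
  have h1 := kop_add_smul hχ ν hz hh c
  simp only [add_zero, mul_zero] at h0
  grind

/-- The normalised intertwining operator on smooth vectors. -/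
def kmapLin (ε : ℤˣ) (μ μ' ν c : ℂ) : SmoothVec ε μ →ₗ[ℂ] SmoothVec ε μ' where
  toFun f := ofRestr μ' (((isQP_restr f).kop (norm_chi ε) ν).const_mul c)
  map_add' f f' := SmoothVec.ext_restr fun θ => by
    have h := kop_add_smul (norm_chi ε) ν (isQP_restr f) (isQP_restr f') 1
    simp only [one_mul] at h
    refine (congrFun (restr_ofRestr _) θ).trans (Eq.trans ?_ (congrArg₂ (· + ·)
      (congrFun (restr_ofRestr _) θ) (congrFun (restr_ofRestr _) θ)).symm)
    exact (congrArg (c * ·) (congrFun h θ)).trans (mul_add _ _ _)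
  map_smul' a f := SmoothVec.ext_restr fun θ => by
    have h := kop_const_mul (norm_chi ε) ν (isQP_restr f) a
    refine (congrFun (restr_ofRestr _) θ).trans (Eq.trans ?_ (congrArg (a * ·)
      (congrFun (restr_ofRestr _) θ)).symm)
    exact (congrArg (c * ·) (congrFun h θ)).trans (mul_left_comm _ _ _)

lemma restr_kmapLin (μ μ' ν c : ℂ) (f : SmoothVec ε μ) :
    restr (kmapLin ε μ μ' ν c f) = fun θ => c * kop ν (restr f) θ :=
  restr_ofRestr (((isQP_restr f).kop (norm_chi ε) ν).const_mul c)

/-- The operator `c Γ(ν)⁻¹ J_ν`, for all `ν`, in terms of restrictions to `K̃`. It intertwines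
for `μ = -ν` and `μ' = ν`. -/
def kmap (ε : ℤˣ) (μ μ' ν c : ℂ) : SmoothVec ε μ →L[ℂ] SmoothVec ε μ' :=
  mkMap (kmapLin ε μ μ' ν c) fun k => by
    obtain ⟨l, C, hC, H⟩ := exists_bd_kop ν
    refine ⟨k + l, (k + 1) * (‖c‖ * C), fun f => ?_⟩
    rw [mul_assoc, mul_assoc]
    refine supNorm_le ?_
    rw [restr_kmapLin]
    exact (H _ (contDiff_restr f) k _ (bd_restr (k + l) f)).const_mul c

lemma restr_kmap (μ μ' ν c : ℂ) (f : SmoothVec ε μ) :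
    restr (kmap ε μ μ' ν c f) = fun θ => c * kop ν (restr f) θ :=
  restr_kmapLin μ μ' ν c f

/-! ### Regularised Fourier integrals -/

lemma norm_expTwoPi (x : ℝ) : ‖expTwoPi x‖ = 1 := by
  rw [expTwoPi, show (2 * π * I * x : ℂ) = ((2 * π * x : ℝ) : ℂ) * I by
    push_cast; ring, norm_exp_ofReal_mul_I]

lemma continuous_expTwoPi : Continuous expTwoPi := by unfold expTwoPi; fun_prop

lemma expTwoPi_add (x y : ℝ) : expTwoPi (x + y) = expTwoPi x * expTwoPi y := by
  simp only [expTwoPi]; rw [← exp_add]; push_cast; ring_nf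

lemma hasDerivAt_expTwoPi_mul (ξ x : ℝ) : HasDerivAt (fun x : ℝ => expTwoPi (ξ * x))
    (2 * π * I * ξ * expTwoPi (ξ * x)) x := by
  have h1 : HasDerivAt (fun z : ℂ => exp (2 * π * I * ξ * z))
      (exp (2 * π * I * ξ * x) * (2 * π * I * ξ)) x := by
    simpa using ((hasDerivAt_id (x : ℂ)).const_mul (2 * π * I * ξ)).cexp
  have h2 := h1.comp_ofReal
  simp only [expTwoPi, ofReal_mul, ← mul_assoc]
  rwa [mul_comm (exp _)] at h2

/-- The Fourier integral of the chart of `h`, regularised by `k`-fold integration by parts. -/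
def wv (k : ℕ) (μ : ℂ) (ξ : ℝ) (h : ℝ → ℂ) : ℂ := (-1 / (2 * π * I * ξ)) ^ k *
    ∫ x, chart (μ + 1 + k) (aopIter (μ + 1) k h) x * expTwoPi (ξ * x)

def wav (μ : ℂ) : ℝ → (ℝ → ℂ) → ℂ := wv (order μ) μ

lemma integral_chart_mul_exp {b : ℂ} (hb : 1 < b.re) {h : ℝ → ℂ} (hh : ContDiff ℝ ∞ h) {M : ℝ}
    (hM : Bd 1 M h) {ξ : ℝ} (hξ : ξ ≠ 0) : ∫ x, chart b h x * expTwoPi (ξ * x) =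
      -1 / (2 * π * I * ξ) * ∫ x, chart (b + 1) (aop b h) x * expTwoPi (ξ * x) := by
  have hg : Continuous fun x => expTwoPi (ξ * x) := continuous_expTwoPi.comp (by fun_prop)
  have h1 : Integrable (chart b h) := integrable_chart hh.continuous hM.norm_le hb
  have h2 : Integrable (chart (b + 1) (aop b h)) :=
    integrable_chart (contDiff_aop b hh).continuous (Bd.norm_le (k := 0) (hM.aop hh b)) (by simp; linarith)
  have hbd : ∀ᵐ x, ‖expTwoPi (ξ * x)‖ ≤ 1 := ae_of_all _ fun x => (norm_expTwoPi _).le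
  have hbd' : ∀ᵐ x : ℝ, ‖2 * π * I * ξ * expTwoPi (ξ * x)‖ ≤
      ‖(2 * π * I * ξ : ℂ)‖ := ae_of_all _ fun x => by
    rw [norm_mul, norm_expTwoPi, mul_one]
  have := integral_mul_deriv_eq_deriv_mul_of_integrable (fun x _ => hasDerivAt_chart b hh x)
    (fun x _ => hasDerivAt_expTwoPi_mul ξ x)
    (h1.mul_bdd (continuous_const.mul hg).aestronglyMeasurable hbd')
    (h2.mul_bdd hg.aestronglyMeasurable hbd) (h1.mul_bdd hg.aestronglyMeasurable hbd)
  have e : ∀ x : ℝ, chart b h x * (2 * π * I * ξ * expTwoPi (ξ * x)) =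
      2 * π * I * ξ * (chart b h x * expTwoPi (ξ * x)) := fun x => by ring
  simp only [e] at this
  rw [integral_const_mul] at this
  have h0 : (2 * π * I * ξ : ℂ) ≠ 0 := by simpa
  grind

lemma exists_bd_iter (b : ℂ) (k l : ℕ) {h : ℝ → ℂ} (hh : ContDiff ℝ ∞ h)
    (hb : ∀ k, ∃ M, Bd k M h) : ∃ M, Bd l M (aopIter b k h) := by
  obtain ⟨C, hC, H⟩ := exists_bd_aopIter b k l
  obtain ⟨M, hM⟩ := hb (k + l)
  grind

lemma wv_succ {k : ℕ} {μ : ℂ} (hk : 0 < μ.re + k) {ξ : ℝ} (hξ : ξ ≠ 0) {h : ℝ → ℂ}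
    (hh : ContDiff ℝ ∞ h) (hb : ∀ k, ∃ M, Bd k M h) : wv (k + 1) μ ξ h = wv k μ ξ h := by
  obtain ⟨M, hM⟩ := exists_bd_iter (μ + 1) k 1 hh hb
  rw [wv, wv, integral_chart_mul_exp (by simp; linarith) (contDiff_aopIter _ k hh) hM hξ, pow_succ,
    mul_assoc]
  simp only [aopIter, cast_succ, add_assoc]

lemma wv_eq_of_le {k m : ℕ} (hkm : k ≤ m) {μ : ℂ} (hk : 0 < μ.re + k) {ξ : ℝ} (hξ : ξ ≠ 0)
    {h : ℝ → ℂ} (hh : ContDiff ℝ ∞ h) (hb : ∀ k, ∃ M, Bd k M h) : wv m μ ξ h = wv k μ ξ h := by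
  induction m, hkm using Nat.le_induction with
  | base => rfl
  | succ m hm ih =>
    rw [wv_succ (hk.trans_le ?_) hξ hh hb, ih]
    simpa

lemma wav_eq_wv {k : ℕ} {μ : ℂ} (hk : 0 < μ.re + k) {ξ : ℝ} (hξ : ξ ≠ 0)
    {h : ℝ → ℂ} (hh : ContDiff ℝ ∞ h) (hb : ∀ k, ∃ M, Bd k M h) : wav μ ξ h = wv k μ ξ h := by
  rcases le_total k (order μ) with hl | hl
  · exact wv_eq_of_le hl hk hξ hh hb
  · exact (wv_eq_of_le hl (order_spec μ) hξ hh hb).symm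

lemma exists_norm_wv_le (k : ℕ) {μ : ℂ} (hk : 0 < μ.re + k) : ∃ C, 0 ≤ C ∧ ∀ (h : ℝ → ℂ) (M : ℝ),
    ContDiff ℝ ∞ h → Bd k M h → ∀ ξ : ℝ, ‖wv k μ ξ h‖ ≤ C * |ξ|⁻¹ ^ k * M := by
  obtain ⟨C, hC, H⟩ := exists_bd_aopIter (μ + 1) k 0
  refine ⟨C * bracketInt (μ + 1 + k).re, mul_nonneg hC (bracketInt_nonneg _), fun h M hh hM ξ => ?_⟩
  have h1 := norm_integral_chart_mul_le (b := μ + 1 + k) (s := (μ + 1 + k).re)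
    (g := fun x => expTwoPi (ξ * x)) (H h hh M hM).norm_le (by simp; linarith) le_rfl
    (fun x => (norm_expTwoPi _).le)
  have h2 : ‖(-1 / (2 * π * I * ξ) : ℂ)‖ ≤ |ξ|⁻¹ := by
    rw [norm_div, norm_neg, norm_one, norm_mul, norm_mul, norm_mul, norm_I, norm_real,
      norm_real, norm_of_nonneg pi_pos.le, norm_eq_abs, one_div, mul_one,
      Complex.norm_ofNat, mul_inv]
    refine mul_le_of_le_one_left (by positivity) (inv_le_one_of_one_le₀ ?_)
    nlinarith [Real.pi_gt_three]
  rw [wv, norm_mul, norm_pow]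
  calc _ ≤ |ξ|⁻¹ ^ k * (C * M * bracketInt (μ + 1 + k).re) :=
        mul_le_mul (pow_le_pow_left₀ (norm_nonneg _) h2 k) h1 (norm_nonneg _) (by positivity)
    _ = _ := by ring

lemma HolFam.differentiableOn_wav {U : Set ℂ} (hU : IsOpen U) {b : ℂ → ℂ} (hb : DifferentiableOn ℂ b U)
    {h : ℂ → ℝ → ℂ} (hh : HolFam U h) {ξ : ℝ} (hξ : ξ ≠ 0) :
    DifferentiableOn ℂ (fun ν => wav (b ν) ξ (h ν)) U := by
  intro ν₀ hν₀
  set k := order (b ν₀) with hk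
  have hV : IsOpen (U ∩ b ⁻¹' {z | 0 < z.re + k}) := hb.continuousOn.isOpen_inter_preimage hU
    (isOpen_lt continuous_const (continuous_re.add continuous_const))
  have hm : ν₀ ∈ U ∩ b ⁻¹' {z | 0 < z.re + k} := ⟨hν₀, order_spec _⟩
  have hb' := hb.mono (Set.inter_subset_left : U ∩ b ⁻¹' {z | 0 < z.re + k} ⊆ U)
  have h1 : DifferentiableOn ℂ (fun ν => wv k (b ν) ξ (h ν)) (U ∩ b ⁻¹' {z | 0 < z.re + k}) := by
    refine (differentiableOn_const _).mul ?_
    refine ((hh.mono Set.inter_subset_left).aopIter hV (hb'.add_const 1) k).differentiableOn_integral_chart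
      hV ((hb'.add_const 1).add_const _) (fun ν hν => ?_) (continuous_expTwoPi.comp (by fun_prop))
      fun x => (norm_expTwoPi _).le
    have : 0 < (b ν).re + k := hν.2
    simp; linarith
  have h2 : DifferentiableOn ℂ (fun ν => wav (b ν) ξ (h ν)) (U ∩ b ⁻¹' {z | 0 < z.re + k}) :=
    h1.congr fun ν hν => wav_eq_wv hν.2 hξ (hh.1 ν hν.1) (hh.exists_bd hν.1)
  exact (h2.differentiableAt (hV.mem_nhds hm)).differentiableWithinAt

lemma aopIter_add_smul (b : ℂ) {h h' : ℝ → ℂ} (hh : ContDiff ℝ ∞ h) (hh' : ContDiff ℝ ∞ h') (c : ℂ)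
    (k : ℕ) : aopIter b k (fun t => h t + c * h' t) = fun t => aopIter b k h t + c * aopIter b k h' t := by
  induction k with
  | zero => rfl
  | succ k ih =>
    rw [aopIter, ih]
    funext t
    have := ((contDiff_aopIter b k hh).differentiable (by simp) t).hasDerivAt.add
      (((contDiff_aopIter b k hh').differentiable (by simp) t).hasDerivAt.const_mul c)
    simp only [aop, aopIter]
    erw [this.deriv]
    ring

lemma wav_add_smul (μ : ℂ) (ξ : ℝ) {h h' : ℝ → ℂ} (hh : ContDiff ℝ ∞ h) (hh' : ContDiff ℝ ∞ h')
    (hb : ∀ k, ∃ M, Bd k M h) (hb' : ∀ k, ∃ M, Bd k M h') (c : ℂ) :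
    wav μ ξ (fun t => h t + c * h' t) = wav μ ξ h + c * wav μ ξ h' := by
  have hk := order_spec μ
  have h1 : 1 < (μ + 1 + order μ).re := by simp; linarith
  have hi : ∀ {h : ℝ → ℂ}, ContDiff ℝ ∞ h → (∀ k, ∃ M, Bd k M h) →
      Integrable fun x => chart (μ + 1 + order μ) (aopIter (μ + 1) (order μ) h) x * expTwoPi (ξ * x) := by
    intro h hh hb
    obtain ⟨M, hM⟩ := exists_bd_iter (μ + 1) (order μ) 0 hh hb
    exact (integrable_chart (contDiff_aopIter _ _ hh).continuous hM.norm_le h1).mul_bdd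
      (continuous_expTwoPi.comp (by fun_prop)).aestronglyMeasurable
      (ae_of_all _ fun x => (norm_expTwoPi _).le)
  rw [wav, wv, wv, wv, aopIter_add_smul _ hh hh', mul_left_comm c, ← mul_add]
  congr 1
  rw [← integral_const_mul, ← integral_add (hi hh hb) ((hi hh' hb').const_mul c)]
  congr 1; funext x; simp only [chart]; ring

lemma SmoothVec.nPlus_eq_chart {ν : ℂ} (f : SmoothVec ε ν) :
    (fun x => f (nPlus x)) = chart (1 - ν) (restr f) := by
  funext x
  have := f.kTilde_mul_nPlus 0 x
  rw [kTilde_zero, one_mul] at this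
  simpa

lemma waveFunctional_eq (μ : ℂ) (n : ℤ) (φ : SmoothVec (-ε) (-μ)) :
    waveFunctional ε μ n φ = wav μ n (restr φ) := by
  rw [waveFunctional, wav, wv, φ.nPlus_eq_chart, iteratedDeriv_chart _ (contDiff_restr φ)]
  push_cast; ring_nf

lemma exists_bd_restr {ν : ℂ} (f : SmoothVec ε ν) (k : ℕ) : ∃ M, Bd k M (restr f) :=
  ⟨_, bd_restr k f⟩

/-- The functional `wav μ ξ` on smooth vectors. -/
def wavDist (ε : ℤˣ) (μ : ℂ) (ξ : ℝ) : Dist ε μ := mkDist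
    { toFun := fun φ => wav μ ξ (restr φ)
      map_add' := fun f f' => by
        have := wav_add_smul μ ξ (contDiff_restr f) (contDiff_restr f') (exists_bd_restr f)
          (exists_bd_restr f') 1
        simp only [one_mul] at this
        exact this
      map_smul' := fun c f => by
        have h0 : ∀ k, ∃ M, Bd k M (fun _ : ℝ => (0 : ℂ)) := fun k =>
          (⟨contDiff_const, by simp⟩ : IsQP (chi ε) fun _ => 0).exists_bd (norm_chi ε) k
        have := wav_add_smul μ ξ contDiff_const (contDiff_restr f) h0 (exists_bd_restr f) c
        have h1 := wav_add_smul μ ξ contDiff_const contDiff_const h0 h0 1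
        simp only [zero_add, mul_zero, one_mul] at this h1
        rw [left_eq_add.1 h1, zero_add] at this
        exact this }
    (by
      obtain ⟨C, hC, H⟩ := exists_norm_wv_le (order μ) (order_spec μ)
      exact ⟨order μ, _, fun f => H _ _ (contDiff_restr f) (bd_restr _ f) ξ⟩)

lemma wavDist_apply (μ : ℂ) (ξ : ℝ) (φ : SmoothVec (-ε) (-μ)) :
    wavDist ε μ ξ φ = wav μ ξ (restr φ) := rfl

lemma distOf_eq {ν : ℂ} {Φ : SmoothVec (-ε) (-ν) → ℂ} {T : Dist ε ν} (h : ∀ φ, T φ = Φ φ) :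
    distOf Φ = T := by
  have hex : ∃ T : Dist ε ν, ∀ φ, T φ = Φ φ := ⟨T, h⟩
  rw [distOf, dif_pos hex]
  exact ContinuousLinearMap.ext fun φ => (hex.choose_spec φ).trans (h φ).symm

lemma wave_of_ne {μ : ℂ} {n : ℤ} (hn : n ≠ 0) : wave ε μ n = wavDist ε μ n := by
  rw [wave, if_neg hn]
  exact distOf_eq fun φ => (waveFunctional_eq μ n φ).symm

/-! ### The constant distribution -/

lemma norm_sub_taylor_le (k : ℕ) : ∀ {f : ℝ → ℂ}, ContDiff ℝ ∞ f → ∀ {C : ℝ},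
    (∀ x ∈ Icc (-1 : ℝ) 1, ‖iteratedDeriv k f x‖ ≤ C) → ∀ x ∈ Icc (-1 : ℝ) 1,
    ‖f x - ∑ j ∈ range k, iteratedDeriv j f 0 / (j.factorial : ℂ) * (x : ℂ) ^ j‖ ≤ C * |x| ^ k := by
  induction k with
  | zero => simp
  | succ k ih =>
    intro f hf C hC x hx
    have hC0 : 0 ≤ C := (norm_nonneg _).trans (hC x hx)
    have ih' := ih (contDiff_deriv hf) (C := C) (by simpa only [← iteratedDeriv_succ'] using hC)
    set g : ℝ → ℂ := fun x => f x -
      ∑ j ∈ range (k + 1), iteratedDeriv j f 0 / (j.factorial : ℂ) * (x : ℂ) ^ j with hg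
    have hd : ∀ y : ℝ, HasDerivAt g (deriv f y -
        ∑ j ∈ range k, iteratedDeriv j (deriv f) 0 / (j.factorial : ℂ) * (y : ℂ) ^ j) y := by
      intro y
      refine (hf.differentiable (by simp) y).hasDerivAt.sub ?_
      have h1 : HasDerivAt (fun x : ℝ => ∑ j ∈ range (k + 1),
          iteratedDeriv j f 0 / (j.factorial : ℂ) * (x : ℂ) ^ j)
          (∑ j ∈ range (k + 1), iteratedDeriv j f 0 / (j.factorial : ℂ) *
            ((j : ℂ) * (y : ℂ) ^ (j - 1))) y :=
        HasDerivAt.fun_sum fun j _ => ((hasDerivAt_pow j (y : ℂ)).comp_ofReal).const_mul _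
      refine h1.congr_deriv ?_
      rw [sum_range_succ']
      simp only [cast_zero, zero_mul, mul_zero, add_zero]
      refine sum_congr rfl fun j _ => ?_
      rw [iteratedDeriv_succ', Nat.factorial_succ]
      have : (j.factorial : ℂ) ≠ 0 := mod_cast j.factorial_ne_zero
      have : ((j + 1 : ℕ) : ℂ) ≠ 0 := mod_cast j.succ_ne_zero
      grind
    have hs : ∀ y ∈ Icc (-|x|) |x|, ‖deriv f y -
        ∑ j ∈ range k, iteratedDeriv j (deriv f) 0 / (j.factorial : ℂ) * (y : ℂ) ^ j‖ ≤
        C * |x| ^ k := fun y hy => by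
      have hx1 : |x| ≤ 1 := abs_le.2 hx
      refine (ih' y ⟨by grind, by grind⟩).trans ?_
      exact mul_le_mul_of_nonneg_left (pow_le_pow_left₀ (abs_nonneg y) (abs_le.2 hy) k) hC0
    have hmv := (convex_Icc (-|x|) |x|).norm_image_sub_le_of_norm_hasDerivWithin_le
      (fun y _ => (hd y).hasDerivWithinAt) hs (x := 0) (y := x) (by simp) ⟨neg_abs_le x, le_abs_self x⟩
    have g0 : g 0 = 0 := by simp [hg, sum_range_succ']
    rw [g0, sub_zero, sub_zero, norm_eq_abs] at hmv
    rw [pow_succ, ← mul_assoc]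
    exact hmv

/-- The kernel of the pairing near infinity. -/
def sgnPow (ε : ℤˣ) (ν : ℂ) (x : ℝ) : ℂ := sgnHalf ε (-x) * ((|x| : ℝ) : ℂ) ^ (ν - 1)

lemma norm_sgnPow (ε : ℤˣ) (ν : ℂ) {x : ℝ} (hx : x ≠ 0) : ‖sgnPow ε ν x‖ = |x| ^ (ν.re - 1) := by
  rw [sgnPow, norm_mul, norm_cpow_eq_rpow_re_of_pos (abs_pos.2 hx), sub_re, one_re]
  have : ‖sgnHalf ε (-x)‖ = 1 := by
    unfold sgnHalf; split_ifs
    · rw [norm_mul, norm_units, norm_I, one_mul]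
    · simp
  rw [this, one_mul]

lemma measurable_sgnPow (ε : ℤˣ) (ν : ℂ) : Measurable (sgnPow ε ν) := by
  unfold sgnPow sgnHalf
  refine Measurable.mul (Measurable.ite ?_ measurable_const measurable_const) (by fun_prop)
  exact (measurableSet_lt measurable_id measurable_const).preimage measurable_neg

lemma integrableOn_abs_rpow {s : ℝ} (hs : 0 < s) :
    IntegrableOn (fun x : ℝ => |x| ^ (s - 1)) (Ioc (-1) 1) := by
  have h1 : IntervalIntegrable (fun x : ℝ => |x| ^ (s - 1)) volume 0 1 := by
    refine (intervalIntegral.intervalIntegrable_rpow' (r := s - 1) (by linarith)).congr ?_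
    intro x hx
    grind
  have h2 : IntervalIntegrable (fun x : ℝ => |x| ^ (s - 1)) volume (-1) 0 := by
    have := (IntervalIntegrable.iff_comp_neg enorm_ne_top).1 h1
    simp only [abs_neg, neg_zero] at this
    gcongr
  exact (intervalIntegrable_iff_integrableOn_Ioc_of_le (by norm_num)).1 (h2.trans h1)

lemma integral_sgnPow_mul_pow (ε : ℤˣ) {ν : ℂ} (k : ℕ) (hk : 0 < ν.re + k) :
    ∫ x in (-1 : ℝ)..1, sgnPow ε ν x * (x : ℂ) ^ k = ((-1) ^ k + ((ε : ℤ) : ℂ) * I) / (ν + k) := by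
  have hk0 : ν + k ≠ 0 := fun h => by
    have := congrArg re h
    simp at this; linarith
  have hre : -1 < (ν - 1 + k).re := by simp; linarith
  have e0 : ∀ x : ℝ, 0 < x → (x : ℂ) ^ (ν - 1) * (x : ℂ) ^ k = (x : ℂ) ^ (ν - 1 + k) := fun x hx => by
    rw [cpow_add _ _ (mod_cast hx.ne'), Complex.cpow_natCast]
  have i0 := intervalIntegral.intervalIntegrable_cpow' hre (a := 0) (b := 1)
  have v0 : ∫ x in (0 : ℝ)..1, (x : ℂ) ^ (ν - 1 + k) = 1 / (ν + k) := by
    rw [integral_cpow (Or.inl hre)]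
    rw [show ν - 1 + k + 1 = ν + k by ring]
    simp_all
  have e1 : EqOn (fun x : ℝ => ((ε : ℤ) : ℂ) * I * (x : ℂ) ^ (ν - 1 + k))
      (fun x => sgnPow ε ν x * (x : ℂ) ^ k) (Set.uIoc 0 1) := by
    intro x hx
    rw [Set.uIoc_of_le zero_le_one] at hx
    simp only [sgnPow, sgnHalf, if_pos (neg_lt_zero.2 hx.1), abs_of_pos hx.1]
    grind
  have e2 : EqOn (fun x : ℝ => (-1) ^ k * (x : ℂ) ^ (ν - 1 + k))
      (fun x => sgnPow ε ν (-x) * ((-x : ℝ) : ℂ) ^ k) (Set.uIoc 0 1) := by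
    intro x hx
    rw [Set.uIoc_of_le zero_le_one] at hx
    simp only [sgnPow, sgnHalf, neg_neg, if_neg (not_lt.2 hx.1.le), abs_neg, abs_of_pos hx.1]
    rw [ofReal_neg, neg_pow, ← e0 x hx.1]; ring
  have i1 : IntervalIntegrable (fun x => sgnPow ε ν x * (x : ℂ) ^ k) volume 0 1 :=
    (i0.const_mul _).congr e1
  have i2 : IntervalIntegrable (fun x => sgnPow ε ν x * (x : ℂ) ^ k) volume (-1) 0 := by
    have := (IntervalIntegrable.iff_comp_neg enorm_ne_top).1 ((i0.const_mul _).congr e2)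
    simp only [neg_neg, neg_zero] at this
    gcongr
  have v1 : ∫ x in (0 : ℝ)..1, sgnPow ε ν x * (x : ℂ) ^ k = ((ε : ℤ) : ℂ) * I / (ν + k) := by
    rw [← intervalIntegral.integral_congr_ae (ae_of_all _ fun x hx => e1 hx), intervalIntegral.integral_const_mul, v0, mul_one_div]
  have v2 : ∫ x in (-1 : ℝ)..0, sgnPow ε ν x * (x : ℂ) ^ k = (-1) ^ k / (ν + k) := by
    have := intervalIntegral.integral_comp_neg (a := 0) (b := 1) fun x => sgnPow ε ν x * (x : ℂ) ^ k
    rw [neg_zero] at this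
    rw [← this, ← intervalIntegral.integral_congr_ae (ae_of_all _ fun x hx => e2 hx), intervalIntegral.integral_const_mul, v0,
      mul_one_div]
  rw [← intervalIntegral.integral_add_adjacent_intervals i2 i1, v1, v2]
  ring

/-- The Taylor coefficients at infinity. -/
def taylorCoeff (ν : ℂ) (h : ℝ → ℂ) (j : ℕ) : ℂ :=
  iteratedDeriv j (chart (1 + ν) fun t => h (-(π / 2) + t)) 0 / (j.factorial : ℂ)

/-- The constant distribution, regularised by a Taylor polynomial of order `k`. -/
def oneReg (ε : ℤˣ) (k : ℕ) (ν : ℂ) (h : ℝ → ℂ) : ℂ := (∫ x in (-1 : ℝ)..1, chart (1 + ν) h x) +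
  (∫ x in (-1 : ℝ)..1, sgnPow ε ν x * (chart (1 + ν) (fun t => h (-(π / 2) + t)) x -
    ∑ j ∈ range k, taylorCoeff ν h j * (x : ℂ) ^ j)) +
  ∑ j ∈ range k, taylorCoeff ν h j * ((-1) ^ j + ((ε : ℤ) : ℂ) * I) / (ν + j)

lemma exists_norm_chart_sub_taylor_le {ν : ℂ} {k : ℕ} (hk : 0 < ν.re + k) {h : ℝ → ℂ}
    (hh : ContDiff ℝ ∞ h) {M : ℝ} (hM : Bd 0 M (aopIter (1 + ν) k fun t => h (-(π / 2) + t)))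
    {x : ℝ} (hx : x ∈ Icc (-1 : ℝ) 1) :
    ‖chart (1 + ν) (fun t => h (-(π / 2) + t)) x -
      ∑ j ∈ range k, taylorCoeff ν h j * (x : ℂ) ^ j‖ ≤ M * |x| ^ k := by
  have hs : ContDiff ℝ ∞ fun t => h (-(π / 2) + t) := hh.comp (contDiff_const.add contDiff_id)
  refine norm_sub_taylor_le k (contDiff_chart (1 + ν) hs) (fun x _ => ?_) x hx
  rw [iteratedDeriv_chart _ hs]
  refine (norm_chart_le (s := 0) hM.norm_le (by simp; linarith) x).trans ?_
  simp

lemma integrable_oneReg {ν : ℂ} {k : ℕ} (hk : 0 < ν.re + k) {h : ℝ → ℂ}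
    (hh : ContDiff ℝ ∞ h) (hb : ∀ k, ∃ M, Bd k M h) : IntervalIntegrable (fun x => sgnPow ε ν x *
      (chart (1 + ν) (fun t => h (-(π / 2) + t)) x -
    ∑ j ∈ range k, taylorCoeff ν h j * (x : ℂ) ^ j)) volume (-1) 1 := by
  have hs : ContDiff ℝ ∞ fun t => h (-(π / 2) + t) := hh.comp (contDiff_const.add contDiff_id)
  obtain ⟨M, hM⟩ := exists_bd_iter (1 + ν) k 0 hs fun k => (hb k).imp fun M hM => hM.comp_add _
  rw [intervalIntegrable_iff_integrableOn_Ioc_of_le (by norm_num)]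
  refine ((integrableOn_abs_rpow hk).const_mul M).mono' ?_ ?_
  · refine ((measurable_sgnPow ε ν).mul (Continuous.measurable ?_)).aestronglyMeasurable
    exact (continuous_chart _ hs.continuous).sub (by fun_prop)
  · refine (ae_restrict_iff' measurableSet_Ioc).2 ?_
    filter_upwards [Measure.ae_ne volume (0 : ℝ)] with x hx0 hx
    rw [norm_mul, norm_sgnPow ε ν hx0]
    calc _ ≤ |x| ^ (ν.re - 1) * (M * |x| ^ k) := mul_le_mul_of_nonneg_left
          (exists_norm_chart_sub_taylor_le hk hh hM ⟨hx.1.le, hx.2⟩) (rpow_nonneg (abs_nonneg x) _)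
      _ = _ := by
        rw [show ν.re + k - 1 = ν.re - 1 + k by ring, rpow_add (abs_pos.2 hx0), rpow_natCast]
        ring

lemma oneReg_succ {ν : ℂ} {k : ℕ} (hk : 0 < ν.re + k) {h : ℝ → ℂ}
    (hh : ContDiff ℝ ∞ h) (hb : ∀ k, ∃ M, Bd k M h) : oneReg ε (k + 1) ν h = oneReg ε k ν h := by
  have h1 := integrable_oneReg (ε := ε) hk hh hb
  have h2 := integrable_oneReg (ε := ε) (k := k + 1) (by push_cast; linarith) hh hb
  have h3 := intervalIntegral.integral_sub h1 h2
  have e : ∀ x : ℝ, sgnPow ε ν x * (chart (1 + ν) (fun t => h (-(π / 2) + t)) x -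
      ∑ j ∈ range k, taylorCoeff ν h j * (x : ℂ) ^ j) - sgnPow ε ν x *
      (chart (1 + ν) (fun t => h (-(π / 2) + t)) x -
      ∑ j ∈ range (k + 1), taylorCoeff ν h j * (x : ℂ) ^ j) =
      taylorCoeff ν h k * (sgnPow ε ν x * (x : ℂ) ^ k) := fun x => by
    rw [sum_range_succ]; ring
  simp only [e] at h3
  rw [intervalIntegral.integral_const_mul, integral_sgnPow_mul_pow ε k hk] at h3
  rw [oneReg, oneReg, sum_range_succ, mul_div_assoc, h3]
  ring

lemma oneReg_eq_of_le {k m : ℕ} (hkm : k ≤ m) {ν : ℂ} (hk : 0 < ν.re + k)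
    {h : ℝ → ℂ} (hh : ContDiff ℝ ∞ h) (hb : ∀ k, ∃ M, Bd k M h) : oneReg ε m ν h = oneReg ε k ν h := by
  induction m, hkm using Nat.le_induction with
  | base => rfl
  | succ m hm ih =>
    rw [oneReg_succ (hk.trans_le ?_) hh hb, ih]
    simpa

lemma oneReg_eq_order {k : ℕ} {ν : ℂ} (hk : 0 < ν.re + k)
    {h : ℝ → ℂ} (hh : ContDiff ℝ ∞ h) (hb : ∀ k, ∃ M, Bd k M h) :
    oneReg ε (order ν) ν h = oneReg ε k ν h := by
  rcases le_total k (order ν) with hl | hl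
  · exact oneReg_eq_of_le hl hk hh hb
  · exact (oneReg_eq_of_le hl (order_spec ν) hh hb).symm

lemma differentiableOn_oneReg (ε : ℤˣ) (k : ℕ) {U : Set ℂ} (hU : IsOpen U) (hk : ∀ ν ∈ U, 0 < ν.re + k)
    (hg : U ⊆ gammaDomain) {χ : ℂ} (hχ : ‖χ‖ = 1) {h : ℝ → ℂ} (hh : IsQP χ h) :
    DifferentiableOn ℂ (fun ν => oneReg ε k ν h) U := by
  have hid : DifferentiableOn ℂ (fun ν : ℂ => 1 + ν) U := differentiableOn_id.const_add 1
  have hf := HolFam.const hχ hh U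
  have hfs := hf.comp_add (-(π / 2))
  have hsm : ContDiff ℝ ∞ fun t => h (-(π / 2) + t) := (hh.comp_add _).contDiff
  have hone : ∀ x : ℝ, ((1 + x ^ 2 : ℝ) : ℂ) ≠ 0 := fun x => mod_cast (one_add_sq_pos x).ne'
  have hchart : ∀ {f : ℝ → ℂ} (x : ℝ), DifferentiableOn ℂ (fun ν => chart (1 + ν) f x) U := fun {f} x =>
    (differentiableOn_const _).mul ((hid.neg.div_const 2).const_cpow (Or.inl (hone x)))
  have ht : ∀ j, DifferentiableOn ℂ (fun ν => taylorCoeff ν h j) U := fun j => by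
    have := (hfs.aopIter hU hid j).differentiableOn 0
    refine (this.div_const (j.factorial : ℂ)).congr fun ν _ => ?_
    rw [taylorCoeff, iteratedDeriv_chart _ hsm, chart]
    simp
  refine (DifferentiableOn.add ?_ ?_).add (DifferentiableOn.fun_sum fun j _ => ?_)
  · simp only [integral_of_le (show (-1 : ℝ) ≤ 1 by norm_num)]
    obtain ⟨M, hM⟩ := hh.exists_bound hχ
    refine differentiableOn_integral (ae_of_all _ fun x => hchart x) (fun ν _ =>
      (continuous_chart _ hh.contDiff.continuous).aestronglyMeasurable) fun ν₀ hν₀ => ?_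
    obtain ⟨r, hr, hr'⟩ := Metric.isOpen_iff.1 hU ν₀ hν₀
    refine ⟨r, hr, hr', fun x => M * (1 + x ^ 2) ^ ((k : ℝ) / 2), ?_, ae_of_all _ fun x ν hν => ?_⟩
    · exact ((continuous_const.mul (Continuous.rpow_const (by fun_prop) fun x =>
        Or.inl (one_add_sq_pos x).ne')).integrableOn_Icc).mono_set Set.Ioc_subset_Icc_self
    · have := hk ν (hr' hν)
      have := norm_chart_le (b := 1 + ν) (s := -k) hM (by simp; linarith) x
      simpa
  · simp only [integral_of_le (show (-1 : ℝ) ≤ 1 by norm_num)]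
    refine differentiableOn_integral ?_ (fun ν _ => ?_) fun ν₀ hν₀ => ?_
    · refine ae_restrict_of_ae ?_
      filter_upwards [Measure.ae_ne volume (0 : ℝ)] with x hx0
      refine DifferentiableOn.mul ?_ ((hchart x).sub (DifferentiableOn.fun_sum fun j _ =>
        (ht j).mul (differentiableOn_const _)))
      refine (differentiableOn_const _).mul ((differentiableOn_id.sub_const 1).const_cpow (Or.inl ?_))
      simpa
    · refine ((measurable_sgnPow ε ν).mul (Continuous.measurable ?_)).aestronglyMeasurable
      exact (continuous_chart _ hsm.continuous).sub (by fun_prop)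
    · obtain ⟨M, hM⟩ := (hfs.aopIter hU hid k).bd ν₀ hν₀ 0
      have h1 := hk ν₀ hν₀
      have h2 : ∀ᶠ ν : ℂ in 𝓝 ν₀, (ν₀.re - k) / 2 < ν.re :=
        continuous_re.continuousAt.eventually (lt_mem_nhds (by linarith))
      obtain ⟨r, hr, H⟩ := Metric.eventually_nhds_iff_ball.1 ((hM.and h2).and (hU.mem_nhds hν₀))
      refine ⟨r, hr, fun ν hν => (H ν hν).2, fun x => M * |x| ^ ((ν₀.re + k) / 2 - 1),
        (integrableOn_abs_rpow (by linarith)).const_mul M, ?_⟩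
      refine (ae_restrict_iff' measurableSet_Ioc).2 ?_
      filter_upwards [Measure.ae_ne volume (0 : ℝ)] with x hx0 hx ν hν
      obtain ⟨⟨hMν, hre⟩, hνU⟩ := H ν hν
      have hx1 : |x| ≤ 1 := abs_le.2 ⟨hx.1.le, hx.2⟩
      rw [norm_mul, norm_sgnPow ε ν hx0]
      calc _ ≤ |x| ^ (ν.re - 1) * (M * |x| ^ k) := mul_le_mul_of_nonneg_left
            (exists_norm_chart_sub_taylor_le (hk ν hνU) hh.contDiff hMν ⟨hx.1.le, hx.2⟩)
            (rpow_nonneg (abs_nonneg x) _)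
        _ = M * |x| ^ (ν.re + k - 1) := by
          rw [show ν.re + k - 1 = ν.re - 1 + k by ring, rpow_add (abs_pos.2 hx0), rpow_natCast]
          ring
        _ ≤ _ := mul_le_mul_of_nonneg_left (Real.rpow_le_rpow_of_exponent_ge (abs_pos.2 hx0) hx1
          (by linarith)) hMν.nonneg
  · refine ((ht j).mul (differentiableOn_const _)).div (differentiableOn_id.add_const _) fun ν hν => ?_
    exact fun h0 => hg hν j (eq_neg_of_add_eq_zero_left h0)

lemma chi_neg (ε : ℤˣ) : chi (-ε) = ((ε : ℤ) : ℂ) * I := by rw [chi]; simp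

lemma chart_inversion (ν : ℂ) {h : ℝ → ℂ} (hh : IsQP (chi (-ε)) h) {x : ℝ} (hx : x ≠ 0) :
    |1 / x ^ 2| • chart (1 + ν) h (-1 / x) =
      sgnPow ε ν x * chart (1 + ν) (fun t => h (-(π / 2) + t)) x := by
  have hx2 : 0 < |x| := abs_pos.2 hx
  have hx2' : ((|x| : ℝ) : ℂ) ≠ 0 := mod_cast hx2.ne'
  have e1 : h (-arctan (-1 / x)) = sgnHalf ε (-x) * h (-(π / 2) + -arctan x) := by
    rw [neg_div, arctan_neg, neg_neg, one_div]
    rcases lt_or_gt_of_ne hx with h0 | h0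
    · rw [Real.arctan_inv_of_neg h0, sgnHalf, if_neg (by linarith), one_mul]; rfl
    · rw [Real.arctan_inv_of_pos h0, sgnHalf, if_pos (by linarith), ← chi_neg, ← hh.add_pi]
      ring_nf
  have e2 : ((1 + (-1 / x) ^ 2 : ℝ) : ℂ) = ((|x| ^ (-2 : ℝ) : ℝ) : ℂ) * ((1 + x ^ 2 : ℝ) : ℂ) := by
    rw [← ofReal_mul]
    congr 1
    rw [rpow_neg hx2.le, rpow_two, sq_abs]
    grind
  have e3 : ((|1 / x ^ 2| : ℝ) : ℂ) = ((|x| : ℝ) : ℂ) ^ (-2 : ℂ) := by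
    rw [abs_div, abs_one, abs_pow, cpow_neg, Complex.cpow_ofNat]
    push_cast; rw [one_div]
  rw [real_smul, chart, chart, e1, e2, mul_cpow_ofReal_nonneg (by positivity)
    (by positivity), ofReal_rpow_cpow hx2, e3, sgnPow, show ν - 1 = -2 + ((-2 : ℝ) : ℂ) * (-(1 + ν) / 2) by
    push_cast; ring, cpow_add _ _ hx2']
  ring

lemma hasDerivAt_neg_one_div {x : ℝ} (hx : x ≠ 0) : HasDerivAt (fun x : ℝ => -1 / x) (1 / x ^ 2) x := by
  have := (hasDerivAt_inv hx).neg
  refine (this.congr_of_eventuallyEq (Eventually.of_forall fun y => ?_)).congr_deriv ?_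
  · simp [neg_div]
  simp

lemma injOn_neg_one_div (s : Set ℝ) : Set.InjOn (fun x : ℝ => -1 / x) s := by
  intro x hx y hy h
  grind

lemma setIntegral_chart_inversion (ν : ℂ) {h : ℝ → ℂ} (hh : IsQP (chi (-ε)) h) {s : Set ℝ}
    (hs : MeasurableSet s) (hs0 : ∀ x ∈ s, x ≠ 0) : ∫ x in (fun x : ℝ => -1 / x) '' s, chart (1 + ν) h x =
      ∫ x in s, sgnPow ε ν x * chart (1 + ν) (fun t => h (-(π / 2) + t)) x := by
  rw [integral_image_eq_integral_abs_deriv_smul hs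
    (fun x hx => (hasDerivAt_neg_one_div (hs0 x hx)).hasDerivWithinAt) (injOn_neg_one_div s)]
  exact setIntegral_congr_fun hs fun x hx => chart_inversion ν hh (hs0 x hx)

lemma integral_chart_eq_oneReg {ν : ℂ} (hν : 0 < ν.re) {h : ℝ → ℂ} (hh : IsQP (chi (-ε)) h) :
    ∫ x, chart (1 + ν) h x = oneReg ε 0 ν h := by
  obtain ⟨M, hM⟩ := hh.exists_bound (norm_chi _)
  have hi : Integrable (chart (1 + ν) h) := integrable_chart hh.contDiff.continuous hM (by simpa)
  have i1 : (fun x : ℝ => -1 / x) '' Ioo 0 1 = Set.Iio (-1) := by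
    ext y
    simp only [Set.mem_image, Set.mem_Ioo, Set.mem_Iio]
    constructor
    · rintro ⟨x, ⟨h0, h1⟩, rfl⟩
      rw [div_lt_iff₀ h0]; linarith
    · intro hy
      refine ⟨-1 / y, ⟨div_pos_of_neg_of_neg (by norm_num) (by linarith), ?_⟩, ?_⟩
      · rw [div_lt_iff_of_neg (by linarith)]; linarith
      simp
  have i2 : (fun x : ℝ => -1 / x) '' Ioo (-1) 0 = Set.Ioi 1 := by
    ext y
    simp only [Set.mem_image, Set.mem_Ioo, Set.mem_Ioi]
    constructor
    · rintro ⟨x, ⟨h0, h1⟩, rfl⟩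
      rw [lt_div_iff_of_neg h1]; linarith
    · intro hy
      refine ⟨-1 / y, ⟨?_, div_neg_of_neg_of_pos (by norm_num) (by linarith)⟩, ?_⟩
      · rw [lt_div_iff₀ (by linarith)]; linarith
      simp
  have s1 := setIntegral_chart_inversion (ε := ε) ν hh (s := Ioo 0 1) measurableSet_Ioo
    fun x hx => hx.1.ne'
  have s2 := setIntegral_chart_inversion (ε := ε) ν hh (s := Ioo (-1) 0) measurableSet_Ioo
    fun x hx => hx.2.ne
  have h0 := integrable_oneReg (ε := ε) (k := 0) (ν := ν) (by simpa) hh.contDiff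
    (hh.exists_bd (norm_chi _))
  simp only [range_zero, sum_empty, sub_zero] at h0
  have t1 : IntervalIntegrable (fun x => sgnPow ε ν x *
      chart (1 + ν) (fun t => h (-(π / 2) + t)) x) volume (-1) 0 :=
    h0.mono_set (by rw [uIcc_of_le (by norm_num), uIcc_of_le (by norm_num)]; grind)
  have t2 : IntervalIntegrable (fun x => sgnPow ε ν x *
      chart (1 + ν) (fun t => h (-(π / 2) + t)) x) volume 0 1 :=
    h0.mono_set (by rw [uIcc_of_le (by norm_num), uIcc_of_le (by norm_num)]; grind)
  rw [oneReg]
  simp only [range_zero, sum_empty, sub_zero, add_zero]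
  rw [← intervalIntegral.integral_add_adjacent_intervals t1 t2,
    integral_of_le (show (-1 : ℝ) ≤ 0 by norm_num),
    integral_of_le (show (0 : ℝ) ≤ 1 by norm_num),
    integral_Ioc_eq_integral_Ioo, integral_Ioc_eq_integral_Ioo, ← s1, ← s2, i1, i2,
    ← intervalIntegral.integral_Iic_add_Ioi (b := 1) hi.integrableOn hi.integrableOn,
    ← intervalIntegral.integral_Iic_sub_Iic (a := -1) (b := 1) hi.integrableOn hi.integrableOn,
    integral_Iic_eq_integral_Iio (x := -1)]
  ring

lemma oneReg_eq_kop {ν : ℂ} (hν : ν ∈ gammaDomain) {h : ℝ → ℂ} (hh : IsQP (chi (-ε)) h) :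
    oneReg ε (order ν) ν h = chi ε * Gamma ν * kop ν h (π / 2) := by
  have hb := hh.exists_bd (norm_chi _)
  have d1 : DifferentiableOn ℂ (fun ν => oneReg ε (order ν) ν h) gammaDomain := by
    intro ν₀ hν₀
    have hV : IsOpen (gammaDomain ∩ {z | 0 < z.re + order ν₀}) := isOpen_gammaDomain.inter
      (isOpen_lt continuous_const (continuous_re.add continuous_const))
    have h1 := differentiableOn_oneReg ε (order ν₀) hV (fun ν hν => hν.2) Set.inter_subset_left
      (norm_chi _) hh
    have h2 : DifferentiableOn ℂ (fun ν => oneReg ε (order ν) ν h)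
        (gammaDomain ∩ {z | 0 < z.re + order ν₀}) :=
      h1.congr fun ν hν => oneReg_eq_order hν.2 hh.contDiff hb
    exact (h2.differentiableAt (hV.mem_nhds ⟨hν₀, order_spec ν₀⟩)).differentiableWithinAt
  have d2 : DifferentiableOn ℂ (fun ν => chi ε * Gamma ν * kop ν h (π / 2)) gammaDomain := by
    refine ((differentiableOn_const _).mul fun ν hν =>
      (differentiableAt_Gamma ν hν).differentiableWithinAt).mul ?_
    exact ((HolFam.const (norm_chi _) hh gammaDomain).kop isOpen_gammaDomain
      differentiableOn_id).differentiableOn _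
  refine eqOn_of_eqOn_open isOpen_gammaDomain isPreconnected_gammaDomain d1 d2
    (V := {z | 0 < z.re}) (isOpen_lt continuous_const continuous_re)
    ⟨1, by simp, mem_gammaDomain_of_re_pos (by simp)⟩ (fun z hz => ?_) hν
  have hz1 : 0 < z.re := hz.1
  rw [oneReg_eq_order (k := 0) (by simpa) hh.contDiff hb, ← integral_chart_eq_oneReg hz1 hh,
    kop_of_re_pos hz1 (norm_chi _) hh, jint]
  have e : (fun x => chart (1 + z) (fun t => h (π / 2 + π / 2 + t)) x) =
      fun x => chi (-ε) * chart (1 + z) h x := by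
    funext x
    simp only [chart]
    rw [show π / 2 + π / 2 + -arctan x = -arctan x + π by ring, hh.add_pi]
    ring
  have hg := Gamma_ne_zero_of_re_pos hz1
  rw [e, integral_const_mul]
  have := chi_mul_chi_neg ε
  grind

/-- The constant distribution in terms of the intertwining operator. -/
def oneDist (ε : ℤˣ) (ν : ℂ) (c : ℂ) : Dist ε ν where
  toFun φ := c * kmap (-ε) (-ν) ν ν 1 φ (kTilde (π / 2))
  map_add' φ φ' := by rw [map_add]; exact mul_add _ _ _
  map_smul' a φ := by rw [map_smul]; exact mul_left_comm _ _ _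
  cont := continuous_const.mul ((continuous_eval _).comp (kmap (-ε) (-ν) ν ν 1).cont)

lemma oneDist_apply (ν c : ℂ) (φ : SmoothVec (-ε) (-ν)) :
    oneDist ε ν c φ = c * kop ν (restr φ) (π / 2) := by
  show c * restr (kmap (-ε) (-ν) ν ν 1 φ) (π / 2) = _
  simp only [restr_kmap, one_mul]

lemma oneFunctional_eq (ν : ℂ) (φ : SmoothVec (-ε) (-ν)) :
    oneFunctional ε ν φ = oneReg ε (order ν) ν (restr φ) := by
  have e1 : ∀ x, φ (nPlus x) = chart (1 + ν) (restr φ) x := fun x => by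
    have := congrFun φ.nPlus_eq_chart x
    simpa
  have e2 : ∀ x, φ (sTilde⁻¹ * nPlus x) =
      chart (1 + ν) (fun t => restr φ (-(π / 2) + t)) x := fun x => by
    rw [sTilde_inv_eq, φ.kTilde_mul_nPlus, sub_neg_eq_add]
  rw [oneFunctional, oneReg]
  simp only [taylorInfty, e1, e2]
  rfl

lemma wave_zero {ν : ℂ} (hν : ν ∈ gammaDomain) : wave ε ν 0 = oneDist ε ν (chi ε * Gamma ν) := by
  rw [wave, if_pos rfl]
  refine distOf_eq fun φ => ?_
  rw [oneDist_apply, oneFunctional_eq, oneReg_eq_kop hν (isQP_restr φ)]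

/-! ### The intertwining operators -/

lemma borel_mul_sTilde_nPlus (u : ℝ) (hu : 0 < u) (y t : ℝ) :
    aTilde u hu * nMinus y * sTilde * nPlus t =
      sTilde * nPlus ((t - y) / u ^ 2) * (aTilde u⁻¹ (inv_pos.2 hu) * nMinus 0) := by
  obtain ⟨m1, m2, m3, m4⟩ := borel_entries u hu y
  have hs : ∀ t, (sTilde * nPlus t).mat.1 0 0 = 0 ∧ (sTilde * nPlus t).mat.1 0 1 = -1 ∧
      (sTilde * nPlus t).mat.1 1 0 = 1 ∧ (sTilde * nPlus t).mat.1 1 1 = t := fun t => by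
    rw [Mp.mul_mat]
    refine ⟨?_, ?_, ?_, ?_⟩ <;> rw [entry_mul] <;> simp [sTilde, nPlus]
  have hX : ∀ t, X (sTilde * nPlus t).mat = 1 := fun t => by rw [X_of_ne (by grind), (hs t).2.2.1]
  have hsg : ∀ t, (sTilde * nPlus t).sgn = 1 := fun t => by
    rw [Mp.mul_sgn, cocycle, ← Mp.mul_mat, hX]; simp [sTilde, nPlus, X, hilbert]
  have hm : ((aTilde u hu * nMinus y) * (sTilde * nPlus t)).mat =
      ((sTilde * nPlus ((t - y) / u ^ 2)) * aTilde u⁻¹ (inv_pos.2 hu)).mat := by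
    rw [Mp.mul_mat _ (sTilde * _), Mp.mul_mat _ (aTilde _ _)]
    obtain ⟨a1, a2, a3, a4⟩ := hs t
    obtain ⟨b1, b2, b3, b4⟩ := hs ((t - y) / u ^ 2)
    have hu' := inv_pos.2 hu
    have c1 : (aTilde u⁻¹ hu').mat.1 0 0 = u⁻¹ := by rfl
    have c2 : (aTilde u⁻¹ hu').mat.1 0 1 = 0 := by rfl
    have c3 : (aTilde u⁻¹ hu').mat.1 1 0 = 0 := by rfl
    have c4 : (aTilde u⁻¹ hu').mat.1 1 1 = u := by simp [aTilde]
    apply SL2_ext <;> rw [entry_mul, entry_mul] <;>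
      simp only [m1, m2, m3, m4, a1, a2, a3, a4, b1, b2, b3, b4, c1, c2, c3, c4] <;>
      field_simp <;> ring
  have hX2 : X ((aTilde u hu * nMinus y) * (sTilde * nPlus t)).mat = u⁻¹ := by
    have : ((aTilde u hu * nMinus y) * (sTilde * nPlus t)).mat.1 1 0 = u⁻¹ := by
      rw [Mp.mul_mat _ (sTilde * _), entry_mul, (hs t).1, (hs t).2.2.1, m3, m4]; simp
    rw [X_of_ne (by grind), this]
  rw [nMinus_zero, mul_one, mul_assoc (aTilde u hu * nMinus y)]
  refine Mp.ext hm ?_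
  have hu' := inv_pos.2 hu
  rw [Mp.mul_sgn _ (sTilde * _), Mp.mul_sgn _ (aTilde _ _), hsg, hsg, sgn_borel, cocycle, cocycle,
    ← Mp.mul_mat _ (sTilde * _), ← Mp.mul_mat _ (aTilde _ _), ← hm, hX2, hX, hX]
  simp [hilbert, not_lt.2 hu.le, show (aTilde u⁻¹ hu').sgn = 1 from rfl]

lemma SmoothVec.mul_sTilde_nPlus {ν : ℂ} (f : SmoothVec ε (-ν)) (θ u : ℝ) (hu : 0 < u) (y t : ℝ) :
    f (kTilde θ * (aTilde u hu * nMinus y) * sTilde * nPlus t) = ((u⁻¹ : ℝ) : ℂ) ^ (1 + ν) *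
      chart (1 + ν) (fun t => restr f (θ + π / 2 + t)) ((t - y) / u ^ 2) := by
  rw [mul_assoc (kTilde θ), mul_assoc (kTilde θ), borel_mul_sTilde_nPlus u hu, ← mul_assoc, f.map_borel,
    sub_neg_eq_add, ← mul_assoc, sTilde_eq, ← kTilde_add, f.kTilde_mul_nPlus, sub_neg_eq_add]

lemma isIntertwining_kmap : IsIntertwining ε fun ν => kmap ε (-ν) ν ν (Gamma ν) := by
  refine ⟨fun ν hν f g => ?_, fun F hF θ => ?_⟩
  · obtain ⟨θ, u, hu, y, rfl⟩ := exists_iwasawa g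
    simp only [f.mul_sTilde_nPlus]
    have hi : Integrable (chart (1 + ν) fun t => restr f (θ + π / 2 + t)) := by
      obtain ⟨M, hM⟩ := (isQP_restr f).exists_bound (norm_chi ε)
      exact integrable_chart ((contDiff_restr f).continuous.comp (by fun_prop)) (fun t => hM _)
        (by simpa)
    have hu2 : u ^ 2 ≠ 0 := by positivity
    refine ⟨((hi.comp_div hu2).comp_sub_right y).const_mul _, ?_⟩
    rw [integral_const_mul, integral_sub_right_eq_self (μ := volume)
      (fun t => chart (1 + ν) (fun t => restr f (θ + π / 2 + t)) (t / u ^ 2)) y,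
      Measure.integral_comp_div, SmoothVec.map_borel]
    have e : kmap ε (-ν) ν ν (Gamma ν) f (kTilde θ) = jint ν (restr f) θ := by
      show restr (kmap ε (-ν) ν ν (Gamma ν) f) θ = _
      simp only [restr_kmap, kop_of_re_pos hν (norm_chi ε) (isQP_restr f)]
      rw [mul_inv_cancel_left₀ (Gamma_ne_zero_of_re_pos hν)]
    have hu0 : (u : ℂ) ≠ 0 := mod_cast hu.ne'
    rw [e, jint, real_smul, ← mul_assoc, ofReal_inv, inv_cpow _ _ (by
      rw [Complex.arg_ofReal_of_nonneg hu.le]; exact pi_pos.ne), ← cpow_neg,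
      abs_of_pos (by positivity), ofReal_pow, ← Complex.cpow_ofNat, ← cpow_add _ _ hu0]
    ring_nf
  · have hq := isQP_restr (F 0)
    have h1 := ((HolFam.const (norm_chi ε) hq gammaDomain).kop isOpen_gammaDomain
      differentiableOn_id).differentiableOn θ
    have h2 : DifferentiableOn ℂ (fun ν => Gamma ν * kop ν (restr (F 0)) θ) gammaDomain :=
      DifferentiableOn.mul (fun ν hν => (differentiableAt_Gamma ν hν).differentiableWithinAt) h1
    refine h2.congr fun ν _ => ?_
    show restr (kmap ε (-ν) ν ν (Gamma ν) (F (-ν))) θ = _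
    simp only [restr_kmap]
    rw [show restr (F (-ν)) = restr (F 0) from funext fun t => hF _ _ t]

/-! ### The extension to distributions -/

lemma integral_mul_jint {ν : ℂ} (hν : 0 < ν.re) {f h : ℝ → ℂ} (hf : IsQP (chi ε) f)
    (hh : IsQP (chi (-ε)) h) : ∫ θ in (-(π / 2))..(π / 2), f θ * jint ν h θ =
      chi (-ε) * ∫ θ in (-(π / 2))..(π / 2), jint ν f θ * h θ := by
  have hp := pi_pos
  obtain ⟨Mf, hMf⟩ := hf.exists_bound (norm_chi _)
  obtain ⟨Mh, hMh⟩ := hh.exists_bound (norm_chi _)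
  have cf := hf.contDiff.continuous
  have ch := hh.contDiff.continuous
  have hν' : 1 < (1 + ν).re := by simpa
  set w : ℝ → ℂ := fun x => ((1 + x ^ 2 : ℝ) : ℂ) ^ (-(1 + ν) / 2) with hw
  have cw : Continuous w := by
    have := continuous_chart (1 + ν) (h := fun _ => 1) continuous_const
    convert this using 1; funext x; rw [chart, one_mul]
  have iw : Integrable w := by
    have := integrable_chart (b := 1 + ν) (h := fun _ => 1) (M := 1) continuous_const (by simp) hν'
    convert this using 1; funext x; rw [chart, one_mul]
  have swap : ∀ g : ℝ → ℝ → ℂ, Continuous (uncurry g) → (∃ M, ∀ θ x, ‖g θ x‖ ≤ M) →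
      ∫ θ in (-(π / 2))..(π / 2), ∫ x, g θ x * w x =
      ∫ x, (∫ θ in (-(π / 2))..(π / 2), g θ x) * w x := by
    rintro g hg ⟨M, hM⟩
    simp only [integral_of_le (show -(π / 2) ≤ π / 2 by linarith)]
    rw [integral_integral_swap]
    · simp only [integral_mul_const]
    · have h1 : Integrable (fun _ : ℝ => M) (volume.restrict (Ioc (-(π / 2)) (π / 2))) :=
        integrable_const M
      refine (h1.mul_prod iw.norm).mono' ?_ (ae_of_all _ fun z => ?_)
      · fun_prop
      · simp only [uncurry, norm_mul]
        exact mul_le_mul_of_nonneg_right (hM _ _) (norm_nonneg _)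
  have e1 : ∀ θ, f θ * jint ν h θ = ∫ x, f θ * h (θ + π / 2 + -arctan x) * w x := fun θ => by
    rw [jint, ← integral_const_mul]; simp only [chart, hw, mul_assoc]
  have e2 : ∀ θ, jint ν f θ * h θ = ∫ x, f (θ + π / 2 + -arctan x) * h θ * w x := fun θ => by
    rw [jint, ← integral_mul_const]; congr 1; funext x; simp only [chart, hw]; ring
  have cat := Real.continuous_arctan
  have bd : ∀ a b : ℝ, ‖f a * h b‖ ≤ Mf * Mh := fun a b => by
    rw [norm_mul]
    exact mul_le_mul (hMf a) (hMh b) (norm_nonneg _) ((norm_nonneg _).trans (hMf 0))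
  simp only [e1, e2]
  rw [swap (fun θ x => f θ * h (θ + π / 2 + -arctan x)) (by
    fun_prop) ⟨_, fun θ x => bd _ _⟩,
    swap (fun θ x => f (θ + π / 2 + -arctan x) * h θ) (by
    fun_prop) ⟨_, fun θ x => bd _ _⟩,
    ← integral_neg_eq_self (fun x => (∫ θ in (-(π / 2))..(π / 2),
      f (θ + π / 2 + -arctan x) * h θ) * w x), ← integral_const_mul]
  congr 1
  funext x
  have hc := chi_mul_chi_neg ε
  have per : Function.Periodic (fun θ => f (θ + π / 2 + arctan x) * h θ) π := fun θ => by
    beta_reduce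
    rw [show θ + π + π / 2 + arctan x = θ + π / 2 + arctan x + π by ring, hf.add_pi, hh.add_pi]
    grind
  have key : ∫ θ in (-(π / 2))..(π / 2), f θ * h (θ + π / 2 + -arctan x) =
      chi (-ε) * ∫ θ in (-(π / 2))..(π / 2), f (θ + π / 2 + arctan x) * h θ := by
    have h1 := intervalIntegral.integral_comp_add_right (a := -(π / 2)) (b := π / 2)
      (fun θ => f (θ + π / 2 + arctan x) * h θ) (π / 2 + -arctan x)
    have h2 := per.intervalIntegral_add_eq (-(π / 2) + (π / 2 + -arctan x)) (-(π / 2))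
    rw [show -(π / 2) + π = π / 2 by ring, show -(π / 2) + (π / 2 + -arctan x) + π =
        π / 2 + (π / 2 + -arctan x) by ring] at h2
    rw [← h2, ← h1, ← intervalIntegral.integral_const_mul]
    refine integral_congr fun θ _ => ?_
    rw [show θ + (π / 2 + -arctan x) + π / 2 + arctan x = θ + π by ring, hf.add_pi, add_assoc θ]
    grind
  simp only [arctan_neg, neg_neg]
  grind

lemma differentiable_integral_holFam {h : ℂ → ℝ → ℂ} (hh : HolFam univ h) {f : ℝ → ℂ}
    (hf : Continuous f) (a b : ℝ) (hab : a ≤ b) :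
    DifferentiableOn ℂ (fun ν => ∫ θ in a..b, f θ * h ν θ) univ := by
  simp only [integral_of_le hab]
  refine differentiableOn_integral (ae_of_all _ fun θ => (differentiableOn_const _).mul
    (hh.differentiableOn θ)) (fun ν hν => (hf.mul (hh.1 ν hν).continuous).aestronglyMeasurable)
    fun ν₀ hν₀ => ?_
  obtain ⟨M, hM⟩ := hh.3 ν₀ hν₀ 0
  obtain ⟨r, hr, H⟩ := Metric.eventually_nhds_iff_ball.1 hM
  refine ⟨r, hr, Set.subset_univ _, fun θ => ‖f θ‖ * M, ?_, ae_of_all _ fun θ ν hν => ?_⟩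
  · exact ((hf.norm.mul continuous_const).integrableOn_Icc).mono_set Set.Ioc_subset_Icc_self
  · rw [norm_mul]
    exact mul_le_mul_of_nonneg_left ((H ν hν).norm_le θ) (norm_nonneg _)

lemma integral_mul_kop (ν : ℂ) {f h : ℝ → ℂ} (hf : IsQP (chi ε) f)
    (hh : IsQP (chi (-ε)) h) : ∫ θ in (-(π / 2))..(π / 2), f θ * kop ν h θ =
      chi (-ε) * ∫ θ in (-(π / 2))..(π / 2), h θ * kop ν f θ := by
  have hp := pi_pos
  have d1 := differentiable_integral_holFam ((HolFam.const (norm_chi _) hh univ).kop isOpen_univ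
    differentiableOn_id) hf.contDiff.continuous (-(π / 2)) (π / 2) (by linarith)
  have d2 := differentiable_integral_holFam ((HolFam.const (norm_chi _) hf univ).kop isOpen_univ
    differentiableOn_id) hh.contDiff.continuous (-(π / 2)) (π / 2) (by linarith)
  refine eqOn_of_eqOn_open isOpen_univ isPreconnected_univ d1
    (DifferentiableOn.mul (differentiableOn_const (chi (-ε))) d2) (V := {z | 0 < z.re})
    (isOpen_lt continuous_const continuous_re)
    ⟨1, by simp, trivial⟩ (fun z hz => ?_) (mem_univ ν)
  have hz1 : 0 < z.re := hz.1
  have h1 := integral_mul_jint hz1 hf hh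
  simp only [id, Pi.mul_apply, kop_of_re_pos hz1 (norm_chi _) hh, kop_of_re_pos hz1 (norm_chi _) hf]
  have e : ∀ (p q : ℝ → ℂ), ∫ θ in (-(π / 2))..(π / 2), p θ * ((Gamma z)⁻¹ * q θ) =
      (Gamma z)⁻¹ * ∫ θ in (-(π / 2))..(π / 2), p θ * q θ := fun p q => by
    rw [← intervalIntegral.integral_const_mul]; grind
  rw [e, e, h1]
  grind

/-- The adjoint of the intertwining operator. -/
def intertwine (ε : ℤˣ) (ν : ℂ) : Dist ε (-ν) →L[ℂ] Dist ε ν :=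
  ContinuousLinearMap.precomp ℂ (kmap (-ε) (-ν) (-(-ν)) ν (chi ε * Gamma ν))

lemma intertwine_apply (ν : ℂ) (T : Dist ε (-ν)) (φ : SmoothVec (-ε) (-ν)) :
    intertwine ε ν T φ = T (kmap (-ε) (-ν) (-(-ν)) ν (chi ε * Gamma ν) φ) := rfl

lemma isExtension_intertwine :
    IsExtension ε (fun ν => kmap ε (-ν) ν ν (Gamma ν)) (intertwine ε) := by
  intro ν hν T f hT φ
  rw [intertwine_apply, hT]
  have h1 := integral_mul_kop ν (isQP_restr f) (isQP_restr φ)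
  have e1 : ∀ θ, f (kTilde θ) * kmap (-ε) (-ν) (-(-ν)) ν (chi ε * Gamma ν) φ (kTilde θ) =
      chi ε * Gamma ν * (restr f θ * kop ν (restr φ) θ) := fun θ => by
    have := congrFun (restr_kmap (-ν) (-(-ν)) ν (chi ε * Gamma ν) φ) θ
    rw [restr] at this
    rw [this, restr]; ring
  have e2 : ∀ θ, kmap ε (-ν) ν ν (Gamma ν) f (kTilde θ) * φ (kTilde θ) =
      Gamma ν * (restr φ θ * kop ν (restr f) θ) := fun θ => by
    have := congrFun (restr_kmap (-ν) ν ν (Gamma ν) f) θ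
    rw [restr] at this
    rw [this, restr]; ring
  simp only [e1, e2]
  rw [intervalIntegral.integral_const_mul, intervalIntegral.integral_const_mul, h1]
  linear_combination (Gamma ν * ∫ θ in (-(π / 2))..(π / 2),
    restr φ θ * kop ν (restr f) θ) * chi_mul_chi_neg ε

/-! ### Fourier transforms of differences of powers -/

/-- The function `y₊^{ν-1}`. -/
def posPow (ν : ℂ) (y : ℝ) : ℂ := if 0 < y then (y : ℂ) ^ (ν - 1) else 0

lemma measurable_posPow (ν : ℂ) : Measurable (posPow ν) :=
  Measurable.ite measurableSet_Ioi (by fun_prop) measurable_const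

lemma posPow_mul_eq (ν : ℂ) (g : ℝ → ℂ) : (fun y : ℝ => posPow ν y * g y) =
    (Set.Ioi (0 : ℝ)).indicator fun y => (y : ℂ) ^ (ν - 1) * g y := by
  funext y
  simp only [posPow, Set.indicator, Set.mem_Ioi]
  simp

lemma integrable_posPow_mul_exp {ν r : ℂ} (hν : 0 < ν.re) (hr : 0 < r.re) :
    Integrable fun y : ℝ => posPow ν y * exp (-(r * y)) := by
  rw [posPow_mul_eq, integrable_indicator_iff measurableSet_Ioi]
  have h := integrableOn_rpow_mul_exp_neg_mul_rpow (s := ν.re - 1) (p := 1) (b := r.re)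
    (by linarith) one_pos hr
  refine h.mono' (by fun_prop) ?_
  filter_upwards [ae_restrict_mem measurableSet_Ioi] with y hy
  rw [norm_mul, norm_cpow_eq_rpow_re_of_pos hy, norm_exp]
  simp

lemma integral_posPow_mul_exp {ν r : ℂ} (hν : 0 < ν.re) (hr : 0 < r.re) :
    ∫ y : ℝ, posPow ν y * exp (-(r * y)) = Gamma ν * (1 / r) ^ ν := by
  have hU : IsOpen {r : ℂ | 0 < r.re} := isOpen_lt continuous_const continuous_re
  have h1 : DifferentiableOn ℂ (fun r : ℂ => ∫ y : ℝ, posPow ν y * exp (-(r * y)))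
      {r : ℂ | 0 < r.re} := by
    refine differentiableOn_integral (ae_of_all _ fun y => by fun_prop)
      (fun r hr => (integrable_posPow_mul_exp hν hr).aestronglyMeasurable) fun r₀ hr₀ => ?_
    have hr₀' : 0 < r₀.re / 2 := by simpa
    have hball : ∀ r ∈ ball r₀ (r₀.re / 2), r₀.re / 2 < r.re := fun r hr => by
      rw [mem_ball_iff_norm] at hr
      have := (abs_re_le_norm (r - r₀)).trans_lt hr
      rw [sub_re] at this
      grind
    refine ⟨_, hr₀', fun r hr => hr₀'.trans (hball r hr), _,
      (integrable_posPow_mul_exp (r := (r₀.re / 2 : ℝ)) hν (by omega)).norm,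
      ae_of_all _ fun y r hr => ?_⟩
    rw [norm_mul, norm_mul, norm_exp, norm_exp]
    by_cases hy : 0 < y
    · refine mul_le_mul_of_nonneg_left (exp_le_exp.2 ?_) (norm_nonneg _)
      simp only [neg_re, Complex.re_mul_ofReal, ofReal_re, neg_le_neg_iff]
      exact mul_le_mul_of_nonneg_right (hball r hr).le hy.le
    · simp [posPow, hy]
  have h2 : DifferentiableOn ℂ (fun r : ℂ => Gamma ν * (1 / r) ^ ν) {r : ℂ | 0 < r.re} := by
    have : ∀ r : ℂ, 0 < r.re → r ≠ 0 := fun r hr h => by simp [h] at hr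
    refine (differentiableOn_const _).mul (DifferentiableOn.cpow ?_ (differentiableOn_const _) ?_)
    · exact (differentiableOn_const _).div differentiableOn_id this
    · intro r hr
      left
      simp_all
  have hc : IsPreconnected {r : ℂ | 0 < r.re} := (convex_halfSpace_re_gt 0).isPreconnected
  refine (h1.analyticOnNhd hU).eqOn_of_preconnected_of_frequently_eq (h2.analyticOnNhd hU) hc
    (z₀ := 1) (by simp) ?_ hr
  let u : ℕ → ℂ := fun n => 1 + 1 / ((n : ℂ) + 1)
  have hu : Tendsto u atTop (𝓝 1) := by
    simpa [u] using (tendsto_one_div_add_atTop_nhds_zero_nat (𝕜 := ℂ)).const_add 1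
  have hu1 : ∀ n, u n ∈ ({1}ᶜ : Set ℂ) := fun n => by
    have : (n : ℂ) + 1 ≠ 0 := mod_cast succ_ne_zero n
    grind
  refine (tendsto_nhdsWithin_iff.2 ⟨hu, Eventually.of_forall hu1⟩).frequently
    (Frequently.of_forall fun n => ?_)
  have e : u n = ((1 + 1 / ((n : ℝ) + 1) : ℝ) : ℂ) := by simp [u]
  rw [e, posPow_mul_eq, integral_indicator measurableSet_Ioi,
    Complex.integral_cpow_mul_exp_neg_mul_Ioi hν (by positivity), mul_comm]

/-- The difference `y₊^{ν-1} - (y-a)₊^{ν-1}`. -/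
def powDiff (ν : ℂ) (a y : ℝ) : ℂ := posPow ν y - posPow ν (y - a)

lemma powDiff_neg (ν : ℂ) (a y : ℝ) : powDiff ν (-a) y = -powDiff ν a (y + a) := by simp [powDiff]

lemma measurable_powDiff (ν : ℂ) (a : ℝ) : Measurable (powDiff ν a) :=
  (measurable_posPow ν).sub ((measurable_posPow ν).comp (measurable_id.sub_const a))

lemma integrable_powDiff_mul_exp {ν r : ℂ} (hν : 0 < ν.re) (hr : 0 < r.re) (a : ℝ) :
    Integrable (fun y : ℝ => powDiff ν a y * exp (-(r * y))) ∧
    ∫ y : ℝ, powDiff ν a y * exp (-(r * y)) = (1 - exp (-(r * a))) * (Gamma ν * (1 / r) ^ ν) := by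
  have h0 := integrable_posPow_mul_exp hν hr
  have h1 := (h0.comp_sub_right a).mul_const (exp (-(r * a)))
  have e : ∀ y : ℝ, powDiff ν a y * exp (-(r * y)) = posPow ν y * exp (-(r * y)) -
      posPow ν (y - a) * exp (-(r * ((y - a : ℝ) : ℂ))) * exp (-(r * a)) := fun y => by
    rw [mul_assoc _ (exp _), ← exp_add, powDiff, sub_mul]
    push_cast; ring_nf
  simp only [e]
  refine ⟨h0.sub h1, ?_⟩
  rw [integral_sub h0 h1, integral_mul_const,
    integral_sub_right_eq_self (fun y : ℝ => posPow ν y * exp (-(r * y))),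
    integral_posPow_mul_exp hν hr]
  ring

lemma integrable_powDiff {ν : ℂ} (hν : 0 < ν.re) (hν1 : ν.re < 1) (a : ℝ) :
    Integrable (powDiff ν a) := by
  have key : ∀ a : ℝ, 0 ≤ a → Integrable (powDiff ν a) := by
    intro a ha
    rw [← integrableOn_univ, ← Set.Iic_union_Ioi (a := 2 * a + 1)]
    refine IntegrableOn.union ?_ ?_
    · have h := (integrable_powDiff_mul_exp hν (r := 1) (by simp) a).1.integrableOn (s := Set.Iic (2 * a + 1))
      have := h.mul_bdd (g := fun y : ℝ => exp y) (c := Real.exp (2 * a + 1)) (by fun_prop) (by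
        filter_upwards [ae_restrict_mem measurableSet_Iic] with y hy
        simpa)
      refine this.congr (ae_of_all _ fun y => ?_)
      simp only [mul_assoc, ← exp_add]
      simp
    · have h := ((integrableOn_Ioi_rpow_of_lt (a := ν.re - 2) (by linarith) (c := 2 * a + 1)
        (by linarith)).const_mul (‖ν - 1‖ * (1 / 2) ^ (ν.re - 2) * a))
      refine h.mono' (measurable_powDiff ν a).aestronglyMeasurable ?_
      filter_upwards [ae_restrict_mem measurableSet_Ioi] with y hy
      have hy : 2 * a + 1 < y := hy
      have hd : ∀ x ∈ Icc (y - a) y, HasDerivWithinAt (fun x : ℝ => (x : ℂ) ^ (ν - 1))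
          ((ν - 1) * (x : ℂ) ^ (ν - 1 - 1)) (Icc (y - a) y) x := fun x hx => by
        have hx0 : 0 < x := by grind
        have h1 := ((hasDerivAt_id (x : ℂ)).cpow_const (c := ν - 1) (Or.inl hx0)).comp_ofReal
        simpa using h1.hasDerivWithinAt
      have hb : ∀ x ∈ Icc (y - a) y, ‖(ν - 1) * (x : ℂ) ^ (ν - 1 - 1)‖ ≤
          ‖ν - 1‖ * ((1 / 2) ^ (ν.re - 2) * y ^ (ν.re - 2)) := fun x hx => by
        have hx0 : 0 < x := by grind
        rw [norm_mul, norm_cpow_eq_rpow_re_of_pos hx0, ← mul_rpow (by norm_num) (by linarith)]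
        have : (ν - 1 - 1).re = ν.re - 2 := by simp; ring
        rw [this]
        refine mul_le_mul_of_nonneg_left ?_ (norm_nonneg _)
        exact Real.rpow_le_rpow_of_nonpos (by linarith) (by grind) (by linarith)
      have := (convex_Icc (y - a) y).norm_image_sub_le_of_norm_hasDerivWithin_le hd hb
        (Set.left_mem_Icc.2 (by linarith)) (Set.right_mem_Icc.2 (by linarith))
      rw [powDiff, posPow, posPow, if_pos (by linarith), if_pos (by linarith)]
      refine this.trans (le_of_eq ?_)
      rw [sub_sub_cancel, norm_of_nonneg ha]; ring
  rcases le_total 0 a with ha | ha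
  · grind
  · have := ((key (-a) (by linarith)).comp_add_right (-a)).neg
    refine this.congr (ae_of_all _ fun y => ?_)
    have e := powDiff_neg ν (-a) y
    simp_all

lemma integral_powDiff {ν : ℂ} (hν : 0 < ν.re) (hν1 : ν.re < 1) (a : ℝ) {ξ : ℝ} (hξ : ξ ≠ 0) :
    ∫ y : ℝ, powDiff ν a y * expTwoPi (ξ * y) =
      (1 - expTwoPi (ξ * a)) * (Gamma ν * (1 / (-(2 * π * I * ξ))) ^ ν) := by
  set w : ℂ := -(2 * π * I * ξ) with hw
  have hwre : w.re = 0 := by simp [hw]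
  have hw0 : w ≠ 0 := by simp_all
  have hex : ∀ y : ℝ, expTwoPi (ξ * y) = exp (-(w * y)) := fun y => by
    rw [expTwoPi, hw]; push_cast; ring_nf
  let u : ℕ → ℝ := fun n => 1 / ((n : ℝ) + 1)
  have hu : Tendsto u atTop (𝓝 0) := tendsto_one_div_add_atTop_nhds_zero_nat
  have hu0 : ∀ n, 0 < u n := fun n => by positivity
  have hu1 : ∀ n, u n ≤ 1 := fun n => by rw [div_le_one (by positivity)]; simp
  have hr : Tendsto (fun n => w + u n) atTop (𝓝 w) := by
    simpa using ((continuous_ofReal.tendsto 0).comp hu).const_add w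
  have h1 : Tendsto (fun n => ∫ y : ℝ, powDiff ν a y * exp (-((w + u n) * y))) atTop
      (𝓝 (∫ y : ℝ, powDiff ν a y * exp (-(w * y)))) := by
    refine tendsto_integral_of_dominated_convergence (fun y => ‖powDiff ν a y‖ * Real.exp |a|)
      (fun n => ((measurable_powDiff ν a).mul (by fun_prop)).aestronglyMeasurable)
      ((integrable_powDiff hν hν1 a).norm.mul_const _) (fun n => ae_of_all _ fun y => ?_)
      (ae_of_all _ fun y => ?_)
    · rw [norm_mul]
      by_cases hy : y < -|a|
      · have : powDiff ν a y = 0 := by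
          have h1 := neg_abs_le a
          have h2 := abs_nonneg a
          rw [powDiff, posPow, posPow, if_neg (by linarith), if_neg (by linarith), sub_zero]
        simp [this]
      · refine mul_le_mul_of_nonneg_left ?_ (norm_nonneg _)
        rw [norm_exp]
        refine exp_le_exp.2 ?_
        have : (-((w + u n) * y)).re = -(u n * y) := by simp [hwre]
        rw [this]
        nlinarith [hu0 n, hu1 n, abs_nonneg a]
    · have : Continuous fun r : ℂ => powDiff ν a y * exp (-(r * y)) := by fun_prop
      exact (this.tendsto w).comp hr
  have h2 : Tendsto (fun n => (1 - exp (-((w + u n) * a))) * (Gamma ν * (1 / (w + u n)) ^ ν)) atTop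
      (𝓝 ((1 - exp (-(w * a))) * (Gamma ν * (1 / w) ^ ν))) := by
    have : ContinuousAt (fun r : ℂ => (1 - exp (-(r * a))) * (Gamma ν * (1 / r) ^ ν)) w := by
      refine ContinuousAt.mul (by fun_prop) (continuousAt_const.mul ?_)
      refine ContinuousAt.cpow (continuousAt_const.div continuousAt_id hw0) continuousAt_const ?_
      right
      simp_all
    exact this.tendsto.comp hr
  simp only [hex]
  refine tendsto_nhds_unique h1 (h2.congr fun n => ?_)
  exact ((integrable_powDiff_mul_exp hν (by simp_all) a).2).symm

/-! ### The intertwining operator as a convolution -/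

lemma ofReal_cpow_eq_exp {r : ℝ} (hr : 0 < r) (s : ℂ) : (r : ℂ) ^ s = exp ((log r : ℝ) * s) := by
  rw [cpow_def_of_ne_zero (mod_cast hr.ne'), ofReal_log hr.le]

lemma tan_arctan_sub_add (x w : ℝ) : tan (arctan w - arctan x + π / 2) = (1 + x * w) / (x - w) := by
  have h1 : sqrt (1 + x ^ 2) ≠ 0 := (sqrt_pos.2 (one_add_sq_pos x)).ne'
  have h2 : sqrt (1 + w ^ 2) ≠ 0 := (sqrt_pos.2 (one_add_sq_pos w)).ne'
  rw [Real.tan_eq_sin_div_cos, Real.sin_add_pi_div_two, Real.cos_add_pi_div_two, Real.cos_sub,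
    Real.sin_sub, Real.sin_arctan, cos_arctan, Real.sin_arctan, cos_arctan]
  grind

lemma arctan_of_lt {x w : ℝ} (h : w < x) :
    arctan ((1 + x * w) / (x - w)) = arctan w - arctan x + π / 2 := by
  refine Real.arctan_eq_of_tan_eq (tan_arctan_sub_add x w) ⟨?_, ?_⟩
  · linarith [Real.neg_pi_div_two_lt_arctan w, Real.arctan_lt_pi_div_two x]
  simpa

lemma arctan_of_gt {x w : ℝ} (h : x < w) :
    arctan ((1 + x * w) / (x - w)) = arctan w - arctan x - π / 2 := by
  refine Real.arctan_eq_of_tan_eq ?_ ⟨?_, ?_⟩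
  · rw [← tan_arctan_sub_add x w, ← Real.tan_periodic]
    ring_nf
  · simpa
  · linarith [Real.neg_pi_div_two_lt_arctan x, Real.arctan_lt_pi_div_two w]

/-- The convolution kernel of the intertwining operator. -/
def convKernel (ε : ℤˣ) (ν : ℂ) (y : ℝ) : ℂ := chi ε * posPow ν y + posPow ν (-y)

lemma convKernel_mul_chart (ν : ℂ) {h : ℝ → ℂ} (hh : IsQP (chi (-ε)) h) {x w : ℝ} (hw : w ≠ x) :
    chi ε * ((1 + x ^ 2 : ℝ) : ℂ) ^ (-(1 - ν) / 2) * (|(1 + x ^ 2) / (x - w) ^ 2| •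
      chart (1 + ν) (fun t => h (-arctan x + π / 2 + t)) ((1 + x * w) / (x - w))) =
    convKernel ε ν (x - w) * chart (1 + ν) h w := by
  have hxw : x - w ≠ 0 := sub_ne_zero.2 hw.symm
  have hx := one_add_sq_pos x
  have hw2 := one_add_sq_pos w
  have hd : 0 < |x - w| := abs_pos.2 hxw
  have e1 : 1 + ((1 + x * w) / (x - w)) ^ 2 = (1 + x ^ 2) * (1 + w ^ 2) / |x - w| ^ 2 := by grind
  have e2 : |(1 + x ^ 2) / (x - w) ^ 2| = Real.exp (log (1 + x ^ 2) - 2 * log |x - w|) := by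
    rw [abs_of_pos (by positivity), Real.exp_sub, Real.exp_log hx, mul_comm 2, Real.exp_mul,
      Real.exp_log hd, rpow_two, sq_abs]
  have e3 : log ((1 + x ^ 2) * (1 + w ^ 2) / |x - w| ^ 2) =
      log (1 + x ^ 2) + log (1 + w ^ 2) - 2 * log |x - w| := by
    rw [Real.log_div (by positivity) (by positivity), Real.log_mul hx.ne' hw2.ne', Real.log_pow]
    norm_num
  have e4 : convKernel ε ν (x - w) * h (-arctan w) = chi ε * (|x - w| : ℝ) ^ (ν - 1) *
      h (-arctan x + π / 2 + -arctan ((1 + x * w) / (x - w))) := by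
    rcases lt_or_gt_of_ne hw with hl | hl
    · rw [arctan_of_lt hl, convKernel, posPow, posPow, if_pos (by linarith), if_neg (by linarith),
        abs_of_pos (by linarith)]
      ring_nf
    · rw [arctan_of_gt hl, convKernel, posPow, posPow, if_neg (by linarith), if_pos (by linarith),
        abs_of_neg (by linarith), show -arctan x + π / 2 +
        -(arctan w - arctan x - π / 2) = -arctan w + π by ring, hh.add_pi]
      linear_combination (-(((-(x - w) : ℝ) : ℂ) ^ (ν - 1) * h (-arctan w))) * chi_mul_chi_neg ε
  rw [chart, chart, ← mul_assoc, e4, e1, e2, real_smul,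
    ofReal_cpow_eq_exp (by positivity : 0 < (1 + x ^ 2) * (1 + w ^ 2) / |x - w| ^ 2),
    ofReal_cpow_eq_exp hx, ofReal_cpow_eq_exp hw2, ofReal_cpow_eq_exp hd, e3]
  have e5 : exp ((log (1 + x ^ 2) : ℝ) * (-(1 - ν) / 2)) *
      (exp ((log (1 + x ^ 2) - 2 * log |x - w| : ℝ)) *
      exp ((log (1 + x ^ 2) + log (1 + w ^ 2) - 2 * log |x - w| : ℝ) *
        (-(1 + ν) / 2))) = exp ((log |x - w| : ℝ) * (ν - 1)) *
        exp ((log (1 + w ^ 2) : ℝ) * (-(1 + ν) / 2)) := by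
    rw [← exp_add, ← exp_add, ← exp_add]
    push_cast; ring_nf
  push_cast at e5 ⊢
  grind

lemma chart_jint {ν : ℂ} (hν : 0 < ν.re) {h : ℝ → ℂ} (hh : IsQP (chi (-ε)) h) (x : ℝ) :
    Integrable (fun y => convKernel ε ν y * chart (1 + ν) h (x - y)) ∧
    chart (1 - ν) (fun t => chi ε * jint ν h t) x =
      ∫ y, convKernel ε ν y * chart (1 + ν) h (x - y) := by
  obtain ⟨M, hM⟩ := hh.exists_bound (norm_chi _)
  set g := chart (1 + ν) (fun t => h (-arctan x + π / 2 + t)) with hg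
  set f : ℝ → ℝ := fun w => (1 + x * w) / (x - w) with hf
  have hgi : Integrable g := integrable_chart (hh.contDiff.continuous.comp (by fun_prop))
    (fun θ => hM _) (by simpa)
  have hfd : ∀ w ∈ ({x}ᶜ : Set ℝ), HasDerivWithinAt f ((1 + x ^ 2) / (x - w) ^ 2) {x}ᶜ w := by
    intro w hw
    have hxw : x - w ≠ 0 := sub_ne_zero.2 (Ne.symm hw)
    have := (((hasDerivAt_id w).const_mul x).const_add 1).div ((hasDerivAt_id w).const_sub x) hxw
    refine (this.congr_deriv ?_).hasDerivWithinAt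
    grind
  have hfi : Set.InjOn f {x}ᶜ := by
    intro w hw w' hw' e
    have h1 : x - w ≠ 0 := sub_ne_zero.2 (Ne.symm hw)
    have h2 : x - w' ≠ 0 := sub_ne_zero.2 (Ne.symm hw')
    simp only [hf] at e
    rw [div_eq_div_iff h1 h2] at e
    have : (1 + x ^ 2) * (w - w') = 0 := by grind
    have := (mul_eq_zero.1 this).resolve_left (one_add_sq_pos x).ne'
    linarith
  have him : f '' {x}ᶜ = {-x}ᶜ := by
    ext t
    constructor
    · rintro ⟨w, hw, rfl⟩ e
      have h1 : x - w ≠ 0 := sub_ne_zero.2 (Ne.symm hw)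
      simp only [hf, Set.mem_singleton_iff, div_eq_iff h1] at e
      have := one_add_sq_pos x
      linarith
    · intro ht
      have ht' : x + t ≠ 0 := fun e => ht (by grind)
      have hx := one_add_sq_pos x
      refine ⟨(x * t - 1) / (x + t), ?_, ?_⟩
      · grind
      grind
  have hae : ∀ z : ℝ, volume.restrict ({z}ᶜ : Set ℝ) = volume := fun z =>
    Measure.restrict_eq_self_of_ae_mem (compl_mem_ae_iff.2 (by simp))
  have hms : MeasurableSet ({x}ᶜ : Set ℝ) := (measurableSet_singleton x).compl
  have hI := integrableOn_image_iff_integrableOn_abs_deriv_smul hms hfd hfi g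
  have hE := integral_image_eq_integral_abs_deriv_smul hms hfd hfi g
  rw [him, hae, hae] at hE
  rw [him, IntegrableOn, IntegrableOn, hae, hae] at hI
  set A : ℂ := chi ε * ((1 + x ^ 2 : ℝ) : ℂ) ^ (-(1 - ν) / 2) with hA
  have hpt : (fun w => A * (|(1 + x ^ 2) / (x - w) ^ 2| • g (f w))) =ᵐ[volume]
      fun w => convKernel ε ν (x - w) * chart (1 + ν) h w := by
    have : ({x}ᶜ : Set ℝ) ∈ ae volume := compl_mem_ae_iff.2 (by simp)
    filter_upwards [this] with w hw using convKernel_mul_chart ν hh hw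
  have hInt := ((hI.1 hgi).const_mul A).congr hpt
  constructor
  · simpa using hInt.comp_sub_left x
  · rw [← integral_sub_left_eq_self _ volume x]
    simp only [sub_sub_cancel]
    rw [← integral_congr_ae hpt, integral_const_mul, ← hE, chart, jint, hA]
    ring

open FourierTransform in
lemma fourier_neg_eq (f : ℝ → ℂ) (ξ : ℝ) : 𝓕 f (-ξ) = ∫ x, f x * expTwoPi (ξ * x) := by
  rw [Real.fourier_real_eq_integral_exp_smul]
  refine integral_congr_ae (ae_of_all _ fun x => ?_)
  simp only [smul_eq_mul]
  rw [mul_comm, expTwoPi]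
  congr 2; push_cast; ring

lemma expTwoPi_zero : expTwoPi 0 = 1 := by simp [expTwoPi]

lemma integral_convKernel_sub {ν : ℂ} (hν : 0 < ν.re) (hν1 : ν.re < 1) (a : ℝ) {ξ : ℝ} (hξ : ξ ≠ 0) :
    Integrable (fun y => convKernel ε ν y - convKernel ε ν (y - a)) ∧
    ∫ y : ℝ, (convKernel ε ν y - convKernel ε ν (y - a)) * expTwoPi (ξ * y) =
      (1 - expTwoPi (ξ * a)) * Gamma ν * (chi ε * (1 / (-(2 * π * I * ξ))) ^ ν +
        (1 / (2 * π * I * ξ)) ^ ν) := by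
  have e : ∀ y, convKernel ε ν y - convKernel ε ν (y - a) =
      chi ε * powDiff ν a y + powDiff ν (-a) (-y) := fun y => by
    rw [convKernel, convKernel, powDiff, powDiff, show -(y - a) = -y - -a by ring]; ring
  simp only [e]
  have i1 := (integrable_powDiff hν hν1 a).const_mul (chi ε)
  have i2 : Integrable fun y => powDiff ν (-a) (-y) := (integrable_powDiff hν hν1 (-a)).comp_neg
  have hb : ∀ᵐ y : ℝ, ‖expTwoPi (ξ * y)‖ ≤ 1 := ae_of_all _ fun y => (norm_expTwoPi _).le
  have hg : Continuous fun x => expTwoPi (ξ * x) := continuous_expTwoPi.comp (by fun_prop)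
  refine ⟨i1.add i2, ?_⟩
  simp only [add_mul]
  rw [integral_add (i1.mul_bdd hg.aestronglyMeasurable hb) (i2.mul_bdd hg.aestronglyMeasurable hb)]
  have h1 : ∫ y, chi ε * powDiff ν a y * expTwoPi (ξ * y) =
      chi ε * ∫ y, powDiff ν a y * expTwoPi (ξ * y) := by
    rw [← integral_const_mul]; ring_nf
  have h2 : ∫ y, powDiff ν (-a) (-y) * expTwoPi (ξ * y) =
      ∫ y, powDiff ν (-a) y * expTwoPi (-ξ * y) := by
    rw [← integral_neg_eq_self]; simp
  rw [h1, h2, integral_powDiff hν hν1 a hξ, integral_powDiff hν hν1 (-a) (neg_ne_zero.2 hξ)]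
  push_cast; ring_nf

open FourierTransform in
lemma integral_chart_jint {ν : ℂ} (hν : 0 < ν.re) (hν1 : ν.re < 1) {h : ℝ → ℂ}
    (hh : IsQP (chi (-ε)) h) {ξ : ℝ} (hξ : ξ ≠ 0) :
    wv 1 (-ν) ξ (fun t => chi ε * jint ν h t) = Gamma ν * (chi ε * (1 / (-(2 * π * I * ξ))) ^ ν +
        (1 / (2 * π * I * ξ)) ^ ν) * wv 0 ν ξ h := by
  set h₁ : ℝ → ℂ := fun t => chi ε * jint ν h t with hh₁
  have hq : IsQP (chi (-ε)) h₁ := by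
    have hk := ((IsQP.kop (norm_chi (-ε)) ν hh).const_mul (Gamma ν)).const_mul (chi ε)
    have hG : Gamma ν ≠ 0 := Gamma_ne_zero_of_re_pos hν
    convert hk using 2 with t
    rw [kop_of_re_pos hν (norm_chi _) hh, mul_inv_cancel_left₀ hG]
  obtain ⟨M₁, hM₁⟩ := hq.exists_bd (norm_chi _) 1
  obtain ⟨M, hM⟩ := hh.exists_bound (norm_chi _)
  set a : ℝ := 1 / (2 * ξ) with ha
  have hea : expTwoPi (ξ * a) = -1 := by
    have : ξ * a = 1 / 2 := by rw [ha]; field_simp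
    rw [this, expTwoPi, ← exp_pi_mul_I]; congr 1; push_cast; ring
  set φ := chart (1 + ν) h with hφ
  set F := chart (1 - ν) h₁ with hF
  set F' := chart (1 - ν + 1) (aop (1 - ν) h₁) with hF'
  have hφi : Integrable φ := integrable_chart hh.contDiff.continuous hM (by simpa using hν)
  have hF'i : Integrable F' := integrable_chart (contDiff_aop _ hq.contDiff).continuous
    (Bd.norm_le (k := 0) (hM₁.aop hq.contDiff _)) (by simp; linarith)
  have hFd : ∀ x, HasDerivAt F (F' x) x := hasDerivAt_chart _ hq.contDiff
  obtain ⟨hki, hk⟩ := integral_convKernel_sub (ε := ε) hν hν1 a hξ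
  set k : ℝ → ℂ := fun y => convKernel ε ν y - convKernel ε ν (y - a) with hkdef
  have hD : (fun x => F x - F (x - a)) = convolution k φ (ContinuousLinearMap.mul ℂ ℂ) volume := by
    funext x
    obtain ⟨i1, e1⟩ := chart_jint hν hh x
    obtain ⟨i2, e2⟩ := chart_jint hν hh (x - a)
    have i3 := i2.comp_sub_right a
    rw [hF, hh₁, e1, e2, ← integral_sub_right_eq_self
      (fun y => convKernel ε ν y * chart (1 + ν) h (x - a - y)) a, ← integral_sub i1 i3, convolution]
    refine integral_congr_ae (ae_of_all _ fun y => ?_)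
    simp only [ContinuousLinearMap.mul_apply', hkdef, hφ, show x - a - (y - a) = x - y by ring]
    ring
  have hDi : Integrable fun x => F x - F (x - a) := by
    rw [hD]; exact Integrable.integrable_convolution _ hki hφi
  have hD'i : Integrable fun x => F' x - F' (x - a) := hF'i.sub (hF'i.comp_sub_right a)
  have hb : ∀ᵐ y : ℝ, ‖expTwoPi (ξ * y)‖ ≤ 1 := ae_of_all _ fun y => (norm_expTwoPi _).le
  have hg : Continuous fun x => expTwoPi (ξ * x) := continuous_expTwoPi.comp (by fun_prop)
  have hI : ∀ {f : ℝ → ℂ}, Integrable f → Integrable fun x => f x * expTwoPi (ξ * x) := fun hf =>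
    hf.mul_bdd hg.aestronglyMeasurable hb
  have hc : (2 * π * I * ξ : ℂ) ≠ 0 := by simp [hξ, pi_ne_zero]
  have hDF : ∫ x, (F x - F (x - a)) * expTwoPi (ξ * x) =
      (∫ y, k y * expTwoPi (ξ * y)) * ∫ x, φ x * expTwoPi (ξ * x) := by
    rw [← fourier_neg_eq, ← fourier_neg_eq, ← fourier_neg_eq, hD]
    exact Real.fourier_mul_convolution_eq hki hφi (-ξ)
  have hparts : (2 * π * I * ξ) * ∫ x, (F x - F (x - a)) * expTwoPi (ξ * x) =
      -∫ x, (F' x - F' (x - a)) * expTwoPi (ξ * x) := by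
    rw [← integral_mul_deriv_eq_deriv_mul_of_integrable (u := fun x => F x - F (x - a))
      (v := fun x => expTwoPi (ξ * x)) (v' := fun x => 2 * π * I * ξ * expTwoPi (ξ * x))
      (fun x _ => (hFd x).sub ((hFd (x - a)).comp_sub_const x a))
      (fun x _ => hasDerivAt_expTwoPi_mul ξ x) ?_ (hI hD'i) (hI hDi), ← integral_const_mul]
    · congr 1; funext x; ring
    · have := (hI hDi).const_mul (2 * π * I * ξ)
      refine this.congr (ae_of_all _ fun x => ?_)
      simp only [Pi.mul_apply]; ring
  have hshift : ∫ x, (F' x - F' (x - a)) * expTwoPi (ξ * x) = 2 * ∫ x, F' x * expTwoPi (ξ * x) := by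
    have i2 : Integrable fun x => F' (x - a) := hF'i.comp_sub_right a
    simp only [sub_mul]
    rw [integral_sub (hI hF'i) (hI i2), ← integral_add_right_eq_self (fun x => F' (x - a) * _) a]
    simp only [add_sub_cancel_right, mul_add, expTwoPi_add, hea]
    simp only [mul_neg, mul_one, integral_neg]
    ring
  rw [hDF, hk, hshift, hea] at hparts
  have e1 : wv 1 (-ν) ξ h₁ = -1 / (2 * π * I * ξ) * ∫ x, F' x * expTwoPi (ξ * x) := by
    rw [wv, hF', pow_one]
    simp only [aopIter, Nat.cast_one, cast_zero, add_zero]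
    rw [show -ν + 1 = 1 - ν by ring]
  have e0 : wv 0 ν ξ h = ∫ x, φ x * expTwoPi (ξ * x) := by
    rw [wv, hφ, pow_zero, one_mul]
    simp only [aopIter, cast_zero, add_zero]
    rw [add_comm ν 1]
  rw [e1, e0]
  generalize ∫ x, F' x * expTwoPi (ξ * x) = S at *
  generalize ∫ x, φ x * expTwoPi (ξ * x) = R at *
  rw [div_mul_eq_mul_div, div_eq_iff hc]
  linear_combination (-1 / 2 : ℂ) * hparts

/-! ### The functional equation of the regularised Fourier integrals -/

lemma wav_const_mul (μ : ℂ) (ξ : ℝ) {h : ℝ → ℂ} (hh : ContDiff ℝ ∞ h)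
    (hb : ∀ k, ∃ M, Bd k M h) (c : ℂ) : wav μ ξ (fun t => c * h t) = c * wav μ ξ h := by
  have hz : ∀ k, ∃ M, Bd k M fun _ => (0 : ℂ) := fun k => ⟨0, fun j _ t => by simp⟩
  have h0 := wav_add_smul μ ξ contDiff_const contDiff_const hz hz 1
  have h1 := wav_add_smul μ ξ contDiff_const hh hz hb c
  grind

/-- The sign of `ξ ≠ 0`. -/
def sg (ξ : ℝ) : ℤ := if 0 < ξ then 1 else -1

lemma one_div_mul_I_cpow {r : ℝ} (hr : 0 < r) (ν : ℂ) {s : ℝ} (hs : s = 1 ∨ s = -1) :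
    (1 / (r * (s * I))) ^ ν = (r : ℂ) ^ (-ν) * (Complex.cos (π * ν / 2) -
      s * I * Complex.sin (π * ν / 2)) := by
  have hr' : (r : ℂ) ≠ 0 := mod_cast hr.ne'
  have hp := pi_pos
  have h0 : exp ((s * (π / 2) : ℝ) * I) = s * I := by
    rcases hs with rfl | rfl
    · simp
    · rw [exp_mul_I, show ((-1 * (π / 2) : ℝ) : ℂ) = -(π / 2) by simp, cos_neg, sin_neg]
      simp
  have h1 : 1 / (r * (s * I)) = exp (-(log r : ℝ) - (s * (π / 2) : ℝ) * I) := by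
    rw [exp_sub, h0, Complex.exp_neg, ← Complex.ofReal_exp, Real.exp_log hr]
    ring
  have him : (-(log r : ℝ) - (s * (π / 2) : ℝ) * I : ℂ).im = -(s * (π / 2)) := by simp
  rw [h1, cpow_def_of_ne_zero (Complex.exp_ne_zero _), Complex.log_exp
    (by rw [him]; rcases hs with rfl | rfl <;> linarith)
    (by rw [him]; rcases hs with rfl | rfl <;> linarith), ofReal_cpow_eq_exp hr, sub_mul, sub_eq_add_neg,
    exp_add, show -((s * (π / 2) : ℝ) * I * ν) =
    (-(s * (π * ν / 2))) * I by push_cast; ring, exp_mul_I, cos_neg,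
    sin_neg]
  rcases hs with rfl | rfl
  · push_cast; ring_nf
  · simp only [ofReal_neg, ofReal_one, neg_mul, one_mul, cos_neg, sin_neg]; ring_nf

lemma sg_mul_abs (ξ : ℝ) : (sg ξ : ℝ) * |ξ| = ξ := by
  rw [sg]; split_ifs with h
  · rw [abs_of_pos h]; simp
  grind

lemma sg_eq (ξ : ℝ) : (sg ξ : ℝ) = 1 ∨ (sg ξ : ℝ) = -1 := by rw [sg]; split_ifs <;> simp

lemma gammaFactor_eq (ν : ℂ) {ξ : ℝ} (hξ : ξ ≠ 0) :
    Gamma ν * (chi ε * (1 / (-(2 * π * I * ξ))) ^ ν +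
      (1 / (2 * π * I * ξ)) ^ ν) = G ε (sg ξ) ν * (|ξ| : ℝ) ^ (-ν) := by
  have hp : 0 < 2 * π * |ξ| := by positivity
  have hx : (ξ : ℂ) = (sg ξ : ℝ) * (|ξ| : ℝ) := mod_cast (sg_mul_abs ξ).symm
  have e1 : (2 * π * I * ξ : ℂ) = (2 * π * |ξ| : ℝ) * ((sg ξ : ℝ) * I) := by
    rw [hx]; push_cast; ring
  have e2 : (-(2 * π * I * ξ) : ℂ) = (2 * π * |ξ| : ℝ) * ((-(sg ξ : ℝ) : ℝ) * I) := by simp_all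
  have e3 : ((2 * π * |ξ| : ℝ) : ℂ) ^ (-ν) = (2 * π : ℂ) ^ (-ν) * (|ξ| : ℝ) ^ (-ν) := by
    rw [ofReal_mul, mul_cpow_ofReal_nonneg (by positivity) (by positivity)]
    simp
  rw [e2, e1, one_div_mul_I_cpow hp ν (by
    rcases sg_eq ξ with h | h <;> rw [h] <;> simp), one_div_mul_I_cpow hp ν (sg_eq ξ), e3, G,
    cpow_neg (2 * π : ℂ), chi]
  push_cast
  linear_combination (Gamma ν * ((2 * π : ℂ) ^ ν)⁻¹ * (|ξ| : ℝ) ^ (-ν) * (sg ξ : ℂ) *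
    Complex.sin (π * ν / 2)) * (-((ε : ℤ) : ℂ) * I_sq + I * units_cast_sq ε)

lemma differentiableOn_G (e₁ e₂ : ℤ) : DifferentiableOn ℂ (G e₁ e₂) gammaDomain := by
  intro ν hν
  have h0 : (2 * π : ℂ) ≠ 0 := by simp
  have h1 : DifferentiableAt ℂ Gamma ν := differentiableAt_Gamma ν hν
  have h2 : DifferentiableAt ℂ (fun s : ℂ => (2 * π : ℂ) ^ s) ν :=
    differentiableAt_id.const_cpow (Or.inl h0)
  refine DifferentiableAt.differentiableWithinAt ?_
  refine DifferentiableAt.mul (DifferentiableAt.div (by fun_prop) h2 ?_) (by fun_prop)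
  simp

lemma wav_kop {ν : ℂ} (hν : ν ∈ gammaDomain) {h : ℝ → ℂ} (hh : IsQP (chi (-ε)) h) {ξ : ℝ}
    (hξ : ξ ≠ 0) : wav (-ν) ξ (fun t => chi ε * Gamma ν * kop ν h t) =
      G ε (sg ξ) ν * (|ξ| : ℝ) ^ (-ν) * wav ν ξ h := by
  have hΓ : DifferentiableOn ℂ Gamma gammaDomain := fun ν hν =>
    (differentiableAt_Gamma ν hν).differentiableWithinAt
  have hk := HolFam.kop isOpen_gammaDomain differentiableOn_id
    (HolFam.const (norm_chi (-ε)) hh gammaDomain)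
  have d1 := HolFam.differentiableOn_wav isOpen_gammaDomain (differentiableOn_neg _)
    (hk.smul isOpen_gammaDomain (hΓ.const_mul (chi ε))) hξ
  have d2 := HolFam.differentiableOn_wav isOpen_gammaDomain differentiableOn_id
    (HolFam.const (norm_chi (-ε)) hh gammaDomain) hξ
  have h0 : ((|ξ| : ℝ) : ℂ) ≠ 0 := by simpa
  have d3 : DifferentiableOn ℂ (fun ν => G ε (sg ξ) ν * (|ξ| : ℝ) ^ (-ν) * wav ν ξ h) gammaDomain :=
    ((differentiableOn_G _ _).mul ((differentiableOn_neg _).const_cpow (Or.inl h0))).mul d2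
  refine eqOn_of_eqOn_open isOpen_gammaDomain isPreconnected_gammaDomain d1 d3
    (V := {ν | 0 < ν.re ∧ ν.re < 1}) ?_ ⟨1 / 2, ?_, ?_⟩ ?_ hν
  · exact (isOpen_lt continuous_const continuous_re).inter
      (isOpen_lt continuous_re continuous_const)
  · norm_num
  · exact mem_gammaDomain_of_re_pos (by norm_num)
  · rintro ν ⟨⟨h1, h2⟩, hν⟩
    have e : (fun t => chi ε * Gamma ν * kop ν h t) = fun t => chi ε * jint ν h t := by
      funext t
      rw [kop_of_re_pos h1 (norm_chi _) hh, mul_assoc,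
        mul_inv_cancel_left₀ (Gamma_ne_zero_of_re_pos h1)]
    have hq := (IsQP.kop (norm_chi (-ε)) ν hh).const_mul (chi ε * Gamma ν)
    show wav (-ν) ξ (fun t => chi ε * Gamma ν * kop ν h t) = _
    rw [wav_eq_wv (k := 1) (by simpa) hξ hq.contDiff (hq.exists_bd (norm_chi _)),
      wav_eq_wv (k := 0) (by simpa) hξ hh.contDiff (hh.exists_bd (norm_chi _)), e,
      integral_chart_jint h1 h2 hh hξ, gammaFactor_eq ν hξ]

open FourierTransform in
lemma eq_zero_of_wav {ν : ℂ} (hν : 0 < ν.re) {χ : ℂ} (hχ : ‖χ‖ = 1) {h : ℝ → ℂ} (hh : IsQP χ h)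
    (hw : ∀ ξ : ℝ, ξ ≠ 0 → wav ν ξ h = 0) (θ : ℝ) : h θ = 0 := by
  obtain ⟨M, hM⟩ := hh.exists_bound hχ
  have hc := continuous_chart (ν + 1) hh.contDiff.continuous
  have hi : Integrable (chart (ν + 1) h) := integrable_chart hh.contDiff.continuous hM (by simpa using hν)
  have h0 : 𝓕 (chart (ν + 1) h) =ᵐ[volume] 0 := by
    have : ({0}ᶜ : Set ℝ) ∈ ae volume := compl_mem_ae_iff.2 (by simp)
    filter_upwards [this] with ξ hξ
    have h1 := hw (-ξ) (neg_ne_zero.2 hξ)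
    rw [wav_eq_wv (k := 0) (by simpa using hν) (neg_ne_zero.2 hξ) hh.contDiff (hh.exists_bd hχ), wv] at h1
    simp only [aopIter, cast_zero, add_zero, pow_zero, one_mul] at h1
    rw [← fourier_neg_eq, neg_neg] at h1
    exact h1
  have h2 : chart (ν + 1) h = 0 := by
    rw [← hc.fourierInv_fourier_eq hi ((integrable_zero ℝ ℂ volume).congr h0.symm)]
    funext x
    rw [Real.fourierInv_eq]
    refine integral_eq_zero_of_ae ?_
    filter_upwards [h0] with y hy
    rw [hy]; simp
  have h3 : ∀ x : ℝ, h (-arctan x) = 0 := fun x => by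
    have h4 := congrFun h2 x
    have h5 : ((1 + x ^ 2 : ℝ) : ℂ) ≠ 0 := mod_cast (one_add_sq_pos x).ne'
    rw [chart, Pi.zero_apply] at h4
    exact (mul_eq_zero.1 h4).resolve_right fun h => h5 ((cpow_eq_zero_iff _ _).1 h).1
  have h6 : EqOn h 0 (Icc (-(π / 2)) (π / 2)) := by
    rw [← closure_Ioo (by linarith [pi_pos])]
    refine EqOn.closure (fun t ht => ?_) hh.contDiff.continuous continuous_zero
    have := h3 (tan (-t))
    rwa [arctan_tan (by linarith [ht.2]) (by linarith [ht.1]), neg_neg] at this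
  obtain ⟨t, ht, e⟩ := hh.exists_mem_Icc hχ (-(π / 2)) θ
  rw [← norm_eq_zero, e, h6 ⟨ht.1, by linarith [ht.2]⟩, Pi.zero_apply, norm_zero]

lemma kop_neg_kop (ν : ℂ) {h : ℝ → ℂ} (hh : IsQP (chi (-ε)) h) (θ : ℝ) :
    kop (-ν) (kop ν h) θ = 2 * ((ε : ℤ) : ℂ) * I * Complex.cos (π * ν) * h θ := by
  have hc := HolFam.const (norm_chi (-ε)) hh univ
  have d1 := ((hc.kop isOpen_univ differentiableOn_id).kop isOpen_univ (differentiableOn_neg _)).differentiableOn θ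
  have d2 : DifferentiableOn ℂ (fun ν : ℂ => 2 * ((ε : ℤ) : ℂ) * I *
      Complex.cos (π * ν) * h θ) univ := by fun_prop
  refine eqOn_of_eqOn_open isOpen_univ isPreconnected_univ d1 d2
    (V := {ν | 0 < ν.re ∧ ν.re < 1}) ?_ ⟨1 / 2, by norm_num, trivial⟩ ?_ (mem_univ ν)
  · exact (isOpen_lt continuous_const continuous_re).inter
      (isOpen_lt continuous_re continuous_const)
  rintro ν ⟨⟨hν0, hν1⟩, -⟩
  set c : ℂ := 2 * ((ε : ℤ) : ℂ) * I * Complex.cos (π * ν) with hcdef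
  have q1 := IsQP.kop (norm_chi (-ε)) ν hh
  have q2 := IsQP.kop (norm_chi (-ε)) (-ν) q1
  have q3 := q2.add (hh.const_mul (-c))
  suffices H : kop (-ν) (kop ν h) θ + -c * h θ = 0 by grind
  refine eq_zero_of_wav hν0 (norm_chi (-ε)) q3 (fun ξ hξ => ?_) θ
  rw [wav_add_smul _ _ q2.contDiff hh.contDiff (q2.exists_bd (norm_chi _)) (hh.exists_bd (norm_chi _))]
  have g1 : ν ∈ gammaDomain := mem_gammaDomain_of_re_pos hν0
  have g2 : -ν ∈ gammaDomain := fun m hm => by simp_all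
  have w1 := wav_kop g1 hh hξ
  have w2 := wav_kop g2 q1 hξ
  rw [neg_neg, wav_const_mul _ _ q2.contDiff (q2.exists_bd (norm_chi _))] at w2
  rw [wav_const_mul _ _ q1.contDiff (q1.exists_bd (norm_chi _))] at w1
  have hΓ1 := Complex.Gamma_ne_zero g1
  have hΓ2 := Complex.Gamma_ne_zero g2
  have hG : G ε (sg ξ) ν * (|ξ| : ℝ) ^ (-ν) * (G ε (sg ξ) (-ν) * (|ξ| : ℝ) ^ ν) =
      -Gamma ν * Gamma (-ν) * c := by
    have e1 : ((|ξ| : ℝ) : ℂ) ^ (-ν) * (|ξ| : ℝ) ^ ν = 1 := by rw [← cpow_add _ _ (by simpa)]; simp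
    have e2 : ((2 * π : ℂ) ^ ν)⁻¹ * ((2 * π : ℂ) ^ (-ν))⁻¹ = 1 := by
      rw [← mul_inv, ← cpow_add _ _ (by simp)]; simp
    have e3 : Complex.cos (π * ν) = Complex.cos (π * ν / 2) ^ 2 - Complex.sin (π * ν / 2) ^ 2 := by
      rw [← Complex.cos_two_mul', mul_div_cancel₀]; simp
    have e4 : (sg ξ : ℂ) ^ 2 = 1 := by
      have : (sg ξ : ℝ) ^ 2 = 1 := by rcases sg_eq ξ with h | h <;> rw [h] <;> simp
      exact_mod_cast this
    have e5 := units_cast_sq ε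
    rw [G, G, mul_neg, neg_div, cos_neg, sin_neg, hcdef, e3]
    generalize Complex.cos (π * ν / 2) = C at *
    generalize Complex.sin (π * ν / 2) = S at *
    set A := ((2 * π : ℂ) ^ ν)⁻¹
    set B := ((2 * π : ℂ) ^ (-ν))⁻¹
    generalize ((ε : ℤ) : ℂ) = e at *
    generalize (sg ξ : ℂ) = s at *
    generalize ((|ξ| : ℝ) : ℂ) ^ (-ν) = X1 at *
    generalize ((|ξ| : ℝ) : ℂ) ^ ν = X2 at *
    rw [div_eq_mul_inv, div_eq_mul_inv]
    have e6 : (C + e * s * S) * (C + e * s * -S) = C ^ 2 - S ^ 2 := by grind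
    have e7 : (1 - e * I) ^ 2 = -2 * e * I := by linear_combination e ^ 2 * I_sq - e5
    grind
  have key : chi ε ^ 2 * Gamma ν * Gamma (-ν) * wav ν ξ (kop (-ν) (kop ν h)) =
      -Gamma ν * Gamma (-ν) * c * wav ν ξ h := by
    grind
  rw [chi_sq] at key
  grind

/-! ### Quadratic Gauss sums -/

/-- The Gauss sum `∑ e(b x² / q)`. -/
def gaussS (b : ℤ) (q : ℕ) [NeZero q] : ℂ := ∑ x : ZMod q, stdAddChar ((b : ZMod q) * x ^ 2)

lemma summable_theta {δ : ℂ} (hδ : 0 < δ.re) :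
    Summable fun n : ℤ => exp (-π * δ * (n : ℂ) ^ 2) := by
  have := (summable_jacobiTheta₂_term_iff 0 (I * δ)).2 (by simpa)
  refine this.congr fun n => ?_
  rw [jacobiTheta₂_term]
  congr 1
  linear_combination (π * (n : ℂ) ^ 2 * δ) * I_sq

lemma ofReal_mul_cpow {r : ℝ} (hr : 0 < r) {x : ℂ} (hx : x ≠ 0) (s : ℂ) :
    ((r : ℂ) * x) ^ s = (r : ℂ) ^ s * x ^ s := by
  have hr' : (r : ℂ) ≠ 0 := mod_cast hr.ne'
  rw [cpow_def_of_ne_zero (mul_ne_zero hr' hx), Complex.log_ofReal_mul hr hx, add_mul,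
    exp_add, cpow_def_of_ne_zero hr', cpow_def_of_ne_zero hx, ofReal_log hr.le]

lemma sum_fin_eq_sum_zmod {q : ℕ} [NeZero q] (f : ZMod q → ℂ) :
    ∑ r : Fin q, f ((r : ℕ) : ZMod q) = ∑ x, f x := by
  refine Fintype.sum_bijective (fun r : Fin q => ((r : ℕ) : ZMod q)) ?_ _ _ fun _ => rfl
  rw [Fintype.bijective_iff_surjective_and_card]
  exact ⟨fun x => ⟨⟨x.val, x.val_lt⟩, ZMod.natCast_zmod_val x⟩, by simp⟩

lemma tsum_residue {q : ℕ} [NeZero q] {δ : ℂ} (hδ : 0 < δ.re) (r : ℂ) :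
    δ ^ (1 / 2 : ℂ) * ∑' k : ℤ, exp (-π * δ * (k * q + r) ^ 2) = (q : ℂ)⁻¹ *
      ∑' n : ℤ, exp (-π / (δ * q ^ 2) * (n : ℂ) ^ 2 + 2 * π * I * n * (r / q)) := by
  have hq : (q : ℂ) ≠ 0 := mod_cast NeZero.ne q
  have hδ0 : δ ≠ 0 := fun h => by simp [h] at hδ
  have h1 := Complex.tsum_exp_neg_quadratic (a := δ * ((q : ℝ) ^ 2 : ℝ))
    (by rw [Complex.re_mul_ofReal]; have := NeZero.pos q; positivity) (-δ * q * r)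
  have e1 : ∀ k : ℤ, exp (-π * δ * (k * q + r) ^ 2) = exp (-π * δ * r ^ 2) *
      exp (-π * (δ * ((q : ℝ) ^ 2 : ℝ)) * (k : ℂ) ^ 2 + 2 * π * (-δ * q * r) * k) := by
    intro k; rw [← exp_add]; push_cast; ring_nf
  have e2 : ∀ n : ℤ, exp (-π / (δ * ((q : ℝ) ^ 2 : ℝ)) * (n + I * (-δ * q * r)) ^ 2) =
      exp (π * δ * r ^ 2) * exp (-π / (δ * q ^ 2) * (n : ℂ) ^ 2 + 2 * π * I * n * (r / q)) := by
    intro n; rw [← exp_add]; congr 1; push_cast; field_simp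
    linear_combination (-(δ ^ 2 * r ^ 2 * q ^ 2)) * I_sq
  have e3 : (δ * ((q : ℝ) ^ 2 : ℝ)) ^ (1 / 2 : ℂ) = q * δ ^ (1 / 2 : ℂ) := by
    have hq' : (0 : ℝ) < q := by have := NeZero.pos q; positivity
    rw [mul_comm, ofReal_mul_cpow (by positivity) hδ0, ← ofReal_ofNat, ← ofReal_one,
      ← ofReal_div, ← ofReal_cpow (by positivity), ← sqrt_eq_rpow,
      sqrt_sq hq'.le]
    simp
  simp only [e1, tsum_mul_left, h1, e2, e3]
  have h3 : δ ^ (1 / 2 : ℂ) ≠ 0 := by simpa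
  have h4 : exp (-π * δ * r ^ 2) * exp (π * δ * r ^ 2) = 1 := by rw [← exp_add]; simp
  grind

lemma tendsto_tsum_theta {α : Type*} {l : Filter α} {δ : α → ℂ}
    (hinv : Tendsto (fun a => (δ a)⁻¹.re) l atTop) {q : ℕ} [NeZero q] (x : ℝ) :
    Tendsto (fun a => ∑' n : ℤ, exp (-π / (δ a * q ^ 2) * (n : ℂ) ^ 2 +
      2 * π * I * n * x)) l (𝓝 1) := by
  have hq : (0 : ℝ) < (q : ℝ) ^ 2 := by have := NeZero.pos q; positivity
  have hn : ∀ (a : α) (n : ℤ), ‖exp (-π / (δ a * q ^ 2) * (n : ℂ) ^ 2 +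
      2 * π * I * n * x)‖ = Real.exp (-(π * (n : ℝ) ^ 2 / q ^ 2 * (δ a)⁻¹.re)) := by
    intro a n
    rw [norm_exp]
    congr 1
    have : -π / (δ a * q ^ 2) * (n : ℂ) ^ 2 + 2 * π * I * n * x =
        ((-(π * (n : ℝ) ^ 2 / q ^ 2) : ℝ) : ℂ) * (δ a)⁻¹ +
        ((2 * π * n * x : ℝ) : ℂ) * I := by
      push_cast; ring
    rw [this, add_re, re_ofReal_mul, re_ofReal_mul]
    simp
  have h0 : ∑' n : ℤ, (if n = 0 then (1 : ℂ) else 0) = 1 := tsum_ite_eq 0 _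
  rw [← h0]
  refine tendsto_tsum_of_dominated_convergence
    (bound := fun n : ℤ => ‖exp (-π * ((1 / q ^ 2 : ℝ) : ℂ) * (n : ℂ) ^ 2)‖)
    (summable_theta (by rw [ofReal_re]; positivity)).norm (fun n => ?_) ?_
  · split_ifs with hn0
    · simpa [hn0] using tendsto_const_nhds
    · rw [tendsto_zero_iff_norm_tendsto_zero]
      simp only [hn]
      refine Real.tendsto_exp_neg_atTop_nhds_zero.comp (Tendsto.const_mul_atTop ?_ hinv)
      positivity
  · filter_upwards [hinv.eventually_ge_atTop 1] with a ha n
    rw [hn, norm_exp]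
    refine exp_le_exp.2 ?_
    have : -π * ((1 / q ^ 2 : ℝ) : ℂ) * (n : ℂ) ^ 2 =
        ((-(π * (n : ℝ) ^ 2 / q ^ 2) : ℝ) : ℂ) := by push_cast; ring
    rw [this, ofReal_re, neg_le_neg_iff]
    exact le_mul_of_one_le_right (by positivity) ha

lemma tendsto_theta {α : Type*} {l : Filter α} {δ : α → ℂ} (hδ : ∀ a, 0 < (δ a).re)
    (hinv : Tendsto (fun a => (δ a)⁻¹.re) l atTop) {q : ℕ} [NeZero q] (f : ZMod q → ℂ) :
    Tendsto (fun a => δ a ^ (1 / 2 : ℂ) * ∑' n : ℤ, f n * exp (-π * δ a * (n : ℂ) ^ 2)) l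
      (𝓝 ((q : ℂ)⁻¹ * ∑ x, f x)) := by
  have hcast : ∀ (k : ℤ) (r : Fin q), ((k * q + (r : ℕ) : ℤ) : ZMod q) = ((r : ℕ) : ZMod q) := fun k r => by
    simp
  have key : ∀ a, δ a ^ (1 / 2 : ℂ) * ∑' n : ℤ, f n * exp (-π * δ a * (n : ℂ) ^ 2) =
      ∑ r : Fin q, f ((r : ℕ) : ZMod q) * ((q : ℂ)⁻¹ * ∑' n : ℤ, exp (-π / (δ a * q ^ 2) * (n : ℂ) ^ 2 +
        2 * π * I * n * (((r : ℕ) / q : ℝ) : ℂ))) := by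
    intro a
    have hs : Summable fun n : ℤ => f n * exp (-π * δ a * (n : ℂ) ^ 2) := by
      refine of_norm_bounded ((summable_theta (hδ a)).norm.mul_left (∑ x, ‖f x‖)) fun n => ?_
      rw [norm_mul]
      exact mul_le_mul_of_nonneg_right (single_le_sum (f := fun x => ‖f x‖)
        (fun _ _ => norm_nonneg _) (Finset.mem_univ _)) (norm_nonneg _)
    have hs' := ((Equiv.prodComm _ _).trans (Int.divModEquiv q).symm).summable_iff.2 hs
    simp only [Function.comp_def] at hs'
    rw [← ((Equiv.prodComm _ _).trans (Int.divModEquiv q).symm).tsum_eq, hs'.tsum_prod, tsum_fintype,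
      mul_sum]
    refine sum_congr rfl fun r _ => ?_
    have e : ∀ k : ℤ, ((Equiv.prodComm _ _).trans (Int.divModEquiv q).symm) (r, k) = k * q + (r : ℕ) :=
      fun k => rfl
    have := tsum_residue (q := q) (hδ a) (r : ℕ)
    push_cast
    rw [← this, mul_left_comm]
    congr 1
    refine (tsum_congr fun k => ?_).trans tsum_mul_left
    simp
  simp only [key]
  have : (q : ℂ)⁻¹ * ∑ x, f x = ∑ r : Fin q, f ((r : ℕ) : ZMod q) * ((q : ℂ)⁻¹ * 1) := by
    rw [← sum_mul, sum_fin_eq_sum_zmod]; ring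
  rw [this]
  exact tendsto_finsetSum _ fun r _ => ((tendsto_tsum_theta hinv _).const_mul _).const_mul _

lemma stdAddChar_mul_sq {q : ℕ} [NeZero q] (b n : ℤ) :
    stdAddChar ((b : ZMod q) * (n : ZMod q) ^ 2) = exp (2 * π * I * (b * n ^ 2) / q) := by
  have := ZMod.stdAddChar_coe (N := q) (b * n ^ 2)
  simpa

lemma gaussS_reciprocity (a c : ℕ) [NeZero a] [NeZero c] [NeZero (4 * a)] :
    gaussS a c = (1 + I) * (√(a * c) / (4 * a) : ℝ) * gaussS (-c) (4 * a) := by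
  have ha : (0 : ℝ) < a := mod_cast NeZero.pos a
  have hc : (0 : ℝ) < c := mod_cast NeZero.pos c
  have ha' : (a : ℂ) ≠ 0 := mod_cast ha.ne'
  have hc' : (c : ℂ) ≠ 0 := mod_cast hc.ne'
  let d : ℕ → ℝ := fun k => 1 / ((k : ℝ) + 1)
  have hd : ∀ k, 0 < d k := fun k => by positivity
  have hd' : ∀ k, (d k : ℂ) ≠ 0 := fun k => mod_cast (hd k).ne'
  have hdlim : Tendsto d atTop (𝓝 0) := tendsto_one_div_add_atTop_nhds_zero_nat
  have hdinv : Tendsto (fun k => (d k)⁻¹) atTop atTop := by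
    simpa [d] using tendsto_atTop_add_const_right atTop (1 : ℝ) tendsto_natCast_atTop_atTop
  let A : ℕ → ℂ := fun k => d k - 2 * a / c * I
  let u : ℕ → ℂ := fun k => 4 * a ^ 2 / c ^ 2 * (d k : ℂ)⁻¹ + 2 * a / c * I
  have hAre : ∀ k, (A k).re = d k := fun k => by
    have : A k = (d k : ℂ) - ((2 * a / c : ℝ) : ℂ) * I := by simp [A]
    simp_all
  have hure : ∀ k, (u k).re = 4 * a ^ 2 / c ^ 2 * (d k)⁻¹ := fun k => by
    have : u k = ((4 * a ^ 2 / c ^ 2 * (d k)⁻¹ : ℝ) : ℂ) + ((2 * a / c : ℝ) : ℂ) * I := by simp [u]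
    rw [this, add_re, re_ofReal_mul, ofReal_re]; simp
  have hupos : ∀ k, 0 < (u k).re := fun k => by simp_all
  have hu0 : ∀ k, u k ≠ 0 := fun k h => by have := hupos k; simp [h] at this
  have hA0 : ∀ k, A k ≠ 0 := fun k h => by have := hAre k; have := hd k; simp_all
  have hAu : ∀ k, (A k)⁻¹ = (u k)⁻¹ + c / (2 * a) * I := fun k => by
    have h0 := hd' k
    have h1 : 1 + c / (2 * a) * I * u k = 2 * a / c * I * (d k : ℂ)⁻¹ := by
      simp only [u]; field_simp; linear_combination (2 * c * d k : ℂ) * I_sq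
    have h2 : A k * (2 * a / c * I * (d k : ℂ)⁻¹) = u k := by
      simp only [A, u]; field_simp; linear_combination (-4 * a : ℂ) * I_sq
    grind
  have t1 := tendsto_theta (δ := fun k => (d k : ℂ)) (l := atTop) (by omega)
    (by simpa) (q := c) fun x => stdAddChar (((a : ℤ) : ZMod c) * x ^ 2)
  have t2 := tendsto_theta (δ := fun k => (u k)⁻¹) (l := atTop) (fun k => by simp [*])
    (by simp only [inv_inv, hure]; exact Tendsto.const_mul_atTop (by positivity) hdinv) (q := 4 * a)
    fun x => stdAddChar (((-c : ℤ) : ZMod (4 * a)) * x ^ 2)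
  have e : ∀ k, (d k : ℂ) ^ (1 / 2 : ℂ) * ∑' n : ℤ, stdAddChar (((a : ℤ) : ZMod c) * (n : ZMod c) ^ 2) *
        exp (-π * d k * (n : ℂ) ^ 2) = (4 * a ^ 2 / c ^ 2 + 2 * a / c * I * d k) ^ (1 / 2 : ℂ) *
        ((A k)⁻¹) ^ (1 / 2 : ℂ) * (((u k)⁻¹) ^ (1 / 2 : ℂ) * ∑' n : ℤ,
        stdAddChar (((-c : ℤ) : ZMod (4 * a)) * (n : ZMod (4 * a)) ^ 2) *
        exp (-π * (u k)⁻¹ * (n : ℂ) ^ 2)) := by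
    intro k
    have h1 := Complex.tsum_exp_neg_mul_int_sq (a := A k) (by grind)
    have e1 : ∀ n : ℤ, exp (-π * A k * (n : ℂ) ^ 2) =
        stdAddChar (((a : ℤ) : ZMod c) * (n : ZMod c) ^ 2) * exp (-π * d k * (n : ℂ) ^ 2) := by
      intro n
      rw [stdAddChar_mul_sq, ← exp_add]
      congr 1; push_cast; ring
    have e2 : ∀ n : ℤ, exp (-π / A k * (n : ℂ) ^ 2) =
        stdAddChar (((-c : ℤ) : ZMod (4 * a)) * (n : ZMod (4 * a)) ^ 2) *
          exp (-π * (u k)⁻¹ * (n : ℂ) ^ 2) := by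
      intro n
      rw [stdAddChar_mul_sq, ← exp_add, div_eq_mul_inv, hAu]
      push_cast; ring_nf
    have e3 : (4 * a ^ 2 / c ^ 2 + 2 * a / c * I * d k : ℂ) = d k * u k := by
      simp only [u]; have := hd' k; field_simp
    have arg_ne : ∀ z : ℂ, 0 < z.re → z.arg ≠ π := fun z hz h => by
      have := (Complex.arg_eq_pi_iff.1 h).1; linarith
    simp only [e1, e2] at h1
    rw [h1, e3, ofReal_mul_cpow (hd k) (hu0 k), inv_cpow _ _ (arg_ne _ (hupos k)),
      inv_cpow _ _ (arg_ne _ (by simp [*])), one_div]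
    have : (u k) ^ (1 / 2 : ℂ) ≠ 0 := by simp [*]
    field_simp
  simp only [e] at t1
  have hdc : Tendsto (fun k => (d k : ℂ)) atTop (𝓝 0) := by
    simpa [Function.comp_def] using (continuous_ofReal.tendsto 0).comp hdlim
  have hp : (4 * a ^ 2 / c ^ 2 : ℂ) = (((2 * a / c) ^ 2 : ℝ) : ℂ) := by push_cast; ring
  have l1 : Tendsto (fun k => (4 * a ^ 2 / c ^ 2 + 2 * a / c * I * d k : ℂ) ^ (1 / 2 : ℂ)) atTop
      (𝓝 ((4 * a ^ 2 / c ^ 2 : ℂ) ^ (1 / 2 : ℂ))) := by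
    have h1 : Tendsto (fun k => (4 * a ^ 2 / c ^ 2 + 2 * a / c * I * d k : ℂ)) atTop
        (𝓝 (4 * a ^ 2 / c ^ 2 : ℂ)) := by
      simpa using (hdc.const_mul (2 * a / c * I : ℂ)).const_add (4 * a ^ 2 / c ^ 2 : ℂ)
    refine h1.cpow tendsto_const_nhds ?_
    rw [hp]; exact Complex.ofReal_mem_slitPlane.2 (by positivity)
  have l2 : Tendsto (fun k => ((A k)⁻¹) ^ (1 / 2 : ℂ)) atTop
      (𝓝 ((1 / ((2 * a / c : ℝ) * ((-1 : ℝ) * I))) ^ (1 / 2 : ℂ))) := by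
    have h0 : ((2 * a / c : ℝ) * ((-1 : ℝ) * I) : ℂ) ≠ 0 := by simp [ha', hc']
    have h1 : Tendsto A atTop (𝓝 ((2 * a / c : ℝ) * ((-1 : ℝ) * I))) := by
      have := hdc.sub_const (2 * a / c * I)
      simpa
    rw [one_div (((2 * a / c : ℝ) : ℂ) * _)]
    refine (h1.inv₀ h0).cpow tendsto_const_nhds (Or.inr ?_)
    rw [inv_im]
    refine div_ne_zero ?_ (normSq_pos.2 h0).ne'
    rw [Complex.im_ofReal_mul]
    simp [ha.ne', hc.ne']
  have := tendsto_nhds_unique t1 ((l1.mul l2).mul t2)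
  rw [one_div_mul_I_cpow (by positivity) _ (Or.inr rfl), hp] at this
  have s1 : (((2 * a / c : ℝ) ^ 2 : ℝ) : ℂ) ^ (1 / 2 : ℂ) = (2 * a / c : ℝ) := by
    rw [← ofReal_ofNat, ← ofReal_one, ← ofReal_div,
      ← ofReal_cpow (by positivity), ← sqrt_eq_rpow, sqrt_sq (by positivity)]
  have s2 : ((2 * a / c : ℝ) : ℂ) ^ (-(1 / 2) : ℂ) = ((√(2 * a / c))⁻¹ : ℝ) := by
    rw [← ofReal_ofNat, ← ofReal_one, ← ofReal_div, ← ofReal_neg,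
      ← ofReal_cpow (by positivity), rpow_neg (by positivity), sqrt_eq_rpow]
  have s3 : (π * (1 / 2) / 2 : ℂ) = ((π / 4 : ℝ) : ℂ) := by push_cast; ring
  have s4 : c * ((2 * a / c) * ((√(2 * a / c))⁻¹ * (√2 / 2))) = √(a * c) := by
    have h2 : √(2 * a / c) * √(a * c) = a * √2 := by
      rw [← sqrt_mul (by positivity), show 2 * (a : ℝ) / c * (a * c) = a ^ 2 * 2 by field_simp,
        sqrt_mul (by positivity), sqrt_sq ha.le]
    have h3 : √(2 * a / c) ≠ 0 := (sqrt_pos.2 (by positivity)).ne'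
    generalize √(2 * (a : ℝ) / c) = P at *
    generalize √((a : ℝ) * c) = Q at *
    field_simp
    grind
  rw [s1, s2, s3, ← Complex.ofReal_cos, ← Complex.ofReal_sin, Real.cos_pi_div_four,
    Real.sin_pi_div_four] at this
  rw [gaussS, gaussS]
  generalize (∑ x, stdAddChar (((a : ℤ) : ZMod c) * x ^ 2)) = S1 at *
  generalize (∑ x, stdAddChar (((-c : ℤ) : ZMod (4 * a)) * x ^ 2)) = S2 at *
  have s5 : S1 = c * ((c : ℂ)⁻¹ * S1) := (mul_inv_cancel_left₀ hc' _).symm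
  rw [s5, this, ← s4]
  push_cast; ring

lemma gaussS_congr {q : ℕ} [NeZero q] {b b' : ℤ} (h : (b : ZMod q) = b') : gaussS b q = gaussS b' q := by
  rw [gaussS, gaussS, h]

lemma gaussS_mul_sq {q : ℕ} [NeZero q] (b : ℤ) (u : (ZMod q)ˣ) {b' : ℤ}
    (h : (b' : ZMod q) = b * (u : ZMod q) ^ 2) : gaussS b' q = gaussS b q := by
  rw [gaussS, gaussS]
  refine Fintype.sum_equiv (Units.mulLeft u) _ _ fun x => ?_
  rw [h, Units.mulLeft_apply]
  ring_nf

lemma gaussS_neg {q : ℕ} [NeZero q] (b : ℤ) : gaussS (-b) q = (starRingEnd ℂ) (gaussS b q) := by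
  rw [gaussS, gaussS, map_sum]
  refine sum_congr rfl fun x _ => ?_
  rw [← AddChar.map_neg_eq_conj]
  simp

lemma gaussS_mul {m n : ℕ} [NeZero m] [NeZero n] [NeZero (m * n)] (h : m.Coprime n) (b : ℤ) :
    gaussS b (m * n) = gaussS (b * n) m * gaussS (b * m) n := by
  have hm : (m : ℂ) ≠ 0 := mod_cast NeZero.ne m
  have hn : (n : ℂ) ≠ 0 := mod_cast NeZero.ne n
  rw [gaussS, gaussS, gaussS, sum_mul_sum, ← Fintype.sum_prod_type']
  let F : ZMod m × ZMod n → ZMod (m * n) := fun p => ((n * p.1.val + m * p.2.val : ℤ) : ZMod (m * n))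
  have hF : Function.Bijective F := by
    rw [Fintype.bijective_iff_injective_and_card]
    refine ⟨fun p p' hp => ?_, by simp⟩
    have h1 := congrArg (ZMod.castHom (Dvd.intro _ rfl : m ∣ m * n) (ZMod m)) hp
    have h2 := congrArg (ZMod.castHom (Dvd.intro_left _ rfl : n ∣ m * n) (ZMod n)) hp
    simp only [F, map_intCast] at h1 h2
    push_cast at h1 h2
    simp only [ZMod.natCast_zmod_val, CharP.cast_eq_zero, zero_mul, add_zero, zero_add] at h1 h2
    have u1 : IsUnit (n : ZMod m) := (ZMod.isUnit_iff_coprime n m).2 h.symm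
    have u2 : IsUnit (m : ZMod n) := (ZMod.isUnit_iff_coprime m n).2 h
    exact Prod.ext (u1.mul_left_cancel h1) (u2.mul_left_cancel h2)
  refine (Fintype.sum_bijective F hF _ _ fun p => ?_).symm
  have e1 : p.1 = ((p.1.val : ℤ) : ZMod m) := by simp
  have e2 : p.2 = ((p.2.val : ℤ) : ZMod n) := by simp
  have t1 : stdAddChar (((b * n : ℤ) : ZMod m) * p.1 ^ 2) =
      exp (2 * π * I * ((b * n : ℤ) * (p.1.val : ℤ) ^ 2) / m) := by
    rw [← stdAddChar_mul_sq, ← e1]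
  have t2 : stdAddChar (((b * m : ℤ) : ZMod n) * p.2 ^ 2) =
      exp (2 * π * I * ((b * m : ℤ) * (p.2.val : ℤ) ^ 2) / n) := by
    rw [← stdAddChar_mul_sq, ← e2]
  rw [t1, t2, stdAddChar_mul_sq, ← exp_add, exp_eq_exp_iff_exists_int]
  refine ⟨-(2 * b * p.1.val * p.2.val), ?_⟩
  push_cast
  field_simp
  ring

lemma gaussS_four_one : gaussS 1 4 = 2 + 2 * I := by
  have h1 : stdAddChar (1 : ZMod 4) = I := by
    have := ZMod.stdAddChar_coe (N := 4) 1
    rw [Int.cast_one] at this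
    rw [this, show (2 * π * I * ((1 : ℤ) : ℂ) / (4 : ℕ) : ℂ) = π / 2 * I by
      ring, Complex.exp_pi_div_two_mul_I]
  have : ∀ x : ZMod 4, ((1 : ℤ) : ZMod 4) * x ^ 2 = if x = 0 ∨ x = 2 then 0 else 1 := by decide
  simp only [gaussS, this]
  rw [show (Finset.univ : Finset (ZMod 4)) = {0, 1, 2, 3} by decide, sum_insert (by decide),
    sum_insert (by decide), sum_insert (by decide), Finset.sum_singleton, if_pos (by decide),
    if_neg (by decide), if_pos (by decide), if_neg (by decide), h1, AddChar.map_zero_eq_one]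
  ring

/-- The sign factor of the quadratic Gauss sum of odd modulus. -/
def epsG (a : ℕ) : ℂ := if a % 4 = 1 then 1 else I

lemma gaussS_odd_pos {a c : ℕ} [NeZero a] [NeZero c] (ha : Odd a) (hc : Odd c)
    (ih : gaussS (-a : ℤ) c = jacobiSym (-a) c * epsG c * (√c : ℝ)) :
    gaussS c a = jacobiSym c a * epsG a * (√a : ℝ) := by
  have : NeZero (4 * c) := ⟨by grind⟩
  have h4 : Coprime 4 c := by
    rw [show 4 = 2 ^ 2 by norm_num]; exact Coprime.pow_left 2 (Nat.coprime_two_left.2 hc)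
  have hcpos : (0 : ℝ) < c := mod_cast NeZero.pos c
  have hsq : √((c : ℝ) * a) * √c = c * √a := by
    rw [sqrt_mul hcpos.le, mul_right_comm, Real.mul_self_sqrt hcpos.le]
  have h1 : gaussS (-(a : ℤ) * (4 : ℕ)) c = gaussS (-a : ℤ) c :=
    gaussS_mul_sq (-a : ℤ) (ZMod.unitOfCoprime 2 (Nat.coprime_two_left.2 hc)) (by norm_num)
  have h2 : gaussS c a = (1 + I) / 4 * gaussS (-(a : ℤ) * c) 4 * jacobiSym (-a) c * epsG c *
      (√a : ℝ) := by
    rw [gaussS_reciprocity, gaussS_mul h4, h1, ih]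
    have : ((√((c : ℝ) * a) / (4 * c) : ℝ) : ℂ) * (√c : ℝ) = (√a : ℝ) / 4 := by
      rw [← ofReal_mul, div_mul_eq_mul_div, hsq]
      push_cast
      have : (c : ℂ) ≠ 0 := mod_cast hcpos.ne'
      field_simp
    grind
  have hg1 : ∀ w : ℤ, (w : ZMod 4) = 1 → gaussS w 4 = 2 + 2 * I := fun w hw => by
    rw [← gaussS_four_one]; exact gaussS_congr (by simpa)
  have hg3 : ∀ w : ℤ, (w : ZMod 4) = 3 → gaussS w 4 = 2 - 2 * I := fun w hw => by
    rw [gaussS_congr (b' := -1) (by simpa), gaussS_neg, gaussS_four_one]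
    rw [map_add, map_mul, conj_I, Complex.conj_ofNat]; ring
  have hz : ∀ n : ℕ, Odd n → n % 4 = 1 ∧ (n : ZMod 4) = 1 ∨ n % 4 = 3 ∧ (n : ZMod 4) = 3 := fun n hn => by
    rcases Nat.odd_mod_four_iff.1 (odd_iff.1 hn) with h | h
    · left; exact ⟨h, by rw [← ZMod.natCast_mod, h]; rfl⟩
    · right; exact ⟨h, by rw [← ZMod.natCast_mod, h]; rfl⟩
  have hI := I_sq
  rw [h2, jacobiSym.neg _ hc]
  have e1 : ∀ {n : ℕ}, n % 4 = 1 → epsG n = 1 := fun h => if_pos h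
  have e3 : ∀ {n : ℕ}, n % 4 = 3 → epsG n = I := fun h => if_neg (by omega)
  rcases hz a ha with ⟨a1, a2⟩ | ⟨a1, a2⟩ <;> rcases hz c hc with ⟨c1, c2⟩ | ⟨c1, c2⟩
  · rw [hg3 _ (by push_cast; grind), ZMod.χ₄_nat_one_mod_four c1,
      jacobiSym.quadratic_reciprocity_one_mod_four a1 hc, e1 a1, e1 c1]
    grind
  · rw [hg1 _ (by push_cast; grind), ZMod.χ₄_nat_three_mod_four c1,
      jacobiSym.quadratic_reciprocity_one_mod_four a1 hc, e1 a1, e3 c1]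
    grind
  · rw [hg1 _ (by push_cast; grind), ZMod.χ₄_nat_one_mod_four c1,
      ← jacobiSym.quadratic_reciprocity_one_mod_four c1 ha, e3 a1, e1 c1]
    grind
  · rw [hg3 _ (by push_cast; grind), ZMod.χ₄_nat_three_mod_four c1,
      jacobiSym.quadratic_reciprocity_three_mod_four a1 c1, e3 a1, e3 c1]
    grind

lemma gaussS_odd_neg {a : ℕ} [NeZero a] (ha : Odd a) {b : ℤ}
    (h : gaussS b a = jacobiSym b a * epsG a * (√a : ℝ)) :
    gaussS (-b) a = jacobiSym (-b) a * epsG a * (√a : ℝ) := by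
  rw [gaussS_neg, h, jacobiSym.neg _ ha, map_mul, map_mul, conj_ofReal, map_intCast, epsG]
  rcases Nat.odd_mod_four_iff.1 (odd_iff.1 ha) with h | h
  · rw [if_pos h, ZMod.χ₄_nat_one_mod_four h]; simp
  · rw [if_neg (by omega), ZMod.χ₄_nat_three_mod_four h, conj_I]; simp

lemma gaussS_odd (a : ℕ) : ∀ [NeZero a], Odd a → ∀ b : ℤ, IsCoprime b a →
    gaussS b a = jacobiSym b a * epsG a * (√a : ℝ) := by
  induction a using Nat.strong_induction_on with
  | _ a ih =>
  intro _ ha b hab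
  rcases eq_or_ne a 1 with rfl | ha1
  · have : ∀ f : ZMod 1 → ℂ, ∑ x, f x = f 0 := fun f => Fintype.sum_unique f
    rw [gaussS, this, Subsingleton.elim (_ * _) (0 : ZMod 1), AddChar.map_zero_eq_one]
    simp [epsG]
  have hpos : ∀ c : ℕ, 0 < c → c < a → Odd c → IsCoprime (c : ℤ) a →
      gaussS c a = jacobiSym c a * epsG a * (√a : ℝ) := fun c hc0 hca hc hcop => by
    have : NeZero c := ⟨hc0.ne'⟩
    exact gaussS_odd_pos ha hc (ih c hca hc _ hcop.symm.neg_left)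
  have hred : ∀ b' : ℤ, b % a = b' % a → gaussS b' a = jacobiSym b' a * epsG a * (√a : ℝ) →
      gaussS b a = jacobiSym b a * epsG a * (√a : ℝ) := fun b' h hb' => by
    rw [gaussS_congr (b' := b') ((ZMod.intCast_eq_intCast_iff' b b' a).2 h), hb', jacobiSym.mod_left' h]
  have ha0 : (0 : ℤ) < a := mod_cast NeZero.pos a
  have hr0 := Int.emod_nonneg b ha0.ne'
  have hr1 := Int.emod_lt_of_pos b ha0
  obtain ⟨r, hr⟩ := Int.eq_ofNat_of_zero_le hr0
  have hcop : IsCoprime (r : ℤ) a := by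
    have h := Int.emod_add_mul_ediv b a
    rw [hr] at h
    rw [← h] at hab
    simpa using hab.add_mul_left_left (-(b / a))
  have hr0' : r ≠ 0 := by
    rintro rfl
    rw [cast_zero, isCoprime_zero_left, Int.isUnit_iff] at hcop
    omega
  rcases Nat.even_or_odd r with he | ho
  · have hsub : ((a - r : ℕ) : ℤ) = a - r := by omega
    refine hred (-((a - r : ℕ) : ℤ)) ?_ (gaussS_odd_neg ha (hpos (a - r) (by omega) (by omega) ?_ ?_))
    · rw [hsub, neg_sub, Int.sub_emod_right, ← hr, Int.emod_emod_of_dvd _ dvd_rfl]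
    · grind
    · rw [hsub]
      have := hcop.neg_left.add_mul_left_left 1
      grind
  · refine hred r ?_ (hpos r (by omega) (by omega) ho hcop)
    rw [← hr, Int.emod_emod_of_dvd _ dvd_rfl]

lemma gaussS_of_four_dvd {a C : ℕ} [NeZero a] [NeZero C] (ha : Odd a) (hC : 4 ∣ C) (h : a.Coprime C) :
    gaussS a C = (1 + I) * (√C : ℝ) * jacobiSym (-C) a * epsG a := by
  have : NeZero (4 * a) := ⟨by grind⟩
  have h4 : Coprime 4 a := by
    rw [show 4 = 2 ^ 2 by norm_num]; exact Coprime.pow_left 2 (Nat.coprime_two_left.2 ha)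
  have hapos : (0 : ℝ) < a := mod_cast NeZero.pos a
  have h1 : gaussS (-(C : ℤ) * (4 : ℕ)) a = gaussS (-C : ℤ) a :=
    gaussS_mul_sq (-C : ℤ) (ZMod.unitOfCoprime 2 (Nat.coprime_two_left.2 ha)) (by norm_num)
  have h2 : gaussS (-(C : ℤ) * a) 4 = 4 := by
    have : ((-(C : ℤ) * a : ℤ) : ZMod 4) = 0 := by
      push_cast; rw [(ZMod.natCast_eq_zero_iff C 4).2 hC]; ring
    simp only [gaussS, this, zero_mul, AddChar.map_zero_eq_one]
    simp
  have h3 : IsCoprime (-(C : ℤ)) a := (Nat.isCoprime_iff_coprime.2 h.symm).neg_left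
  rw [gaussS_reciprocity, gaussS_mul h4, h1, h2, gaussS_odd a ha _ h3]
  have : ((√((a : ℝ) * C) / (4 * a) : ℝ) : ℂ) * (√a : ℝ) = (√C : ℝ) / 4 := by
    rw [← ofReal_mul, div_mul_eq_mul_div, sqrt_mul hapos.le, mul_right_comm,
      Real.mul_self_sqrt hapos.le]
    push_cast
    have : (a : ℂ) ≠ 0 := mod_cast hapos.ne'
    field_simp
  grind

lemma kronecker_of_odd (c : ℤ) {d : ℤ} (hd : Odd d) :
    kronecker c d = (if d < 0 ∧ c < 0 then -1 else 1) * jacobiSym c d.natAbs := by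
  have h0 : d ≠ 0 := by grind
  have h1 : padicValNat 2 d.natAbs = 0 := padicValNat.eq_zero_of_not_dvd (by grind)
  rw [kronecker, if_neg h0, h1]
  simp

lemma gaussS_eq_kronecker {c d : ℤ} [NeZero c.natAbs] (h4 : (4 : ℤ) ∣ c) (hd : d % 4 = 1)
    (hcd : IsCoprime c d) :
    gaussS d c.natAbs = (1 + I) * (√|(c : ℝ)| : ℝ) * kronecker c d := by
  have hodd : Odd d := Int.odd_iff.2 (by omega)
  have hd0 : d ≠ 0 := by omega
  have : NeZero d.natAbs := ⟨Int.natAbs_ne_zero.2 hd0⟩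
  have hC : (c.natAbs : ℝ) = |(c : ℝ)| := by simp
  have h1 := gaussS_of_four_dvd (a := d.natAbs) (C := c.natAbs) hodd.natAbs
    (by omega) ((Int.isCoprime_iff_gcd_eq_one.1 hcd.symm))
  rw [hC] at h1
  rw [kronecker_of_odd c hodd]
  have hJ : jacobiSym (-(c.natAbs : ℤ)) d.natAbs = ZMod.χ₄ d.natAbs * jacobiSym c.natAbs d.natAbs :=
    jacobiSym.neg _ hodd.natAbs
  have hJ' : jacobiSym (-c) d.natAbs = ZMod.χ₄ d.natAbs * jacobiSym c d.natAbs :=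
    jacobiSym.neg _ hodd.natAbs
  rw [hJ] at h1
  have hI := I_sq
  rcases lt_or_gt_of_ne hd0 with hn | hp
  · have hm : d.natAbs % 4 = 3 := by omega
    rw [ZMod.χ₄_nat_three_mod_four hm] at h1 hJ'
    have e : d = -(d.natAbs : ℤ) := by omega
    have e2 : epsG d.natAbs = I := if_neg (by omega)
    have : gaussS d c.natAbs = gaussS (-(d.natAbs : ℤ)) c.natAbs := by rw [← e]
    rw [this, gaussS_neg, h1, e2]
    simp only [map_mul, map_add, map_one, conj_I, conj_ofReal, map_intCast]
    rcases lt_or_ge c 0 with hc | hc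
    · rw [if_pos ⟨hn, hc⟩, show (c.natAbs : ℤ) = -c by omega, hJ']
      grind
    · rw [if_neg (by omega), show (c.natAbs : ℤ) = c by omega]
      grind
  · have hm : d.natAbs % 4 = 1 := by omega
    rw [ZMod.χ₄_nat_one_mod_four hm] at h1 hJ'
    have e : d = (d.natAbs : ℤ) := by omega
    have e2 : epsG d.natAbs = 1 := if_pos hm
    have : gaussS d c.natAbs = gaussS (d.natAbs : ℤ) c.natAbs := by rw [← e]
    rw [this, h1, e2, if_neg (by omega)]
    grind

lemma gaussS_inv {q : ℕ} [NeZero q] {a d : ℤ} (h : (a : ZMod q) * d = 1) : gaussS a q = gaussS d q := by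
  have hu : IsUnit (d : ZMod q) := IsUnit.of_mul_eq_one _ (mul_comm (a : ZMod q) d ▸ h)
  refine (gaussS_mul_sq a hu.unit ?_).symm
  rw [IsUnit.unit_spec]
  grind

lemma gaussS_two_pow {a a' e : ℕ} (he : 2 ≤ e) (ha : Odd a) (h : a % 8 = a' % 8) :
    gaussS a (2 ^ e) = gaussS a' (2 ^ e) := by
  have ha' : Odd a' := by grind
  have : NeZero a := ⟨ha.pos.ne'⟩
  have : NeZero a' := ⟨ha'.pos.ne'⟩
  have hC : 4 ∣ 2 ^ e := pow_dvd_pow 2 he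
  have hJ : ∀ {x : ℕ}, Odd x → jacobiSym (-((2 ^ e : ℕ) : ℤ)) x = ZMod.χ₄ x * ZMod.χ₈ x ^ e := fun hx => by
    rw [jacobiSym.neg _ hx, Nat.cast_pow, jacobiSym.pow_left, cast_ofNat, jacobiSym.at_two hx]
  rw [gaussS_of_four_dvd ha hC (Coprime.pow_right _ (Nat.coprime_two_right.2 ha)),
    gaussS_of_four_dvd ha' hC (Coprime.pow_right _ (Nat.coprime_two_right.2 ha')), hJ ha, hJ ha', epsG, epsG,
    show a % 4 = a' % 4 by omega, (ZMod.natCast_eq_natCast_iff' a a' 8).2 h,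
    (ZMod.natCast_eq_natCast_iff' a a' 4).2 (by omega)]

lemma norm_jacobiSym_le (a : ℤ) (b : ℕ) : ‖((jacobiSym a b : ℤ) : ℂ)‖ ≤ 1 := by
  rcases jacobiSym.trichotomy a b with h | h | h <;> simp [h]

lemma norm_gaussS_le {C : ℕ} [NeZero C] (hC : 4 ∣ C) {a : ℕ} (ha : a.Coprime C) :
    ‖gaussS a C‖ ≤ 2 * √C := by
  have hodd : Odd a := by
    rw [← Nat.coprime_two_right]
    exact ha.coprime_dvd_right ((by norm_num : 2 ∣ 4).trans hC)
  have : NeZero a := ⟨hodd.pos.ne'⟩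
  rw [gaussS_of_four_dvd hodd hC ha, norm_mul, norm_mul, norm_mul, norm_real,
    norm_of_nonneg (Real.sqrt_nonneg _)]
  have h1 : ‖1 + I‖ ≤ 2 := (norm_add_le _ _).trans (by simp; norm_num)
  have h2 : ‖epsG a‖ ≤ 1 := by rw [epsG]; split_ifs <;> simp
  calc _ ≤ 2 * √C * 1 * 1 := by
        gcongr
        exact norm_jacobiSym_le _ _
    _ = _ := by ring

/-! ### Counting square roots -/

/-- The number of solutions of `x² ≡ m` modulo `q`. -/
def sqCount (m : ℤ) : ArithmeticFunction ℤ :=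
  ⟨fun q => ∑ x ∈ range q, if (q : ℤ) ∣ (x : ℤ) ^ 2 - m then 1 else 0, by simp⟩

lemma sqCount_apply (m : ℤ) (q : ℕ) :
    sqCount m q = ∑ x ∈ range q, if (q : ℤ) ∣ (x : ℤ) ^ 2 - m then 1 else 0 := rfl

lemma sum_range_eq_sum_zmod {M : Type*} [AddCommMonoid M] {q : ℕ} [NeZero q] (f : ZMod q → M) :
    ∑ x ∈ range q, f (x : ZMod q) = ∑ x, f x := by
  rw [Finset.sum_range]
  refine Fintype.sum_bijective (fun r : Fin q => ((r : ℕ) : ZMod q)) ?_ _ _ fun _ => rfl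
  rw [Fintype.bijective_iff_surjective_and_card]
  exact ⟨fun x => ⟨⟨x.val, x.val_lt⟩, ZMod.natCast_zmod_val x⟩, by simp⟩

lemma sqCount_eq (m : ℤ) (q : ℕ) [NeZero q] :
    sqCount m q = ∑ x : ZMod q, if x ^ 2 = m then 1 else 0 := by
  rw [sqCount_apply, ← sum_range_eq_sum_zmod]
  refine sum_congr rfl fun x _ => ?_
  have : (q : ℤ) ∣ (x : ℤ) ^ 2 - m ↔ (x : ZMod q) ^ 2 = m := by
    rw [← ZMod.intCast_zmod_eq_zero_iff_dvd]; push_cast; grind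
  grind

lemma sqCount_isMultiplicative (m : ℤ) : (sqCount m).IsMultiplicative := by
  rw [IsMultiplicative.iff_ne_zero]
  refine ⟨by simp [sqCount_apply], fun {a b} ha hb hab => ?_⟩
  have : NeZero a := ⟨ha⟩
  have : NeZero b := ⟨hb⟩
  rw [sqCount_eq, sqCount_eq, sqCount_eq, sum_mul_sum, ← Fintype.sum_prod_type']
  refine Fintype.sum_equiv (ZMod.chineseRemainder hab).toEquiv _ _ fun x => ?_
  have : x ^ 2 = (m : ZMod (a * b)) ↔ (ZMod.chineseRemainder hab x).1 ^ 2 = m ∧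
      (ZMod.chineseRemainder hab x).2 ^ 2 = m := by
    rw [← (ZMod.chineseRemainder hab).injective.eq_iff, map_pow, map_intCast, Prod.ext_iff]
    rfl
  simp only [RingEquiv.toEquiv_eq_coe, EquivLike.coe_coe, this, ite_and, ite_mul, one_mul, zero_mul]

lemma sum_range_mul_of_periodic {f : ℕ → ℤ} {T : ℕ} (hf : ∀ x, f (x + T) = f x) (n : ℕ) :
    ∑ x ∈ range (n * T), f x = n * ∑ x ∈ range T, f x := by
  have hp : ∀ n x, f (n * T + x) = f x := fun n x => by
    induction n with
    | zero => simp
    | succ n ih => grind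
  induction n with
  | zero => simp
  | succ n ih => rw [add_mul, one_mul, Finset.sum_range_add, ih]; grind

lemma sqCount_sq_dvd {p : ℕ} (hp : p.Prime) (m : ℤ) (k : ℕ) :
    sqCount (p ^ 2 * m) (p ^ (k + 2)) = p * sqCount m (p ^ k) := by
  have hp0 : (p : ℤ) ≠ 0 := mod_cast hp.ne_zero
  have hdvd : ∀ y : ℕ, ((p ^ (k + 2) : ℕ) : ℤ) ∣ ((p * y : ℕ) : ℤ) ^ 2 - p ^ 2 * m ↔
      ((p ^ k : ℕ) : ℤ) ∣ (y : ℤ) ^ 2 - m := fun y => by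
    rw [show ((p ^ (k + 2) : ℕ) : ℤ) = p ^ 2 * ((p ^ k : ℕ) : ℤ) by grind,
      show ((p * y : ℕ) : ℤ) ^ 2 - p ^ 2 * m = p ^ 2 * ((y : ℤ) ^ 2 - m) by grind]
    exact mul_dvd_mul_iff_left (pow_ne_zero 2 hp0)
  rw [sqCount_apply, sqCount_apply, ← sum_range_mul_of_periodic (T := p ^ k) _ p]
  · rw [show p ^ (k + 2) = p * (p * p ^ k) by ring, ← show p ^ (k + 2) = p * (p * p ^ k) by ring]
    symm
    refine Finset.sum_bij_ne_zero (fun y _ _ => p * y) ?_ ?_ ?_ ?_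
    · intro y hy _
      rw [mem_range] at *
      calc p * y < p * (p * p ^ k) := by gcongr; exact hp.pos
        _ = _ := by ring
    · simp_all
    · intro x hx hx'
      have hx1 : ((p ^ (k + 2) : ℕ) : ℤ) ∣ (x : ℤ) ^ 2 - p ^ 2 * m := by grind
      have h2 : (p : ℤ) ∣ (x : ℤ) ^ 2 := by
        have h3 : (p : ℤ) ∣ ((p ^ (k + 2) : ℕ) : ℤ) := by simp
        have := dvd_add (h3.trans hx1) (Dvd.intro (p * m) rfl : (p : ℤ) ∣ p * (p * m))
        grind
      have h4 : p ∣ x := by exact_mod_cast (Nat.prime_iff_prime_int.1 hp).dvd_of_dvd_pow h2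
      obtain ⟨y, rfl⟩ := h4
      refine ⟨y, ?_, ?_, rfl⟩
      · rw [mem_range] at *
        have : p * y < p * (p * p ^ k) := by grind
        exact lt_of_mul_lt_mul_left this (Nat.zero_le p)
      grind
    grind
  · intro y
    have : ((p ^ k : ℕ) : ℤ) ∣ ((y + p ^ k : ℕ) : ℤ) ^ 2 - m ↔ ((p ^ k : ℕ) : ℤ) ∣ (y : ℤ) ^ 2 - m := by
      rw [show ((y + p ^ k : ℕ) : ℤ) ^ 2 - m = ((y : ℤ) ^ 2 - m) +
        ((p ^ k : ℕ) : ℤ) * (2 * y + (p ^ k : ℕ)) by grind]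
      simp
    grind

lemma sqCount_prime_dvd {p : ℕ} (hp : p.Prime) {m : ℤ} (h1 : (p : ℤ) ∣ m) (h2 : ¬ (p : ℤ) ^ 2 ∣ m)
    (k : ℕ) : sqCount m (p ^ (k + 2)) = 0 := by
  rw [sqCount_apply]
  refine sum_eq_zero fun x _ => if_neg fun hx => h2 ?_
  have h3 : (p : ℤ) ^ 2 ∣ (x : ℤ) ^ 2 - m := by
    refine dvd_trans ?_ hx; push_cast; exact pow_dvd_pow _ (by omega)
  have h4 : (p : ℤ) ∣ (x : ℤ) := by
    refine (Nat.prime_iff_prime_int.1 hp).dvd_of_dvd_pow (n := 2) ?_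
    have := dvd_add ((dvd_pow_self (p : ℤ) two_ne_zero).trans h3) h1
    simpa
  have := dvd_sub (pow_dvd_pow_of_dvd h4 2) h3
  simpa

lemma sqCount_prime {p : ℕ} (hp : p.Prime) (h2 : p ≠ 2) (m : ℤ) :
    sqCount m p = 1 + jacobiSym m p := by
  have : Fact p.Prime := ⟨hp⟩
  have : NeZero p := ⟨hp.ne_zero⟩
  rw [← jacobiSym.legendreSym.to_jacobiSym, add_comm, ← legendreSym.card_sqrts p h2, sqCount_eq,
    Finset.sum_boole, Set.toFinset_ofPred]

lemma sum_range_mul (f : ℕ → ℤ) (p q : ℕ) : ∑ x ∈ range (p * q), f x =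
      ∑ y ∈ range q, ∑ t ∈ range p, f (t * q + y) := by
  rw [Finset.sum_comm]
  induction p with
  | zero => simp
  | succ p ih => rw [add_mul, one_mul, Finset.sum_range_add, ih, sum_range_succ]

lemma sum_range_dvd_linear {p : ℕ} (hp : p.Prime) {a : ℤ} (ha : ¬ (p : ℤ) ∣ a) (u : ℤ) :
    ∑ t ∈ range p, (if (p : ℤ) ∣ a * t + u then (1 : ℤ) else 0) = 1 := by
  have : Fact p.Prime := ⟨hp⟩
  have : NeZero p := ⟨hp.ne_zero⟩
  have ha' : (a : ZMod p) ≠ 0 := by rwa [Ne, ZMod.intCast_zmod_eq_zero_iff_dvd]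
  have h : ∀ t : ℕ, (p : ℤ) ∣ a * t + u ↔ (t : ZMod p) = -(u : ZMod p) / a := fun t => by
    rw [← ZMod.intCast_zmod_eq_zero_iff_dvd, eq_div_iff ha', ← add_eq_zero_iff_eq_neg]
    push_cast; ring_nf
  simp only [h]
  rw [sum_range_eq_sum_zmod (fun t : ZMod p => if t = -(u : ZMod p) / a then (1 : ℤ) else 0)]
  simp

lemma sqCount_hensel {p : ℕ} (hp : p.Prime) (h2 : p ≠ 2) {m : ℤ} (hm : ¬ (p : ℤ) ∣ m) (k : ℕ) :
    sqCount m (p ^ (k + 2)) = sqCount m (p ^ (k + 1)) := by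
  have hpi := Nat.prime_iff_prime_int.1 hp
  rw [sqCount_apply, sqCount_apply, show p ^ (k + 2) = p * p ^ (k + 1) by ring, sum_range_mul]
  refine sum_congr rfl fun y _ => ?_
  set q := p ^ (k + 1) with hq
  have hq0 : (q : ℤ) ≠ 0 := mod_cast (pow_pos hp.pos _).ne'
  have hpq : (p : ℤ) ∣ q := by simp_all
  by_cases hy : (q : ℤ) ∣ (y : ℤ) ^ 2 - m
  · rw [if_pos hy]
    obtain ⟨u, hu⟩ := hy
    have hpy : ¬ (p : ℤ) ∣ 2 * y := fun h => by
      rcases hpi.dvd_or_dvd h with h | h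
      · have : p ∣ 2 := mod_cast h
        exact h2 ((Nat.prime_dvd_prime_iff_eq hp prime_two).1 this)
      · refine hm ?_
        have h3 := dvd_sub (dvd_pow h two_ne_zero) (hpq.trans (Dvd.intro u hu.symm))
        grind
    refine Eq.trans ?_ (sum_range_dvd_linear hp hpy u)
    refine sum_congr rfl fun t _ => ?_
    obtain ⟨r, hr⟩ := hpq
    have : ((p * q : ℕ) : ℤ) ∣ ((t * q + y : ℕ) : ℤ) ^ 2 - m ↔ (p : ℤ) ∣ 2 * y * t + u := by
      rw [show ((t * q + y : ℕ) : ℤ) ^ 2 - m = q * (2 * y * t + u + q * t ^ 2) by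
        grind,
        show ((p * q : ℕ) : ℤ) = q * p by grind, mul_dvd_mul_iff_left hq0]
      exact dvd_add_left (by rw [hr, mul_assoc]; simp)
    grind
  · rw [if_neg hy]
    refine sum_eq_zero fun t _ => if_neg fun h => hy ?_
    have h1 : (q : ℤ) ∣ ((t * q + y : ℕ) : ℤ) ^ 2 - m := dvd_trans (by simp) h
    rw [show ((t * q + y : ℕ) : ℤ) ^ 2 - m = ((y : ℤ) ^ 2 - m) + q * (q * t ^ 2 + 2 * y * t) by
      grind] at h1
    simp_all

/-! ### The convolution of the Liouville function with the number of square roots -/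

/-- The contribution of `g` to `sqDivSum m l`. -/
def sqDivTerm (m : ℤ) (g l : ℕ) : ℤ :=
  if g ^ 2 ∣ l ∧ ((g ^ 2 : ℕ) : ℤ) ∣ m then g * jacobiSym (m / (g ^ 2 : ℕ)) (l / g ^ 2) else 0

lemma sqDivTerm_eq_zero {m : ℤ} {g l : ℕ} (h : ¬ g ^ 2 ∣ l) : sqDivTerm m g l = 0 :=
  if_neg fun H => h H.1

lemma jacobiSym_eq_zero_of_dvd {p : ℕ} (hp : p.Prime) {m : ℤ} (h : (p : ℤ) ∣ m) :
    jacobiSym m p = 0 := by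
  have : NeZero p := ⟨hp.ne_zero⟩
  rw [jacobiSym.eq_zero_iff_not_coprime]
  intro H
  have := Int.dvd_coe_gcd h (dvd_refl (p : ℤ))
  rw [H] at this
  exact hp.one_lt.ne' (mod_cast Int.eq_one_of_dvd_one (by positivity) this)

/-- The sum of `g (m / g² | l / g²)` over all `g` with `g² ∣ l` and `g² ∣ m`. -/
def sqDivSum (m : ℤ) : ArithmeticFunction ℤ := ⟨fun l => ∑ g ∈ l.divisors, sqDivTerm m g l, by simp⟩

lemma sqDivSum_apply (m : ℤ) (l : ℕ) : sqDivSum m l = ∑ g ∈ l.divisors, sqDivTerm m g l := rfl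

lemma jacobiSym_mul_sq {a : ℤ} {g b : ℕ} (h : g.Coprime b) :
    jacobiSym (a * (g ^ 2 : ℕ)) b = jacobiSym a b := by
  rw [jacobiSym.mul_left, Nat.cast_pow, jacobiSym.sq_one' (by simpa using h), mul_one]

lemma sqDivTerm_mul {m : ℤ} {g₁ g₂ l₁ l₂ : ℕ} (h : l₁.Coprime l₂) (hl₁ : l₁ ≠ 0) (hl₂ : l₂ ≠ 0)
    (h₁ : g₁ ∣ l₁) (h₂ : g₂ ∣ l₂) :
    sqDivTerm m (g₁ * g₂) (l₁ * l₂) = sqDivTerm m g₁ l₁ * sqDivTerm m g₂ l₂ := by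
  have hg1 : 0 < g₁ := Nat.pos_of_dvd_of_pos h₁ (Nat.pos_of_ne_zero hl₁)
  have hg2 : 0 < g₂ := Nat.pos_of_dvd_of_pos h₂ (Nat.pos_of_ne_zero hl₂)
  have h12 : g₁.Coprime l₂ := h.coprime_dvd_left h₁
  have h21 : g₂.Coprime l₁ := (h.coprime_dvd_right h₂).symm
  have hgg : (g₁ ^ 2).Coprime (g₂ ^ 2) := (h12.coprime_dvd_right h₂).pow 2 2
  have hl : (g₁ * g₂) ^ 2 ∣ l₁ * l₂ ↔ g₁ ^ 2 ∣ l₁ ∧ g₂ ^ 2 ∣ l₂ := by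
    rw [mul_pow]
    refine ⟨fun H => ⟨?_, ?_⟩, fun H => mul_dvd_mul H.1 H.2⟩
    · exact (h12.pow_left 2).dvd_of_dvd_mul_right (dvd_trans (Dvd.intro _ rfl) H)
    · exact (h21.pow_left 2).dvd_of_dvd_mul_left (dvd_trans (Dvd.intro_left _ rfl) H)
  have hm : (((g₁ * g₂) ^ 2 : ℕ) : ℤ) ∣ m ↔ ((g₁ ^ 2 : ℕ) : ℤ) ∣ m ∧ ((g₂ ^ 2 : ℕ) : ℤ) ∣ m := by
    rw [mul_pow, cast_mul]
    refine ⟨fun H => ⟨dvd_trans (Dvd.intro _ rfl) H, dvd_trans (Dvd.intro_left _ rfl) H⟩, fun H => ?_⟩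
    exact IsCoprime.mul_dvd (Nat.isCoprime_iff_coprime.2 hgg) H.1 H.2
  unfold sqDivTerm
  by_cases H : (g₁ ^ 2 ∣ l₁ ∧ ((g₁ ^ 2 : ℕ) : ℤ) ∣ m) ∧ (g₂ ^ 2 ∣ l₂ ∧ ((g₂ ^ 2 : ℕ) : ℤ) ∣ m)
  · obtain ⟨⟨a1, b1⟩, a2, b2⟩ := H
    rw [if_pos (hl.2 ⟨a1, a2⟩ |>.elim fun r hr => ⟨⟨r, hr⟩, hm.2 ⟨b1, b2⟩⟩), if_pos ⟨a1, b1⟩, if_pos ⟨a2, b2⟩]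
    obtain ⟨t, rfl⟩ := hm.2 ⟨b1, b2⟩
    obtain ⟨r₁, rfl⟩ := a1
    obtain ⟨r₂, rfl⟩ := a2
    have z1 : ((g₁ ^ 2 : ℕ) : ℤ) ≠ 0 := by positivity
    have z2 : ((g₂ ^ 2 : ℕ) : ℤ) ≠ 0 := by positivity
    have hr1 : r₁ ≠ 0 := right_ne_zero_of_mul hl₁
    have hr2 : r₂ ≠ 0 := right_ne_zero_of_mul hl₂
    have e0 : (((g₁ * g₂) ^ 2 : ℕ) : ℤ) * t / ((g₁ * g₂) ^ 2 : ℕ) = t :=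
      Int.mul_ediv_cancel_left _ (by positivity)
    have e1 : (((g₁ * g₂) ^ 2 : ℕ) : ℤ) * t / (g₁ ^ 2 : ℕ) = t * (g₂ ^ 2 : ℕ) := by
      rw [mul_pow, cast_mul, mul_assoc, Int.mul_ediv_cancel_left _ z1, mul_comm]
    have e2 : (((g₁ * g₂) ^ 2 : ℕ) : ℤ) * t / (g₂ ^ 2 : ℕ) = t * (g₁ ^ 2 : ℕ) := by
      rw [mul_pow, mul_comm (g₁ ^ 2), cast_mul, mul_assoc, Int.mul_ediv_cancel_left _ z2, mul_comm]
    have e3 : g₁ ^ 2 * r₁ * (g₂ ^ 2 * r₂) / (g₁ * g₂) ^ 2 = r₁ * r₂ := by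
      rw [show g₁ ^ 2 * r₁ * (g₂ ^ 2 * r₂) = (g₁ * g₂) ^ 2 * (r₁ * r₂) by ring]
      simp_all
    rw [e0, e1, e2, e3, Nat.mul_div_cancel_left _ (by positivity), Nat.mul_div_cancel_left _ (by positivity),
      jacobiSym_mul_sq (h21.coprime_dvd_right (Dvd.intro_left _ rfl)),
      jacobiSym_mul_sq (h12.coprime_dvd_right (Dvd.intro_left _ rfl)), jacobiSym.mul_right' _ hr1 hr2]
    grind
  grind

lemma sqDivSum_isMultiplicative (m : ℤ) : (sqDivSum m).IsMultiplicative := by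
  rw [IsMultiplicative.iff_ne_zero]
  refine ⟨by simp [sqDivSum_apply, sqDivTerm], fun {a b} ha hb hab => ?_⟩
  rw [sqDivSum_apply, sqDivSum_apply, sqDivSum_apply, hab.divisors_mul, Finset.sum_map,
    sum_mul_sum, ← Finset.sum_product', ← Finset.sum_attach (a.divisors ×ˢ b.divisors)]
  refine sum_congr rfl fun x _ => ?_
  have := Finset.mem_product.1 x.2
  exact sqDivTerm_mul hab ha hb (Nat.dvd_of_mem_divisors this.1) (Nat.dvd_of_mem_divisors this.2)

lemma sqDivSum_prime_pow {p : ℕ} (hp : p.Prime) (m : ℤ) (k : ℕ) :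
    sqDivSum m (p ^ k) = ∑ j ∈ range (k + 1), sqDivTerm m (p ^ j) (p ^ k) := by
  rw [sqDivSum_apply, Nat.sum_divisors_prime_pow hp]

lemma sqDivSum_one (m : ℤ) : sqDivSum m 1 = 1 := (sqDivSum_isMultiplicative m).1

lemma sqDivSum_sq_not_dvd {p : ℕ} (hp : p.Prime) {m : ℤ} (hm : ¬ ((p ^ 2 : ℕ) : ℤ) ∣ m) (k : ℕ) :
    sqDivSum m (p ^ k) = jacobiSym m p ^ k := by
  rw [sqDivSum_prime_pow hp, Finset.sum_eq_single 0]
  · simp [sqDivTerm, jacobiSym.pow_right]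
  · intro j _ hj
    refine if_neg fun h => hm (dvd_trans ?_ h.2)
    simp_all
  · simp

lemma sqDivSum_prime {p : ℕ} (hp : p.Prime) (m : ℤ) : sqDivSum m p = jacobiSym m p := by
  have := sqDivSum_prime_pow hp m 1
  rw [pow_one] at this
  rw [this, sum_range_succ, Finset.sum_range_one, sqDivTerm_eq_zero (g := p ^ 1)]
  · simp [sqDivTerm]
  · intro h
    have := Nat.le_of_dvd hp.pos h
    have h2 := hp.two_le
    nlinarith

lemma sqDivSum_sq_dvd {p : ℕ} (hp : p.Prime) (m : ℤ) (k : ℕ) :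
    sqDivSum (p ^ 2 * m) (p ^ (k + 2)) = p * sqDivSum m (p ^ k) := by
  have hp0 := hp.pos
  have h0 : jacobiSym (p ^ 2 * m) p = 0 :=
    jacobiSym_eq_zero_of_dvd hp (by rw [pow_two, mul_assoc]; simp)
  have hs : ∀ j, sqDivTerm (p ^ 2 * m) (p ^ (j + 1)) (p ^ (k + 2)) = p * sqDivTerm m (p ^ j) (p ^ k) := by
    intro j
    have e1 : (p ^ (j + 1)) ^ 2 ∣ p ^ (k + 2) ↔ (p ^ j) ^ 2 ∣ p ^ k := by
      rw [show (p ^ (j + 1)) ^ 2 = p ^ 2 * (p ^ j) ^ 2 by ring, show p ^ (k + 2) = p ^ 2 * p ^ k by ring]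
      exact mul_dvd_mul_iff_left (by positivity)
    have e2 : (((p ^ (j + 1)) ^ 2 : ℕ) : ℤ) ∣ p ^ 2 * m ↔ (((p ^ j) ^ 2 : ℕ) : ℤ) ∣ m := by
      rw [show (((p ^ (j + 1)) ^ 2 : ℕ) : ℤ) = p ^ 2 * ((p ^ j) ^ 2 : ℕ) by grind]
      exact mul_dvd_mul_iff_left (by positivity)
    have e3 : p ^ (k + 2) / (p ^ (j + 1)) ^ 2 = p ^ k / (p ^ j) ^ 2 := by
      rw [show (p ^ (j + 1)) ^ 2 = p ^ 2 * (p ^ j) ^ 2 by ring, show p ^ (k + 2) = p ^ 2 * p ^ k by ring]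
      exact Nat.mul_div_mul_left _ _ (by positivity)
    have e4 : (p : ℤ) ^ 2 * m / ((p ^ (j + 1)) ^ 2 : ℕ) = m / ((p ^ j) ^ 2 : ℕ) := by
      rw [show (((p ^ (j + 1)) ^ 2 : ℕ) : ℤ) = p ^ 2 * ((p ^ j) ^ 2 : ℕ) by grind]
      simp_all
    unfold sqDivTerm
    grind
  rw [sqDivSum_prime_pow hp, sqDivSum_prime_pow hp, sum_range_succ', sum_range_succ]
  simp only [hs]
  rw [← mul_sum, sqDivTerm_eq_zero (g := p ^ (k + 1))]
  · simp [sqDivTerm, jacobiSym.pow_right, h0]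
  · intro h
    rw [← pow_mul] at h
    have := Nat.pow_dvd_pow_iff_le_right hp.one_lt |>.1 h
    omega

lemma sqCount_prime_of_or {p : ℕ} (hp : p.Prime) {m : ℤ} (h : p ≠ 2 ∨ m = 0) :
    sqCount m p = 1 + jacobiSym m p := by
  by_cases h2 : p = 2
  · obtain rfl : m = 0 := by tauto
    subst h2
    simp only [sqCount_apply, sum_range_succ, Finset.sum_range_zero]
    norm_num
  · exact sqCount_prime hp h2 m

lemma sqDivSum_add {p : ℕ} (hp : p.Prime) (k : ℕ) (m : ℤ) (h : p ≠ 2 ∨ m = 0) :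
    sqDivSum m (p ^ (k + 1)) + sqDivSum m (p ^ k) = sqCount m (p ^ (k + 1)) := by
  induction k using Nat.strong_induction_on generalizing m with
  | _ k ih =>
  by_cases hm : ((p ^ 2 : ℕ) : ℤ) ∣ m
  · obtain ⟨m, rfl⟩ := hm
    have hp0 := hp.pos
    have h' : p ≠ 2 ∨ m = 0 := h.imp_right fun H => by
      rcases mul_eq_zero.1 H with H | H
      · simp_all
      · exact H
    have h0 : jacobiSym ((p ^ 2 : ℕ) * m) p = 0 :=
      jacobiSym_eq_zero_of_dvd hp (by rw [pow_two, cast_mul, mul_assoc]; simp)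
    match k, ih with
    | 0, _ =>
      rw [zero_add, pow_zero, pow_one, sqDivSum_one, sqDivSum_prime hp, sqCount_prime_of_or hp h, add_comm]
    | 1, _ =>
      have e := sqDivSum_sq_dvd hp m 0
      have e' := sqCount_sq_dvd hp m 0
      simp only [zero_add, pow_zero, sqDivSum_one, (sqCount_isMultiplicative m).1] at e e'
      push_cast at *
      rw [pow_one, sqDivSum_prime hp, h0]
      omega
    | k + 2, ih =>
      push_cast
      rw [show k + 2 + 1 = k + 1 + 2 by ring, sqDivSum_sq_dvd hp, sqDivSum_sq_dvd hp,
        sqCount_sq_dvd hp, ← mul_add]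
      grind
  · have h1 := sqCount_prime_of_or hp h
    have h2 : p ≠ 2 := h.resolve_right fun H => hm (H ▸ dvd_zero _)
    rw [sqDivSum_sq_not_dvd hp hm, sqDivSum_sq_not_dvd hp hm]
    by_cases hpm : (p : ℤ) ∣ m
    · rw [jacobiSym_eq_zero_of_dvd hp hpm] at h1 ⊢
      match k with
      | 0 => simp [h1]
      | k + 1 => rw [sqCount_prime_dvd hp hpm (mod_cast hm)]; simp
    · have e : sqCount m (p ^ (k + 1)) = sqCount m p := by
        clear ih
        induction k with
        | zero => simp
        | succ k ihk => rw [sqCount_hensel hp h2 hpm, ihk]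
      rw [e, h1]
      have hg : m.gcd p = 1 := by
        rw [← Int.isCoprime_iff_gcd_eq_one, isCoprime_comm]
        exact ((Nat.prime_iff_prime_int.1 hp).coprime_iff_not_dvd).2 hpm
      rcases jacobiSym.eq_one_or_neg_one hg with H | H <;> rw [H] <;> ring

lemma liouville_prime_pow {p : ℕ} (hp : p.Prime) (k : ℕ) : liouville (p ^ k) = (-1) ^ k := by
  rw [liouville_apply (pow_ne_zero _ hp.ne_zero), cardFactors_apply_prime_pow hp]

lemma liouville_mul_prime_pow {p : ℕ} (hp : p.Prime) (f : ArithmeticFunction ℤ) (k : ℕ) :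
    (liouville * f) (p ^ (k + 1)) + (liouville * f) (p ^ k) = f (p ^ (k + 1)) := by
  have h : ∀ k, (liouville * f) (p ^ k) = ∑ j ∈ range (k + 1), (-1) ^ (k - j) * f (p ^ j) := by
    intro k
    rw [mul_apply, Nat.sum_divisorsAntidiagonal' (fun a b => liouville a * f b),
      Nat.sum_divisors_prime_pow hp]
    refine sum_congr rfl fun j hj => ?_
    rw [Nat.pow_div (by grind) hp.pos, liouville_prime_pow hp]
  rw [h, h, sum_range_succ, add_right_comm, ← Finset.sum_add_distrib, sum_eq_zero]
  · simp
  · intro j hj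
    rw [Nat.succ_sub (by grind), pow_succ]
    ring

/-- The Liouville function convolved with the number of square roots. -/
lemma liouville_mul_sqCount {m : ℤ} {l : ℕ} (h : Odd l ∨ m = 0) :
    (liouville * sqCount m) l = sqDivSum m l := by
  have hM := isMultiplicative_liouville.mul (sqCount_isMultiplicative m)
  have hp : ∀ {p : ℕ} (k : ℕ), p.Prime → (p ≠ 2 ∨ m = 0) →
      (liouville * sqCount m) (p ^ k) = sqDivSum m (p ^ k) := by
    intro p k hp h
    induction k with
    | zero => rw [pow_zero, hM.1, sqDivSum_one]
    | succ k ih => linarith [liouville_mul_prime_pow hp (sqCount m) k, sqDivSum_add hp k m h]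
  induction l using Nat.recOnPosPrimePosCoprime with
  | prime_pow p k hp' hk =>
    grind
  | zero => simp
  | one => rw [hM.1, sqDivSum_one]
  | coprime a b ha hb hab iha ihb =>
    rw [hM.2 hab, (sqDivSum_isMultiplicative m).2 hab,
      iha (h.imp_left fun H => (odd_mul.1 H).1), ihb (h.imp_left fun H => (odd_mul.1 H).2)]

/-! ### The primitive part of the number of square roots -/

lemma isSquare_mul_iff_of_coprime {a b : ℕ} (h : a.Coprime b) :
    IsSquare (a * b) ↔ IsSquare a ∧ IsSquare b := by
  refine ⟨fun H => ?_, fun H => H.1.mul H.2⟩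
  obtain ⟨r, hr⟩ := (isSquare_iff_exists_sq _).1 H
  have h1 : IsUnit (gcd a b) := by simpa
  obtain ⟨d, hd⟩ := exists_eq_pow_of_mul_eq_pow h1 hr
  obtain ⟨e, he⟩ := exists_eq_pow_of_mul_eq_pow (by grind) ((mul_comm b a).trans hr)
  exact ⟨(isSquare_iff_exists_sq _).2 ⟨d, hd⟩, (isSquare_iff_exists_sq _).2 ⟨e, he⟩⟩

lemma liouville_mul_zeta {n : ℕ} (hn : n ≠ 0) :
    (liouville * (zeta : ArithmeticFunction ℤ)) n = if IsSquare n then 1 else 0 := by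
  have hM := isMultiplicative_liouville.mul isMultiplicative_zeta.natCast (R := ℤ)
  induction n using Nat.recOnPosPrimePosCoprime with
  | prime_pow p k hp hk =>
    have h : ∀ k, (liouville * (zeta : ArithmeticFunction ℤ)) (p ^ k) = if Even k then 1 else 0 := by
      intro k
      rw [coe_mul_zeta_apply, Nat.sum_divisors_prime_pow hp]
      induction k with
      | zero => simp [liouville_apply_one]
      | succ k ih =>
        rw [sum_range_succ, ih, liouville_prime_pow hp]
        rcases Nat.even_or_odd k with h | h
        · simp_all
        simp_all
    rw [h]
    have : IsSquare (p ^ k) ↔ Even k := by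
      refine ⟨fun ⟨r, hr⟩ => ?_, fun H => H.isSquare_pow p⟩
      have := congrArg (fun n => n.factorization p) hr
      have hr0 : r ≠ 0 := by grind
      simp only [Nat.factorization_mul hr0 hr0, hp.factorization_pow, Finsupp.single_eq_same,
        Finsupp.add_apply] at this
      grind
    grind
  | zero => omega
  | one => rw [hM.1]; simp
  | coprime a b ha hb hab iha ihb =>
    rw [hM.2 hab, iha (by omega), ihb (by omega)]
    simp only [isSquare_mul_iff_of_coprime hab]
    grind

/-- The Moebius transform of the number of square roots of `m`. -/
def sqPrim (m : ℤ) : ArithmeticFunction ℤ := moebius * sqCount m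

lemma sqPrim_isMultiplicative (m : ℤ) : (sqPrim m).IsMultiplicative :=
  isMultiplicative_moebius.mul (sqCount_isMultiplicative m)

lemma sqInd_mul_sqPrim {m : ℤ} {l : ℕ} (h : Odd l) :
    (liouville * (zeta : ArithmeticFunction ℤ) * sqPrim m) l = sqDivSum m l := by
  rw [← liouville_mul_sqCount (Or.inl h), sqPrim, mul_assoc, ← mul_assoc _ _ (sqCount m),
    coe_zeta_mul_moebius, one_mul]

lemma sum_range_fraction {M : Type*} [AddCommMonoid M] {q : ℕ} (hq : q ≠ 0) (f : ℕ → ℕ → M) :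
    ∑ a ∈ range q, f (a / q.gcd a) (q / q.gcd a) =
      ∑ d ∈ q.divisors, ∑ b ∈ (range d).filter d.Coprime, f b d := by
  have hg : ∀ a, 0 < q.gcd a := fun a => Nat.gcd_pos_of_pos_left _ (Nat.pos_of_ne_zero hq)
  rw [Finset.sum_sigma']
  refine Finset.sum_bij' (fun a _ => ⟨q / q.gcd a, a / q.gcd a⟩) (fun x _ => x.2 * (q / x.1)) ?_ ?_ ?_ ?_ ?_
  · intro a ha
    have ha := mem_range.1 ha
    simp only [mem_sigma, mem_divisors, mem_filter, mem_range]
    refine ⟨⟨Nat.div_dvd_of_dvd (Nat.gcd_dvd_left q a), hq⟩, ?_, Nat.coprime_div_gcd_div_gcd (hg a)⟩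
    exact Nat.div_lt_div_of_lt_of_dvd (Nat.gcd_dvd_left q a) ha
  · rintro ⟨d, b⟩ hx
    simp only [mem_sigma, mem_divisors, mem_filter, mem_range] at hx
    obtain ⟨⟨⟨r, rfl⟩, -⟩, hb, -⟩ := hx
    have hd : 0 < d := by omega
    have hr : 0 < r := Nat.pos_of_ne_zero (right_ne_zero_of_mul hq)
    simp_all
  · intro a _
    simp only
    rw [Nat.div_div_self (Nat.gcd_dvd_left q a) hq]
    exact Nat.div_mul_cancel (Nat.gcd_dvd_right q a)
  · rintro ⟨d, b⟩ hx
    simp only [mem_sigma, mem_divisors, mem_filter, mem_range] at hx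
    obtain ⟨⟨⟨r, rfl⟩, -⟩, hb, hc⟩ := hx
    have hd : 0 < d := by omega
    have hr : 0 < r := Nat.pos_of_ne_zero (right_ne_zero_of_mul hq)
    simp only
    rw [Nat.mul_div_cancel_left _ hd, Nat.gcd_mul_right, hc, one_mul, Nat.mul_div_cancel _ hr,
      Nat.mul_div_cancel _ hr]
  simp

/-- The sum of the Gauss sums `gaussS a q` against the additive character of `-m`. -/
def gaussTwist (m : ℤ) (a q : ℕ) : ℂ := ∑ x ∈ range q, exp (2 * π * I * (a * ((x : ℂ) ^ 2 - m)) / q)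

lemma gaussTwist_eq (m : ℤ) (a q : ℕ) [NeZero q] :
    gaussTwist m a q = gaussS a q * exp (-(2 * π * I * (a * m) / q)) := by
  rw [gaussS, ← sum_range_eq_sum_zmod (fun x : ZMod q => (stdAddChar (((a : ℤ) : ZMod q) * x ^ 2) : ℂ)),
    sum_mul, gaussTwist]
  refine sum_congr rfl fun x _ => ?_
  have := stdAddChar_mul_sq (q := q) a x
  push_cast at this ⊢
  rw [this, ← exp_add]
  ring_nf

lemma exp_periodic {q : ℕ} (hq : q ≠ 0) (y j : ℤ) : exp (2 * π * I * ((y + q * j : ℤ) : ℂ) / q) =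
      exp (2 * π * I * (y : ℂ) / q) := by
  have h : (q : ℂ) ≠ 0 := mod_cast hq
  rw [← Complex.exp_periodic.int_mul j (2 * π * I * (y : ℂ) / q)]
  congr 1; push_cast; field_simp

lemma gaussTwist_fraction {m : ℤ} {q : ℕ} (hq : q ≠ 0) (a : ℕ) :
    gaussTwist m a q = (q.gcd a : ℕ) * gaussTwist m (a / q.gcd a) (q / q.gcd a) := by
  have hg : 0 < q.gcd a := Nat.gcd_pos_of_pos_left _ (Nat.pos_of_ne_zero hq)
  obtain ⟨d, hd⟩ := Nat.gcd_dvd_left q a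
  obtain ⟨b, hb⟩ := Nat.gcd_dvd_right q a
  set g := q.gcd a
  have hd0 : d ≠ 0 := by grind
  rw [show a / g = b by simp_all, show q / g = d by simp_all]
  have hgc : (g : ℂ) ≠ 0 := mod_cast hg.ne'
  have h : ∀ x : ℕ, exp (2 * π * I * (a * ((x : ℂ) ^ 2 - m)) / q) =
      exp (2 * π * I * (b * ((x : ℂ) ^ 2 - m)) / d) := by
    intro x
    congr 1
    rw [hd, hb]
    grind
  have hp : ∀ k x : ℕ, exp (2 * π * I * (b * (((k * d + x : ℕ) : ℂ) ^ 2 - m)) / d) =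
      exp (2 * π * I * (b * ((x : ℂ) ^ 2 - m)) / d) := by
    intro k x
    have := exp_periodic hd0 (b * ((x : ℤ) ^ 2 - m)) (b * (k * (k * d + 2 * x)))
    push_cast at this ⊢
    grind
  rw [gaussTwist, gaussTwist]
  simp only [h]
  rw [hd]
  clear_value g
  clear h hb hd
  induction g with
  | zero => simp
  | succ k ih =>
    rw [add_mul, one_mul, Finset.sum_range_add]
    simp only [hp]
    rcases Nat.eq_zero_or_pos k with rfl | hk
    · simp
    · rw [ih hk (mod_cast hk.ne')]; grind

lemma sum_gaussTwist (m : ℤ) (q : ℕ) [NeZero q] :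
    ∑ a ∈ range q, gaussTwist m a q = q * sqCount m q := by
  classical
  have hq := NeZero.ne q
  simp only [gaussTwist]
  rw [Finset.sum_comm, sqCount_apply]
  push_cast
  rw [mul_sum]
  refine sum_congr rfl fun x _ => ?_
  have h1 : ∀ a : ℕ, exp (2 * π * I * (a * ((x : ℂ) ^ 2 - m)) / q) =
      stdAddChar ((a : ZMod q) * (((x : ℤ) ^ 2 - m : ℤ) : ZMod q)) := by
    intro a
    have := ZMod.stdAddChar_coe (N := q) (a * ((x : ℤ) ^ 2 - m))
    simp_all
  simp only [h1]
  rw [sum_range_eq_sum_zmod (fun a : ZMod q =>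
    (stdAddChar (a * (((x : ℤ) ^ 2 - m : ℤ) : ZMod q)) : ℂ)),
    AddChar.sum_mulShift _ (ZMod.isPrimitive_stdAddChar q), ZMod.card]
  simp only [ZMod.intCast_zmod_eq_zero_iff_dvd]
  simp

lemma sqPrim_eq_gaussTwist (m : ℤ) {q : ℕ} (hq : 0 < q) :
    ((sqPrim m q : ℤ) : ℂ) = (∑ b ∈ (range q).filter q.Coprime, gaussTwist m b q) / q := by
  have h := (sum_eq_iff_sum_mul_moebius_eq (R := ℂ)
    (f := fun d => (∑ b ∈ (range d).filter d.Coprime, gaussTwist m b d) / d)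
    (g := fun q => ((sqCount m q : ℤ) : ℂ))).1 ?_ q hq
  · rw [← h, sqPrim, mul_apply]
    simp
  · intro q hq
    have : NeZero q := ⟨hq.ne'⟩
    have hq' : (q : ℂ) ≠ 0 := mod_cast hq.ne'
    have e := sum_gaussTwist m q
    rw [sum_congr rfl fun a _ => gaussTwist_fraction hq.ne' a] at e
    have e2 := sum_range_fraction hq.ne' fun b d => gaussTwist m b d / d
    simp only [← Finset.sum_div] at e2
    rw [← e2]
    rw [eq_comm, ← mul_right_inj' hq', ← e, mul_sum]
    refine sum_congr rfl fun a _ => ?_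
    have hg : 0 < q.gcd a := Nat.gcd_pos_of_pos_left _ hq
    have hg' : ((q.gcd a : ℕ) : ℂ) ≠ 0 := mod_cast hg.ne'
    rw [Nat.cast_div (Nat.gcd_dvd_left q a) hg']
    field_simp

lemma norm_sqPrim_le_of_gaussS (m : ℤ) {q : ℕ} [NeZero q] {B : ℝ}
    (h : ∀ a : ℕ, a.Coprime q → ‖gaussS a q‖ ≤ B) : ‖((sqPrim m q : ℤ) : ℂ)‖ ≤ B := by
  have hq : 0 < q := Nat.pos_of_ne_zero (NeZero.ne q)
  have hB : 0 ≤ B := (norm_nonneg _).trans (h 1 (Nat.coprime_one_left q))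
  rw [sqPrim_eq_gaussTwist m hq, norm_div, Complex.norm_natCast, div_le_iff₀ (mod_cast hq)]
  calc _ ≤ ∑ b ∈ (range q).filter q.Coprime, B := norm_sum_le_of_le _ fun b hb => by
        rw [gaussTwist_eq, norm_mul]
        have : ‖exp (-(2 * π * I * (b * m) / q))‖ = 1 := by
          rw [show -(2 * π * I * ((b : ℂ) * m) / q) =
            ((-(2 * π * (b * m) / q) : ℝ) : ℂ) * I by push_cast; ring]
          exact norm_exp_ofReal_mul_I _
        rw [this, mul_one]
        grind
    _ ≤ B * q := by
        rw [sum_const, nsmul_eq_mul, mul_comm]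
        gcongr
        grind

lemma norm_sqPrim_le_of_four_dvd (m : ℤ) {q : ℕ} (hq : q ≠ 0) (h : 4 ∣ q) :
    ‖((sqPrim m q : ℤ) : ℂ)‖ ≤ 2 * √q := by
  have : NeZero q := ⟨hq⟩
  exact norm_sqPrim_le_of_gaussS m fun a ha => norm_gaussS_le h ha

lemma norm_sqPrim_le_of_odd (m : ℤ) {q : ℕ} (h : Odd q) : ‖((sqPrim m q : ℤ) : ℂ)‖ ≤ √q := by
  have : NeZero q := ⟨h.pos.ne'⟩
  refine norm_sqPrim_le_of_gaussS m fun a ha => ?_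
  rw [gaussS_odd q h a (Nat.isCoprime_iff_coprime.2 ha), norm_mul, norm_mul, norm_real,
    norm_of_nonneg (Real.sqrt_nonneg _)]
  have : ‖epsG q‖ ≤ 1 := by unfold epsG; split_ifs <;> simp
  calc _ ≤ 1 * 1 * √q := by gcongr; exact norm_jacobiSym_le _ _
    _ = _ := by ring

lemma sqPrim_two_pow {m : ℤ} {e : ℕ} (he : 2 ≤ e) (h : sqPrim m (2 ^ e) ≠ 0) : (2 : ℤ) ^ e ∣ 8 * m := by
  have : NeZero (2 ^ e) := ⟨by positivity⟩
  have hq : (2 ^ e : ℂ) ≠ 0 := pow_ne_zero _ two_ne_zero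
  set z := exp (-(2 * π * I * (8 * m) / (2 ^ e : ℕ))) with hz
  have hper : ∀ y j : ℕ, gaussTwist m (y + 2 ^ e * j) (2 ^ e) = gaussTwist m y (2 ^ e) := fun y j => by
    unfold gaussTwist
    refine sum_congr rfl fun x _ => ?_
    have := exp_periodic (q := 2 ^ e) (NeZero.ne _) (y * ((x : ℤ) ^ 2 - m)) (j * ((x : ℤ) ^ 2 - m))
    push_cast at this ⊢
    grind
  have hodd : ∀ a : ℕ, (2 ^ e).Coprime a ↔ Odd a := fun a => by
    rw [Nat.coprime_pow_left_iff (by omega), Nat.coprime_two_left]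
  have hsh : ∀ a : ℕ, Odd a → gaussTwist m (a + 8) (2 ^ e) = z * gaussTwist m a (2 ^ e) := fun a ha => by
    have h8 := gaussS_two_pow he (a := a + 8) (a' := a) (by grind) (by omega)
    rw [gaussTwist_eq, gaussTwist_eq, h8, mul_left_comm z, hz, ← exp_add]
    grind
  have hsum : ∑ b ∈ (range (2 ^ e)).filter (2 ^ e).Coprime, gaussTwist m b (2 ^ e) =
      z * ∑ b ∈ (range (2 ^ e)).filter (2 ^ e).Coprime, gaussTwist m b (2 ^ e) := by
    rw [mul_sum]
    have h1 : ∀ b ∈ (range (2 ^ e)).filter (2 ^ e).Coprime, z * gaussTwist m b (2 ^ e) =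
        gaussTwist m ((b + 8) % 2 ^ e) (2 ^ e) := fun b hb => by
      rw [← hsh b ((hodd b).1 (mem_filter.1 hb).2), ← hper ((b + 8) % 2 ^ e) ((b + 8) / 2 ^ e), Nat.mod_add_div]
    rw [sum_congr rfl h1]
    have hmaps : ∀ b ∈ (range (2 ^ e)).filter (2 ^ e).Coprime,
        (b + 8) % 2 ^ e ∈ (range (2 ^ e)).filter (2 ^ e).Coprime := fun b hb => by
      rw [mem_filter, mem_range] at *
      refine ⟨Nat.mod_lt _ (by positivity), ?_⟩
      rw [hodd] at *
      have h2 : 2 ∣ 2 ^ e := dvd_pow_self 2 (by omega)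
      rw [odd_iff, Nat.mod_mod_of_dvd _ h2] at *
      omega
    have hinj : Set.InjOn (fun b => (b + 8) % 2 ^ e) ((range (2 ^ e)).filter (2 ^ e).Coprime) := by
      intro b hb c hc hbc
      have hb := mem_range.1 (mem_filter.1 hb).1
      have hc := mem_range.1 (mem_filter.1 hc).1
      have : b % 2 ^ e = c % 2 ^ e := Nat.ModEq.add_right_cancel' 8 hbc
      rwa [Nat.mod_eq_of_lt hb, Nat.mod_eq_of_lt hc] at this
    symm
    refine Finset.sum_bij (fun b _ => (b + 8) % 2 ^ e) hmaps (fun b hb c hc => hinj hb hc) ?_ fun _ _ => rfl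
    exact fun c hc => (Finset.surjOn_of_injOn_of_card_le _ hmaps hinj le_rfl hc).imp fun b hb => ⟨hb.1, hb.2⟩
  have hne : ∑ b ∈ (range (2 ^ e)).filter (2 ^ e).Coprime, gaussTwist m b (2 ^ e) ≠ 0 := by
    intro H
    have := sqPrim_eq_gaussTwist m (q := 2 ^ e) (by positivity)
    rw [H, zero_div] at this
    exact h (mod_cast this)
  have hz1 : z = 1 := (mul_right_cancel₀ hne (by simpa)).symm
  rw [hz, Complex.exp_eq_one_iff] at hz1
  obtain ⟨n, hn⟩ := hz1
  refine ⟨-n, ?_⟩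
  have h2 : (2 * π * I : ℂ) ≠ 0 := Complex.two_pi_I_ne_zero
  have h3 : (8 * m : ℂ) = 2 ^ e * -n := by grind
  exact_mod_cast h3

/-! ### Dirichlet series over odd integers -/

lemma natCast_cpow_neg_mul (a b : ℕ) (s : ℂ) :
    (((a * b : ℕ) : ℂ)) ^ (-s) = (a : ℂ) ^ (-s) * (b : ℂ) ^ (-s) := by
  rw [cast_mul, Complex.natCast_mul_natCast_cpow]

lemma natCast_sq_cpow (g : ℕ) (s : ℂ) : ((g ^ 2 : ℕ) : ℂ) ^ (-s) = (g : ℂ) ^ (-(2 * s)) := by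
  rw [Nat.cast_pow, ← Complex.natCast_cpow_natCast_mul]
  simp

lemma odd_injective : Function.Injective fun j : ℕ => 2 * j + 1 := fun a b h => by simpa using h

lemma zetaTwo_eq_tsum {s : ℂ} (hs : 1 < s.re) :
    Summable (fun j : ℕ => ((2 * j + 1 : ℕ) : ℂ) ^ (-s)) ∧
      zetaTwo s = ∑' j : ℕ, ((2 * j + 1 : ℕ) : ℂ) ^ (-s) := by
  have hS : Summable fun n : ℕ => (n : ℂ) ^ (-s) := by
    have := Complex.summable_one_div_nat_cpow.2 hs
    simpa only [cpow_neg, one_div] using this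
  have ho : Summable fun j : ℕ => ((2 * j + 1 : ℕ) : ℂ) ^ (-s) := hS.comp_injective odd_injective
  have he : Summable fun j : ℕ => ((2 * j : ℕ) : ℂ) ^ (-s) :=
    hS.comp_injective (mul_right_injective₀ (two_ne_zero (α := ℕ)))
  have hz : riemannZeta s = ∑' n : ℕ, (n : ℂ) ^ (-s) := by
    rw [zeta_eq_tsum_one_div_nat_cpow hs]
    simp only [cpow_neg, one_div]
  have h2 : ∑' k : ℕ, ((2 * k : ℕ) : ℂ) ^ (-s) = (2 : ℂ) ^ (-s) * riemannZeta s := by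
    simp only [natCast_cpow_neg_mul, tsum_mul_left, hz, cast_ofNat]
  have h3 := tsum_even_add_odd (f := fun n : ℕ => (n : ℂ) ^ (-s)) he ho
  rw [← hz, h2] at h3
  refine ⟨ho, ?_⟩
  rw [zetaTwo, sub_mul, one_mul, sub_eq_iff_eq_add, add_comm]
  exact h3.symm

/-- The restriction of an arithmetic function to odd integers. -/
def oddPart (f : ArithmeticFunction ℤ) : ArithmeticFunction ℂ :=
  ⟨fun n => if Odd n then (f n : ℂ) else 0, by simp⟩

lemma oddPart_apply (f : ArithmeticFunction ℤ) (n : ℕ) :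
    oddPart f n = if Odd n then (f n : ℂ) else 0 := rfl

lemma oddPart_mul (f g : ArithmeticFunction ℤ) : oddPart (f * g) = oddPart f * oddPart g := by
  ext n
  rw [mul_apply, oddPart_apply]
  split_ifs with h
  · rw [mul_apply, Int.cast_sum]
    refine sum_congr rfl fun x hx => ?_
    have h1 := odd_mul.1 ((Nat.mem_divisorsAntidiagonal.1 hx).1.symm ▸ h)
    rw [oddPart_apply, oddPart_apply, if_pos h1.1, if_pos h1.2, Int.cast_mul]
  · refine (sum_eq_zero fun x hx => ?_).symm
    rw [← (Nat.mem_divisorsAntidiagonal.1 hx).1, odd_mul, not_and_or] at h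
    rw [oddPart_apply, oddPart_apply]
    grind

lemma term_oddPart (f : ArithmeticFunction ℤ) (s : ℂ) (j : ℕ) :
    LSeries.term (oddPart f) s (2 * j + 1) = f (2 * j + 1) * ((2 * j + 1 : ℕ) : ℂ) ^ (-s) := by
  rw [LSeries.term_of_ne_zero (by omega), oddPart_apply, if_pos (by simp), cpow_neg, div_eq_mul_inv]

lemma support_term_oddPart (f : ArithmeticFunction ℤ) (s : ℂ) :
    Function.support (LSeries.term (oddPart f) s) ⊆ Set.range fun j : ℕ => 2 * j + 1 := by
  intro n hn
  have h0 : n ≠ 0 := by rintro rfl; simp at hn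
  rw [Function.mem_support, LSeries.term_of_ne_zero h0, oddPart_apply] at hn
  simp_all

lemma LSeries_oddPart (f : ArithmeticFunction ℤ) (s : ℂ) :
    LSeries (oddPart f) s = ∑' j : ℕ, (f (2 * j + 1) : ℂ) * ((2 * j + 1 : ℕ) : ℂ) ^ (-s) := by
  rw [LSeries, ← odd_injective.tsum_eq (support_term_oddPart f s)]
  simp only [term_oddPart]

lemma LSeriesSummable_oddPart {f : ArithmeticFunction ℤ} {s : ℂ} : LSeriesSummable (oddPart f) s ↔
      Summable fun j : ℕ => (f (2 * j + 1) : ℂ) * ((2 * j + 1 : ℕ) : ℂ) ^ (-s) := by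
  rw [LSeriesSummable, ← odd_injective.summable_iff (fun n hn => by
    by_contra h; exact hn (support_term_oddPart f s h))]
  simp only [Function.comp_def, term_oddPart]

lemma norm_natCast_cpow_neg {n : ℕ} (hn : 0 < n) (s : ℂ) : ‖(n : ℂ) ^ (-s)‖ = (n : ℝ) ^ (-s.re) := by
  rw [norm_natCast_cpow_of_pos hn, neg_re]

lemma summable_sqPrim_odd (m : ℤ) {s : ℂ} (hs : 3 / 2 < s.re) :
    Summable fun j : ℕ => ((sqPrim m (2 * j + 1) : ℤ) : ℂ) * ((2 * j + 1 : ℕ) : ℂ) ^ (-s) := by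
  have h1 : Summable fun n : ℕ => (n : ℝ) ^ (1 / 2 - s.re) := Real.summable_nat_rpow.2 (by linarith)
  refine of_norm_bounded (h1.comp_injective odd_injective) fun j => ?_
  have h0 : 0 < 2 * j + 1 := by omega
  have h0' : (0 : ℝ) < (2 * j + 1 : ℕ) := mod_cast h0
  rw [norm_mul, norm_natCast_cpow_neg h0, Function.comp_def]
  simp only
  rw [sub_eq_add_neg, rpow_add h0', ← sqrt_eq_rpow]
  gcongr
  exact norm_sqPrim_le_of_odd m (by simp)

lemma sum_sqInd_odd {s : ℂ} (hs : 1 / 2 < s.re) :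
    LSeriesSummable (oddPart (liouville * (zeta : ArithmeticFunction ℤ))) s ∧
    LSeries (oddPart (liouville * (zeta : ArithmeticFunction ℤ))) s = zetaTwo (2 * s) := by
  have h2 : 1 < (2 * s).re := by simp; linarith
  obtain ⟨hS, hz⟩ := zetaTwo_eq_tsum h2
  set F := LSeries.term (oddPart (liouville * (zeta : ArithmeticFunction ℤ))) s
  have hinj : Function.Injective fun j : ℕ => (2 * j + 1) ^ 2 :=
    (Nat.pow_left_injective (n := 2) (by norm_num)).comp odd_injective
  have hF : ∀ j : ℕ, F ((2 * j + 1) ^ 2) = ((2 * j + 1 : ℕ) : ℂ) ^ (-(2 * s)) := fun j => by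
    have h1 : Odd ((2 * j + 1) ^ 2) := Odd.pow (by simp)
    rw [show F _ = _ from LSeries.term_of_ne_zero (by positivity) _ _, oddPart_apply, if_pos h1,
      liouville_mul_zeta (by positivity), if_pos (IsSquare.sq _), Int.cast_one, one_div, ← cpow_neg,
      natCast_sq_cpow]
  have hsupp : Function.support F ⊆ Set.range fun j : ℕ => (2 * j + 1) ^ 2 := by
    intro n hn
    obtain ⟨j, rfl⟩ := support_term_oddPart _ s hn
    have hn : F (2 * j + 1) ≠ 0 := hn
    rw [show F (2 * j + 1) = _ from term_oddPart _ s j, liouville_mul_zeta (by omega)] at hn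
    have : IsSquare (2 * j + 1) := by simp_all
    obtain ⟨r, hr⟩ := this
    have hr' : Odd r := by
      have : Odd (r * r) := hr ▸ (by simp)
      grind
    obtain ⟨i, rfl⟩ := hr'
    exact ⟨i, by grind⟩
  constructor
  · rw [LSeriesSummable, ← hinj.summable_iff fun n hn => by by_contra h; exact hn (hsupp h)]
    rw [show LSeries.term _ s ∘ _ = _ from funext hF]
    exact hS
  · rw [LSeries, ← hinj.tsum_eq hsupp, hz]
    simp only [hF]

lemma zetaTwo_mul_sqPrim_odd (m : ℤ) {s : ℂ} (hs : 3 / 2 < s.re) :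
    zetaTwo (2 * s) * ∑' j : ℕ, ((sqPrim m (2 * j + 1) : ℤ) : ℂ) * ((2 * j + 1 : ℕ) : ℂ) ^ (-s) =
      ∑' j : ℕ, ((sqDivSum m (2 * j + 1) : ℤ) : ℂ) * ((2 * j + 1 : ℕ) : ℂ) ^ (-s) := by
  obtain ⟨hS, hz⟩ := sum_sqInd_odd (s := s) (by linarith)
  have h1 := LSeriesSummable_oddPart.2 (summable_sqPrim_odd m hs)
  have := LSeries_mul' hS h1
  rw [hz, ← oddPart_mul, LSeries_oddPart, LSeries_oddPart] at this
  rw [← this]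
  exact tsum_congr fun j => by rw [sqInd_mul_sqPrim (by simp)]

/-! ### The Dirichlet series of the Eisenstein coefficients -/

/-- The Euler factor at `2`. -/
def twoFactor (m : ℤ) (s : ℂ) : ℂ :=
  ∑' e : ℕ, ((sqPrim m (2 ^ (e + 2)) : ℤ) : ℂ) * ((2 ^ (e + 2) : ℕ) : ℂ) ^ (-s)

/-- The Dirichlet series of the quadratic symbol `(D / ·)` over odd integers. -/
def oddL (D : ℤ) (s : ℂ) : ℂ :=
  ∑' j : ℕ, ((jacobiSym D (2 * j + 1) : ℤ) : ℂ) * ((2 * j + 1 : ℕ) : ℂ) ^ (-s)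

lemma summable_twoFactor (m : ℤ) {s : ℂ} (hs : 1 / 2 < s.re) :
    Summable fun e : ℕ => ((sqPrim m (2 ^ (e + 2)) : ℤ) : ℂ) * ((2 ^ (e + 2) : ℕ) : ℂ) ^ (-s) := by
  set r : ℝ := (2 : ℝ) ^ (1 / 2 - s.re) with hr
  have hr0 : 0 ≤ r := by positivity
  have hr1 : r < 1 := Real.rpow_lt_one_of_one_lt_of_neg one_lt_two (by linarith)
  have h1 : Summable fun e : ℕ => 2 * r ^ (e + 2) :=
    ((summable_nat_add_iff 2).2 (summable_geometric_of_lt_one hr0 hr1)).mul_left 2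
  refine of_norm_bounded h1 fun e => ?_
  have h0 : 0 < 2 ^ (e + 2) := by positivity
  have h0' : (0 : ℝ) < (2 ^ (e + 2) : ℕ) := mod_cast h0
  have : r ^ (e + 2) = ((2 ^ (e + 2) : ℕ) : ℝ) ^ (1 / 2 - s.re) := by
    rw [hr, ← rpow_natCast, ← rpow_mul (by norm_num), mul_comm, rpow_mul (by norm_num),
      rpow_natCast]
    simp
  rw [norm_mul, norm_natCast_cpow_neg h0, this, sub_eq_add_neg, rpow_add h0', ← sqrt_eq_rpow,
    ← mul_assoc]
  gcongr
  exact norm_sqPrim_le_of_four_dvd m h0.ne' (by rw [pow_add]; simp)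

lemma tsum_four_dvd_sqPrim (m : ℤ) {s : ℂ} (hs : 3 / 2 < s.re) :
    ∑' c : ℕ, (if 4 ∣ c then ((sqPrim m c : ℤ) : ℂ) * (c : ℂ) ^ (-s) else 0) =
      twoFactor m s * ∑' j : ℕ, ((sqPrim m (2 * j + 1) : ℤ) : ℂ) * ((2 * j + 1 : ℕ) : ℂ) ^ (-s) := by
  rw [twoFactor, tsum_mul_tsum_of_summable_norm (summable_twoFactor m (by linarith)).norm
    (summable_sqPrim_odd m hs).norm]
  have hinj : Function.Injective fun x : ℕ × ℕ => 2 ^ (x.1 + 2) * (2 * x.2 + 1) := by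
    rintro ⟨a, b⟩ ⟨c, d⟩ h
    simp only at h
    have h1 : ∀ a b : ℕ, padicValNat 2 (2 ^ (a + 2) * (2 * b + 1)) = a + 2 := fun a b => by simp
    have h2 := congrArg (padicValNat 2) h
    rw [h1, h1] at h2
    simp_all
  rw [← hinj.tsum_eq]
  · refine tsum_congr fun x => ?_
    have hc : (2 ^ (x.1 + 2)).Coprime (2 * x.2 + 1) := Coprime.pow_left _ (by simp)
    rw [if_pos ((Dvd.intro_left (2 ^ x.1) (pow_add 2 x.1 2).symm).mul_right _),
      (sqPrim_isMultiplicative m).2 hc, natCast_cpow_neg_mul]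
    grind
  · intro c hc
    have hc : (if 4 ∣ c then ((sqPrim m c : ℤ) : ℂ) * (c : ℂ) ^ (-s) else 0) ≠ 0 := hc
    have h4 : 4 ∣ c := by grind
    have hc0 : c ≠ 0 := by rintro rfl; simp at hc
    obtain ⟨k, n, hn, rfl⟩ := Nat.exists_eq_two_pow_mul_odd hc0
    obtain ⟨j, rfl⟩ := hn
    have hk : 2 ≤ k := by
      by_contra h
      interval_cases k <;> omega
    exact ⟨(k - 2, j), by grind⟩

lemma zetaTwo_mul_tsum_sqPrim (m : ℤ) {s : ℂ} (hs : 3 / 2 < s.re) :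
    zetaTwo (2 * s) * ∑' c : ℕ, (if 4 ∣ c then ((sqPrim m c : ℤ) : ℂ) * (c : ℂ) ^ (-s) else 0) =
      twoFactor m s * ∑' j : ℕ, ((sqDivSum m (2 * j + 1) : ℤ) : ℂ) * ((2 * j + 1 : ℕ) : ℂ) ^ (-s) := by
  rw [tsum_four_dvd_sqPrim m hs, mul_left_comm, zetaTwo_mul_sqPrim_odd m hs]

/-! ### Continuation of the Hurwitz zeta function, with bounds -/

/-- The binomial coefficient `-w` over `j`. -/
def binom (w : ℂ) : ℕ → ℂ
  | 0 => 1
  | j + 1 => binom w j * (-(w + j)) / (j + 1)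

lemma binom_succ_mul (w : ℂ) (j : ℕ) : (j + 1) * binom w (j + 1) = binom w j * (-(w + j)) := by
  have : (j + 1 : ℂ) ≠ 0 := mod_cast succ_ne_zero j
  rw [binom]; field_simp

lemma binom_succ_mul' (w : ℂ) (j : ℕ) : (j + 1) * binom w (j + 1) = -w * binom (w + 1) j := by
  induction j with
  | zero => simp [binom]
  | succ j ih =>
    have h0 : (j + 1 : ℂ) ≠ 0 := mod_cast succ_ne_zero j
    have h2 := binom_succ_mul (w + 1) j
    rw [binom_succ_mul, ← mul_right_inj' h0]
    grind

lemma differentiable_binom (j : ℕ) : Differentiable ℂ fun w => binom w j := by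
  induction j with
  | zero => exact differentiable_const _
  | succ j ih =>
    simp only [binom]
    fun_prop

/-- The remainder of the binomial series of `(1 + x)^(-w)`. -/
def powRem (J : ℕ) (w : ℂ) (x : ℝ) : ℂ :=
  ((1 + x : ℝ) : ℂ) ^ (-w) - ∑ j ∈ range J, binom w j * (x : ℂ) ^ j

lemma powRem_succ (J : ℕ) (w : ℂ) (x : ℝ) :
    powRem (J + 1) w x = powRem J w x - binom w J * (x : ℂ) ^ J := by
  rw [powRem, powRem, sum_range_succ]; ring

lemma hasDerivAt_powRem (J : ℕ) (w : ℂ) {x : ℝ} (hx : 0 ≤ x) :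
    HasDerivAt (powRem (J + 1) w) (-w * powRem J (w + 1) x) x := by
  have h1 : HasDerivAt (fun x : ℝ => ((1 + x : ℝ) : ℂ) ^ (-w))
      (-w * ((1 + x : ℝ) : ℂ) ^ (-(w + 1))) x := by
    have h2 : HasDerivAt (fun z : ℂ => (1 + z) ^ (-w)) (-w * (1 + (x : ℂ)) ^ (-w - 1) * 1) (x : ℂ) := by
      refine ((hasDerivAt_id (x : ℂ)).const_add 1).cpow_const (Or.inl ?_)
      simp only [id, add_re, one_re, ofReal_re]
      linarith
    convert h2.comp_ofReal using 1
    · simp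
    push_cast; ring_nf
  have h4 : HasDerivAt (fun x : ℝ => ∑ j ∈ range (J + 1), binom w j * (x : ℂ) ^ j)
      (-w * ∑ j ∈ range J, binom (w + 1) j * (x : ℂ) ^ j) x := by
    have h5 : HasDerivAt (fun x : ℝ => ∑ j ∈ range (J + 1), binom w j * (x : ℂ) ^ j)
        (∑ j ∈ range (J + 1), binom w j * (j * (x : ℂ) ^ (j - 1))) x := by
      refine HasDerivAt.fun_sum fun j _ => HasDerivAt.const_mul _ ?_
      simpa using (hasDerivAt_pow j (x : ℂ)).comp_ofReal
    convert h5 using 1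
    rw [sum_range_succ', mul_sum]
    simp only [cast_zero, zero_mul, mul_zero, add_zero]
    refine sum_congr rfl fun j _ => ?_
    rw [Nat.add_sub_cancel, cast_succ, ← mul_assoc, ← mul_assoc, ← binom_succ_mul' w j,
      mul_comm (binom w (j + 1))]
  have := h1.sub h4
  rw [powRem, mul_sub]
  exact this

lemma exists_norm_powRem_le (J : ℕ) : ∀ R : ℝ, 0 ≤ R → ∃ C : ℝ, 0 ≤ C ∧ ∀ w : ℂ, ‖w‖ ≤ R →
    ∀ x ∈ Icc (0 : ℝ) 1, ‖powRem J w x‖ ≤ C * x ^ J := by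
  induction J with
  | zero =>
    intro R hR
    refine ⟨2 ^ R, by positivity, fun w hw x hx => ?_⟩
    have h0 : 0 < 1 + x := by grind
    simp only [powRem, range_zero, sum_empty, sub_zero, pow_zero, mul_one]
    rw [norm_cpow_eq_rpow_re_of_pos h0]
    calc (1 + x) ^ (-w).re ≤ (1 + x) ^ R := Real.rpow_le_rpow_of_exponent_le (by grind)
          ((re_le_norm _).trans (by simpa))
      _ ≤ 2 ^ R := Real.rpow_le_rpow h0.le (by grind) hR
  | succ J ih =>
    intro R hR
    obtain ⟨C, hC, h⟩ := ih (R + 1) (by linarith)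
    refine ⟨R * C, by positivity, fun w hw x hx => ?_⟩
    have h0 : powRem (J + 1) w 0 = 0 := by
      rw [powRem, sum_range_succ']
      simp [binom]
    have := norm_image_sub_le_of_norm_deriv_le_segment' (f := powRem (J + 1) w)
      (f' := fun y => -w * powRem J (w + 1) y) (a := 0) (b := x) (C := R * C * x ^ J)
      (fun y hy => (hasDerivAt_powRem J w hy.1).hasDerivWithinAt) (fun y hy => by
        rw [norm_mul, norm_neg, mul_assoc]
        have h1 : ‖w + 1‖ ≤ R + 1 := (norm_add_le _ _).trans (by simpa)
        have h2 := h (w + 1) h1 y ⟨hy.1, hy.2.le.trans hx.2⟩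
        have h3 : y ^ J ≤ x ^ J := pow_le_pow_left₀ hy.1 hy.2.le _
        gcongr
        exact h2.trans (by gcongr)) x ⟨hx.1, le_rfl⟩
    rw [h0, sub_zero, sub_zero] at this
    calc _ ≤ _ := this
      _ = _ := by ring

/-- The entire function `(s - 1) ζ(s)`. -/
def zetaStar (s : ℂ) : ℂ := if s = 1 then 1 else (s - 1) * riemannZeta s

lemma zetaStar_of_ne {s : ℂ} (hs : s ≠ 1) : zetaStar s = (s - 1) * riemannZeta s := if_neg hs

lemma differentiable_zetaStar : Differentiable ℂ zetaStar := by
  have h1 : ∀ s ≠ 1, DifferentiableAt ℂ zetaStar s := fun s hs => by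
    have : zetaStar =ᶠ[𝓝 s] fun s => (s - 1) * riemannZeta s := by
      filter_upwards [isOpen_ne.mem_nhds hs] with z hz using zetaStar_of_ne hz
    exact ((differentiableAt_id.sub_const 1).mul (differentiableAt_riemannZeta hs)).congr_of_eventuallyEq this
  intro s
  by_cases hs : s = 1
  · subst hs
    refine (Complex.analyticAt_of_differentiable_on_punctured_nhds_of_continuousAt ?_ ?_).differentiableAt
    · filter_upwards [self_mem_nhdsWithin] with z hz using h1 z hz
    · rw [continuousAt_iff_punctured_nhds, show zetaStar 1 = 1 from if_pos rfl]
      refine riemannZeta_residue_one.congr' ?_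
      filter_upwards [self_mem_nhdsWithin] with z hz using (zetaStar_of_ne hz).symm
  grind

/-- The terms of the convergent part of the Hurwitz zeta function. -/
def hurwTerm (J : ℕ) (w : ℂ) (a : ℝ) (n : ℕ) : ℂ :=
  ((n + 1 : ℕ) : ℂ) ^ (-w) * powRem J w (a / (n + 1 : ℕ))

lemma exists_norm_hurwTerm_le (J : ℕ) {R : ℝ} (hR : 0 ≤ R) : ∃ C : ℝ, 0 ≤ C ∧ ∀ w : ℂ, ‖w‖ ≤ R →
    ∀ a ∈ Icc (0 : ℝ) 1, ∀ n : ℕ, ‖hurwTerm J w a n‖ ≤ C * ((n + 1 : ℕ) : ℝ) ^ (-(w.re + J)) := by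
  obtain ⟨C, hC, h⟩ := exists_norm_powRem_le J R hR
  refine ⟨C, hC, fun w hw a ha n => ?_⟩
  have h0 : (0 : ℝ) < (n + 1 : ℕ) := by positivity
  have h1 : (1 : ℝ) ≤ (n + 1 : ℕ) := by simp
  have hx : a / (n + 1 : ℕ) ∈ Icc (0 : ℝ) 1 :=
    ⟨div_nonneg ha.1 h0.le, (div_le_one h0).2 (ha.2.trans h1)⟩
  rw [hurwTerm, norm_mul, norm_natCast_cpow_of_pos (Nat.succ_pos n), neg_add, rpow_add h0,
    mul_left_comm, neg_re]
  gcongr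
  refine (h w hw _ hx).trans ?_
  gcongr
  rw [rpow_neg h0.le, rpow_natCast, div_pow, div_eq_mul_inv]
  calc a ^ J * _ ≤ 1 * _ := by gcongr; exact pow_le_one₀ ha.1 ha.2
    _ = _ := one_mul _

lemma summable_succ_rpow {r : ℝ} (hr : 1 < r) : Summable fun n : ℕ => ((n + 1 : ℕ) : ℝ) ^ (-r) :=
  (summable_nat_add_iff 1).2 (Real.summable_nat_rpow.2 (by linarith))

lemma summable_hurwTerm {J : ℕ} {w : ℂ} {a : ℝ} (hw : 1 < w.re + J) (ha : a ∈ Icc (0 : ℝ) 1) :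
    Summable (hurwTerm J w a) := by
  obtain ⟨C, hC, h⟩ := exists_norm_hurwTerm_le J (norm_nonneg w)
  exact of_norm_bounded ((summable_succ_rpow hw).mul_left C) (h w le_rfl a ha)

/-- The Hurwitz zeta function times `w - 1`, for `Re w > -J`. -/
def hurwAux (J : ℕ) (w : ℂ) (a : ℝ) : ℂ := (w - 1) * (a : ℂ) ^ (-w) + zetaStar w -
    (w - 1) * ∑ j ∈ range J, binom w j / (j + 1) * (a : ℂ) ^ (j + 1) * zetaStar (w + j + 1) +
    (w - 1) * ∑' n, hurwTerm (J + 1) w a n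

lemma hasSum_succ_cpow {s : ℂ} (hs : 1 < s.re) :
    HasSum (fun n : ℕ => ((n + 1 : ℕ) : ℂ) ^ (-s)) (riemannZeta s) := by
  have hS : Summable fun n : ℕ => (n : ℂ) ^ (-s) := by
    have := Complex.summable_one_div_nat_cpow.2 hs
    simpa only [cpow_neg, one_div] using this
  rw [((summable_nat_add_iff 1).2 hS).hasSum_iff, zeta_eq_tsum_one_div_nat_add_one_cpow hs]
  refine tsum_congr fun n => ?_
  rw [cpow_neg, one_div]; simp

lemma hurwAux_succ {J : ℕ} {w : ℂ} {a : ℝ} (hw : 0 < w.re + J) (ha : a ∈ Icc (0 : ℝ) 1) :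
    hurwAux (J + 1) w a = hurwAux J w a := by
  have h1 : 1 < (w + J + 1).re := by simpa
  have hz := hasSum_succ_cpow h1
  have hne : w + J + 1 ≠ 1 := fun h => by simp_all
  have hS := (summable_hurwTerm (J := J + 1) (w := w) (a := a) (by grind) ha).hasSum
  have hT : HasSum (hurwTerm (J + 1 + 1) w a) (∑' n, hurwTerm (J + 1) w a n -
      binom w (J + 1) * (a : ℂ) ^ (J + 1) * riemannZeta (w + J + 1)) := by
    refine (hS.sub (hz.mul_left _)).congr_fun ?_
    intro n
    have h0 : ((n + 1 : ℕ) : ℂ) ≠ 0 := mod_cast succ_ne_zero n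
    have h2 : ((n + 1 : ℕ) : ℂ) ^ (-(w + J + 1)) =
        ((n + 1 : ℕ) : ℂ) ^ (-w) * (((n + 1 : ℕ) : ℂ) ^ (J + 1))⁻¹ := by
      rw [show -(w + J + 1) = -w - ((J + 1 : ℕ) : ℂ) by grind, cpow_sub _ _ h0,
        Complex.cpow_natCast, div_eq_mul_inv]
    rw [hurwTerm, hurwTerm, powRem_succ (J + 1), h2]
    push_cast
    rw [div_pow]
    ring
  rw [hurwAux, hurwAux, hT.tsum_eq, sum_range_succ, zetaStar_of_ne hne]
  have := binom_succ_mul w J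
  have hJ : (J + 1 : ℂ) ≠ 0 := mod_cast succ_ne_zero J
  grind

lemma hurwAux_eq {J J' : ℕ} {w : ℂ} {a : ℝ} (hw : 0 < w.re + J) (h : J ≤ J')
    (ha : a ∈ Icc (0 : ℝ) 1) : hurwAux J' w a = hurwAux J w a := by
  induction J', h using Nat.le_induction with
  | base => rfl
  | succ J' h ih =>
    rw [hurwAux_succ _ ha, ih]
    have : (J : ℝ) ≤ J' := mod_cast h
    linarith

lemma hurwAux_of_one_lt {J : ℕ} {w : ℂ} {a : ℝ} (hw : 1 < w.re) (ha : a ∈ Ioc (0 : ℝ) 1) :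
    HasSum (fun k : ℕ => (w - 1) * ((k + a : ℝ) : ℂ) ^ (-w)) (hurwAux J w a) := by
  have ha' : a ∈ Icc (0 : ℝ) 1 := ⟨ha.1.le, ha.2⟩
  rw [hurwAux_eq (J := 0) (by grind) (Nat.zero_le J) ha']
  have hz := hasSum_succ_cpow hw
  have hne : w ≠ 1 := fun h => by simp_all
  have hS := (summable_hurwTerm (J := 1) (w := w) (a := a) (by grind) ha').hasSum
  have h1 : HasSum (fun k : ℕ => (w - 1) * (((k + 1 : ℕ) + a : ℝ) : ℂ) ^ (-w))
      ((w - 1) * (∑' n, hurwTerm 1 w a n + riemannZeta w)) := by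
    refine ((hS.add hz).mul_left _).congr_fun ?_
    intro n
    have h0 : (0 : ℝ) < (n + 1 : ℕ) := by positivity
    rw [hurwTerm, powRem, Finset.sum_range_one, binom, pow_zero, mul_one, mul_sub, mul_one, sub_add_cancel]
    have h2 : (((n + 1 : ℕ) : ℝ) + a) = ((n + 1 : ℕ) : ℝ) * (1 + a / (n + 1 : ℕ)) := by field_simp
    rw [h2, ofReal_mul, mul_cpow_ofReal_nonneg h0.le (by have := ha.1; positivity)]
    simp
  have h2 := (hasSum_nat_add_iff (f := fun k : ℕ => (w - 1) * ((k + a : ℝ) : ℂ) ^ (-w)) 1).1 h1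
  have h3 : hurwAux 0 w a = (w - 1) * (∑' n, hurwTerm 1 w a n + riemannZeta w) +
      ∑ i ∈ range 1, (w - 1) * ((i + a : ℝ) : ℂ) ^ (-w) := by
    rw [hurwAux, zetaStar_of_ne hne, Finset.sum_range_one, range_zero, sum_empty]
    ring_nf
  grind

lemma differentiableAt_hurwAux {J : ℕ} {w : ℂ} {a : ℝ} (hw : 1 < w.re + J) (ha : a ∈ Ioc (0 : ℝ) 1) :
    DifferentiableAt ℂ (fun w => hurwAux J w a) w := by
  have ha' : a ∈ Icc (0 : ℝ) 1 := ⟨ha.1.le, ha.2⟩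
  set U : Set ℂ := {z | ‖z‖ < ‖w‖ + 1 ∧ 1 < z.re + J} with hU
  have hUo : IsOpen U := (isOpen_lt continuous_norm continuous_const).inter
    (isOpen_lt continuous_const (continuous_re.add continuous_const))
  have hwU : w ∈ U := ⟨by linarith, hw⟩
  obtain ⟨C, hC, h⟩ := exists_norm_hurwTerm_le (J + 1) (R := ‖w‖ + 1) (by positivity)
  have ha0 : (a : ℂ) ≠ 0 := mod_cast ha.1.ne'
  have hT : DifferentiableOn ℂ (fun z => ∑' n, hurwTerm (J + 1) z a n) U := by
    refine Complex.differentiableOn_tsum_of_summable_norm (u := fun n : ℕ => C * ((n + 1 : ℕ) : ℝ) ^ (-(2 : ℝ)))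
      ((summable_succ_rpow (by norm_num)).mul_left C) (fun n => ?_) hUo fun n z hz => ?_
    · intro z _
      have h1 : ((n + 1 : ℕ) : ℂ) ≠ 0 := mod_cast succ_ne_zero n
      have h2 : ((1 + a / (n + 1 : ℕ) : ℝ) : ℂ) ≠ 0 := by
        have := ha.1
        exact_mod_cast (by positivity : (0 : ℝ) < 1 + a / (n + 1 : ℕ)).ne'
      refine DifferentiableAt.differentiableWithinAt ?_
      unfold hurwTerm powRem
      have hb := fun j => (differentiable_binom j).differentiableAt (x := z)
      have e1 := (differentiableAt_id (𝕜 := ℂ) (x := z)).neg.const_cpow (c := ((n + 1 : ℕ) : ℂ)) (Or.inl h1)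
      have e2 := (differentiableAt_id (𝕜 := ℂ) (x := z)).neg.const_cpow
        (c := ((1 + a / (n + 1 : ℕ) : ℝ) : ℂ)) (Or.inl h2)
      fun_prop
    · refine (h z hz.1.le a ha' n).trans ?_
      gcongr
      · simp
      grind
  have hT' := hT.differentiableAt (hUo.mem_nhds hwU)
  have e1 := (differentiableAt_id (𝕜 := ℂ) (x := w)).neg.const_cpow (c := (a : ℂ)) (Or.inl ha0)
  have hw1 : DifferentiableAt ℂ (fun w : ℂ => w - 1) w := differentiableAt_id.sub_const 1
  unfold hurwAux
  refine (((hw1.mul e1).add (differentiable_zetaStar w)).sub (hw1.mul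
    (DifferentiableAt.fun_sum fun j _ => ?_))).add (hw1.mul hT')
  refine (((differentiable_binom j w).div_const _).mul_const _).mul ?_
  exact (differentiable_zetaStar (w + j + 1)).comp w
    (f := fun z : ℂ => z + j + 1) ((differentiableAt_id.add_const _).add_const _)

lemma exists_norm_hurwAux_le (J : ℕ) {R : ℝ} (hR : 0 ≤ R) : ∃ C : ℝ, 0 ≤ C ∧ ∀ w : ℂ, ‖w‖ ≤ R →
    1 < w.re + J → ∀ a ∈ Ioc (0 : ℝ) 1, ‖hurwAux J w a‖ ≤ C * a⁻¹ ^ R := by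
  obtain ⟨C₁, hC₁, h₁⟩ := exists_norm_hurwTerm_le (J + 1) hR
  obtain ⟨C₂, h₂⟩ := (isCompact_closedBall (0 : ℂ) (R + J + 1)).exists_bound_of_continuousOn
    differentiable_zetaStar.continuous.continuousOn
  have hb : ∀ j, ∃ B : ℝ, 0 ≤ B ∧ ∀ w : ℂ, ‖w‖ ≤ R → ‖binom w j‖ ≤ B := fun j => by
    obtain ⟨B, h⟩ := (isCompact_closedBall (0 : ℂ) R).exists_bound_of_continuousOn
      (differentiable_binom j).continuous.continuousOn
    exact ⟨B, (norm_nonneg _).trans (h 0 (by simpa)), fun w hw => h w (by simpa)⟩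
  choose B hB0 hB using hb
  set S := ∑' n : ℕ, ((n + 1 : ℕ) : ℝ) ^ (-(2 : ℝ))
  have hS : 0 ≤ S := tsum_nonneg fun n => by positivity
  have hC₂ : 0 ≤ C₂ := (norm_nonneg _).trans (h₂ 0 (by simp; positivity))
  refine ⟨(R + 1) + C₂ + (R + 1) * ∑ j ∈ range J, B j * C₂ + (R + 1) * (C₁ * S), ?_, ?_⟩
  · have : 0 ≤ ∑ j ∈ range J, B j * C₂ := sum_nonneg fun j _ => mul_nonneg (hB0 j) hC₂
    positivity
  intro w hw hwJ a ha
  have ha' : a ∈ Icc (0 : ℝ) 1 := ⟨ha.1.le, ha.2⟩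
  have ha1 : 1 ≤ a⁻¹ := (one_le_inv₀ ha.1).2 ha.2
  have haR : 1 ≤ a⁻¹ ^ R := Real.one_le_rpow ha1 hR
  have hw1 : ‖w - 1‖ ≤ R + 1 := (norm_sub_le _ _).trans (by simpa)
  have ha0 : 0 < a := ha.1
  have n1 : ‖(w - 1) * (a : ℂ) ^ (-w)‖ ≤ (R + 1) * a⁻¹ ^ R := by
    rw [norm_mul, norm_cpow_eq_rpow_re_of_pos ha.1]
    have : a ^ (-w).re ≤ a⁻¹ ^ R := by
      rw [neg_re, rpow_neg ha.1.le, ← Real.inv_rpow ha.1.le]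
      exact Real.rpow_le_rpow_of_exponent_le ha1 ((re_le_norm w).trans hw)
    gcongr
  have n2 : ‖zetaStar w‖ ≤ C₂ := h₂ w (by rw [mem_closedBall_zero_iff]; grind)
  have n3 : ‖(w - 1) * ∑ j ∈ range J, binom w j / (j + 1) * (a : ℂ) ^ (j + 1) * zetaStar (w + j + 1)‖ ≤
      (R + 1) * ∑ j ∈ range J, B j * C₂ := by
    rw [norm_mul]
    gcongr
    refine norm_sum_le_of_le _ fun j hj => ?_
    have hj' : (j : ℝ) + 1 ≤ J := mod_cast mem_range.1 hj
    have e1 : ‖zetaStar (w + j + 1)‖ ≤ C₂ := h₂ _ (by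
      rw [mem_closedBall_zero_iff]
      calc ‖w + j + 1‖ ≤ ‖w‖ + ‖(j : ℂ)‖ + ‖(1 : ℂ)‖ := norm_add₃_le
        _ ≤ _ := by rw [Complex.norm_natCast, norm_one]; linarith)
    have e2 : ‖(j + 1 : ℂ)‖ = j + 1 := by rw [← cast_succ, Complex.norm_natCast, cast_succ]
    rw [norm_mul, norm_mul, norm_div, norm_pow, norm_real, norm_of_nonneg ha.1.le, e2]
    have e3 : ‖binom w j‖ / (j + 1) * a ^ (j + 1) ≤ B j := by
      have e4 : ‖binom w j‖ / (j + 1) ≤ ‖binom w j‖ := div_le_self (norm_nonneg _) (by simp)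
      calc _ ≤ ‖binom w j‖ * 1 := mul_le_mul e4 (pow_le_one₀ ha.1.le ha.2) (by positivity) (norm_nonneg _)
        _ ≤ _ := by grind
    gcongr
    exact hB0 j
  have n4 : ‖(w - 1) * ∑' n, hurwTerm (J + 1) w a n‖ ≤ (R + 1) * (C₁ * S) := by
    rw [norm_mul]
    gcongr
    rw [← tsum_mul_left]
    refine tsum_of_norm_bounded ((summable_succ_rpow (by norm_num)).mul_left C₁).hasSum fun n => ?_
    refine (h₁ w hw a ha' n).trans ?_
    gcongr
    · simp
    grind
  have hX : 0 ≤ C₂ + (R + 1) * ∑ j ∈ range J, B j * C₂ + (R + 1) * (C₁ * S) := by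
    have : 0 ≤ ∑ j ∈ range J, B j * C₂ := sum_nonneg fun j _ => mul_nonneg (hB0 j) hC₂
    positivity
  calc ‖hurwAux J w a‖ ≤ (R + 1) * a⁻¹ ^ R + C₂ + (R + 1) * ∑ j ∈ range J, B j * C₂ +
        (R + 1) * (C₁ * S) := by
        unfold hurwAux
        refine (norm_add_le _ _).trans (add_le_add ((norm_sub_le _ _).trans (add_le_add
          ((norm_add_le _ _).trans (add_le_add n1 n2)) n3)) n4)
    _ ≤ _ := by nlinarith

/-- The entire function `(w - 1) ζ(w, a)`, for `0 < a ≤ 1`. -/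
def hurw (w : ℂ) (a : ℝ) : ℂ := hurwAux (⌊1 - w.re⌋₊ + 1) w a

lemma hurw_eq {J : ℕ} {w : ℂ} {a : ℝ} (hw : 1 < w.re + J) (ha : a ∈ Icc (0 : ℝ) 1) :
    hurw w a = hurwAux J w a := by
  have h := Nat.lt_floor_add_one (1 - w.re)
  rcases le_total J (⌊1 - w.re⌋₊ + 1) with h' | h'
  · exact hurwAux_eq (by linarith) h' ha
  · exact (hurwAux_eq (by push_cast; linarith) h' ha).symm

lemma differentiable_hurw {a : ℝ} (ha : a ∈ Ioc (0 : ℝ) 1) : Differentiable ℂ fun w => hurw w a := by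
  intro w
  obtain ⟨J, hJ⟩ := exists_nat_gt (1 - w.re)
  refine (differentiableAt_hurwAux (J := J) (by linarith) ha).congr_of_eventuallyEq ?_
  have : {z : ℂ | 1 < z.re + J} ∈ 𝓝 w :=
    (isOpen_lt continuous_const (continuous_re.add continuous_const)).mem_nhds
      (show 1 < w.re + J by linarith)
  filter_upwards [this] with z hz using hurw_eq hz ⟨ha.1.le, ha.2⟩

lemma exists_norm_hurw_le {R : ℝ} (hR : 0 ≤ R) : ∃ C : ℝ, 0 ≤ C ∧ ∀ w : ℂ, ‖w‖ ≤ R →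
    ∀ a ∈ Ioc (0 : ℝ) 1, ‖hurw w a‖ ≤ C * a⁻¹ ^ R := by
  obtain ⟨J, hJ⟩ := exists_nat_gt (1 + R)
  obtain ⟨C, hC, h⟩ := exists_norm_hurwAux_le J hR
  refine ⟨C, hC, fun w hw a ha => ?_⟩
  have h1 : 1 < w.re + J := by linarith [neg_le_of_abs_le ((abs_re_le_norm w).trans hw)]
  rw [hurw_eq h1 ⟨ha.1.le, ha.2⟩]
  grind

lemma hasSum_hurw {w : ℂ} {a : ℝ} (hw : 1 < w.re) (ha : a ∈ Ioc (0 : ℝ) 1) :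
    HasSum (fun k : ℕ => (w - 1) * ((k + a : ℝ) : ℂ) ^ (-w)) (hurw w a) := hurwAux_of_one_lt hw ha

/-! ### Continuation of the quadratic L-functions -/

lemma summable_oddL (D : ℤ) {s : ℂ} (hs : 1 < s.re) :
    Summable fun j : ℕ => ((jacobiSym D (2 * j + 1) : ℤ) : ℂ) * ((2 * j + 1 : ℕ) : ℂ) ^ (-s) := by
  refine of_norm_bounded (zetaTwo_eq_tsum hs).1.norm fun j => ?_
  rw [norm_mul]
  exact mul_le_of_le_one_left (norm_nonneg _) (norm_jacobiSym_le _ _)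

lemma jacobiSym_odd_add (D : ℤ) (j l : ℕ) :
    jacobiSym D (2 * (j + 2 * D.natAbs * l) + 1) = jacobiSym D (2 * j + 1) := by
  rw [jacobiSym.mod_right D (b := 2 * (j + 2 * D.natAbs * l) + 1) (by simp),
    jacobiSym.mod_right D (b := 2 * j + 1) (by simp),
    show 2 * (j + 2 * D.natAbs * l) + 1 = 2 * j + 1 + 4 * D.natAbs * l by ring, Nat.add_mul_mod_self_left]

/-- The entire function `(s - 1) * oddL D s`. -/
def oddLStar (D : ℤ) (s : ℂ) : ℂ := ((4 * D.natAbs : ℕ) : ℂ) ^ (-s) * ∑ r ∈ range (2 * D.natAbs),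
    ((jacobiSym D (2 * r + 1) : ℤ) : ℂ) * hurw s (((2 * r + 1 : ℕ) : ℝ) / (4 * D.natAbs : ℕ))

lemma residue_mem_Ioc {D : ℤ} {r : ℕ} (hr : r < 2 * D.natAbs) :
    ((2 * r + 1 : ℕ) : ℝ) / (4 * D.natAbs : ℕ) ∈ Ioc (0 : ℝ) 1 := by
  have h0 : (0 : ℝ) < (4 * D.natAbs : ℕ) := mod_cast (by omega : 0 < 4 * D.natAbs)
  refine ⟨by positivity, (div_le_one h0).2 ?_⟩
  exact_mod_cast (by omega : 2 * r + 1 ≤ 4 * D.natAbs)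

lemma oddLStar_eq {D : ℤ} (hD : D ≠ 0) {s : ℂ} (hs : 1 < s.re) :
    oddLStar D s = (s - 1) * oddL D s := by
  have hN : 0 < D.natAbs := natAbs_pos.2 hD
  have : NeZero (2 * D.natAbs) := ⟨by omega⟩
  rw [oddL, Nat.sumByResidueClasses (summable_oddL D hs) (2 * D.natAbs),
    ← sum_range_eq_sum_zmod (fun r : ZMod (2 * D.natAbs) =>
      ∑' m : ℕ, ((jacobiSym D (2 * (r.val + 2 * D.natAbs * m) + 1) : ℤ) : ℂ) *
        ((2 * (r.val + 2 * D.natAbs * m) + 1 : ℕ) : ℂ) ^ (-s)), oddLStar, mul_sum, mul_sum]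
  refine sum_congr rfl fun r hr => ?_
  have hr := mem_range.1 hr
  rw [ZMod.val_natCast, Nat.mod_eq_of_lt hr, ← (hasSum_hurw hs (residue_mem_Ioc hr)).tsum_eq]
  simp only [jacobiSym_odd_add]
  rw [tsum_mul_left, tsum_mul_left, mul_left_comm, mul_left_comm (s - 1)]
  congr 1
  rw [mul_left_comm]
  congr 1
  rw [← tsum_mul_left]
  refine tsum_congr fun k => ?_
  have h0 : (0 : ℝ) < (4 * D.natAbs : ℕ) := mod_cast (by omega : 0 < 4 * D.natAbs)
  have h1 : ((2 * (r + 2 * D.natAbs * k) + 1 : ℕ) : ℂ) =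
      ((4 * D.natAbs : ℕ) : ℂ) * ((k + ((2 * r + 1 : ℕ) : ℝ) / (4 * D.natAbs : ℕ) : ℝ) : ℂ) := by
    have hd : (D.natAbs : ℂ) ≠ 0 := mod_cast hN.ne'
    push_cast
    grind
  rw [h1, ← Complex.ofReal_natCast, mul_cpow_ofReal_nonneg h0.le (by positivity)]

lemma differentiable_oddLStar {D : ℤ} (hD : D ≠ 0) : Differentiable ℂ (oddLStar D) := by
  have hN : ((4 * D.natAbs : ℕ) : ℂ) ≠ 0 := by simpa
  unfold oddLStar
  refine Differentiable.mul (differentiable_neg.const_cpow (Or.inl hN)) ?_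
  exact Differentiable.fun_sum fun r hr =>
    (differentiable_hurw (residue_mem_Ioc (mem_range.1 hr))).const_mul _

lemma rpow_neg_re_le {x R : ℝ} (hx : 1 ≤ x) {s : ℂ} (hs : ‖s‖ ≤ R) : x ^ (-s.re) ≤ x ^ R :=
  Real.rpow_le_rpow_of_exponent_le hx ((neg_le_abs _).trans ((abs_re_le_norm s).trans hs))

lemma exists_norm_oddLStar_le {R : ℝ} (hR : 0 ≤ R) : ∃ C : ℝ, 0 ≤ C ∧ ∀ D : ℤ, D ≠ 0 → ∀ s : ℂ, ‖s‖ ≤ R →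
    ‖oddLStar D s‖ ≤ C * ((4 * D.natAbs : ℕ) : ℝ) ^ (2 * R + 1) := by
  obtain ⟨C, hC, h⟩ := exists_norm_hurw_le hR
  refine ⟨C, hC, fun D hD s hs => ?_⟩
  have hN : 0 < D.natAbs := natAbs_pos.2 hD
  set x : ℝ := ((4 * D.natAbs : ℕ) : ℝ) with hx
  have hx1 : 1 ≤ x := by rw [hx]; exact_mod_cast (by omega : 1 ≤ 4 * D.natAbs)
  have hx0 : 0 < x := by linarith
  rw [oddLStar, norm_mul, norm_natCast_cpow_neg (by omega)]
  have h1 : ‖∑ r ∈ range (2 * D.natAbs), ((jacobiSym D (2 * r + 1) : ℤ) : ℂ) *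
      hurw s (((2 * r + 1 : ℕ) : ℝ) / (4 * D.natAbs : ℕ))‖ ≤ x * (C * x ^ R) := by
    have h2 : ∀ r ∈ range (2 * D.natAbs), ‖((jacobiSym D (2 * r + 1) : ℤ) : ℂ) *
        hurw s (((2 * r + 1 : ℕ) : ℝ) / (4 * D.natAbs : ℕ))‖ ≤ C * x ^ R := fun r hr => by
      rw [norm_mul]
      refine (mul_le_of_le_one_left (norm_nonneg _) (norm_jacobiSym_le _ _)).trans ?_
      have hm := residue_mem_Ioc (mem_range.1 hr)
      refine (h s hs _ hm).trans ?_
      gcongr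
      rw [inv_div]
      exact div_le_self hx0.le (by simp)
    refine (norm_sum_le_of_le _ h2).trans ?_
    rw [sum_const, nsmul_eq_mul, Finset.card_range]
    gcongr
    grind
  calc _ ≤ x ^ R * (x * (C * x ^ R)) := by
        exact mul_le_mul (rpow_neg_re_le hx1 hs) h1 (norm_nonneg _) (by positivity)
    _ = C * (x ^ R * x ^ R * x ^ (1 : ℝ)) := by rw [Real.rpow_one]; ring
    _ = _ := by rw [← rpow_add hx0, ← rpow_add hx0]; ring_nf

/-! ### The sum over square divisors -/

/-- The odd `g` with `g² ∣ m`. -/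
def sqDivisors (m : ℤ) : Finset ℕ := m.natAbs.divisors.filter fun g => Odd g ∧ ((g ^ 2 : ℕ) : ℤ) ∣ m

lemma hasSum_sqDivTerm {m : ℤ} {g : ℕ} (hg : Odd g) (hgm : ((g ^ 2 : ℕ) : ℤ) ∣ m) {s : ℂ} (hs : 1 < s.re) :
    HasSum (fun j : ℕ => ((sqDivTerm m g (2 * j + 1) : ℤ) : ℂ) * ((2 * j + 1 : ℕ) : ℂ) ^ (-s))
      ((g : ℂ) ^ (1 - 2 * s) * oddL (m / (g ^ 2 : ℕ)) s) := by
  have hg0 : g ≠ 0 := hg.pos.ne'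
  have hodd : ∀ i : ℕ, Odd (g ^ 2 * (2 * i + 1)) := fun i => hg.pow.mul (by simp)
  choose φ hφ using hodd
  have hinj : Function.Injective φ := fun a b h => by
    have h1 := hφ a
    rw [h, ← hφ b] at h1
    have := Nat.eq_of_mul_eq_mul_left (by positivity) h1
    omega
  rw [← hinj.hasSum_iff]
  · refine ((summable_oddL (m / (g ^ 2 : ℕ)) hs).hasSum.mul_left _).congr_fun fun i => ?_
    rw [Function.comp_apply, ← hφ i, sqDivTerm, if_pos ⟨Dvd.intro _ rfl, hgm⟩,
      Nat.mul_div_cancel_left _ (by positivity), natCast_cpow_neg_mul, natCast_sq_cpow,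
      sub_eq_add_neg, cpow_add _ _ (mod_cast hg0), cpow_one]
    push_cast; ring
  · intro j hj
    by_cases h : g ^ 2 ∣ 2 * j + 1
    · obtain ⟨k, hk⟩ := h
      have : Odd (g ^ 2 * k) := hk ▸ (by simp)
      obtain ⟨i, rfl⟩ := (odd_mul.1 this).2
      grind
    · rw [sqDivTerm_eq_zero h]; simp

lemma hasSum_sqDivSum {m : ℤ} (hm : m ≠ 0) {s : ℂ} (hs : 1 < s.re) :
    HasSum (fun j : ℕ => ((sqDivSum m (2 * j + 1) : ℤ) : ℂ) * ((2 * j + 1 : ℕ) : ℂ) ^ (-s))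
      (∑ g ∈ sqDivisors m, (g : ℂ) ^ (1 - 2 * s) * oddL (m / (g ^ 2 : ℕ)) s) := by
  have h := hasSum_sum fun g (hg : g ∈ sqDivisors m) =>
    hasSum_sqDivTerm (mem_filter.1 hg).2.1 (mem_filter.1 hg).2.2 hs
  refine h.congr_fun fun j => ?_
  rw [← sum_mul, sqDivSum_apply, ← Int.cast_sum]
  congr 2
  have key : ∀ g, sqDivTerm m g (2 * j + 1) ≠ 0 → g ∈ (2 * j + 1).divisors ∧ g ∈ sqDivisors m := by
    intro g hg
    have H : g ^ 2 ∣ 2 * j + 1 ∧ ((g ^ 2 : ℕ) : ℤ) ∣ m := by by_contra H; exact hg (if_neg H)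
    have h1 : g ∣ 2 * j + 1 := (dvd_pow_self g two_ne_zero).trans H.1
    refine ⟨mem_divisors.2 ⟨h1, by omega⟩, mem_filter.2 ⟨mem_divisors.2 ⟨?_, by simpa⟩, ?_, H.2⟩⟩
    · exact (dvd_pow_self g two_ne_zero).trans (Int.natCast_dvd.1 H.2)
    · exact Odd.of_dvd_nat (by simp) h1
  exact Finset.sum_congr_of_eq_on_inter (fun g _ h2 => by grind)
    (fun g _ h2 => by grind) fun _ _ _ => rfl

lemma twoFactor_eq_sum {m : ℤ} (hm : m ≠ 0) (s : ℂ) : twoFactor m s = ∑ e ∈ range (8 * m.natAbs),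
      ((sqPrim m (2 ^ (e + 2)) : ℤ) : ℂ) * ((2 ^ (e + 2) : ℕ) : ℂ) ^ (-s) := by
  refine tsum_eq_sum fun e he => ?_
  by_cases h : sqPrim m (2 ^ (e + 2)) = 0
  · rw [h]; simp
  · have h1 := sqPrim_two_pow (by omega) h
    have h2 : 2 ^ (e + 2) ∣ 8 * m.natAbs := by
      have := Int.natAbs_dvd_natAbs.2 h1
      simpa [Int.natAbs_mul, Int.natAbs_pow] using this
    have h3 := Nat.le_of_dvd (by omega) h2
    have h4 : e + 2 < 2 ^ (e + 2) := Nat.lt_two_pow_self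
    grind

/-- The function `(s - 1) ζ₂(2 s) ∑_{4 ∣ c} h_m(c) c^(-s)`, which is entire in `s` for `m ≠ 0`. -/
def eisStar (m : ℤ) (s : ℂ) : ℂ :=
  twoFactor m s * ∑ g ∈ sqDivisors m, (g : ℂ) ^ (1 - 2 * s) * oddLStar (m / (g ^ 2 : ℕ)) s

lemma pos_of_mem_sqDivisors {m : ℤ} {g : ℕ} (hg : g ∈ sqDivisors m) : 0 < g :=
  (mem_filter.1 hg).2.1.pos

lemma ediv_sq_ne_zero {m : ℤ} (hm : m ≠ 0) {g : ℕ} (hg : g ∈ sqDivisors m) : m / (g ^ 2 : ℕ) ≠ 0 := by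
  obtain ⟨t, ht⟩ := (mem_filter.1 hg).2.2
  simp_all

lemma natAbs_ediv_sq_le (m : ℤ) (g : ℕ) : (m / (g ^ 2 : ℕ)).natAbs ≤ m.natAbs :=
  Int.natAbs_ediv_le_natAbs _ _

lemma eisStar_eq {m : ℤ} (hm : m ≠ 0) {s : ℂ} (hs : 3 / 2 < s.re) :
    zetaTwo (2 * s) * ∑' c : ℕ, (if 4 ∣ c then ((sqPrim m c : ℤ) : ℂ) * (c : ℂ) ^ (-s) else 0) =
      eisStar m s / (s - 1) := by
  have h1 : 1 < s.re := by linarith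
  have hs1 : s - 1 ≠ 0 := fun h => by
    have := congrArg re h
    simp at this; linarith
  rw [zetaTwo_mul_tsum_sqPrim m hs, (hasSum_sqDivSum hm h1).tsum_eq, eisStar, mul_div_assoc]
  congr 1
  rw [eq_div_iff hs1, sum_mul]
  refine sum_congr rfl fun g hg => ?_
  rw [oddLStar_eq (ediv_sq_ne_zero hm hg) h1]
  ring

lemma differentiable_eisStar {m : ℤ} (hm : m ≠ 0) : Differentiable ℂ (eisStar m) := by
  have h2 : Differentiable ℂ (twoFactor m) := by
    rw [show twoFactor m = _ from funext (twoFactor_eq_sum hm)]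
    fun_prop
  refine h2.mul (Differentiable.fun_sum fun g hg => Differentiable.mul ?_
    (differentiable_oddLStar (ediv_sq_ne_zero hm hg)))
  have : (g : ℂ) ≠ 0 := mod_cast (pos_of_mem_sqDivisors hg).ne'
  exact Differentiable.const_cpow (by fun_prop) (Or.inl this)

lemma norm_twoFactor_le {m : ℤ} (hm : m ≠ 0) {R : ℝ} {s : ℂ} (hs : ‖s‖ ≤ R) :
    ‖twoFactor m s‖ ≤ 2 * ((8 * m.natAbs : ℕ) : ℝ) ^ (R + 2) := by
  have hN : 0 < m.natAbs := natAbs_pos.2 hm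
  have hR : 0 ≤ R := (norm_nonneg _).trans hs
  set x : ℝ := ((8 * m.natAbs : ℕ) : ℝ) with hx
  have hx1 : 1 ≤ x := by rw [hx]; exact_mod_cast (by omega : 1 ≤ 8 * m.natAbs)
  have hx0 : 0 < x := by linarith
  rw [twoFactor_eq_sum hm]
  have h2 : ∀ e ∈ range (8 * m.natAbs), ‖((sqPrim m (2 ^ (e + 2)) : ℤ) : ℂ) *
      ((2 ^ (e + 2) : ℕ) : ℂ) ^ (-s)‖ ≤ 2 * x * x ^ R := fun e _ => by
    by_cases h : sqPrim m (2 ^ (e + 2)) = 0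
    · rw [h, Int.cast_zero, zero_mul, norm_zero]; positivity
    have h1 := sqPrim_two_pow (by omega) h
    have h2 : 2 ^ (e + 2) ∣ 8 * m.natAbs := by
      have := Int.natAbs_dvd_natAbs.2 h1
      simpa [Int.natAbs_mul, Int.natAbs_pow] using this
    have h3 : ((2 ^ (e + 2) : ℕ) : ℝ) ≤ x := by rw [hx]; exact_mod_cast Nat.le_of_dvd (by omega) h2
    have h4 : (1 : ℝ) ≤ (2 ^ (e + 2) : ℕ) := mod_cast Nat.one_le_two_pow
    rw [norm_mul, norm_natCast_cpow_neg (by positivity)]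
    have h5 : ‖((sqPrim m (2 ^ (e + 2)) : ℤ) : ℂ)‖ ≤ 2 * x := by
      refine (norm_sqPrim_le_of_four_dvd m (by positivity) (by grind)).trans ?_
      gcongr
      refine (Real.sqrt_le_left (by positivity)).2 ?_
      nlinarith
    gcongr
    exact (rpow_neg_re_le h4 hs).trans (Real.rpow_le_rpow (by positivity) h3 hR)
  refine (norm_sum_le_of_le _ h2).trans (le_of_eq ?_)
  rw [sum_const, nsmul_eq_mul, Finset.card_range, rpow_add hx0, rpow_two]
  ring

lemma exists_norm_eisStar_le {R : ℝ} (hR : 0 ≤ R) : ∃ C A : ℝ, 0 ≤ C ∧ 0 ≤ A ∧ ∀ m : ℤ, m ≠ 0 →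
    ∀ s : ℂ, ‖s‖ ≤ R → ‖eisStar m s‖ ≤ C * ((8 * m.natAbs : ℕ) : ℝ) ^ A := by
  obtain ⟨C, hC, h⟩ := exists_norm_oddLStar_le hR
  refine ⟨2 * C, (R + 2) + (1 + (1 + 2 * R + (2 * R + 1))), by positivity, by positivity, fun m hm s hs => ?_⟩
  have hN : 0 < m.natAbs := natAbs_pos.2 hm
  have h2 := norm_twoFactor_le hm hs
  set x : ℝ := ((8 * m.natAbs : ℕ) : ℝ) with hx
  have hx1 : 1 ≤ x := by rw [hx]; exact_mod_cast (by omega : 1 ≤ 8 * m.natAbs)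
  have hx0 : 0 < x := by linarith
  have h3 : ∀ g ∈ sqDivisors m, ‖(g : ℂ) ^ (1 - 2 * s) * oddLStar (m / (g ^ 2 : ℕ)) s‖ ≤
      x ^ (1 + 2 * R) * (C * x ^ (2 * R + 1)) := fun g hg => by
    have hg0 := pos_of_mem_sqDivisors hg
    have hg1 : (1 : ℝ) ≤ g := mod_cast hg0
    have hgm : (g : ℝ) ≤ x := by
      rw [hx]
      have := Nat.divisor_le (mem_filter.1 hg).1
      exact_mod_cast (by omega : g ≤ 8 * m.natAbs)
    rw [norm_mul, norm_natCast_cpow_of_pos hg0]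
    have e1 : (g : ℝ) ^ (1 - 2 * s).re ≤ x ^ (1 + 2 * R) := by
      refine (Real.rpow_le_rpow_of_exponent_le hg1 ?_).trans (Real.rpow_le_rpow (by positivity) hgm (by positivity))
      have := (neg_le_abs _).trans ((abs_re_le_norm s).trans hs)
      simp; linarith
    have e2 : ‖oddLStar (m / (g ^ 2 : ℕ)) s‖ ≤ C * x ^ (2 * R + 1) := by
      refine (h _ (ediv_sq_ne_zero hm hg) s hs).trans ?_
      gcongr
      rw [hx]
      have := natAbs_ediv_sq_le m g
      exact_mod_cast (by omega : 4 * (m / (g ^ 2 : ℕ)).natAbs ≤ 8 * m.natAbs)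
    gcongr
  have h4 : ((sqDivisors m).card : ℝ) ≤ x := by
    rw [hx]
    have e1 : (sqDivisors m).card ≤ m.natAbs.divisors.card := Finset.card_filter_le _ _
    have e2 := Nat.card_divisors_le_self m.natAbs
    exact_mod_cast (by omega : (sqDivisors m).card ≤ 8 * m.natAbs)
  rw [eisStar, norm_mul]
  calc _ ≤ (2 * x ^ (R + 2)) * (x * (x ^ (1 + 2 * R) * (C * x ^ (2 * R + 1)))) := by
        refine mul_le_mul h2 ((norm_sum_le_of_le _ h3).trans ?_) (norm_nonneg _) (by positivity)
        rw [sum_const, nsmul_eq_mul]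
        gcongr
    _ = _ := by
        rw [rpow_add hx0 (R + 2) (1 + (1 + 2 * R + (2 * R + 1))),
          rpow_add hx0 1 (1 + 2 * R + (2 * R + 1)), rpow_add hx0 (1 + 2 * R) (2 * R + 1), Real.rpow_one]
        ring

/-! ### The case `m = 0` -/

lemma sqPrim_prime_pow {p : ℕ} (hp : p.Prime) (m : ℤ) (k : ℕ) :
    sqPrim m (p ^ (k + 1)) = sqCount m (p ^ (k + 1)) - sqCount m (p ^ k) := by
  have h : ∀ k, ∑ j ∈ range (k + 1), sqPrim m (p ^ j) = sqCount m (p ^ k) := fun k => by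
    rw [← Nat.sum_divisors_prime_pow hp, ← coe_zeta_mul_apply, sqPrim, ← mul_assoc, coe_zeta_mul_moebius,
      one_mul]
  rw [← h, ← h, sum_range_succ _ (k + 1)]
  ring

lemma sqCount_zero_two_pow (j : ℕ) :
    sqCount 0 (2 ^ (2 * j)) = 2 ^ j ∧ sqCount 0 (2 ^ (2 * j + 1)) = 2 ^ j := by
  have h : ∀ k, sqCount 0 (2 ^ (k + 2)) = 2 * sqCount 0 (2 ^ k) := fun k => by
    have := sqCount_sq_dvd prime_two 0 k
    simpa
  induction j with
  | zero =>
    have := sqCount_prime_of_or prime_two (m := 0) (Or.inr rfl)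
    rw [jacobiSym.zero_left one_lt_two] at this
    exact ⟨(sqCount_isMultiplicative 0).1, by rfl⟩
  | succ j ih =>
    grind

lemma twoFactor_zero {s : ℂ} (hs : 1 / 2 < s.re) :
    twoFactor 0 s = (2 : ℂ) ^ (-(2 * s)) / (1 - (2 : ℂ) ^ (1 - 2 * s)) := by
  have h2 : (2 : ℂ) ≠ 0 := two_ne_zero
  have he : ∀ j : ℕ, sqPrim 0 (2 ^ (2 * j + 2)) = 2 ^ j := fun j => by
    rw [show 2 * j + 2 = 2 * j + 1 + 1 by ring, sqPrim_prime_pow prime_two, (sqCount_zero_two_pow j).2,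
      show 2 * j + 1 + 1 = 2 * (j + 1) by ring, (sqCount_zero_two_pow (j + 1)).1]
    ring
  have ho : ∀ j : ℕ, sqPrim 0 (2 ^ (2 * j + 1 + 2)) = 0 := fun j => by
    rw [show 2 * j + 1 + 2 = 2 * (j + 1) + 1 by ring, sqPrim_prime_pow prime_two,
      (sqCount_zero_two_pow (j + 1)).1, (sqCount_zero_two_pow (j + 1)).2, sub_self]
  have hS := summable_twoFactor 0 hs
  have hp : ∀ j : ℕ, ((2 ^ (2 * j + 2) : ℕ) : ℂ) ^ (-s) = (2 : ℂ) ^ (-(2 * s)) * ((2 : ℂ) ^ (-(2 * s))) ^ j := by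
    intro j
    rw [← Complex.cpow_nat_mul, ← cpow_add _ _ h2, Nat.cast_pow, ← Complex.natCast_cpow_natCast_mul,
      cast_ofNat]
    congr 1; grind
  have h1 : ∑' j : ℕ, ((sqPrim 0 (2 ^ (2 * j + 2)) : ℤ) : ℂ) * ((2 ^ (2 * j + 2) : ℕ) : ℂ) ^ (-s) =
      (2 : ℂ) ^ (-(2 * s)) / (1 - (2 : ℂ) ^ (1 - 2 * s)) := by
    have hr : ‖(2 : ℂ) ^ (1 - 2 * s)‖ < 1 := by
      have := norm_natCast_cpow_of_pos (n := 2) two_pos (1 - 2 * s)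
      rw [cast_ofNat] at this
      rw [this]
      exact Real.rpow_lt_one_of_one_lt_of_neg (by norm_num) (by simp; linarith)
    rw [div_eq_mul_inv, ← tsum_geometric_of_norm_lt_one hr, ← tsum_mul_left]
    refine tsum_congr fun j => ?_
    rw [he, hp, sub_eq_add_neg, cpow_add _ _ h2, cpow_one, mul_pow]
    grind
  rw [← h1, twoFactor]
  refine (Function.Injective.tsum_eq (g := fun j : ℕ => 2 * j) (mul_right_injective₀ two_ne_zero) ?_).symm
  intro e hE
  rcases Nat.even_or_odd' e with ⟨j, rfl | rfl⟩
  · simp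
  simp_all

lemma sqDivSum_zero {l : ℕ} (hl : l ≠ 0) :
    sqDivSum 0 l = ∑ g ∈ l.divisors, if g ^ 2 = l then (g : ℤ) else 0 := by
  rw [sqDivSum_apply]
  refine sum_congr rfl fun g hg => ?_
  unfold sqDivTerm
  by_cases h : g ^ 2 ∣ l
  · obtain ⟨k, rfl⟩ := h
    have hg0 : 0 < g ^ 2 := Nat.pos_of_ne_zero (left_ne_zero_of_mul hl)
    have hk : 0 < k := Nat.pos_of_ne_zero (right_ne_zero_of_mul hl)
    rw [if_pos ⟨Dvd.intro _ rfl, dvd_zero _⟩, Int.zero_ediv, Nat.mul_div_cancel_left _ hg0]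
    by_cases hk1 : k = 1
    · subst hk1; simp
    · rw [jacobiSym.zero_left (by omega), if_neg, mul_zero]
      simp_all
  · rw [if_neg fun H => h H.1, if_neg fun H : g ^ 2 = l => h ⟨1, by omega⟩]

lemma tsum_sqDivSum_zero {s : ℂ} (hs : 1 < s.re) :
    ∑' j : ℕ, ((sqDivSum 0 (2 * j + 1) : ℤ) : ℂ) * ((2 * j + 1 : ℕ) : ℂ) ^ (-s) = zetaTwo (2 * s - 1) := by
  rw [(zetaTwo_eq_tsum (s := 2 * s - 1) (by simp; linarith)).2]
  have hsq : ∀ i : ℕ, 2 * (2 * i ^ 2 + 2 * i) + 1 = (2 * i + 1) ^ 2 := fun i => by ring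
  have hinj : Function.Injective fun i : ℕ => 2 * i ^ 2 + 2 * i := fun a b h => by
    have h : 2 * a ^ 2 + 2 * a = 2 * b ^ 2 + 2 * b := h
    have h1 : (2 * a + 1) ^ 2 = (2 * b + 1) ^ 2 := by grind
    simp_all
  rw [← hinj.tsum_eq]
  · refine tsum_congr fun i => ?_
    have h0 : ((2 * i + 1 : ℕ) : ℂ) ≠ 0 := mod_cast succ_ne_zero (2 * i)
    rw [hsq, sqDivSum_zero (by positivity), Finset.sum_eq_single (2 * i + 1), if_pos rfl, natCast_sq_cpow,
      show -(2 * s - 1) = -(2 * s) + 1 by ring, cpow_add _ _ h0, cpow_one]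
    · push_cast; ring
    · simp_all
    simp
  · intro j hj
    by_contra H
    refine hj ?_
    simp only
    rw [sqDivSum_zero (by omega), sum_eq_zero]
    · simp
    · intro g _
      refine if_neg fun hg => H ?_
      have : Odd (g ^ 2) := hg ▸ (by simp)
      obtain ⟨i, rfl⟩ := (Nat.odd_pow_iff two_ne_zero).1 this
      grind

lemma zetaTwo_mul_tsum_zero {s : ℂ} (hs : 3 / 2 < s.re) :
    zetaTwo (2 * s) * ∑' c : ℕ, (if 4 ∣ c then ((sqPrim 0 c : ℤ) : ℂ) * (c : ℂ) ^ (-s) else 0) =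
      (2 : ℂ) ^ (-(2 * s)) * riemannZeta (2 * s - 1) := by
  rw [zetaTwo_mul_tsum_sqPrim 0 hs, tsum_sqDivSum_zero (by linarith), twoFactor_zero (by linarith), zetaTwo,
    show -(2 * s - 1) = 1 - 2 * s by ring]
  have : 1 - (2 : ℂ) ^ (1 - 2 * s) ≠ 0 := fun h => by
    have hr : ‖(2 : ℂ) ^ (1 - 2 * s)‖ < 1 := by
      have := norm_natCast_cpow_of_pos (n := 2) two_pos (1 - 2 * s)
      rw [cast_ofNat] at this
      rw [this]
      exact Real.rpow_lt_one_of_one_lt_of_neg (by norm_num) (by simp; linarith)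
    rw [← sub_eq_zero.1 h, norm_one] at hr
    grind
  field_simp

/-! ### The cosets of the Eisenstein series -/

lemma hilbert_of_nonneg_left {x : ℝ} (hx : 0 ≤ x) (y : ℝ) : hilbert x y = 1 :=
  if_neg fun h => hx.not_gt h.1

lemma hilbert_of_nonneg_right (x : ℝ) {y : ℝ} (hy : 0 ≤ y) : hilbert x y = 1 :=
  if_neg fun h => hy.not_gt h.2

lemma X_nPlus (x : ℝ) : X (nPlus x).mat = 1 := by simp [X, nPlus]

lemma mul_nPlus_entries (g : SL(2, ℝ)) (x : ℝ) :
    (g * (nPlus x).mat).1 0 0 = g.1 0 0 ∧ (g * (nPlus x).mat).1 0 1 = g.1 0 0 * x + g.1 0 1 ∧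
    (g * (nPlus x).mat).1 1 0 = g.1 1 0 ∧ (g * (nPlus x).mat).1 1 1 = g.1 1 0 * x + g.1 1 1 := by
  simp only [entry_mul]; simp [nPlus]

lemma sgn_mul_nPlus (g : Mp) (x : ℝ) : (g * nPlus x).sgn = g.sgn := by
  obtain ⟨-, -, e, e'⟩ := mul_nPlus_entries g.mat x
  have : X (g.mat * (nPlus x).mat) = X g.mat := by
    by_cases h : g.mat.1 1 0 = 0
    · rw [X_of_eq h, X_of_eq (e.trans h), e', h, zero_mul, zero_add]
    · rw [X_of_ne h, X_of_ne (e ▸ h), e]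
  rw [Mp.mul_sgn, cocycle, this, hilbert_of_nonneg_left (div_self (X_ne_zero _) ▸ zero_le_one)]
  exact (mul_one _).trans (one_mul _)

lemma nPlus_add (x y : ℝ) : nPlus (x + y) = nPlus x * nPlus y := by
  refine Mp.ext (SL2_ext ?_ ?_ ?_ ?_) (sgn_mul_nPlus _ _).symm <;>
    simp only [Mp.mul_mat, entry_mul] <;> simp [nPlus, add_comm]

lemma mem_GammaInf {g : Mp} : g ∈ GammaInf ↔ ∃ m : ℤ, nPlus m = g := by
  let f : Multiplicative ℝ →* Mp := ⟨⟨fun x => nPlus x.toAdd, nPlus_zero⟩, fun x y => nPlus_add _ _⟩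
  have h : ∀ m : ℤ, nPlus 1 ^ m = nPlus m := fun m => by
    have := map_zpow f (Multiplicative.ofAdd 1) m
    rw [← ofAdd_zsmul, zsmul_one] at this
    exact this.symm
  simp only [GammaInf, Subgroup.mem_zpowers_iff, h]

lemma eq_mul_nPlus {g h : Mp} (e : (g : Mp ⧸ GammaInf) = h) : ∃ m : ℤ, h = g * nPlus m := by
  obtain ⟨m, hm⟩ := mem_GammaInf.1 (QuotientGroup.eq.1 e)
  exact ⟨m, by simp_all⟩

lemma nPlus_mul_sTilde (x : ℝ) : nPlus x * sTilde = sTilde * nMinus (-x) := by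
  have e : ∀ g h : Mp, (g * h).mat = g.mat * h.mat := fun _ _ => rfl
  have hm : (nPlus x * sTilde).mat = (sTilde * nMinus (-x)).mat := by
    apply SL2_ext <;> simp only [e, entry_mul] <;> simp [nPlus, sTilde, nMinus]
  have h1 : X (nPlus x * sTilde).mat = 1 := by simp only [e, X, entry_mul]; simp [nPlus, sTilde]
  have h2 : X sTilde.mat = 1 := by simp [X, sTilde]
  refine Mp.ext hm ?_
  rw [Mp.mul_sgn, Mp.mul_sgn, cocycle, cocycle, ← e, ← e, ← hm, h1, h2,
    hilbert_of_nonneg_right _ (by simp), hilbert_of_nonneg_left (by simp)]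
  rfl

lemma SmoothVec.mul_nPlus_mul_sTilde (f : SmoothVec ε ν) (g : Mp) (x : ℝ) :
    f (g * nPlus x * sTilde) = f (g * sTilde) := by
  have := f.map_borel (g * sTilde) 1 one_pos (-x)
  rw [aTilde_one, one_mul, ofReal_one, Complex.one_cpow, one_mul] at this
  rw [mul_assoc, nPlus_mul_sTilde, ← mul_assoc, this]

/-- The value of `φ` at `γ s̃` in terms of its restriction to `Ñ`. -/
lemma SmoothVec.apply_mul_sTilde (φ : SmoothVec ε ν) {γ : Mp} {a b c d : ℝ}
    (hm : γ.mat.1 = !![a, b; c, d]) (hc : c ≠ 0) (hd : d ≠ 0) :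
    φ (γ * sTilde) = (if 0 < c then chi ε else 1) * ((γ.sgn : ℤ) : ℂ) * (|c| : ℝ) ^ (ν - 1) *
      φ (nPlus (a / c)) := by
  have hdet := det_eq γ.mat
  simp only [hm, of_apply, cons_val', cons_val_zero, cons_val_one, cons_val_fin_one] at hdet
  have e : ∀ g h : Mp, (g * h).mat = g.mat * h.mat := fun _ _ => rfl
  have hu : 0 < |c|⁻¹ := inv_pos.2 (abs_pos.2 hc)
  set e₁ : ℤˣ := if 0 < c then -1 else 1 with he₁
  set e₂ : ℤˣ := if 0 < c then -γ.sgn else γ.sgn with he₂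
  have hec : ((e₁ : ℤ) : ℝ) * |c| = -c := by
    rcases hc.lt_or_gt with h | h
    · simp [he₁, h.not_gt, abs_of_neg h]
    · simp [he₁, h, abs_of_pos h]
  have hec' : ((e₁ : ℤ) : ℝ) * |c|⁻¹ = -c⁻¹ := by grind
  have key : γ * sTilde = nPlus (a / c) * (mTilde e₁ e₂ * aTilde |c|⁻¹ hu * nMinus (-d / c)) := by
    have hM : (mTilde e₁ e₂ * aTilde |c|⁻¹ hu * nMinus (-d / c)).mat.1 = !![-c⁻¹, 0; d, -c] := by
      ext i j
      fin_cases i <;> fin_cases j <;> simp only [e, entry_mul] <;>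
        simp [mTilde, aTilde, nMinus, hec, hec']
      field_simp
    have hm' : (γ * sTilde).mat.1 = !![b, -a; d, -c] := by
      ext i j
      fin_cases i <;> fin_cases j <;> simp only [e, entry_mul] <;> simp [sTilde, hm]
    have hmat : (γ * sTilde).mat =
        (nPlus (a / c) * (mTilde e₁ e₂ * aTilde |c|⁻¹ hu * nMinus (-d / c))).mat := by
      refine Subtype.ext ?_
      rw [hm', e, Matrix.SpecialLinearGroup.coe_mul, hM]
      ext i j
      fin_cases i <;> fin_cases j <;> simp [Matrix.mul_apply, Fin.sum_univ_two, nPlus] <;>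
        field_simp
      linarith
    refine Mp.ext hmat ?_
    have xs : X sTilde.mat = 1 := by simp [X, sTilde]
    have xg : X γ.mat = c := by simp [X, hm, hc]
    have xp : X (γ * sTilde).mat = d := by simp [X, hm', hd]
    have xm : X (mTilde e₁ e₂).mat = ((e₁ : ℤ) : ℝ) := by simp [X, mTilde]
    have xa : X (aTilde |c|⁻¹ hu).mat = |c| := by simp [X, aTilde]
    have xma : X ((mTilde e₁ e₂).mat * (aTilde |c|⁻¹ hu).mat) = -c := by
      rw [← hec]; simp only [X, entry_mul]; simp [mTilde, aTilde]
    have xn : X (nMinus (-d / c)).mat = -d / c := by simp [X, nMinus, hc, hd]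
    have xM : X (mTilde e₁ e₂ * aTilde |c|⁻¹ hu * nMinus (-d / c)).mat = d := by simp [X, hM, hd]
    have hh : ∀ x y : ℝ, hilbert x y = if x < 0 ∧ y < 0 then -1 else 1 := fun _ _ => rfl
    rw [Mp.mul_sgn, Mp.mul_sgn (nPlus _), cocycle, cocycle, ← e, ← e, ← hmat, xp, X_nPlus, xs, xg,
      xM, Mp.mul_sgn, Mp.mul_sgn, cocycle, cocycle, xma, xm, xa, ← e, xM, xn, e, xma,
      div_self hd, hilbert_of_nonneg_right _ zero_le_one, hh, hh, hh]
    have hdd : d / (-d / c) = -c := by field_simp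
    rcases hc.lt_or_gt with h | h
    · simp [he₁, he₂, h.not_gt, hdd, abs_of_neg h, div_neg_iff, h, sTilde, nPlus,
        mTilde, aTilde, nMinus]
      grind
    · rcases hd.lt_or_gt with h' | h' <;>
      simp [he₁, he₂, h, h.not_gt, hdd, h', h'.not_gt, abs_of_pos h,
        div_neg_iff, sTilde, nPlus, mTilde, aTilde, nMinus]
  rw [key, φ.2.2, omega]
  have hp : (((|c|⁻¹ : ℝ) : ℂ) ^ (ν - 1))⁻¹ = ((|c| : ℝ) : ℂ) ^ (ν - 1) := by
    rw [ofReal_inv, inv_cpow _ _ (by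
      rw [Complex.arg_ofReal_of_nonneg (abs_nonneg c)]; positivity), inv_inv]
  have hs : (sigma ε e₁ e₂)⁻¹ = (if 0 < c then chi ε else 1) * ((γ.sgn : ℤ) : ℂ) := by
    rcases units_eq_one_or γ.sgn with h | h <;> rcases units_eq_one_or ε with h' | h' <;>
      by_cases h0 : 0 < c <;> simp [sigma, chi, he₁, he₂, h, h', h0]
  grind

/-- The terms of the Eisenstein series: `(a, c)` is the first column of `γ`, up to sign, unless
`c = 0`, where `a` is replaced by `0`. -/
def eisTerm (ε : ℤˣ) (μ : ℂ) (h : ℝ → ℂ) (p : ℤ × ℕ) : ℂ :=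
  if hc : p.2 = 0 then (if p.1 = 0 then h (π / 2) else 0)
  else if 4 ∣ p.2 ∧ IsCoprime p.1 (p.2 : ℤ) then
    haveI := NeZero.mk hc
    (1 - ((ε : ℤ) : ℂ) * I)⁻¹ * gaussS (ε * p.1) p.2 * (p.2 : ℂ) ^ (-(μ + 3 / 2)) *
      chart (1 + μ) h (p.1 / p.2)
  else 0

lemma kronecker_eq_one_or {c d : ℤ} (hd : d % 4 = 1) (hcd : IsCoprime c d) :
    kronecker c d = 1 ∨ kronecker c d = -1 := by
  rw [kronecker_of_odd c (Int.odd_iff.2 (by omega))]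
  have := jacobiSym.eq_one_or_neg_one (a := c) (b := d.natAbs) (by
    rw [Int.gcd, Int.natAbs_natCast]; exact Int.isCoprime_iff_gcd_eq_one.1 hcd)
  grind

lemma kronecker_zero_one : kronecker 0 1 = 1 := by rw [kronecker_of_odd 0 odd_one]; simp

lemma gaussS_units_mul (ε : ℤˣ) {c d : ℤ} [NeZero c.natAbs] (h4 : (4 : ℤ) ∣ c) (hd : d % 4 = 1)
    (hcd : IsCoprime c d) : gaussS (ε * d) c.natAbs =
      (1 + ((ε : ℤ) : ℂ) * I) * (√|(c : ℝ)| : ℝ) * kronecker c d := by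
  have := gaussS_eq_kronecker h4 hd hcd
  rcases units_eq_one_or ε with rfl | rfl
  · simpa
  · rw [show (((-1 : ℤˣ) : ℤ) * d) = -d by simp, gaussS_neg, this]
    simp

lemma one_sub_units_mul_I (ε : ℤˣ) : (1 - ((ε : ℤ) : ℂ) * I) * (1 + ((ε : ℤ) : ℂ) * I) = 2 := by
  linear_combination (-((ε : ℤ) : ℂ) * (ε : ℤ)) * I_sq + units_cast_sq ε

lemma eisTerm_neg_mul {μ : ℂ} {h : ℝ → ℂ} {a c d : ℤ} {b : ℤ} (hc : c ≠ 0) (h4 : (4 : ℤ) ∣ c)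
    (hd : d % 4 = 1) (hdet : a * d - b * c = 1) :
    eisTerm ε μ h (c.sign * a, c.natAbs) = (if 0 < c then chi (-ε) else 1) * kronecker c d *
      (|(c : ℝ)| : ℝ) ^ (-μ - 1) * chart (1 + μ) h (a / c) := by
  have hc' : c.natAbs ≠ 0 := Int.natAbs_ne_zero.2 hc
  have hca : IsCoprime a c := ⟨d, -b, by linarith⟩
  have hs : c.sign = 1 ∧ 0 < c ∨ c.sign = -1 ∧ c < 0 := by grind
  have hco : IsCoprime (c.sign * a) (c.natAbs : ℤ) := by
    rw [Int.isCoprime_iff_gcd_eq_one, Int.gcd, Int.natAbs_natCast]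
    rcases hs with ⟨e, -⟩ | ⟨e, -⟩ <;> simpa [e, Int.gcd] using Int.isCoprime_iff_gcd_eq_one.1 hca
  rw [eisTerm, dif_neg hc', if_pos ⟨by omega, hco⟩]
  have := NeZero.mk hc'
  have hz : (c : ZMod c.natAbs) = 0 := (ZMod.intCast_zmod_eq_zero_iff_dvd _ _).2 (by simp)
  have hg : gaussS ((ε * (c.sign : ℤ)) * a) c.natAbs = gaussS ((ε * (c.sign : ℤ)) * d) c.natAbs := by
    refine gaussS_inv ?_
    have h1 : (a : ZMod c.natAbs) * d = 1 := by
      have := congrArg (Int.cast : ℤ → ZMod c.natAbs) hdet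
      grind
    have h2 : (((ε : ℤ) * c.sign : ℤ) : ZMod c.natAbs) * ((ε * c.sign : ℤ) : ZMod c.natAbs) = 1 := by
      have h3 : ((ε : ℤ) * c.sign) * (ε * c.sign) = 1 := by
        rcases units_eq_one_or ε with rfl | rfl <;> rcases hs with ⟨e, -⟩ | ⟨e, -⟩ <;> simp [e]
      exact_mod_cast congrArg (Int.cast : ℤ → ZMod c.natAbs) h3
    grind
  have habs : 0 < |(c : ℝ)| := abs_pos.2 (cast_ne_zero.2 hc)
  have hn : ((c.natAbs : ℕ) : ℂ) = ((|(c : ℝ)| : ℝ) : ℂ) := by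
    rw [← Complex.ofReal_natCast, Nat.cast_natAbs, cast_abs]
  have hpow : ((√|(c : ℝ)| : ℝ) : ℂ) * ((|(c : ℝ)| : ℝ) : ℂ) ^ (-(μ + 3 / 2)) =
      ((|(c : ℝ)| : ℝ) : ℂ) ^ (-μ - 1) := by
    rw [sqrt_eq_rpow, ofReal_cpow habs.le, ← cpow_add _ _ (ofReal_ne_zero.2 habs.ne')]
    push_cast
    ring_nf
  have hq : ((c.sign * a : ℤ) : ℝ) / (c.natAbs : ℕ) = a / c := by
    rw [show ((c.natAbs : ℕ) : ℝ) = c.sign * c by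
      rw [← Int.cast_mul, Int.sign_mul_self_eq_natAbs]; simp, Int.cast_mul]
    refine mul_div_mul_left _ _ ?_
    simpa
  have h12 := one_sub_units_mul_I ε
  have hne : (1 - ((ε : ℤ) : ℂ) * I) ≠ 0 := left_ne_zero_of_mul (h12 ▸ two_ne_zero)
  simp only []
  rw [hq, hn, ← hpow, ← mul_assoc, hg]
  have hcop : IsCoprime c d := ⟨-b, a, by linarith⟩
  have hk : gaussS ((ε * (c.sign : ℤ)) * d) c.natAbs = (1 - ((ε : ℤ) : ℂ) * I) *
      (if 0 < c then chi (-ε) else 1) * (√|(c : ℝ)| : ℝ) * kronecker c d := by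
    rcases hs with ⟨e, h0⟩ | ⟨e, h0⟩
    · rw [e, mul_one, gaussS_units_mul ε h4 hd hcop, if_pos h0, chi_neg]
      grind
    · have := gaussS_units_mul (-ε) h4 hd hcop
      rw [e, if_neg h0.not_gt]
      simpa
  grind

lemma exists_mem_Gamma14 {a c : ℤ} (ha : a % 4 = 1) (hc : (4 : ℤ) ∣ c) (h : IsCoprime a c) :
    ∃ γ ∈ Gamma14, γ.mat.1 0 0 = a ∧ γ.mat.1 1 0 = c := by
  obtain ⟨d, b, e⟩ := h
  have hd : d % 4 = 1 := by
    obtain ⟨k, rfl⟩ := hc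
    have h1 : d * a % 4 = 1 := by rw [show d * a = 1 + 4 * (-(b * k)) by linarith]; omega
    rw [Int.mul_emod, ha] at h1
    omega
  have hk := kronecker_eq_one_or hd (⟨b, a, by linarith⟩ : IsCoprime c d)
  have hu : ∃ u : ℤˣ, (u : ℤ) = kronecker c d := by
    rcases hk with h | h
    exacts [⟨1, by simp [h]⟩, ⟨-1, by simp [h]⟩]
  obtain ⟨u, hu⟩ := hu
  refine ⟨⟨⟨!![(a : ℝ), ((-b : ℤ) : ℝ); (c : ℝ), (d : ℝ)], ?_⟩, u⟩, ⟨a, -b, c, d, rfl, ha, hd,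
    Int.emod_eq_zero_of_dvd hc, hu⟩, rfl, rfl⟩
  rw [Matrix.det_fin_two_of]
  exact_mod_cast (by linarith : a * d - -b * c = 1)

lemma exists_injective_eisCosets (ε : ℤˣ) : ∃ j : EisCosets → ℤ × ℕ, Function.Injective j ∧
    (∀ q μ (φ : SmoothVec (-ε) (-μ)),
      act q.1.out (deltaInfty ε μ) φ = eisTerm ε μ (restr φ) (j q)) ∧
    ∀ p, p ∉ Set.range j → ∀ μ h, eisTerm ε μ h p = 0 := by
  choose γ hγ hq using fun q : EisCosets => q.2
  choose a b c d hm ha hd hc hs using hγ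
  have hdet : ∀ q, a q * d q - b q * c q = 1 := fun q => by
    have := det_eq (γ q).mat
    simp only [hm, of_apply, cons_val', cons_val_zero, cons_val_one, cons_val_fin_one] at this
    exact_mod_cast this
  have ha' : ∀ q, a q % 4 = 1 := ha
  have hd' : ∀ q, d q % 4 = 1 := hd
  have h4 : ∀ q, (4 : ℤ) ∣ c q := fun q => Int.dvd_of_emod_eq_zero (hc q)
  have h0 : ∀ q, c q = 0 → a q = 1 ∧ d q = 1 := fun q h => by
    have h1 := hdet q
    rw [h, mul_zero, sub_zero] at h1
    have h2 := ha' q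
    rcases Int.eq_one_or_neg_one_of_mul_eq_one h1 with h | h <;> rw [h] at h1 h2 <;> omega
  refine ⟨fun q => ((c q).sign * a q, (c q).natAbs), fun q q' e => ?_, fun q μ φ => ?_,
    fun p hp μ h => ?_⟩
  · obtain ⟨e1, e2⟩ := Prod.mk.inj e
    have hca : c q = c q' ∧ a q = a q' := by grind
    obtain ⟨ec, ea⟩ := hca
    have h1 := hdet q
    have h2 := hdet q'
    rw [← ec, ← ea] at h2
    set m := d q * b q' - b q * d q' with hmdef
    have hb' : b q' = a q * m + b q := by grind
    have hdd : d q' = c q * m + d q := by grind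
    have hk : kronecker (c q') (d q') = kronecker (c q) (d q) := by
      rw [← ec]
      by_cases hz : c q = 0
      · grind
      · have : NeZero (c q).natAbs := ⟨Int.natAbs_ne_zero.2 hz⟩
        have g1 := gaussS_eq_kronecker (h4 q) (hd' q) ⟨-b q, a q, by linarith⟩
        have g2 := gaussS_eq_kronecker (h4 q) (hd' q') ⟨-b q', a q, by linarith⟩
        have hz' : (c q : ZMod (c q).natAbs) = 0 :=
          (ZMod.intCast_zmod_eq_zero_iff_dvd _ _).2 (by simp)
        rw [gaussS_congr (b' := d q) (by rw [hdd]; grind), g1] at g2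
        have hne : (1 + I) * ((√|(c q : ℝ)| : ℝ) : ℂ) ≠ 0 := by
          refine mul_ne_zero (fun h => ?_) (ofReal_ne_zero.2
            (sqrt_pos.2 (abs_pos.2 (cast_ne_zero.2 hz))).ne')
          simpa using congrArg re h
        exact_mod_cast (mul_left_cancel₀ hne g2).symm
    have : γ q' = γ q * nPlus m := by
      obtain ⟨i1, i2, i3, i4⟩ := mul_nPlus_entries (γ q).mat m
      refine Mp.ext (SL2_ext ?_ ?_ ?_ ?_) (Units.ext ?_)
      · rw [Mp.mul_mat, i1, hm, hm]; simp [ea]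
      · rw [Mp.mul_mat, i2, hm, hm]; simp [hb']
      · rw [Mp.mul_mat, i3, hm, hm]; simp [ec]
      · rw [Mp.mul_mat, i4, hm, hm]; simp [hdd]
      · rw [sgn_mul_nPlus, hs, hs, hk]
    refine Subtype.ext ?_
    rw [← hq q, ← hq q', this]
    exact QuotientGroup.eq.2 (mem_GammaInf.2 ⟨m, by simp⟩)
  · obtain ⟨m, hm'⟩ := eq_mul_nPlus ((hq q).trans (QuotientGroup.out_eq' q.1).symm)
    have h1 : act q.1.out (deltaInfty ε μ) φ = φ (q.1.out * sTilde) := by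
      show φ ((q.1.out⁻¹)⁻¹ * ((sTilde⁻¹)⁻¹ * 1)) = _
      simp
    rw [h1, hm', φ.mul_nPlus_mul_sTilde]
    by_cases hz : c q = 0
    · obtain ⟨e1, e2⟩ := h0 q hz
      have : γ q = 1 * nPlus (b q) := by
        obtain ⟨i1, i2, i3, i4⟩ := mul_nPlus_entries 1 (b q : ℝ)
        refine Mp.ext (SL2_ext ?_ ?_ ?_ ?_) (Units.ext ?_)
        · rw [Mp.mul_mat]; exact ((hm q ▸ (by simp [e1]) : (γ q).mat.1 0 0 = 1)).trans i1.symm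
        · rw [Mp.mul_mat]; refine Eq.trans ?_ i2.symm; rw [hm]; simp
        · rw [Mp.mul_mat]; refine Eq.trans ?_ i3.symm; simp [*]
        · rw [Mp.mul_mat]; refine Eq.trans ?_ i4.symm; simp [*]
        · rw [sgn_mul_nPlus, hs, hz, e2, kronecker_zero_one]; rfl
      rw [this, φ.mul_nPlus_mul_sTilde, one_mul, sTilde_eq, eisTerm, dif_pos (by simp [hz]),
        if_pos (by simp [hz])]
      rfl
    · rw [φ.apply_mul_sTilde (hm q) (cast_ne_zero.2 hz) (cast_ne_zero.2 (by
        grind)), eisTerm_neg_mul hz (h4 q) (hd' q) (hdet q), hs]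
      have := congrFun φ.nPlus_eq_chart (a q / c q : ℝ)
      simp [*]
  · contrapose! hp
    have key : ∀ {a₀ c₀ : ℤ}, a₀ % 4 = 1 → (4 : ℤ) ∣ c₀ → IsCoprime a₀ c₀ →
        ∃ q, c q = c₀ ∧ a q = a₀ := fun {a₀ c₀} h1 h2 h3 => by
      obtain ⟨g, hg, e1, e2⟩ := exists_mem_Gamma14 h1 h2 h3
      refine ⟨⟨(g : Mp ⧸ GammaInf), g, hg, rfl⟩, ?_⟩
      set q : EisCosets := ⟨(g : Mp ⧸ GammaInf), g, hg, rfl⟩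
      obtain ⟨m, hm'⟩ := eq_mul_nPlus (hq q).symm
      obtain ⟨i1, -, i3, -⟩ := mul_nPlus_entries g.mat m
      rw [← Mp.mul_mat, ← hm', hm q] at i1 i3
      rw [e1] at i1
      rw [e2] at i3
      simp only [of_apply, cons_val', cons_val_zero, cons_val_one, cons_val_fin_one] at i1 i3
      exact ⟨mod_cast i3, mod_cast i1⟩
    obtain ⟨x, y⟩ := p
    unfold eisTerm at hp
    simp only at hp
    split_ifs at hp with hy hx hxy
    · obtain ⟨q, e1, -⟩ := key (a₀ := 1) (c₀ := 0) (by norm_num) (dvd_zero _) isCoprime_one_left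
      grind
    · grind
    · have hy' : (0 : ℤ) < y := by omega
      have hodd : x % 4 = 1 ∨ (-x) % 4 = 1 := by
        obtain ⟨u, v, e⟩ := hxy.2
        obtain ⟨k, rfl⟩ := hxy.1
        have : u * x + 4 * (v * k) = 1 := by grind
        rcases Int.emod_two_eq_zero_or_one x with h | h
        · obtain ⟨z, rfl⟩ := Int.dvd_of_emod_eq_zero h
          grind
        · omega
      have hd4 : (4 : ℤ) ∣ y := mod_cast hxy.1
      rcases hodd with h | h
      · grind
      · obtain ⟨q, e1, e2⟩ := key h (dvd_neg.2 hd4) hxy.2.neg_neg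
        grind
    grind

/-! ### Fourier expansion of the Eisenstein series -/

def fw (μ : ℂ) (h : ℝ → ℂ) (ξ : ℝ) : ℂ := ∫ x, chart (1 + μ) h x * expTwoPi (ξ * x)

lemma wav_eq_fw {μ : ℂ} (hμ : 0 < μ.re) {χ : ℂ} (hχ : ‖χ‖ = 1) {h : ℝ → ℂ} (hh : IsQP χ h)
    {ξ : ℝ} (hξ : ξ ≠ 0) : wav μ ξ h = fw μ h ξ := by
  rw [wav_eq_wv (k := 0) (by simpa) hξ hh.contDiff (hh.exists_bd hχ)]
  simp [wv, aopIter, fw, add_comm]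

lemma exists_norm_wav_le (k : ℕ) {μ : ℂ} (hk : 0 < μ.re + k) : ∃ C, 0 ≤ C ∧
    ∀ {χ : ℂ}, ‖χ‖ = 1 → ∀ {h : ℝ → ℂ}, IsQP χ h → ∀ M, Bd k M h → ∀ n : ℤ, n ≠ 0 →
      ‖wav μ n h‖ ≤ C * (|n| : ℝ)⁻¹ ^ k * M := by
  obtain ⟨C, h0, hC⟩ := exists_norm_wv_le k hk
  refine ⟨C, h0, fun hχ h hh M hM n hn => ?_⟩
  rw [wav_eq_wv hk (cast_ne_zero.2 hn) hh.contDiff (hh.exists_bd hχ)]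
  exact hC h M hh.contDiff hM n

lemma summable_int_inv_sq : Summable fun n : ℤ => (|n| : ℝ)⁻¹ ^ 2 := by
  simpa using (Real.summable_one_div_int_pow (p := 2)).2 one_lt_two

lemma summable_fw {μ : ℂ} (hμ : 0 < μ.re) {χ : ℂ} (hχ : ‖χ‖ = 1) {h : ℝ → ℂ} (hh : IsQP χ h) :
    Summable fun n : ℤ => ‖fw μ h n‖ := by
  obtain ⟨C, -, hC⟩ := exists_norm_wav_le 2 (μ := μ) (by positivity)
  obtain ⟨M, hM⟩ := hh.exists_bd hχ 2
  refine Summable.of_norm_bounded_eventually ((summable_int_inv_sq.mul_left C).mul_right M) ?_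
  filter_upwards [(Set.finite_singleton (0 : ℤ)).compl_mem_cofinite] with n hn
  rw [norm_norm, ← wav_eq_fw hμ hχ hh (cast_ne_zero.2 hn)]
  grind

lemma poisson_chart {μ : ℂ} (hμ : 0 < μ.re) {χ : ℂ} (hχ : ‖χ‖ = 1) {h : ℝ → ℂ} (hh : IsQP χ h)
    (x : ℝ) : ∑' m : ℤ, chart (1 + μ) h (x + m) = ∑' n : ℤ, fw μ h n * expTwoPi (-(n * x)) := by
  obtain ⟨M, hM⟩ := hh.exists_bound hχ
  have e : ∀ n : ℤ, FourierTransform.fourier (chart (1 + μ) h) (n : ℝ) = fw μ h (-n : ℝ) := fun n => by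
    have := fourier_neg_eq (chart (1 + μ) h) (-n : ℝ)
    rwa [neg_neg] at this
  rw [Real.tsum_eq_tsum_fourier_of_rpow_decay_of_summable (b := 1 + μ.re)
    (continuous_chart _ hh.contDiff.continuous) (by linarith), ← (Equiv.neg ℤ).tsum_eq]
  · refine tsum_congr fun n => ?_
    rw [e, fourier_coe_apply, expTwoPi]
    simp only [Equiv.neg_apply]
    push_cast
    ring_nf
  · refine Asymptotics.IsBigO.of_bound M ?_
    filter_upwards [(isCompact_singleton (x := (0 : ℝ))).compl_mem_cocompact] with y hy
    have h0 : 0 < |y| := abs_pos.2 hy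
    refine (norm_chart_le hM (s := 1 + μ.re) (by simp) y).trans ?_
    rw [norm_of_nonneg (by positivity)]
    refine mul_le_mul_of_nonneg_left ?_ ((norm_nonneg _).trans (hM 0))
    rw [show -(1 + μ.re) = 2 * (-(1 + μ.re) / 2) by ring, rpow_mul h0.le,
      rpow_two, sq_abs, show 2 * (-(1 + μ.re) / 2) / 2 = -(1 + μ.re) / 2 by ring]
    exact Real.rpow_le_rpow_of_nonpos (by rw [← sq_abs]; positivity) (by linarith) (by linarith)
  · simp only [e]
    have := (summable_fw hμ hχ hh).of_norm.comp_injective (Equiv.neg ℤ).injective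
    exact this.congr fun n => by simp

/-- Poisson summation with a periodic weight. -/
lemma tsum_periodic_mul_chart {μ : ℂ} (hμ : 0 < μ.re) {χ : ℂ} (hχ : ‖χ‖ = 1) {h : ℝ → ℂ}
    (hh : IsQP χ h) {c : ℕ} [NeZero c] (K : ZMod c → ℂ)
    (hS : Summable fun a : ℤ => K a * chart (1 + μ) h (a / c)) :
    ∑' a : ℤ, K a * chart (1 + μ) h (a / c) =
      ∑' n : ℤ, fw μ h n * ∑ r ∈ range c, K r * expTwoPi (-(n * (r / c))) := by
  have hc : (c : ℝ) ≠ 0 := Nat.cast_ne_zero.2 (NeZero.ne c)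
  have hs := fun r : ℝ => (of_norm_bounded (summable_fw hμ hχ hh)
    (f := fun n : ℤ => fw μ h n * expTwoPi (-(n * r))) fun n => by
      rw [norm_mul, norm_expTwoPi, mul_one])
  obtain ⟨e, he⟩ : ∃ e : Fin c × ℤ ≃ ℤ, ∀ r m, e (r, m) = m * c + (r : ℕ) :=
    ⟨(Equiv.prodComm (Fin c) ℤ).trans (Int.divModEquiv c).symm, fun _ _ => rfl⟩
  rw [← e.tsum_eq, Summable.tsum_prod (f := fun p : Fin c × ℤ => K (e p : ℤ) *
    chart (1 + μ) h ((e p : ℤ) / c)) ((e.summable_iff).2 hS), tsum_fintype]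
  have : ∀ r : Fin c, ∑' m : ℤ, K ((e (r, m) : ℤ)) * chart (1 + μ) h ((e (r, m) : ℤ) / c) =
      ∑' n : ℤ, K (r : ℕ) * (fw μ h n * expTwoPi (-(n * ((r : ℕ) / c : ℝ)))) := fun r => by
    rw [tsum_mul_left, ← poisson_chart hμ hχ hh, ← tsum_mul_left]
    refine tsum_congr fun m => ?_
    rw [he]
    congr 2
    · simp
    · push_cast; field_simp; ring
  rw [sum_congr rfl fun r _ => this r,
    Fin.sum_univ_eq_sum_range fun r => ∑' n : ℤ, K (r : ℕ) * (fw μ h n * expTwoPi (-(n * (r / c : ℝ)))),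
    ← Summable.tsum_finsetSum fun r _ => (hs _).mul_left _]
  refine tsum_congr fun n => ?_
  rw [mul_sum]
  grind

lemma sum_gaussS_expTwoPi (ε : ℤˣ) (n : ℤ) (c : ℕ) [NeZero c] :
    ∑ r ∈ range c, (if IsCoprime (r : ℤ) (c : ℤ) then gaussS (ε * r) c else 0) *
      expTwoPi (-(n * (r / c))) = c * sqPrim (ε * n) c := by
  have hc : (c : ℂ) ≠ 0 := Nat.cast_ne_zero.2 (NeZero.ne c)
  have key : ∀ m : ℤ, ∑ r ∈ range c, (if IsCoprime (r : ℤ) (c : ℤ) then gaussS r c else 0) *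
      expTwoPi (-(m * (r / c))) = c * sqPrim m c := fun m => by
    rw [sqPrim_eq_gaussTwist m (NeZero.pos c), mul_div_cancel₀ _ hc, Finset.sum_filter]
    refine sum_congr rfl fun r _ => ?_
    simp only [Nat.isCoprime_iff_coprime, Nat.coprime_comm (n := r)]
    split_ifs
    · rw [gaussTwist_eq, expTwoPi]
      push_cast
      ring_nf
    simp
  rcases units_eq_one_or ε with rfl | rfl
  · simp_all
  · have := congrArg (starRingEnd ℂ) (key (-n))
    simp only [map_sum, map_mul, apply_ite (starRingEnd ℂ), map_zero, ← gaussS_neg, map_natCast,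
      map_intCast] at this
    simp only [Units.val_neg, Units.val_one, neg_mul, one_mul]
    rw [← this]
    refine sum_congr rfl fun r _ => ?_
    congr 1
    rw [expTwoPi, expTwoPi, ← exp_conj]
    simp [conj_ofReal, Complex.conj_ofNat]

lemma norm_one_sub_inv (ε : ℤˣ) : ‖(1 - ((ε : ℤ) : ℂ) * I)⁻¹‖ ≤ 1 := by
  rw [norm_inv]
  refine inv_le_one_of_one_le₀ ?_
  simpa using abs_re_le_norm (1 - ((ε : ℤ) : ℂ) * I)

lemma norm_gaussS_units_le (ε : ℤˣ) {a : ℤ} {c : ℕ} [NeZero c] (h4 : 4 ∣ c)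
    (h : IsCoprime a (c : ℤ)) : ‖gaussS (ε * a) c‖ ≤ 2 * √c := by
  have hc : (0 : ℤ) < c := mod_cast NeZero.pos c
  obtain ⟨k, hk⟩ := Int.eq_ofNat_of_zero_le (Int.emod_nonneg a hc.ne')
  have hk' : (a : ZMod c) = (k : ℤ) := by rw [← hk]; simp
  have hco : k.Coprime c := by
    rw [← Nat.isCoprime_iff_coprime, ← hk, Int.emod_def]
    simpa
  have h1 : gaussS (ε * a) c = gaussS (ε * k) c := gaussS_congr (by grind)
  rw [h1]
  rcases units_eq_one_or ε with rfl | rfl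
  · simpa using norm_gaussS_le h4 hco
  · have := norm_gaussS_le h4 hco
    simpa [gaussS_neg] using this

def eisBound (μ : ℂ) (p : ℤ × ℕ) : ℝ :=
  (if p = 0 then 1 else 0) + 2 * ‖![p.1, (p.2 : ℤ)]‖ ^ (-(1 + μ.re))

lemma eisBound_nonneg (μ : ℂ) (p : ℤ × ℕ) : 0 ≤ eisBound μ p := by unfold eisBound; positivity

lemma summable_eisBound {μ : ℂ} (hμ : 1 < μ.re) : Summable (eisBound μ) := by
  refine (hasSum_ite_eq (0 : ℤ × ℕ) (1 : ℝ)).summable.add (Summable.mul_left 2 ?_)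
  refine (EisensteinSeries.summable_one_div_norm_rpow (k := 1 + μ.re) (by linarith)).comp_injective
    (i := fun p : ℤ × ℕ => ![p.1, (p.2 : ℤ)]) fun p q e => ?_
  exact Prod.ext (congrFun e 0) (Int.natCast_inj.1 (congrFun e 1))

lemma norm_eisTerm_le {μ : ℂ} (hμ : 1 < μ.re) {h : ℝ → ℂ} {M : ℝ} (hM : ∀ θ, ‖h θ‖ ≤ M)
    (p : ℤ × ℕ) : ‖eisTerm ε μ h p‖ ≤ eisBound μ p * M := by
  have hM0 := (norm_nonneg _).trans (hM 0)
  obtain ⟨a, c⟩ := p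
  unfold eisTerm
  simp only
  split_ifs with hc ha hac
  · rw [eisBound, if_pos (by simp [ha, hc])]
    exact (hM _).trans (le_mul_of_one_le_left hM0 (le_add_of_nonneg_right (by positivity)))
  · rw [norm_zero]; exact mul_nonneg (eisBound_nonneg _ _) hM0
  · have := NeZero.mk hc
    have hc0 : (0 : ℝ) < c := Nat.cast_pos.2 (NeZero.pos c)
    have hn : 0 < ‖![a, (c : ℤ)]‖ := norm_pos_iff.2 fun e => hc (Int.natCast_inj.1 (congrFun e 1))
    have hx := one_add_sq_pos (a / c : ℝ)
    have key : ‖![a, (c : ℤ)]‖ ≤ c * (1 + (a / c : ℝ) ^ 2) ^ (1 / 2 : ℝ) := by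
      rw [← sqrt_eq_rpow, EisensteinSeries.norm_eq_max_natAbs]
      have h1 : (c : ℝ) * √(1 + (a / c : ℝ) ^ 2) = √(c ^ 2 + a ^ 2) := by
        rw [show (c : ℝ) ^ 2 + a ^ 2 = c ^ 2 * (1 + (a / c : ℝ) ^ 2) by field_simp,
          sqrt_mul (by positivity), sqrt_sq hc0.le]
      rw [h1]
      push_cast
      refine max_le ?_ ?_
      · rw [Nat.cast_natAbs, cast_abs]
        exact Real.abs_le_sqrt (by simp)
      · exact Real.le_sqrt_of_sq_le (by simp [sq_nonneg])
    have key2 : (c : ℝ) ^ (-(1 + μ.re)) * (1 + (a / c : ℝ) ^ 2) ^ (-(1 + μ.re) / 2) ≤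
        ‖![a, (c : ℤ)]‖ ^ (-(1 + μ.re)) := by
      refine le_trans (le_of_eq ?_) (Real.rpow_le_rpow_of_nonpos hn key (by linarith))
      rw [mul_rpow hc0.le (by positivity), ← rpow_mul hx.le]
      ring_nf
    rw [norm_mul, norm_mul, norm_mul, norm_natCast_cpow_neg (NeZero.pos c), eisBound,
      if_neg fun e => hc (congrArg Prod.snd e), zero_add]
    calc _ ≤ 1 * (2 * √c) * (c : ℝ) ^ (-(μ + 3 / 2).re) *
          (M * (1 + (a / c : ℝ) ^ 2) ^ (-(1 + μ.re) / 2)) := by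
          gcongr
          · exact norm_one_sub_inv ε
          · exact norm_gaussS_units_le ε hac.1 hac.2
          · exact norm_chart_le hM (by simp) _
      _ = 2 * ((c : ℝ) ^ (-(1 + μ.re)) * (1 + (a / c : ℝ) ^ 2) ^ (-(1 + μ.re) / 2)) * M := by
          have : √c * (c : ℝ) ^ (-(μ + 3 / 2).re) = (c : ℝ) ^ (-(1 + μ.re)) := by
            rw [sqrt_eq_rpow, ← rpow_add hc0]
            norm_num
            ring_nf
          grind
      _ ≤ _ := by gcongr
  · rw [norm_zero]; exact mul_nonneg (eisBound_nonneg _ _) hM0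

lemma tsum_eisTerm_fst {μ : ℂ} (hμ : 1 < μ.re) {h : ℝ → ℂ} (hh : IsQP (chi (-ε)) h) (c : ℕ)
    (hS : Summable fun a : ℤ => eisTerm ε μ h (a, c)) : ∑' a : ℤ, eisTerm ε μ h (a, c) =
      (if c = 0 then h (π / 2) else 0) + (1 - ((ε : ℤ) : ℂ) * I)⁻¹ * ∑' n : ℤ, fw μ h n *
        (if 4 ∣ c then (sqPrim (ε * n) c : ℂ) * (c : ℂ) ^ (-(μ + 1 / 2)) else 0) := by
  by_cases hc : c = 0
  · subst hc
    simp [eisTerm]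
  have := NeZero.mk hc
  rw [if_neg hc, zero_add]
  by_cases h4 : 4 ∣ c
  swap
  · simp [eisTerm, hc, h4]
  simp only [h4, if_true]
  have hc0 : (c : ℂ) ≠ 0 := Nat.cast_ne_zero.2 hc
  have hne : (1 - ((ε : ℤ) : ℂ) * I)⁻¹ * (c : ℂ) ^ (-(μ + 3 / 2)) ≠ 0 :=
    mul_ne_zero (inv_ne_zero (left_ne_zero_of_mul (one_sub_units_mul_I ε ▸ two_ne_zero)))
      (by simp_all)
  obtain ⟨K, hK⟩ : ∃ K : ZMod c → ℂ, ∀ a : ℤ, K a =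
      if IsCoprime a (c : ℤ) then gaussS (ε * a) c else 0 := by
    refine ⟨fun r => if IsCoprime (r.val : ℤ) (c : ℤ) then gaussS (ε * r.val) c else 0, fun a => ?_⟩
    have h1 : IsCoprime (((a : ZMod c).val : ℕ) : ℤ) (c : ℤ) ↔ IsCoprime a (c : ℤ) := by
      rw [ZMod.val_intCast, Int.emod_def, sub_eq_add_neg, ← mul_neg]
      exact IsCoprime.add_mul_left_left_iff
    have h2 : gaussS (ε * ((a : ZMod c).val : ℕ)) c = gaussS (ε * a) c := gaussS_congr (by simp)
    grind
  have e : ∀ a : ℤ, eisTerm ε μ h (a, c) = (1 - ((ε : ℤ) : ℂ) * I)⁻¹ * (c : ℂ) ^ (-(μ + 3 / 2)) *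
      (K a * chart (1 + μ) h (a / c)) := fun a => by
    rw [eisTerm, dif_neg hc, hK]
    grind
  simp only [e] at hS ⊢
  rw [tsum_mul_left, tsum_periodic_mul_chart (by linarith) (norm_chi _) hh K
    ((summable_mul_left_iff hne).1 hS), mul_assoc, ← tsum_mul_left]
  congr 1
  refine tsum_congr fun n => ?_
  have : ∑ r ∈ range c, K r * expTwoPi (-(n * (r / c))) = c * sqPrim (ε * n) c := by
    rw [← sum_gaussS_expTwoPi]
    refine sum_congr rfl fun r _ => ?_
    rw [← hK, Int.cast_natCast]
  rw [this, show -(μ + 1 / 2) = -(μ + 3 / 2) + 1 by ring, cpow_add _ _ hc0, cpow_one]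
  ring

def eisCoeff (ε : ℤˣ) (n : ℤ) (μ : ℂ) : ℂ :=
  (1 - ((ε : ℤ) : ℂ) * I)⁻¹ * eisStar (ε * n) (μ + 1 / 2) / (μ - 1 / 2)

def eisZero (ε : ℤˣ) (μ : ℂ) : ℂ := (1 - ((ε : ℤ) : ℂ) * I)⁻¹ *
  (2 : ℂ) ^ (-(2 * μ + 1)) * chi ε * (π : ℂ) ^ μ * completedRiemannZeta (2 * μ)

def eisFun (ε : ℤˣ) (μ : ℂ) (h : ℝ → ℂ) : ℂ :=
  (∑' n : ℤ, if n = 0 then 0 else eisCoeff ε n μ * wav μ n h) +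
    eisZero ε μ * kop μ h (π / 2) + zetaTwo (2 * μ + 1) * h (π / 2)

lemma units_mul_ne_zero (ε : ℤˣ) {n : ℤ} (hn : n ≠ 0) : (ε : ℤ) * n ≠ 0 := mul_ne_zero ε.ne_zero hn

lemma fw_zero {μ : ℂ} (hμ : 0 < μ.re) {h : ℝ → ℂ} (hh : IsQP (chi (-ε)) h) :
    fw μ h 0 = chi ε * Gamma μ * kop μ h (π / 2) := by
  have h0 : order μ = 0 := Nat.floor_eq_zero.2 (by linarith)
  rw [← oneReg_eq_kop (mem_gammaDomain_of_re_pos hμ) hh, h0, ← integral_chart_eq_oneReg hμ hh, fw]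
  simp [expTwoPi_zero]

lemma zetaTwo_mul_tsum_eisTerm {μ : ℂ} (hμ : 1 < μ.re) {h : ℝ → ℂ} (hh : IsQP (chi (-ε)) h) :
    zetaTwo (2 * μ + 1) * ∑' p, eisTerm ε μ h p = eisFun ε μ h := by
  have hμ0 : 0 < μ.re := by linarith
  have hχ := norm_chi (-ε)
  obtain ⟨M, hM⟩ := hh.exists_bound hχ
  have hS : Summable (eisTerm ε μ h) := of_norm_bounded
    ((summable_eisBound hμ).mul_right M) (norm_eisTerm_le hμ hM)
  set D : ℤ → ℕ → ℂ := fun m c =>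
    if 4 ∣ c then (sqPrim m c : ℂ) * (c : ℂ) ^ (-(μ + 1 / 2)) else 0 with hD
  have hD2 : ∀ m c, ‖D m c‖ ≤ 2 * (c : ℝ) ^ (-μ.re) := fun m c => by
    rcases Nat.eq_zero_or_pos c with rfl | hc
    · simp only [hD, dvd_zero, if_true, ArithmeticFunction.map_zero, Int.cast_zero, zero_mul,
        norm_zero]
      positivity
    simp only [hD]
    split_ifs with h4
    · rw [norm_mul, norm_natCast_cpow_neg hc]
      refine (mul_le_mul_of_nonneg_right (norm_sqPrim_le_of_four_dvd m hc.ne' h4)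
        (by positivity)).trans (le_of_eq ?_)
      rw [mul_assoc, sqrt_eq_rpow, ← rpow_add (Nat.cast_pos.2 hc)]
      norm_num
    · rw [norm_zero]; positivity
  have hP : Summable fun p : ℤ × ℕ => fw μ h p.1 * D (ε * p.1) p.2 := by
    refine of_norm_bounded ((summable_fw hμ0 hχ hh).mul_of_nonneg
      ((Real.summable_nat_rpow.2 (neg_lt_neg hμ)).mul_left 2) (fun _ => norm_nonneg _)
      fun _ => by positivity) fun p => ?_
    rw [norm_mul]
    exact mul_le_mul_of_nonneg_left (hD2 _ _) (norm_nonneg _)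
  have h1 : ∑' p, eisTerm ε μ h p = h (π / 2) + (1 - ((ε : ℤ) : ℂ) * I)⁻¹ *
      ∑' n : ℤ, fw μ h n * ∑' c, D (ε * n) c := by
    rw [← (Equiv.prodComm ℕ ℤ).tsum_eq]
    refine (Summable.tsum_prod (f := fun p : ℕ × ℤ => eisTerm ε μ h (p.2, p.1)) hS.prod_symm).trans ?_
    have hQ : Summable fun c : ℕ => ∑' n : ℤ, fw μ h n * D (ε * n) c := hP.prod_symm.prod
    refine (tsum_congr fun c => tsum_eisTerm_fst hμ hh c (hS.prod_symm.prod_factor c)).trans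
      ((Summable.tsum_add (hasSum_ite_eq 0 _).summable (hQ.mul_left _)).trans ?_)
    rw [tsum_ite_eq, tsum_mul_left]
    congr 2
    refine (Summable.tsum_comm (f := fun (n : ℤ) (c : ℕ) => fw μ h n * D (ε * n) c) hP).trans ?_
    exact tsum_congr fun n => tsum_mul_left
  have hre : 3 / 2 < (μ + 1 / 2).re := by simp; linarith
  have h2 : 2 * μ + 1 = 2 * (μ + 1 / 2) := by ring
  have h3 : (1 - ((ε : ℤ) : ℂ) * I)⁻¹ * (zetaTwo (2 * μ + 1) *
      ∑' n : ℤ, fw μ h n * ∑' c, D (ε * n) c) =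
      eisZero ε μ * kop μ h (π / 2) +
        ∑' n : ℤ, if n = 0 then 0 else eisCoeff ε n μ * wav μ n h := by
    have hs : Summable fun n : ℤ => fw μ h n * ∑' c, D (ε * n) c := by
      simpa only [tsum_mul_left] using hP.prod
    rw [hs.tsum_eq_add_tsum_ite 0, mul_add, mul_add]
    congr 1
    · have e0 := zetaTwo_mul_tsum_zero hre
      rw [← h2, show 2 * μ + 1 - 1 = 2 * μ by ring] at e0
      have e1 := fw_zero hμ0 hh
      have e2 : Gamma μ * riemannZeta (2 * μ) = (π : ℂ) ^ μ * completedRiemannZeta (2 * μ) := by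
        have hz : μ ≠ 0 := fun h => by simp [h] at hμ0
        rw [riemannZeta_def_of_ne_zero (by simpa), Complex.Gammaℝ_def,
          mul_div_cancel_left₀ _ two_ne_zero, show -(2 * μ) / 2 = -μ by ring, cpow_neg]
        have := Gamma_ne_zero_of_re_pos hμ0
        field_simp
      simp only [Int.cast_zero, mul_zero, e1]
      simp only [hD]
      rw [eisZero]
      grind
    · rw [← tsum_mul_left, ← tsum_mul_left]
      refine tsum_congr fun n => ?_
      split_ifs with hn
      · simp
      · have e0 := eisStar_eq (units_mul_ne_zero ε hn) hre
        rw [← h2, show μ + 1 / 2 - 1 = μ - 1 / 2 by ring] at e0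
        rw [wav_eq_fw hμ0 hχ hh (cast_ne_zero.2 hn), eisCoeff]
        grind
  rw [h1, eisFun]
  grind

lemma exists_norm_eisCoeff_le (ε : ℤˣ) {R δ : ℝ} (hR : 0 ≤ R) (hδ : 0 < δ) : ∃ (C : ℝ) (k : ℕ),
    0 ≤ C ∧ ∀ n : ℤ, n ≠ 0 → ∀ μ : ℂ, ‖μ‖ ≤ R → δ ≤ ‖μ - 1 / 2‖ →
      ‖eisCoeff ε n μ‖ ≤ C * |(n : ℝ)| ^ k := by
  obtain ⟨C, A, hC, hA, hb⟩ := exists_norm_eisStar_le (R := R + 1) (by linarith)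
  refine ⟨C * 8 ^ A / δ, ⌈A⌉₊, by positivity, fun n hn μ hμ hμ' => ?_⟩
  have h1 := hb (ε * n) (units_mul_ne_zero ε hn) (μ + 1 / 2) ((norm_add_le _ _).trans (by
    norm_num; linarith))
  have hn1 : 1 ≤ |(n : ℝ)| := mod_cast Int.one_le_abs hn
  rw [Int.natAbs_mul, Int.units_natAbs, one_mul] at h1
  rw [eisCoeff, norm_div, norm_mul, div_mul_eq_mul_div]
  refine div_le_div₀ (by positivity) ?_ hδ hμ'
  refine (mul_le_of_le_one_left (norm_nonneg _) (norm_one_sub_inv ε)).trans (h1.trans ?_)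
  push_cast
  rw [Nat.cast_natAbs, cast_abs, mul_rpow (by norm_num) (abs_nonneg _), ← mul_assoc]
  gcongr
  rw [← rpow_natCast]
  exact Real.rpow_le_rpow_of_exponent_le hn1 (Nat.le_ceil A)

/-! ### The Eisenstein distribution -/

lemma exists_hasSum_wavDist (μ : ℂ) {c : ℤ → ℂ} {C : ℝ} {k : ℕ} (hC : 0 ≤ C)
    (hc : ∀ n, n ≠ 0 → ‖c n‖ ≤ C * |(n : ℝ)| ^ k) :
    ∃ S, HasSum (fun n : ℤ => if n = 0 then 0 else c n • wavDist ε μ n) S := by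
  obtain ⟨B, hB0, hB⟩ := exists_norm_wav_le (order μ + k + 2) (μ := μ) (by
    have := order_spec μ; grind)
  set T : ℤ → Dist ε μ := fun n => if n = 0 then 0 else c n • wavDist ε μ n
  set l := order μ + k + 2
  have hb : ∀ n φ, ‖T n φ‖ ≤ C * B * (|n| : ℝ)⁻¹ ^ 2 * supNorm l φ := fun n φ => by
    by_cases hn : n = 0
    · simp [T, hn]
    have hn1 : 1 ≤ |(n : ℝ)| := mod_cast Int.one_le_abs hn
    have h1 := hB (norm_chi _) (isQP_restr φ) _ (bd_restr l φ) n hn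
    have hs := supNorm_nonneg l φ
    simp only [T, if_neg hn]
    show ‖c n * wavDist ε μ n φ‖ ≤ _
    rw [norm_mul, wavDist_apply]
    refine (mul_le_mul (hc n hn) h1 (norm_nonneg _) (by positivity)).trans ?_
    rw [show C * |(n : ℝ)| ^ k * (B * (|n| : ℝ)⁻¹ ^ l * supNorm l φ) =
      C * B * (|(n : ℝ)| ^ k * (|n| : ℝ)⁻¹ ^ l) * supNorm l φ by ring]
    gcongr
    have hn0 : |(n : ℝ)| ≠ 0 := by positivity
    rw [show l = k + (2 + order μ) by omega, pow_add, ← mul_assoc, ← mul_pow, mul_inv_cancel₀ hn0,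
      one_pow, one_mul, pow_add]
    exact mul_le_of_le_one_right (by positivity) (pow_le_one₀ (by positivity)
      (inv_le_one_of_one_le₀ hn1))
  have hs := summable_int_inv_sq.mul_left (C * B)
  have hsum : ∀ φ, Summable fun n => T n φ := fun φ =>
    of_norm_bounded (hs.mul_right _) fun n => hb n φ
  refine ⟨mkDist ⟨⟨fun φ => ∑' n, T n φ, fun φ φ' => ?_⟩, fun z φ => ?_⟩
    ⟨l, ∑' n : ℤ, C * B * (|n| : ℝ)⁻¹ ^ 2, fun φ => ?_⟩, hasSum_strong (fun φ => (hsum φ).hasSum) hs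
    (fun n => by positivity) hb⟩
  · simp only [map_add]; exact (hsum φ).tsum_add (hsum φ')
  · simp only [map_smul, smul_eq_mul]; exact tsum_mul_left
  · rw [← tsum_mul_right]
    exact tsum_of_norm_bounded (hs.mul_right _).hasSum fun n => hb n φ

def eisDist (ε : ℤˣ) (μ : ℂ) : Dist ε μ :=
  (∑' n : ℤ, if n = 0 then 0 else eisCoeff ε n μ • wavDist ε μ n) + oneDist ε μ (eisZero ε μ) +
    zetaTwo (2 * μ + 1) • deltaInfty ε μ

lemma hasSum_eisCoeff {μ : ℂ} (hμ : μ ≠ 1 / 2) :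
    HasSum (fun n : ℤ => if n = 0 then 0 else eisCoeff ε n μ • wavDist ε μ n)
      (∑' n : ℤ, if n = 0 then 0 else eisCoeff ε n μ • wavDist ε μ n) := by
  obtain ⟨C, k, hC, h⟩ := exists_norm_eisCoeff_le ε (norm_nonneg μ) (norm_pos_iff.2 (sub_ne_zero.2 hμ))
  obtain ⟨S, hS⟩ := exists_hasSum_wavDist μ hC fun n hn => h n hn μ le_rfl le_rfl
  exact hS.summable.hasSum

lemma deltaInfty_apply (μ : ℂ) (φ : SmoothVec (-ε) (-μ)) : deltaInfty ε μ φ = restr φ (π / 2) := by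
  show φ ((sTilde⁻¹)⁻¹ * 1) = φ (kTilde _)
  rw [inv_inv, mul_one, sTilde_eq]

lemma eisDist_apply {μ : ℂ} (hμ : μ ≠ 1 / 2) (φ : SmoothVec (-ε) (-μ)) :
    eisDist ε μ φ = eisFun ε μ (restr φ) := by
  have h := (hasSum_eisCoeff (ε := ε) hμ).map (⟨⟨fun T : Dist ε μ => T φ, rfl⟩, fun _ _ => rfl⟩ :
    Dist ε μ →+ ℂ) (ContinuousEvalConst.continuous_eval_const φ)
  show (∑' n : ℤ, _ : Dist ε μ) φ + oneDist ε μ (eisZero ε μ) φ +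
    zetaTwo (2 * μ + 1) * deltaInfty ε μ φ = _
  rw [oneDist_apply, deltaInfty_apply, eisFun]
  congr 2
  refine h.tsum_eq.symm.trans (tsum_congr fun n => ?_)
  simp only [Function.comp_apply, AddMonoidHom.coe_mk, ZeroHom.coe_mk]
  split_ifs
  · rfl
  rfl

lemma differentiableAt_zetaTwo {s : ℂ} (hs : s ≠ 1) : DifferentiableAt ℂ zetaTwo s :=
  ((differentiableAt_const _).sub (differentiableAt_id.neg.const_cpow (.inl two_ne_zero))).mul
    (differentiableAt_riemannZeta hs)

lemma differentiableOn_eisCoeff (ε : ℤˣ) {n : ℤ} (hn : n ≠ 0) :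
    DifferentiableOn ℂ (eisCoeff ε n) {μ | μ ≠ 1 / 2} := fun μ hμ =>
  ((((differentiable_eisStar (units_mul_ne_zero ε hn)).comp (differentiable_id.add_const _)).const_mul
    _ μ).div (differentiableAt_id.sub_const _) (sub_ne_zero.2 hμ)).differentiableWithinAt

lemma differentiableOn_eisFun {h : ℝ → ℂ} (hh : IsQP (chi (-ε)) h) :
    DifferentiableOn ℂ (fun μ => eisFun ε μ h) {μ | μ ≠ 0 ∧ μ ≠ 1 / 2} := by
  have hF := HolFam.const (norm_chi (-ε)) hh univ
  intro μ ⟨h0, h1⟩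
  refine DifferentiableAt.differentiableWithinAt (.add (.add ?_ (.mul ?_ ?_)) (.mul_const ?_ _))
  · obtain ⟨δ, hδ, hδ'⟩ : ∃ δ, 0 < δ ∧ δ + δ = ‖μ - 1 / 2‖ :=
      ⟨_, half_pos (norm_pos_iff.2 (sub_ne_zero.2 h1)), add_halves _⟩
    obtain ⟨C, k, hC, hc⟩ := exists_norm_eisCoeff_le ε (add_nonneg (norm_nonneg μ) hδ.le) hδ
    set l := order μ + k + 2
    obtain ⟨M, hM⟩ := (hF.aopIter isOpen_univ (b := fun ν => ν + 1)
      (differentiableOn_id.add_const _) l).bd μ (mem_univ _) 0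
    have ho := order_spec μ
    have hre : ∀ᶠ z in 𝓝 μ, -(order μ : ℝ) < z.re :=
      continuous_re.continuousAt.eventually (lt_mem_nhds (by linarith))
    obtain ⟨r, hr, hb⟩ := Metric.eventually_nhds_iff_ball.1 (hM.and hre)
    have hV : ball μ (min r δ) ∈ 𝓝 μ := Metric.ball_mem_nhds _ (lt_min hr hδ)
    have hin : ∀ z ∈ ball μ (min r δ), ‖z‖ ≤ ‖μ‖ + δ ∧ δ ≤ ‖z - 1 / 2‖ := fun z hz => by
      have hz' : ‖z - μ‖ < δ := by rw [← dist_eq_norm]; simp_all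
      have e1 := norm_add_le (z - μ) μ
      have e2 := norm_sub_le_norm_sub_add_norm_sub μ z (1 / 2)
      rw [sub_add_cancel] at e1
      rw [norm_sub_rev μ z] at e2
      grind
    refine (Complex.differentiableOn_tsum_of_summable_norm (u := fun n : ℤ => C * (|M| * bracketInt 2) *
      (|n| : ℝ)⁻¹ ^ 2) (summable_int_inv_sq.mul_left _) (fun n => ?_) Metric.isOpen_ball
      fun n z hz => ?_).differentiableAt hV
    · by_cases hn : n = 0
      · simp [hn]
      simp only [if_neg hn]
      refine ((differentiableOn_eisCoeff ε hn).mono fun z hz e => ?_).mul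
        ((hF.differentiableOn_wav isOpen_univ differentiableOn_id (cast_ne_zero.2 hn)).mono
          (Set.subset_univ _))
      have := (hin z hz).2
      rw [e, sub_self, norm_zero] at this
      linarith
    · by_cases hn : n = 0
      · simp [hn]
      have hn1 : 1 ≤ |(n : ℝ)| := mod_cast Int.one_le_abs hn
      obtain ⟨hM', hre'⟩ := hb z (Metric.ball_subset_ball (min_le_left _ _) hz)
      have hl : (l : ℝ) = order μ + k + 2 := by simp [l]
      have hk0 : (0 : ℝ) ≤ k := k.cast_nonneg
      rw [if_neg hn, wav_eq_wv (k := l) (by grind) (cast_ne_zero.2 hn) hh.contDiff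
        (hh.exists_bd (norm_chi _)), wv, norm_mul, norm_mul, norm_pow]
      have hI := norm_integral_chart_mul_le (b := z + 1 + l) (s := 2)
        (fun θ => (hM'.norm_le θ).trans (le_abs_self M)) one_lt_two
        (by simp [hl]; linarith) fun x => (norm_expTwoPi (n * x)).le
      have hp : ‖-1 / (2 * π * I * (n : ℝ))‖ ≤ |(n : ℝ)|⁻¹ := by
        rw [norm_div, norm_neg, norm_one, one_div]
        refine inv_anti₀ (by positivity) ?_
        rw [norm_mul, norm_real, norm_eq_abs]
        refine le_mul_of_one_le_left (abs_nonneg _) ?_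
        simp only [norm_mul, norm_real, norm_I, norm_eq_abs, abs_of_pos pi_pos, Complex.norm_ofNat]
        linarith [Real.pi_gt_three]
      calc _ ≤ C * |(n : ℝ)| ^ k * (|(n : ℝ)|⁻¹ ^ l * (|M| * bracketInt 2)) :=
            mul_le_mul (hc n hn z (hin z hz).1 (hin z hz).2) (mul_le_mul
              (pow_le_pow_left₀ (norm_nonneg _) hp _) hI (norm_nonneg _) (by positivity))
              (by positivity) (by positivity)
        _ = C * (|M| * bracketInt 2) * ((|(n : ℝ)| * |(n : ℝ)|⁻¹) ^ k * |(n : ℝ)|⁻¹ ^ 2 *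
              |(n : ℝ)|⁻¹ ^ order μ) := by
            ring
        _ ≤ _ := by
            rw [mul_inv_cancel₀ (by positivity), one_pow, one_mul]
            refine mul_le_mul_of_nonneg_left (mul_le_of_le_one_right (by positivity) (pow_le_one₀
              (by positivity) (inv_le_one_of_one_le₀ hn1))) (mul_nonneg hC (mul_nonneg (abs_nonneg _)
                (bracketInt_nonneg _)))
  · refine .mul (.mul (.mul (.mul (differentiableAt_const _) (.const_cpow ?_ (.inl two_ne_zero)))
      (differentiableAt_const _)) (differentiableAt_id.const_cpow
      (.inl (ofReal_ne_zero.2 pi_ne_zero)))) (.comp μ (differentiableAt_completedZeta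
      (by simpa) fun h => h1 (by grind)) (by fun_prop))
    fun_prop
  · exact ((hF.kop isOpen_univ differentiableOn_id).differentiableOn _).differentiableAt
      Filter.univ_mem
  · exact .comp μ (differentiableAt_zetaTwo fun h => h0 (by grind)) (by fun_prop)

lemma isEisenstein_eisDist : IsEisenstein ε (eisDist ε) := by
  refine ⟨fun ν hν => ?_, fun F hF => ?_⟩
  · obtain ⟨j, hj, hv, h0⟩ := exists_injective_eisCosets ε
    have hne : ν ≠ 1 / 2 := fun h => by rw [h] at hν; norm_num at hν
    have hb : ∀ p (φ : SmoothVec (-ε) (-ν)), ‖eisTerm ε ν (restr φ) p‖ ≤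
        eisBound ν p * supNorm 0 φ := fun p φ => norm_eisTerm_le hν (bd_restr 0 φ).norm_le p
    have hs := summable_eisBound hν
    refine hasSum_strong (k := 0) (C := fun q => ‖zetaTwo (2 * ν + 1)‖ * eisBound ν (j q)) (fun φ => ?_)
      ((hs.comp_injective hj).mul_left _) (fun q => mul_nonneg (norm_nonneg _) (eisBound_nonneg _ _))
      fun q φ => ?_
    · rw [eisDist_apply hne, ← zetaTwo_mul_tsum_eisTerm hν (isQP_restr φ)]
      have := (of_norm_bounded (hs.mul_right _) fun p => hb p φ).hasSum
      exact (((hj.hasSum_iff fun p hp => h0 p hp ν _).2 this).congr_fun fun q => hv q ν φ).mul_left _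
    · show ‖zetaTwo (2 * ν + 1) * act q.1.out (deltaInfty ε ν) φ‖ ≤ _
      rw [norm_mul, hv, mul_assoc]
      exact mul_le_mul_of_nonneg_left (hb _ _) (norm_nonneg _)
  · refine (differentiableOn_eisFun (isQP_restr (F 0))).congr fun ν hν => ?_
    rw [eisDist_apply hν.2]
    exact congrArg _ (funext fun θ => hF _ _ θ)

lemma integral_expTwoPi_mul (k : ℤ) :
    ∫ x in (0 : ℝ)..1, expTwoPi (k * x) = if k = 0 then 1 else 0 := by
  split_ifs with hk
  · simp [hk, expTwoPi_zero]
  have h0 : 2 * π * I * (k : ℝ) ≠ 0 := by simpa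
  have h := intervalIntegral.integral_eq_sub_of_hasDerivAt (a := 0) (b := 1)
    (fun x _ => hasDerivAt_expTwoPi_mul k x)
    (continuous_const.mul (continuous_expTwoPi.comp (by fun_prop))).continuousOn.intervalIntegrable
  rw [intervalIntegral.integral_const_mul] at h
  have e : expTwoPi (k * 1) = 1 := by
    rw [expTwoPi, mul_one, mul_comm]
    simp
  rw [e, mul_zero, expTwoPi_zero, sub_self] at h
  grind

/-- The Fourier coefficients of a partition of unity. -/
lemma integral_mul_expTwoPi {ψ : ℝ → ℝ} (hψ : Continuous ψ) (hc : HasCompactSupport ψ)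
    (h1 : ∀ x, ∑' m : ℤ, ψ (x + m) = 1) (k : ℤ) :
    ∫ x, (ψ x : ℂ) * expTwoPi (k * x) = if k = 0 then 1 else 0 := by
  have hcont : Continuous fun x : ℝ => (ψ x : ℂ) * expTwoPi (k * x) :=
    (continuous_ofReal.comp hψ).mul (continuous_expTwoPi.comp (by fun_prop))
  have hint := hcont.integrable_of_hasCompactSupport (μ := volume)
    ((hc.comp_left (g := fun y : ℝ => (y : ℂ)) ofReal_zero).mul_right)
  obtain ⟨R, hR⟩ := (IsCompact.isBounded hc).subset_closedBall 0
  set s := Finset.Icc (-(⌈R⌉₊ + 1 : ℤ)) (⌈R⌉₊ + 1)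
  have hs : ∀ m ∉ s, ∀ x ∈ Icc (0 : ℝ) 1, ψ (x + m) = 0 := fun m hm x hx => by
    refine image_eq_zero_of_notMem_tsupport fun h => hm ?_
    have h2 := hR h
    rw [mem_closedBall_zero_iff, norm_eq_abs, abs_le] at h2
    have h3 := Nat.le_ceil R
    refine Finset.mem_Icc.2 ⟨?_, ?_⟩ <;> have h4 := hx.1 <;> have h5 := hx.2
    · have : (-(⌈R⌉₊ + 1 : ℝ)) ≤ m := by linarith
      exact_mod_cast this
    · have : (m : ℝ) ≤ ⌈R⌉₊ + 1 := by linarith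
      exact_mod_cast this
  have he : ∀ (m : ℤ) (x : ℝ), expTwoPi (k * (x + m)) = expTwoPi (k * x) := fun m x => by
    rw [mul_add, expTwoPi_add, ← Int.cast_mul]
    have : expTwoPi ((k * m : ℤ) : ℝ) = 1 := by
      rw [expTwoPi, mul_comm]
      exact_mod_cast Complex.exp_int_mul_two_pi_mul_I (k * m)
    grind
  have hz : ∀ m ∉ s, ∫ x in (0 : ℝ)..1, (ψ (x + m) : ℂ) * expTwoPi (k * (x + m)) = 0 :=
    fun m hm => by
      rw [integral_congr (g := fun _ => 0) fun x hx => ?_]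
      · simp
      simp_all
  rw [hint.hasSum_intervalIntegral_comp_add_int.unique (hasSum_sum_of_ne_finset_zero hz),
    ← integral_expTwoPi_mul]
  refine (intervalIntegral.integral_finsetSum (s := s)
    (f := fun (m : ℤ) x => (ψ (x + m) : ℂ) * expTwoPi (k * (x + m))) fun m _ =>
    Continuous.intervalIntegrable (μ := volume) (hcont.comp (continuous_add_const (m : ℝ))) 0 1).symm.trans ?_
  refine integral_congr fun x hx => ?_
  rw [uIcc_of_le zero_le_one] at hx
  have h2 := h1 x
  rw [tsum_eq_sum fun m hm => hs m hm x hx] at h2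
  simp only [he]
  rw [← sum_mul, ← Complex.ofReal_sum, h2, ofReal_one, one_mul]

lemma isEisensteinCoeff_eisCoeff : IsEisensteinCoeff ε (eisDist ε) (eisCoeff ε) := by
  refine fun n hn => ⟨fun ν hν ψ φ hψ hc h1 hφ => ?_, differentiableOn_eisCoeff ε hn⟩
  have hν0 : 0 < ν.re := by linarith
  have hh := isQP_restr φ
  have hch : ∀ x, chart (1 + ν) (restr φ) x = ψ x * expTwoPi (-(n * x)) := fun x => by
    rw [← hφ, show (1 : ℂ) + ν = 1 - -ν by ring]
    exact (congrFun φ.nPlus_eq_chart x).symm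
  have hfw : ∀ m : ℤ, fw ν (restr φ) m = if m - n = 0 then 1 else 0 := fun m => by
    rw [← integral_mul_expTwoPi hψ.continuous hc h1, fw]
    refine integral_congr_ae (ae_of_all _ fun x => ?_)
    simp only [hch]
    rw [mul_assoc, ← expTwoPi_add]
    push_cast
    ring_nf
  have hk : kop ν (restr φ) (π / 2) = 0 := by
    have h2 := fw_zero hν0 hh
    have h3 := hfw 0
    rw [if_neg (by omega), Int.cast_zero, h2] at h3
    exact (mul_eq_zero.1 h3).resolve_left
      (mul_ne_zero (chi_ne_zero ε) (Gamma_ne_zero_of_re_pos hν0))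
  have hinf : restr φ (π / 2) = 0 := by
    have h2 : Tendsto (fun x => restr φ (-arctan x)) atBot (𝓝 (restr φ (-(-(π / 2))))) :=
      (hh.contDiff.continuous.tendsto _).comp
        (tendsto_nhds_of_tendsto_nhdsWithin Real.tendsto_arctan_atBot).neg
    rw [neg_neg] at h2
    refine tendsto_nhds_unique h2 (tendsto_const_nhds.congr' ?_)
    have h3 := hasCompactSupport_iff_eventuallyEq.1 hc
    rw [coclosedCompact_eq_cocompact] at h3
    filter_upwards [atBot_le_cocompact h3] with x hx
    have h4 := norm_chart (1 + ν) (restr φ) x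
    rw [hch, hx, Pi.zero_apply, ofReal_zero, zero_mul, norm_zero] at h4
    exact (norm_eq_zero.1 ((mul_eq_zero.1 h4.symm).resolve_right
      (rpow_pos_of_pos (one_add_sq_pos x) _).ne')).symm
  rw [eisDist_apply (fun h => by rw [h] at hν; norm_num at hν), eisFun, hk, hinf, mul_zero, mul_zero,
    add_zero, add_zero, tsum_eq_single n fun m hm => ?_]
  · rw [if_neg hn, wav_eq_fw hν0 (norm_chi _) hh (cast_ne_zero.2 hn), hfw, if_pos (sub_self n),
      mul_one]
  · by_cases h0 : m = 0
    · grind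
    rw [if_neg h0, wav_eq_fw hν0 (norm_chi _) hh (cast_ne_zero.2 h0), hfw,
      if_neg (sub_ne_zero.2 hm), mul_zero]

/-! ### The functional equation -/

lemma G0_eq {s : ℂ} (hs : ∀ m : ℕ, s ≠ -(2 * m)) : G0 s = Gammaℝ s * (Gammaℝ (1 - s))⁻¹ := by
  have hD := Complex.differentiable_one_div_Gamma
  have hf : MeromorphicOn (fun s => 2 * Gamma s / (2 * π : ℂ) ^ s *
      Complex.cos (π * s / 2)) univ := fun z _ => by
    have hπ : (2 * π : ℂ) ≠ 0 := by simp
    have h1 : MeromorphicAt Gamma z := by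
      exact MeromorphicAt.inv_iff.1 (hD.analyticAt z).meromorphicAt
    have h2 : Differentiable ℂ fun s : ℂ => (2 * π : ℂ) ^ s :=
      differentiable_id.const_cpow (.inl hπ)
    have h3 : Differentiable ℂ fun s : ℂ => Complex.cos (π * s / 2) := by fun_prop
    exact (((MeromorphicAt.const 2 z).mul h1).div (h2.analyticAt z).meromorphicAt).mul
      (h3.analyticAt z).meromorphicAt
  have hne : ∀ᶠ z in 𝓝[≠] s, (Gamma z)⁻¹ ≠ 0 := by
    refine (hD.analyticAt s).eventually_eq_zero_or_eventually_ne_zero.resolve_left fun h => ?_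
    have := AnalyticOnNhd.eqOn_zero_of_preconnected_of_eventuallyEq_zero
      (fun z _ => hD.analyticAt z) isPreconnected_univ (mem_univ s) h (mem_univ 1)
    simp at this
  have hopen : ∀ᶠ z in 𝓝 s, DifferentiableAt ℂ Gammaℝ z := by
    have h1 : ∀ᶠ z in 𝓝 s, z / 2 ∈ gammaDomain := by
      refine ((continuous_id.div_const (2 : ℂ)).continuousAt.eventually
        (isOpen_gammaDomain.mem_nhds fun m h => hs m ?_))
      grind
    filter_upwards [h1] with z hz
    exact (DifferentiableAt.const_cpow (by fun_prop) (.inl (ofReal_ne_zero.2 pi_ne_zero))).mul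
      (.comp z (differentiableAt_Gamma _ hz) (by fun_prop))
  have hg : AnalyticAt ℂ (fun z => Gammaℝ z * (Gammaℝ (1 - z))⁻¹) s := by
    refine Complex.analyticAt_iff_eventually_differentiableAt.2 ?_
    filter_upwards [hopen] with z hz
    exact hz.mul ((Complex.differentiable_Gammaℝ_inv.comp (by fun_prop :
      Differentiable ℂ fun z : ℂ => 1 - z)) z)
  rw [G0, toMeromorphicNFOn_eq_toMeromorphicNFAt hf (mem_univ s)]
  refine (toMeromorphicNFAt_eventuallyEq_nhds_congr ?_).self_of_nhds.trans
    (congrFun (toMeromorphicNFAt_eq_self.2 hg.meromorphicNFAt) s)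
  filter_upwards [hne] with z hz
  rw [← div_eq_mul_inv, Complex.Gammaℝ_div_Gammaℝ_one_sub fun n h => hz ?_, Complex.Gammaℂ_def,
    cpow_neg, div_eq_mul_inv]
  · ring
  · rw [inv_eq_zero, Complex.Gamma_eq_zero_iff]
    exact ⟨2 * n + 1, by grind⟩

lemma two_mul_ne {ν : ℂ} (hν : ∀ m : ℕ, ν ≠ -m) (m : ℕ) : 2 * ν ≠ -(2 * m) := fun h =>
  hν m (by grind)

lemma Gammaℝ_two_mul_ne_zero {ν : ℂ} (hν : ∀ m : ℕ, ν ≠ -m) : Gammaℝ (2 * ν) ≠ 0 :=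
  fun h => (Complex.Gammaℝ_eq_zero_iff.1 h).elim (two_mul_ne hν)

lemma coeff_zero (a : ℤ → ℂ → ℂ) {ν : ℂ} (hν : ∀ m : ℕ, ν ≠ -m) :
    coeff ε a ν 0 = zetaTwo (2 * -ν + 1) := by
  have h0 : 2 * ν ≠ 0 := by simpa using two_mul_ne hν 0
  rw [coeff, if_pos rfl, zetaTwo, show -(2 * -ν + 1) = 2 * ν - 1 by ring,
    show 2 * -ν + 1 = 1 - 2 * ν by ring]
  by_cases h1 : 2 * ν = 1
  · simp [h1]
  rw [G0_eq (two_mul_ne hν), riemannZeta_def_of_ne_zero h0,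
    riemannZeta_def_of_ne_zero (sub_ne_zero.2 (Ne.symm h1)), completedRiemannZeta_one_sub]
  have := Gammaℝ_two_mul_ne_zero hν
  field_simp

lemma coeffInfty_eq {ν : ℂ} (hν : ∀ m : ℕ, ν ≠ -m) (h : ν ≠ -1 / 2) :
    coeffInfty ε ν = eisZero ε (-ν) * (chi ε * Gamma ν *
      (2 * ((ε : ℤ) : ℂ) * I * Complex.cos (π * ν))) := by
  have h1 : 2 * ν + 1 ≠ 0 := fun e => h (by grind)
  have hcos := Complex.Gammaℝ_one_sub_mul_Gammaℝ_one_add (2 * ν)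
  rw [show (π * (2 * ν) / 2 : ℂ) = π * ν by ring, ← inv_inj, inv_inv, mul_inv] at hcos
  have h12 := one_sub_units_mul_I ε
  have hne : (1 - ((ε : ℤ) : ℂ) * I) ≠ 0 := left_ne_zero_of_mul (h12 ▸ two_ne_zero)
  have hk : (1 - ((ε : ℤ) : ℂ) * I)⁻¹ * (chi ε ^ 2 * (2 * ((ε : ℤ) : ℂ) * I)) =
      1 - ((ε : ℤ) : ℂ) * I := by
    rw [chi_sq]
    grind
  rw [coeffInfty, G0_eq (two_mul_ne hν), riemannZeta_def_of_ne_zero h1, eisZero, ← hcos,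
    show 2 * -ν = 1 - (1 + 2 * ν) by ring, completedRiemannZeta_one_sub,
    show -(1 - (1 + 2 * ν) + 1) = 2 * ν - 1 by ring, add_comm (2 * ν) 1, Complex.Gammaℝ_def,
    show -(2 * ν) / 2 = -ν by ring, mul_div_cancel_left₀ _ two_ne_zero, div_eq_mul_inv]
  grind

lemma sg_intCast (n : ℤ) (hn : n ≠ 0) : sg n = n.sign := by
  rcases hn.lt_or_gt with h | h
  · have : ¬ (0 : ℝ) < n := by simpa using h.le
    simp [sg, this, Int.sign_eq_neg_one_of_neg h]
  · simp [sg, h, Int.sign_eq_one_of_pos h]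

lemma hasSum_functional_equation {ν : ℂ} (hν : ∀ m : ℕ, ν ≠ -m) (h : ν ≠ -1 / 2) :
    HasSum (fun n : ℤ => coeff ε (eisCoeff ε) ν n • wave ε ν n)
      (intertwine ε ν (eisDist ε (-ν)) - coeffInfty ε ν • deltaInfty ε ν) := by
  have hne : -ν ≠ 1 / 2 := fun e => h (by grind)
  have hr : ∀ φ : SmoothVec (-ε) (-ν), restr (kmap (-ε) (-ν) (-(-ν)) ν (chi ε * Gamma ν) φ) =
        fun θ => chi ε * Gamma ν * kop ν (restr φ) θ := restr_kmap _ _ _ _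
  have hw : ∀ n : ℤ, n ≠ 0 → intertwine ε ν (eisCoeff ε n (-ν) • wavDist ε (-ν) n) =
      coeff ε (eisCoeff ε) ν n • wave ε ν n := fun n hn => by
    ext φ
    rw [intertwine_apply, coeff, if_neg hn, wave_of_ne hn]
    show eisCoeff ε n (-ν) * wavDist ε (-ν) n _ = _ * wavDist ε ν n φ
    rw [wavDist_apply, wavDist_apply, hr, wav_kop hν (isQP_restr φ) (cast_ne_zero.2 hn),
      sg_intCast n hn, ← cast_abs, Complex.ofReal_intCast]
    ring
  have hS := ((hasSum_eisCoeff (ε := ε) hne).mapL (intertwine ε ν)).add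
    (hasSum_ite_eq 0 (coeff ε (eisCoeff ε) ν 0 • wave ε ν 0))
  convert hS using 1
  · funext n
    by_cases hn : n = 0
    · simp [hn]
    simp [*]
  · have hone : intertwine ε ν (oneDist ε (-ν) (eisZero ε (-ν))) =
        coeffInfty ε ν • deltaInfty ε ν := by
      ext φ
      show _ = coeffInfty ε ν * deltaInfty ε ν φ
      rw [intertwine_apply, oneDist_apply, hr, deltaInfty_apply,
        kop_const_mul (norm_chi (-ε)) _ ((isQP_restr φ).kop (norm_chi _) ν)]
      simp only []
      rw [kop_neg_kop ν (isQP_restr φ), coeffInfty_eq hν h]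
      ring
    have hdel : intertwine ε ν (deltaInfty ε (-ν)) = wave ε ν 0 := by
      ext φ
      rw [intertwine_apply, deltaInfty_apply, hr, wave_zero hν, oneDist_apply]
    rw [eisDist, map_add, map_add, hone, map_smul, hdel, coeff_zero _ hν]
    abel

end

end Metaplectic

theorem mainTheorem7 (ε : ℤˣ) : ∃ (E : ∀ ν : ℂ, Metaplectic.Dist ε ν) (a : ℤ → ℂ → ℂ)
      (J : ∀ ν : ℂ, Metaplectic.SmoothVec ε (-ν) →L[ℂ] Metaplectic.SmoothVec ε ν)
      (I : ∀ ν : ℂ, Metaplectic.Dist ε (-ν) →L[ℂ] Metaplectic.Dist ε ν),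
      Metaplectic.IsEisenstein ε E ∧ Metaplectic.IsEisensteinCoeff ε E a ∧
      Metaplectic.IsIntertwining ε J ∧ Metaplectic.IsExtension ε J I ∧
      ∀ ν : ℂ, (∀ m : ℕ, ν ≠ -m) → ν ≠ -1 / 2 →
        HasSum (fun n : ℤ => Metaplectic.coeff ε a ν n • Metaplectic.wave ε ν n)
          (I ν (E (-ν)) - Metaplectic.coeffInfty ε ν • Metaplectic.deltaInfty ε ν) :=
  ⟨Metaplectic.eisDist ε, Metaplectic.eisCoeff ε, _, Metaplectic.intertwine ε,
    Metaplectic.isEisenstein_eisDist, Metaplectic.isEisensteinCoeff_eisCoeff,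
    Metaplectic.isIntertwining_kmap, Metaplectic.isExtension_intertwine,
    fun _ hν h => Metaplectic.hasSum_functional_equation hν h⟩
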